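/- **Conventions.** Let $G$ be a graph on the ordered vertex set $V(G)$ with $n=|V(G)|\ge 1$, let $\mathsf w:V(G)\to\mathbb Q$, extended to sets by $\mathsf w(X)=\sum_{v\in X}\mathsf w(v)$, and let $\mathsf{opt}\in\{\min,\max\}$. A rooted layout of $G$ is a rooted binary tree $T$ together with a bijection between its leaves and $V(G)$; for a node $x$ of $T$, $V_x$ is the set of vertices at the leaves below $x$, and $\overline{V_x}=V(G)\setminus V_x$. For $A\subseteq V(G)$ and $X,Y\subseteq A$, write $X\equiv^1_A Y$ if $\min(1,|X\cap N(u)|)=\min(1,|Y\cap N(u)|)$ for all $u\in V(G)\setminus A$. Let $\mathsf{nec}_1(A)$ be the number of classes of $\equiv^1_A$, and let $\mathcal R_A$ be the set containing from each class the lexicographically smallest among its sets of minimum size. For $\mathcal A\subseteq 2^{V(G)}$ and $Y\subseteq V(G)$ put $\mathsf{best}(\mathcal A,Y)=\mathsf{opt}\{\mathsf w(X): X\in\mathcal A,\ G[X\cup Y]\text{ is connected}\}$, where $\max\emptyset=-\infty$, $\min\emptyset=+\infty$, and a connected graph is nonempty. For $R'\subseteq\overline{V_x}$ and $\mathcal A,\mathcal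 B\subseteq 2^{V_x}$, say that $\mathcal B$ $(x,R')$-represents $\mathcal A$ if $\mathsf{best}(\mathcal A,Y)=\mathsf{best}(\mathcal B,Y)$ for every $Y\subseteq\overline{V_x}$ with $Y\equiv^1_{\overline{V_x}}R'$. Algorithms run on a unit-cost word RAM with words of $O(\log N)$ bits, where weights are atomic objects that can be copied, added and compared in one step. Here $N=m$ when two $m\times m$ matrices are multiplied, and $N=n+|\mathcal A|+\mathsf{nec}_1(V_x)$ for the algorithm below. Let $\omega$ be any real number such that two $m\times m$ matrices over $GF(2)$ can be multiplied in time $O(m^{\omega})$. **Theorem 3.2.** For each choice of $\mathsf{opt}$ there is an algorithm $\mathsf{reduce}$ with the following property. Let $G$, $\mathsf w$, a rooted layout of $G$ and a node $x$ of it be as above, and let $R\in\mathcal R_{V_x}$, $R'\subseteq\overline{V_x}$ and $\mathcal A\subseteq 2^{V_x}$ be such that $X\equiv^1_{V_x}R$ for all $X\in\mathcal A$. Given $G,\mathsf w,V_x,R,R',\mathcal A$, the algorithm outputs in time $$O\bigl(\max(1,|\mathcal A|)\cdot \mathsf{nec}_1(V_x)^{2(\omega-1)}\cdot n^2\bigr)$$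 a subset $\mathcal B\subseteq\mathcal A$ that $(x,R')$-represents $\mathcal A$ and satisfies $|\mathcal B|\le \mathsf{nec}_1(V_x)^2$, except that only $|\mathcal B|\le 2$ is claimed in the degenerate case where $\emptyset\in\mathcal A$, $V_x\ne V(G)$ and $G$ has no edge between $V_x$ and $\overline{V_x}$. The constant in $O(\cdot)$ depends only on $\omega$ and $\mathsf{opt}$. -/

import Mathlib

/-! ## Graphs, neighbour equivalence, rooted layouts -/

open Classical in
/-- `X` and `Y` (meant to be subsets of `A`) are `d`-neighbour equivalent over `A`. -/
def NeighborEquiv {n : ℕ} (G : SimpleGraph (Fin n)) (d : ℕ) (A X Y : Finset (Fin n)) : Prop :=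
  ∀ u, u ∉ A →
    min d (X.filter (fun v => G.Adj u v)).card = min d (Y.filter (fun v => G.Adj u v)).card

/-- `d`-neighbour equivalence as an equivalence relation on the subsets of `A`. -/
def neighborSetoid {n : ℕ} (G : SimpleGraph (Fin n)) (d : ℕ) (A : Finset (Fin n)) :
    Setoid {X : Finset (Fin n) // X ⊆ A} where
  r X Y := NeighborEquiv G d A X.1 Y.1
  iseqv :=
    ⟨fun _ _ _ => rfl, fun h u hu => (h u hu).symm, fun h k u hu => (h u hu).trans (k u hu)⟩

/-- `nec_d(A)`: the number of `d`-neighbour equivalence classes over `A`. -/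
noncomputable def nec {n : ℕ} (G : SimpleGraph (Fin n)) (d : ℕ) (A : Finset (Fin n)) : ℕ :=
  Nat.card (Quotient (neighborSetoid G d A))

/-- `R = rep_A^d(X)`: among the subsets of `A` that are `d`-neighbour equivalent to `X`, the set
`R` has minimum size, and it is lexicographically smallest among those of minimum size. -/
def IsRep {n : ℕ} (G : SimpleGraph (Fin n)) (d : ℕ) (A X R : Finset (Fin n)) : Prop :=
  R ⊆ A ∧ NeighborEquiv G d A R X ∧
    ∀ Z, Z ⊆ A → NeighborEquiv G d A Z X →
      R.card ≤ Z.card ∧ (R.card = Z.card → R.sort (· ≤ ·) ≤ Z.sort (· ≤ ·))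

/-- The set of the representatives of all `d`-neighbour equivalence classes over `A`. -/
def RepSet {n : ℕ} (G : SimpleGraph (Fin n)) (d : ℕ) (A : Finset (Fin n)) :
    Set (Finset (Fin n)) :=
  {R | ∃ X, X ⊆ A ∧ IsRep G d A X R}

/-- Rooted binary trees with leaves labelled by elements of `V`. A node of a tree is given by the
subtree that is rooted at this node. -/
inductive BinTree (V : Type) : Type
  | leaf (v : V) : BinTree V
  | node (l r : BinTree V) : BinTree V

namespace BinTree

/-- The labels of the leaves, from left to right. -/
def leaves {V : Type} : BinTree V → List V
  | leaf v => [v]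
  | node l r => l.leaves ++ r.leaves

/-- `IsNode x T`: `x` is (the subtree rooted at) a node of `T`. -/
inductive IsNode {V : Type} : BinTree V → BinTree V → Prop
  | root (T : BinTree V) : IsNode T T
  | left {x l : BinTree V} (r : BinTree V) : IsNode x l → IsNode x (node l r)
  | right {x r : BinTree V} (l : BinTree V) : IsNode x r → IsNode x (node l r)

/-- `T` is a rooted layout of a graph with vertex set `Fin n`: the labelling is a bijection
between the leaves and the vertices. -/
def IsLayout {n : ℕ} (T : BinTree (Fin n)) : Prop :=
  T.leaves.Nodup ∧ ∀ v, v ∈ T.leaves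

/-- `V_x`: the set of the vertices that label the leaves below the node `x`. -/
def verts {n : ℕ} (x : BinTree (Fin n)) : Finset (Fin n) :=
  x.leaves.toFinset

end BinTree

/-! ## Representative families -/

/-- Whether weights are to be maximized or minimized. -/
inductive Opt : Type
  | max : Opt
  | min : Opt

/-- The weight of a vertex set as an element of `ℚ ∪ {-∞, +∞}`. -/
def setWeight {n : ℕ} (w : Fin n → ℚ) (X : Finset (Fin n)) : WithBot (WithTop ℚ) :=
  (((∑ v ∈ X, w v : ℚ) : WithTop ℚ) : WithBot (WithTop ℚ))

open Classical in
/-- `best(𝒜, Y)`: the optimum of `w(X)` over the `X ∈ 𝒜` for which `G[X ∪ Y]` is connected, where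
`max ∅ = -∞` and `min ∅ = +∞`. (In Mathlib, a connected graph is nonempty.) -/
noncomputable def best {n : ℕ} (o : Opt) (G : SimpleGraph (Fin n)) (w : Fin n → ℚ)
    (𝒜 : Finset (Finset (Fin n))) (Y : Finset (Fin n)) : WithBot (WithTop ℚ) :=
  match o with
  | Opt.max =>
      (𝒜.filter (fun X => (G.induce {v | v ∈ X ∪ Y}).Connected)).sup (setWeight w)
  | Opt.min =>
      (𝒜.filter (fun X => (G.induce {v | v ∈ X ∪ Y}).Connected)).inf (setWeight w)

/-- `ℬ` `(x, R')`-represents `𝒜`, where `A` is the set `V_x`. -/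
def Represents {n : ℕ} (o : Opt) (G : SimpleGraph (Fin n)) (w : Fin n → ℚ)
    (A R' : Finset (Fin n)) (ℬ 𝒜 : Finset (Finset (Fin n))) : Prop :=
  ∀ Y, Y ⊆ Aᶜ → NeighborEquiv G 1 Aᶜ Y R' → best o G w 𝒜 Y = best o G w ℬ Y

/-! ## A unit-cost word RAM

The machine has word registers and finitely many word memories (those that are named in the
program) holding natural numbers that may not exceed the word bound `S`, and registers and memories
for rational weights. Weights can only be copied, added and compared, and the only weight that a
program can create by itself is `0`. -/

namespace WordRAM

/-- The contents of the registers and of the memories. -/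
structure Store : Type where
  /-- the word registers -/
  reg : ℕ → ℕ
  /-- `mem a i` is the cell with address `i` of the word memory `a` -/
  mem : ℕ → ℕ → ℕ
  /-- the weight registers -/
  wreg : ℕ → ℚ
  /-- `wmem a i` is the cell with address `i` of the weight memory `a` -/
  wmem : ℕ → ℕ → ℚ

/-- All words are at most `S`. -/
def Store.Bounded (S : ℕ) (s : Store) : Prop :=
  (∀ x, s.reg x ≤ S) ∧ ∀ a i, s.mem a i ≤ S

/-- The instructions. The arguments `x y z i` are names of word registers, `p q r` of weight
registers, `a` of memories, and `k` is a literal. -/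
inductive Instr : Type
  | const (x k : ℕ) : Instr
  | copy (x y : ℕ) : Instr
  | add (x y z : ℕ) : Instr
  | sub (x y z : ℕ) : Instr
  | mul (x y z : ℕ) : Instr
  | div (x y z : ℕ) : Instr
  | load (x a i : ℕ) : Instr
  | store (a i x : ℕ) : Instr
  | wzero (p : ℕ) : Instr
  | wcopy (p q : ℕ) : Instr
  | wadd (p q r : ℕ) : Instr
  | wload (p a i : ℕ) : Instr
  | wstore (a i p : ℕ) : Instr

/-- Overwrite a word register. -/
def Store.setReg (s : Store) (x v : ℕ) : Store :=
  { s with reg := Function.update s.reg x v }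

/-- Overwrite a word cell. -/
def Store.setMem (s : Store) (a i v : ℕ) : Store :=
  { s with mem := Function.update s.mem a (Function.update (s.mem a) i v) }

/-- Overwrite a weight register. -/
def Store.setWReg (s : Store) (p : ℕ) (v : ℚ) : Store :=
  { s with wreg := Function.update s.wreg p v }

/-- Overwrite a weight cell. -/
def Store.setWMem (s : Store) (a i : ℕ) (v : ℚ) : Store :=
  { s with wmem := Function.update s.wmem a (Function.update (s.wmem a) i v) }

/-- The effect of an instruction. -/
def Instr.effect : Instr → Store → Store
  | const x k, s => s.setReg x k
  | copy x y, s => s.setReg x (s.reg y)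
  | add x y z, s => s.setReg x (s.reg y + s.reg z)
  | sub x y z, s => s.setReg x (s.reg y - s.reg z)
  | mul x y z, s => s.setReg x (s.reg y * s.reg z)
  | div x y z, s => s.setReg x (s.reg y / s.reg z)
  | load x a i, s => s.setReg x (s.mem a (s.reg i))
  | store a i x, s => s.setMem a (s.reg i) (s.reg x)
  | wzero p, s => s.setWReg p 0
  | wcopy p q, s => s.setWReg p (s.wreg q)
  | wadd p q r, s => s.setWReg p (s.wreg q + s.wreg r)
  | wload p a i, s => s.setWReg p (s.wmem a (s.reg i))
  | wstore a i p, s => s.setWMem a (s.reg i) (s.wreg p)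

/-- The tests: equality and order of words, strict order of weights. -/
inductive Test : Type
  | eq (x y : ℕ) : Test
  | lt (x y : ℕ) : Test
  | wlt (p q : ℕ) : Test

/-- When a test succeeds. -/
def Test.Holds : Test → Store → Prop
  | eq x y, s => s.reg x = s.reg y
  | lt x y, s => s.reg x < s.reg y
  | wlt p q, s => s.wreg p < s.wreg q

/-- Programs. -/
inductive Prog : Type
  | skip : Prog
  | instr (i : Instr) : Prog
  | seq (P Q : Prog) : Prog
  | ite (b : Test) (P Q : Prog) : Prog
  | loop (b : Test) (P : Prog) : Prog

/-- `Exec S P s s' t`: with word bound `S`, the program `P` started in the store `s` halts in the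
store `s'` after `t` steps. Each instruction and each test is one step; a program that would produce
a word larger than `S` gets stuck. -/
inductive Exec (S : ℕ) : Prog → Store → Store → ℕ → Prop
  | skip (s : Store) : Exec S Prog.skip s s 1
  | instr (i : Instr) (s : Store) (h : (i.effect s).Bounded S) :
      Exec S (Prog.instr i) s (i.effect s) 1
  | seq {P Q : Prog} {s s' s'' : Store} {t t' : ℕ} :
      Exec S P s s' t → Exec S Q s' s'' t' → Exec S (Prog.seq P Q) s s'' (t + t')
  | iteTrue {b : Test} {P : Prog} (Q : Prog) {s s' : Store} {t : ℕ} :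
      b.Holds s → Exec S P s s' t → Exec S (Prog.ite b P Q) s s' (1 + t)
  | iteFalse {b : Test} (P : Prog) {Q : Prog} {s s' : Store} {t : ℕ} :
      ¬ b.Holds s → Exec S Q s s' t → Exec S (Prog.ite b P Q) s s' (1 + t)
  | loopDone {b : Test} (P : Prog) {s : Store} :
      ¬ b.Holds s → Exec S (Prog.loop b P) s s 1
  | loopStep {b : Test} {P : Prog} {s s' s'' : Store} {t t' : ℕ} :
      b.Holds s → Exec S P s s' t → Exec S (Prog.loop b P) s' s'' t' →
      Exec S (Prog.loop b P) s s'' (1 + t + t')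

/-! ### Representation of data in the memories -/

/-- The word memory `a` holds the matrix `M` over `GF(2)`, row by row, one entry per cell. -/
def HoldsMatrix (s : Store) (a : ℕ) {m : ℕ} (M : Matrix (Fin m) (Fin m) (ZMod 2)) : Prop :=
  ∀ i j : Fin m, s.mem a (i.1 * m + j.1) = (M i j).val

open Classical in
/-- The word memory `a` holds the adjacency matrix of `G`. -/
def HoldsGraph (s : Store) (a : ℕ) {n : ℕ} (G : SimpleGraph (Fin n)) : Prop :=
  ∀ u v : Fin n, s.mem a (u.1 * n + v.1) = if G.Adj u v then 1 else 0

/-- The word memory `a` holds, from address `i` on, the characteristic vector of `X`. -/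
def HoldsSet (s : Store) (a i : ℕ) {n : ℕ} (X : Finset (Fin n)) : Prop :=
  ∀ v : Fin n, s.mem a (i + v.1) = if v ∈ X then 1 else 0

/-- The word register `x` holds the number of members of the family `𝒜`, and the word memory `a`
holds the characteristic vectors of the members, one after the other, in some order. -/
def HoldsFamily (s : Store) (x a : ℕ) {n : ℕ} (𝒜 : Finset (Finset (Fin n))) : Prop :=
  ∃ L : List (Finset (Fin n)), L.Nodup ∧ L.toFinset = 𝒜 ∧ s.reg x = L.length ∧
    ∀ k : Fin L.length, HoldsSet s a (k.1 * n) (L.get k)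

/-- The weight memory `a` holds the vertex weights. -/
def HoldsWeights (s : Store) (a : ℕ) {n : ℕ} (w : Fin n → ℚ) : Prop :=
  ∀ v : Fin n, s.wmem a v.1 = w v

/-- `ω` is an exponent of matrix multiplication over `GF(2)`: some program multiplies two `m × m`
matrices in `O(m ^ ω)` steps on words of `O(log m)` bits (and on longer ones). Everything outside
the input is arbitrary at the start. -/
def MatMulExponent (ω : ℝ) : Prop :=
  ∃ (P : Prog) (c : ℕ) (C : ℝ), ∀ (m : ℕ), 1 ≤ m →
    ∀ (A B : Matrix (Fin m) (Fin m) (ZMod 2)) (S : ℕ), (m + 1) ^ c ≤ S →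
    ∀ s : Store, s.Bounded S → s.reg 0 = m → HoldsMatrix s 0 A → HoldsMatrix s 1 B →
    ∃ (s' : Store) (t : ℕ), Exec S P s s' t ∧ (t : ℝ) ≤ C * (m : ℝ) ^ ω ∧ HoldsMatrix s' 2 (A * B)

/-- The input of `reduce`: the number of vertices, the graph, the sets `A = V_x`, `R`, `R'`, the
vertex weights, and the family `𝒜`. -/
structure HoldsInput (s : Store) {n : ℕ} (G : SimpleGraph (Fin n)) (w : Fin n → ℚ)
    (A R R' : Finset (Fin n)) (𝒜 : Finset (Finset (Fin n))) : Prop where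
  size : s.reg 0 = n
  graph : HoldsGraph s 0 G
  side : HoldsSet s 1 0 A
  cls : HoldsSet s 2 0 R
  cls' : HoldsSet s 3 0 R'
  family : HoldsFamily s 1 4 𝒜
  weights : HoldsWeights s 0 w

end WordRAM

/-! Write `A` for the set of vertices below the node. The trace of `Y ⊆ Aᶜ` is the set of vertices
of `A` with a neighbour in `Y`. All `Y` equivalent to `R'` have the same trace `T'`
(`trace_eq_of_neighborEquiv`), and there are at most `nec G 1 A` traces (`card_traces_le_nec`).

Connectedness becomes linear over GF(2) by counting cuts modulo two. Suppose that `T'` is nonempty,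
and attach to `X ⊆ A` a vector indexed by pairs of traces. It is zero if some component of `X`
misses `T'`; otherwise its entry at a pair is 1 iff no component of `X` meets both traces. Let `Y`
have trace `T'` and fix `y ∈ Y`. Consider the sets `Z` with `y ∈ Z ⊆ Y` that are unions of
components of `Y` and for which the entry at the traces of `Z` and `Y \ Z` is 1. If every component
of `X` meets `T'`, they are the intersections with `Y` of the unions of components of `X ∪ Y` that
contain `y`, and every component of `X ∪ Y` meets `Y`. With `c` components there are `2 ^ (c - 1)`
of them, an odd number exactly if `X ∪ Y` is connected (`card_splits`). So the sum of the entries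
over all `Z` that are unions of components of `Y` is a linear functional, depending only on `Y`,
that decides connectedness of `X ∪ Y` (`exists_functional`). If `T'` is empty, no edge joins `X` to
`Y`, and two bits suffice: one for a nonempty connected `X`, one for `X = ∅` when `A` is not
everything.

Now suppose that the vector of each member of the family is spanned by vectors of selected members
that are at least as good in weight (`Selection`). A functional that is nonzero on a vector is
nonzero on one of the vectors spanning it, so the selected members represent the family
(`Selection.exists_better`, `represents_of_selection`). A basis chosen greedily in order of weight
has this property (`Selection.round`), and its size is at most the width of the vectors (`len_le`).

The basis is computed in batches. Let `M` be a power of two between the width and twice the width. A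
round merges at most `M` selected vectors with at most `M` new ones, sorts them by weight and keeps
the rows that do not depend on earlier rows. The dependences come from an elimination that treats
the rows one by one, but clears them in dyadic blocks on the schedule of a binary counter: a block
of `s` rows costs `M / s` products of `s × s` matrices (`Elim.Inv`, `elimProg_wp`). A round thus
takes about `M ^ ω * log M` steps, that is, `M ^ (ω - 1) * log M` for each vector of a full batch.
Here `2 ≤ ω`, because a product has to be written down (`MatMulExponent.two_le`), and `log M =
O(n)`, because there are at most `2 ^ n` traces.

On the side of the machine, expressions are compiled so that the odd registers serve as a stack, and
`Wp` is a program logic with time bounds on the even registers. The given multiplication program is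
moved to separate registers and memories (`Multiplies.wp`). -/

namespace WordRAM

/-! ## Frames: what a program cannot change -/

/-- The locations of a store: word registers, word memories, weight registers, weight memories. -/
inductive Loc : Type
  | reg (x : ℕ) : Loc
  | mem (a : ℕ) : Loc
  | wreg (p : ℕ) : Loc
  | wmem (a : ℕ) : Loc

/-- Two stores agree at a location. -/
def Loc.Same : Loc → Store → Store → Prop
  | reg x, s, s' => s'.reg x = s.reg x
  | mem a, s, s' => s'.mem a = s.mem a
  | wreg p, s, s' => s'.wreg p = s.wreg p
  | wmem a, s, s' => s'.wmem a = s.wmem a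

theorem Loc.Same.refl (l : Loc) (s : Store) : l.Same s s := by cases l <;> rfl

theorem Loc.Same.trans {l : Loc} {s s' s'' : Store} (h : l.Same s s') (h' : l.Same s' s'') :
    l.Same s s'' := by
  cases l <;> exact Eq.trans h' h

/-- The location that an instruction writes to. -/
def Instr.target : Instr → Loc
  | const x _ | copy x _ | add x _ _ | sub x _ _ | mul x _ _ | div x _ _ | load x _ _ => .reg x
  | store a _ _ => .mem a
  | wzero p | wcopy p _ | wadd p _ _ | wload p _ _ => .wreg p
  | wstore a _ _ => .wmem a

/-- The program contains an instruction that writes to the location. -/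
def Prog.Writes : Prog → Loc → Prop
  | skip, _ => False
  | instr i, l => i.target = l
  | seq P Q, l => P.Writes l ∨ Q.Writes l
  | ite _ P Q, l => P.Writes l ∨ Q.Writes l
  | loop _ P, l => P.Writes l

theorem Instr.same_effect (i : Instr) (s : Store) {l : Loc} (h : i.target ≠ l) :
    l.Same s (i.effect s) := by
  cases i <;> cases l <;> simp only [Instr.target, ne_eq, Loc.reg.injEq, Loc.mem.injEq,
    Loc.wreg.injEq, Loc.wmem.injEq] at h <;>
    first
    | rfl
    | exact Function.update_of_ne (Ne.symm h) _ _

/-- A frame can be read off the text of the program: only targets of its instructions can change.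
Later preservation claims thereby become syntactic checks that `simp` mostly settles. -/
theorem Exec.same {S : ℕ} {P : Prog} {s s' : Store} {t : ℕ} (h : Exec S P s s' t) {l : Loc}
    (hl : ¬ P.Writes l) : l.Same s s' := by
  induction h with
  | skip s => exact .refl _ _
  | instr i s _ => exact i.same_effect s hl
  | seq _ _ ih ih' =>
    simp only [Prog.Writes, not_or] at hl
    exact (ih hl.1).trans (ih' hl.2)
  | iteTrue Q _ _ ih =>
    simp only [Prog.Writes, not_or] at hl
    exact ih hl.1
  | iteFalse P _ _ ih =>
    simp only [Prog.Writes, not_or] at hl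
    exact ih hl.2
  | loopDone P _ => exact .refl _ _
  | loopStep _ _ _ ih ih' => exact (ih hl).trans (ih' hl)

theorem Exec.bounded {S : ℕ} {P : Prog} {s s' : Store} {t : ℕ} (h : Exec S P s s' t)
    (hs : s.Bounded S) : s'.Bounded S := by
  induction h with
  | skip s => exact hs
  | instr i s h => exact h
  | seq _ _ ih ih' => exact ih' (ih hs)
  | iteTrue Q _ _ ih => exact ih hs
  | iteFalse P _ _ ih => exact ih hs
  | loopDone P _ => exact hs
  | loopStep _ _ _ ih ih' => exact ih' (ih hs)

theorem Store.Bounded.setReg {S : ℕ} {s : Store} (hs : s.Bounded S) (x : ℕ) {v : ℕ} (hv : v ≤ S) :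
    (s.setReg x v).Bounded S := by
  refine ⟨fun y => ?_, hs.2⟩
  by_cases h : y = x
  · subst h; simpa [Store.setReg] using hv
  · simpa [Store.setReg, Function.update_of_ne h] using hs.1 y

theorem Store.Bounded.setMem {S : ℕ} {s : Store} (hs : s.Bounded S) (a i : ℕ) {v : ℕ}
    (hv : v ≤ S) : (s.setMem a i v).Bounded S := by
  refine ⟨hs.1, fun b j => ?_⟩
  by_cases h : b = a
  · subst h
    by_cases hj : j = i
    · subst hj; simpa [Store.setMem] using hv
    · simpa [Store.setMem, Function.update_of_ne hj] using hs.2 b j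
  · simpa [Store.setMem, Function.update_of_ne h] using hs.2 b j

/-! ## Expressions -/

/-- The store that a program sees if it uses the even word registers only; the odd ones serve for
intermediate results. -/
def Store.user (s : Store) : Store :=
  { s with reg := fun x => s.reg (2 * x) }

/-- Arithmetic expressions over the word registers and the word memories. -/
inductive Ex : Type
  | lit (k : ℕ) : Ex
  | var (x : ℕ) : Ex
  | add (e f : Ex) : Ex
  | sub (e f : Ex) : Ex
  | mul (e f : Ex) : Ex
  | div (e f : Ex) : Ex
  | ld (a : ℕ) (e : Ex) : Ex

namespace Ex

instance : Add Ex := ⟨add⟩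
instance : Sub Ex := ⟨sub⟩
instance : Mul Ex := ⟨mul⟩
instance : Div Ex := ⟨div⟩
instance (k : ℕ) : OfNat Ex k := ⟨lit k⟩

/-- The value of an expression. -/
def eval : Ex → Store → ℕ
  | lit k, _ => k
  | var x, s => s.reg x
  | add e f, s => e.eval s + f.eval s
  | sub e f, s => e.eval s - f.eval s
  | mul e f, s => e.eval s * f.eval s
  | div e f, s => e.eval s / f.eval s
  | ld a e, s => s.mem a (e.eval s)

/-- The intermediate results of the evaluation fit into a word. -/
def Ok (S : ℕ) : Ex → Store → Prop
  | lit k, _ => k ≤ S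
  | var _, _ => True
  | add e f, s => e.Ok S s ∧ f.Ok S s ∧ e.eval s + f.eval s ≤ S
  | sub e f, s => e.Ok S s ∧ f.Ok S s
  | mul e f, s => e.Ok S s ∧ f.Ok S s ∧ e.eval s * f.eval s ≤ S
  | div e f, s => e.Ok S s ∧ f.Ok S s
  | ld _ e, s => e.Ok S s

/-- The number of steps of the evaluation. -/
def cost : Ex → ℕ
  | lit _ => 1
  | var _ => 1
  | add e f => e.cost + (f.cost + 1)
  | sub e f => e.cost + (f.cost + 1)
  | mul e f => e.cost + (f.cost + 1)
  | div e f => e.cost + (f.cost + 1)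
  | ld _ e => e.cost + 1

section simps
variable (S : ℕ) (s : Store) (e f : Ex) (k x a : ℕ)
@[simp] theorem eval_ofNat : (no_index (OfNat.ofNat k) : Ex).eval s = OfNat.ofNat k := rfl
@[simp] theorem eval_lit : (lit k).eval s = k := rfl
@[simp] theorem eval_var : (var x).eval s = s.reg x := rfl
@[simp] theorem eval_add : (e + f).eval s = e.eval s + f.eval s := rfl
@[simp] theorem eval_sub : (e - f).eval s = e.eval s - f.eval s := rfl
@[simp] theorem eval_mul : (e * f).eval s = e.eval s * f.eval s := rfl
@[simp] theorem eval_div : (e / f).eval s = e.eval s / f.eval s := rfl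
@[simp] theorem eval_ld : (ld a e).eval s = s.mem a (e.eval s) := rfl
@[simp] theorem ok_ofNat : (no_index (OfNat.ofNat k) : Ex).Ok S s ↔ OfNat.ofNat k ≤ S := Iff.rfl
@[simp] theorem ok_lit : (lit k).Ok S s ↔ k ≤ S := Iff.rfl
@[simp] theorem ok_var : (var x).Ok S s ↔ True := Iff.rfl
@[simp] theorem ok_add : (e + f).Ok S s ↔ e.Ok S s ∧ f.Ok S s ∧ e.eval s + f.eval s ≤ S := Iff.rfl
@[simp] theorem ok_sub : (e - f).Ok S s ↔ e.Ok S s ∧ f.Ok S s := Iff.rfl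
@[simp] theorem ok_mul : (e * f).Ok S s ↔ e.Ok S s ∧ f.Ok S s ∧ e.eval s * f.eval s ≤ S := Iff.rfl
@[simp] theorem ok_div : (e / f).Ok S s ↔ e.Ok S s ∧ f.Ok S s := Iff.rfl
@[simp] theorem ok_ld : (ld a e).Ok S s ↔ e.Ok S s := Iff.rfl
@[simp] theorem cost_ofNat : (no_index (OfNat.ofNat k) : Ex).cost = 1 := rfl
@[simp] theorem cost_lit : (lit k).cost = 1 := rfl
@[simp] theorem cost_var : (var x).cost = 1 := rfl
@[simp] theorem cost_add : (e + f).cost = e.cost + (f.cost + 1) := rfl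
@[simp] theorem cost_sub : (e - f).cost = e.cost + (f.cost + 1) := rfl
@[simp] theorem cost_mul : (e * f).cost = e.cost + (f.cost + 1) := rfl
@[simp] theorem cost_div : (e / f).cost = e.cost + (f.cost + 1) := rfl
@[simp] theorem cost_ld : (ld a e).cost = e.cost + 1 := rfl
end simps

/-- The program that evaluates the expression into the register `2 * d + 1`. -/
def comp : Ex → ℕ → Prog
  | lit k, d => .instr (.const (2 * d + 1) k)
  | var x, d => .instr (.copy (2 * d + 1) (2 * x))
  | add e f, d =>
    .seq (e.comp d) (.seq (f.comp (d + 1)) (.instr (.add (2 * d + 1) (2 * d + 1) (2 * d + 3))))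
  | sub e f, d =>
    .seq (e.comp d) (.seq (f.comp (d + 1)) (.instr (.sub (2 * d + 1) (2 * d + 1) (2 * d + 3))))
  | mul e f, d =>
    .seq (e.comp d) (.seq (f.comp (d + 1)) (.instr (.mul (2 * d + 1) (2 * d + 1) (2 * d + 3))))
  | div e f, d =>
    .seq (e.comp d) (.seq (f.comp (d + 1)) (.instr (.div (2 * d + 1) (2 * d + 1) (2 * d + 3))))
  | ld a e, d => .seq (e.comp d) (.instr (.load (2 * d + 1) a (2 * d + 1)))

theorem writes_comp (e : Ex) (d : ℕ) (l : Loc) (h : (e.comp d).Writes l) :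
    ∃ d', d ≤ d' ∧ l = .reg (2 * d' + 1) := by
  induction e generalizing d with
  | lit k => exact ⟨d, le_rfl, h.symm⟩
  | var x => exact ⟨d, le_rfl, h.symm⟩
  | add e f ihe ihf | sub e f ihe ihf | mul e f ihe ihf | div e f ihe ihf =>
    rcases h with h | h | h
    · exact ihe _ h
    · obtain ⟨d', h1, h2⟩ := ihf _ h
      exact ⟨d', by omega, h2⟩
    · exact ⟨d, le_rfl, h.symm⟩
  | ld a e ih =>
    rcases h with h | h
    · exact ih _ h
    · exact ⟨d, le_rfl, h.symm⟩

/-- Evaluation at depth `d` writes only odd registers from `2 * d + 1` on, so values pending at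
smaller depths survive: the odd registers act as a stack. -/
theorem reg_eq_of_exec_comp {S : ℕ} {e : Ex} {d : ℕ} {s s' : Store} {t : ℕ}
    (h : Exec S (e.comp d) s s' t) {c : ℕ} (hc : c < d) :
    s'.reg (2 * c + 1) = s.reg (2 * c + 1) :=
  h.same (l := .reg (2 * c + 1)) fun hw => by
    obtain ⟨d', h1, h2⟩ := writes_comp e d _ hw
    injection h2 with h2
    omega

theorem _root_.WordRAM.Store.user_setReg_odd (s : Store) (d v : ℕ) :
    (s.setReg (2 * d + 1) v).user = s.user := by
  simp only [Store.user, Store.setReg]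
  congr 1
  funext x
  exact Function.update_of_ne (by omega) _ _

theorem exec_comp {S : ℕ} (e : Ex) (d : ℕ) (s : Store) (hs : s.Bounded S) (h : e.Ok S s.user) :
    ∃ s', Exec S (e.comp d) s s' e.cost ∧ s'.user = s.user ∧
      s'.reg (2 * d + 1) = e.eval s.user := by
  have fin : ∀ (i : Instr) (d : ℕ) (s : Store) (v : ℕ), i.effect s = s.setReg (2 * d + 1) v →
      v ≤ S → s.Bounded S → Exec S (.instr i) s (s.setReg (2 * d + 1) v) 1 := by
    intro i d s v he hv hb
    rw [← he]
    exact .instr i s (by rw [he]; exact hb.setReg _ hv)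
  have val : ∀ (d : ℕ) (s : Store) (v : ℕ), (s.setReg (2 * d + 1) v).reg (2 * d + 1) = v := by
    intro d s v
    simp [Store.setReg]
  induction e generalizing s d with
  | lit k => exact ⟨_, fin _ d s k rfl h hs, s.user_setReg_odd _ _, val _ _ _⟩
  | var x =>
    exact ⟨_, fin _ d s (s.reg (2 * x)) rfl (hs.1 _) hs, s.user_setReg_odd _ _, val _ _ _⟩
  | add e f ihe ihf | sub e f ihe ihf | mul e f ihe ihf | div e f ihe ihf =>
    obtain ⟨s1, e1, u1, v1⟩ := ihe d s hs h.1
    have hf : f.Ok S s1.user := by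
      rw [u1]
      first
      | exact h.2.1
      | exact h.2
    have b1 := e1.bounded hs
    obtain ⟨s2, e2, u2, v2⟩ := ihf (d + 1) s1 b1 hf
    have b2 := e2.bounded b1
    have v2' : s2.reg (2 * d + 3) = f.eval s.user := by rw [← u1]; exact v2
    have v1' : s2.reg (2 * d + 1) = e.eval s.user := by
      rw [reg_eq_of_exec_comp e2 (by omega), v1]
    refine ⟨_, Exec.seq e1 (Exec.seq e2 (fin _ d s2 _ rfl ?_ b2)), ?_, ?_⟩
    -- Differences and quotients do not exceed their first operand; only sums and products need the
    -- bound from `Ok`.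
    · first
      | exact (Nat.sub_le _ _).trans (b2.1 _)
      | exact (Nat.div_le_self _ _).trans (b2.1 _)
      | (rw [v1', v2']; exact h.2.2)
    · rw [Store.user_setReg_odd, u2, u1]
    · rw [val, v1', v2']; rfl
  | ld a e ih =>
    obtain ⟨s1, e1, u1, v1⟩ := ih d s hs h
    have b1 := e1.bounded hs
    refine ⟨_, Exec.seq e1 (fin (.load (2 * d + 1) a (2 * d + 1)) d s1 _ rfl (b1.2 _ _) b1),
      ?_, ?_⟩
    · rw [Store.user_setReg_odd, u1]
    · rw [val, v1]
      change s1.user.mem a _ = s.user.mem a _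
      rw [u1]

end Ex

end WordRAM

namespace WordRAM

/-! ## Commands on the user part of the store -/

infixr:60 " ;; " => Prog.seq

/-- Assign the value of an expression to a register. -/
def asg (x : ℕ) (e : Ex) : Prog := e.comp 0 ;; .instr (.copy (2 * x) 1)

/-- Store the value of `f` in the word memory `a` at the address `e`. -/
def st (a : ℕ) (e f : Ex) : Prog := e.comp 0 ;; f.comp 1 ;; .instr (.store a 1 3)

/-- Run `P` if the value of `e` is positive and `Q` otherwise. -/
def cond (e : Ex) (P Q : Prog) : Prog := e.comp 0 ;; .instr (.const 3 0) ;; .ite (.lt 3 1) P Q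

/-- Run `P` for all values of the register `x` that are less than the value of the register `b`. -/
def forP (x b : ℕ) (P : Prog) : Prog :=
  asg x 0 ;; .loop (.lt (2 * x) (2 * b)) (P ;; asg x (.var x + 1))

/-- Load the weight at the address `e` of the weight memory `a`. -/
def wld (p a : ℕ) (e : Ex) : Prog := e.comp 0 ;; .instr (.wload p a 1)

/-- Store a weight at the address `e` of the weight memory `a`. -/
def wst (a : ℕ) (e : Ex) (p : ℕ) : Prog := e.comp 0 ;; .instr (.wstore a 1 p)

/-- The location of the full store that corresponds to a location of the user part. -/
def Loc.full : Loc → Loc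
  | reg x => reg (2 * x)
  | l => l

/-- The program may change the location of the user part of the store. -/
def Prog.UW (P : Prog) (l : Loc) : Prop := P.Writes l.full

theorem Ex.not_writes_comp (e : Ex) (d : ℕ) (l : Loc) : ¬ (e.comp d).Writes l.full := by
  intro h
  obtain ⟨d', _, h2⟩ := e.writes_comp d _ h
  cases l <;> simp only [Loc.full, Loc.reg.injEq, reduceCtorEq] at h2
  omega

section UW
variable (P Q : Prog) (l : Loc) (x a b p q : ℕ) (e f : Ex) (t : Test)

@[simp] theorem uw_seq : (P ;; Q).UW l ↔ P.UW l ∨ Q.UW l := Iff.rfl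
@[simp] theorem uw_ite : (Prog.ite t P Q).UW l ↔ P.UW l ∨ Q.UW l := Iff.rfl
@[simp] theorem uw_skip : Prog.skip.UW l ↔ False := Iff.rfl

@[simp] theorem uw_asg : (asg x e).UW l ↔ l = .reg x := by
  simp only [Prog.UW, asg, Prog.Writes, e.not_writes_comp, false_or, Instr.target]
  cases l <;> simp [Loc.full, eq_comm]

@[simp] theorem uw_st : (st a e f).UW l ↔ l = .mem a := by
  simp only [Prog.UW, st, Prog.Writes, e.not_writes_comp, f.not_writes_comp, false_or,
    Instr.target]
  cases l <;> simp [Loc.full, eq_comm]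

@[simp] theorem uw_cond : (cond e P Q).UW l ↔ P.UW l ∨ Q.UW l := by
  simp only [Prog.UW, cond, Prog.Writes, e.not_writes_comp, false_or, Instr.target]
  cases l <;> simp [Loc.full]
  omega

@[simp] theorem uw_forP : (forP x b P).UW l ↔ l = .reg x ∨ P.UW l := by
  have h := fun e : Ex => uw_asg l x e
  simp only [Prog.UW] at h
  simp only [Prog.UW, forP, Prog.Writes, h]
  tauto

@[simp] theorem uw_wld : (wld p a e).UW l ↔ l = .wreg p := by
  simp only [Prog.UW, wld, Prog.Writes, e.not_writes_comp, false_or, Instr.target]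
  cases l <;> simp [Loc.full, eq_comm]

@[simp] theorem uw_wst : (wst a e p).UW l ↔ l = .wmem a := by
  simp only [Prog.UW, wst, Prog.Writes, e.not_writes_comp, false_or, Instr.target]
  cases l <;> simp [Loc.full, eq_comm]

@[simp] theorem uw_wzero : (Prog.instr (.wzero p)).UW l ↔ l = .wreg p := by
  simp only [Prog.UW, Prog.Writes, Instr.target]
  cases l <;> simp [Loc.full, eq_comm]

@[simp] theorem uw_wadd (r : ℕ) : (Prog.instr (.wadd p q r)).UW l ↔ l = .wreg p := by
  simp only [Prog.UW, Prog.Writes, Instr.target]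
  cases l <;> simp [Loc.full, eq_comm]

end UW

/-- The locations that `P` does not write to have the same contents in the two stores. -/
structure Fr (P : Prog) (u v : Store) : Prop where
  same : ∀ l : Loc, ¬ P.UW l → l.Same u v

namespace Fr
variable {P Q : Prog} {u v w : Store}

theorem reg (h : Fr P u v) (x : ℕ) (hx : ¬ P.UW (.reg x)) : v.reg x = u.reg x := h.same _ hx
theorem mem (h : Fr P u v) (a : ℕ) (ha : ¬ P.UW (.mem a)) : v.mem a = u.mem a := h.same _ ha
theorem wmem (h : Fr P u v) (a : ℕ) (ha : ¬ P.UW (.wmem a)) : v.wmem a = u.wmem a := h.same _ ha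

theorem trans (h : Fr P u v) (h' : Fr P v w) : Fr P u w :=
  ⟨fun l hl => (h.same l hl).trans (h'.same l hl)⟩

theorem weaken (h : Fr P u v) (hPQ : ∀ l, P.UW l → Q.UW l) : Fr Q u v :=
  ⟨fun l hl => h.same l fun h' => hl (hPQ l h')⟩

end Fr

/-- Started in a store with user part `u`, the program halts after at most `T` steps, and the user
part of the final store satisfies `Q`. -/
def Wp (S : ℕ) (P : Prog) (T : ℕ) (u : Store) (Q : Store → Prop) : Prop :=
  ∀ s : Store, s.Bounded S → s.user = u →
    ∃ s' t, Exec S P s s' t ∧ t ≤ T ∧ Q s'.user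

namespace Wp
variable {S : ℕ} {P P' : Prog} {T T' : ℕ} {u : Store} {Q Q' R : Store → Prop}

theorem mono (h : Wp S P T u Q) (hT : T ≤ T') (hQ : ∀ v, Q v → Q' v) : Wp S P T' u Q' := by
  intro s hs hu
  obtain ⟨s', t, h1, h2, h3⟩ := h s hs hu
  exact ⟨s', t, h1, h2.trans hT, hQ _ h3⟩

theorem post (h : Wp S P T u Q) (hQ : ∀ v, Q v → Q' v) : Wp S P T u Q' := h.mono le_rfl hQ

theorem time (h : Wp S P T u Q) (hT : T ≤ T') : Wp S P T' u Q := h.mono hT fun _ => id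

/-- The frame comes for free from `Exec.same`, so specifications need to mention only what changes.
-/
theorem frame (h : Wp S P T u Q) : Wp S P T u fun v => Q v ∧ Fr P u v := by
  intro s hs hu
  obtain ⟨s', t, h1, h2, h3⟩ := h s hs hu
  refine ⟨s', t, h1, h2, h3, ⟨fun l hl => ?_⟩⟩
  have := h1.same hl
  subst hu
  cases l <;> exact this

theorem seq (h : Wp S P T u R) (h' : ∀ v, R v → Fr P u v → Wp S P' T' v Q) :
    Wp S (P ;; P') (T + T') u Q := by
  intro s hs hu
  obtain ⟨s1, t1, h1, h2, h3, h4⟩ := h.frame s hs hu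
  obtain ⟨s2, t2, h5, h6, h7⟩ := h' _ h3 h4 s1 (h1.bounded hs) rfl
  exact ⟨s2, t1 + t2, .seq h1 h5, by omega, h7⟩

theorem skip (h : Q u) : Wp S .skip 1 u Q := fun s _ hu => ⟨s, 1, .skip s, le_rfl, hu ▸ h⟩

theorem _root_.WordRAM.Store.user_setReg_even (s : Store) (x v : ℕ) :
    (s.setReg (2 * x) v).user = s.user.setReg x v := by
  simp only [Store.user, Store.setReg]
  congr 1
  funext y
  by_cases h : y = x
  · subst h; simp
  · rw [Function.update_of_ne h, Function.update_of_ne (by omega)]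

theorem asg {x : ℕ} {e : Ex} (he : e.Ok S u) (h : Q (u.setReg x (e.eval u))) :
    Wp S (asg x e) (e.cost + 1) u Q := by
  intro s hs hu
  subst hu
  obtain ⟨s1, h1, h2, h3⟩ := e.exec_comp 0 s hs he
  refine ⟨_, _, .seq h1 (.instr (.copy (2 * x) 1) s1
    ((h1.bounded hs).setReg _ ((h1.bounded hs).1 _))), le_rfl, ?_⟩
  have h3' : s1.reg 1 = e.eval s.user := h3
  rw [Instr.effect, Store.user_setReg_even, h2, h3']
  exact h

theorem st {a : ℕ} {e f : Ex} (he : e.Ok S u) (hf : f.Ok S u)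
    (h : Q (u.setMem a (e.eval u) (f.eval u))) :
    Wp S (st a e f) (e.cost + (f.cost + 1)) u Q := by
  intro s hs hu
  subst hu
  obtain ⟨s1, h1, h2, h3⟩ := e.exec_comp 0 s hs he
  have b1 := h1.bounded hs
  obtain ⟨s2, h4, h5, h6⟩ := f.exec_comp 1 s1 b1 (h2 ▸ hf)
  have b2 := h4.bounded b1
  refine ⟨_, _, .seq h1 (.seq h4 (.instr (.store a 1 3) s2 (b2.setMem _ _ (b2.1 _)))), le_rfl, ?_⟩
  have h3' : s2.reg 1 = e.eval s.user := by
    rw [← h3]; exact Ex.reg_eq_of_exec_comp h4 (c := 0) (by omega)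
  have h6' : s2.reg 3 = f.eval s.user := by rw [← h2]; exact h6
  have : (s2.setMem a (s2.reg 1) (s2.reg 3)).user = s2.user.setMem a (s2.reg 1) (s2.reg 3) := rfl
  rw [Instr.effect, this, h5, h2, h3', h6']
  exact h

theorem cond {e : Ex} (he : e.Ok S u) (h : 0 < e.eval u → Wp S P T u Q)
    (h' : e.eval u = 0 → Wp S P' T u Q) : Wp S (cond e P P') (e.cost + T + 2) u Q := by
  intro s hs hu
  subst hu
  obtain ⟨s1, h1, h2, h3⟩ := e.exec_comp 0 s hs he
  have b1 := h1.bounded hs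
  have h3' : s1.reg 1 = e.eval s.user := h3
  have b2 : ((Instr.const 3 0).effect s1).Bounded S := b1.setReg _ (Nat.zero_le _)
  have u2 : ((Instr.const 3 0).effect s1).user = s.user :=
    (s1.user_setReg_odd 1 0).trans h2
  have r3 : ((Instr.const 3 0).effect s1).reg 3 = 0 := by simp [Instr.effect, Store.setReg]
  have r1 : ((Instr.const 3 0).effect s1).reg 1 = e.eval s.user := by
    simp [Instr.effect, Store.setReg, h3']
  by_cases hp : 0 < e.eval s.user
  · obtain ⟨s', t, h4, h5, h6⟩ := h hp _ b2 u2
    exact ⟨s', _, .seq h1 (.seq (.instr _ _ b2) (.iteTrue _ (by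
      simpa [Test.Holds, r3, r1] using hp) h4)), by omega, h6⟩
  · obtain ⟨s', t, h4, h5, h6⟩ := h' (by omega) _ b2 u2
    exact ⟨s', _, .seq h1 (.seq (.instr _ _ b2) (.iteFalse _ (by
      simpa [Test.Holds, r3, r1] using hp) h4)), by omega, h6⟩

theorem wcond {p q : ℕ} (h : u.wreg p < u.wreg q → Wp S P T u Q)
    (h' : ¬ u.wreg p < u.wreg q → Wp S P' T u Q) : Wp S (.ite (.wlt p q) P P') (T + 1) u Q := by
  intro s hs hu
  subst hu
  by_cases hp : s.wreg p < s.wreg q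
  · obtain ⟨s', t, h4, h5, h6⟩ := h hp s hs rfl
    exact ⟨s', _, .iteTrue _ hp h4, by omega, h6⟩
  · obtain ⟨s', t, h4, h5, h6⟩ := h' hp s hs rfl
    exact ⟨s', _, .iteFalse _ hp h4, by omega, h6⟩

theorem wld {p a : ℕ} {e : Ex} (he : e.Ok S u) (h : Q (u.setWReg p (u.wmem a (e.eval u)))) :
    Wp S (wld p a e) (e.cost + 1) u Q := by
  intro s hs hu
  subst hu
  obtain ⟨s1, h1, h2, h3⟩ := e.exec_comp 0 s hs he
  refine ⟨_, _, .seq h1 (.instr (.wload p a 1) s1 (h1.bounded hs)), le_rfl, ?_⟩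
  have h3' : s1.reg 1 = e.eval s.user := h3
  have : (s1.setWReg p (s1.wmem a (s1.reg 1))).user =
    s1.user.setWReg p (s1.user.wmem a (s1.reg 1)) := rfl
  rw [Instr.effect, this, h2, h3']
  exact h

theorem wst {p a : ℕ} {e : Ex} (he : e.Ok S u) (h : Q (u.setWMem a (e.eval u) (u.wreg p))) :
    Wp S (wst a e p) (e.cost + 1) u Q := by
  intro s hs hu
  subst hu
  obtain ⟨s1, h1, h2, h3⟩ := e.exec_comp 0 s hs he
  refine ⟨_, _, .seq h1 (.instr (.wstore a 1 p) s1 (h1.bounded hs)), le_rfl, ?_⟩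
  have h3' : s1.reg 1 = e.eval s.user := h3
  have : (s1.setWMem a (s1.reg 1) (s1.wreg p)).user =
    s1.user.setWMem a (s1.reg 1) (s1.user.wreg p) := rfl
  rw [Instr.effect, this, h2, h3']
  exact h

theorem wzero {p : ℕ} (h : Q (u.setWReg p 0)) : Wp S (.instr (.wzero p)) 1 u Q := by
  intro s hs hu
  subst hu
  exact ⟨_, _, .instr (.wzero p) s hs, le_rfl, h⟩

theorem wadd {p q r : ℕ} (h : Q (u.setWReg p (u.wreg q + u.wreg r))) :
    Wp S (.instr (.wadd p q r)) 1 u Q := by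
  intro s hs hu
  subst hu
  exact ⟨_, _, .instr (.wadd p q r) s hs, le_rfl, h⟩

/-- The rule for loops: `I k` is the invariant when the counter has the value `k`. -/
theorem forP {x b : ℕ} (I : ℕ → Store → Prop) (C : ℕ → ℕ) (hx : ¬ P.UW (.reg x))
    (hb : ¬ P.UW (.reg b)) (hxb : b ≠ x) (h0 : I 0 (u.setReg x 0))
    (hI : ∀ k < u.reg b, ∀ v, Fr (forP x b P) u v → v.reg x = k → I k v →
      Wp S P (C k) v fun v' => I (k + 1) (v'.setReg x (k + 1)))
    (hQ : ∀ v, Fr (WordRAM.forP x b P) u v → v.reg x = u.reg b → I (u.reg b) v → Q v) :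
    Wp S (WordRAM.forP x b P) (∑ k ∈ Finset.range (u.reg b), (C k + 5) + 3) u Q := by
  set N := u.reg b with hN
  have hfb : ∀ v, Fr (WordRAM.forP x b P) u v → v.reg b = N := fun v hv =>
    hv.reg b (by simp [hxb, hb])
  -- Induction on the number `d` of rounds that remain.
  have main : ∀ d k : ℕ, k + d = N → ∀ v, Fr (WordRAM.forP x b P) u v → v.reg x = k → I k v →
      Wp S (.loop (.lt (2 * x) (2 * b)) (P ;; WordRAM.asg x (.var x + 1)))
        (∑ j ∈ Finset.Ico k N, (C j + 5) + 1) v Q := by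
    intro d
    induction d with
    | zero =>
      intro k hk v hv hvx hIv s hs hu
      subst hu
      obtain rfl : k = N := by omega
      have e1 : s.reg (2 * x) = N := hvx
      have e2 : s.reg (2 * b) = N := hfb _ hv
      exact ⟨s, 1, .loopDone _ (by simp [Test.Holds, e1, e2]), by omega, hQ _ hv hvx hIv⟩
    | succ d ih =>
      intro k hk v hv hvx hIv s hs hu
      subst hu
      have hkN : k < N := by omega
      have e1 : s.reg (2 * x) = k := hvx
      have e2 : s.reg (2 * b) = N := hfb _ hv
      obtain ⟨s1, t1, h1, h2, h3, h4⟩ := (hI k hkN _ hv hvx hIv).frame s hs rfl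
      have b1 := h1.bounded hs
      have e3 : s1.user.reg x = k := by rw [h4.reg x hx]; exact hvx
      -- The increased counter fits into a word because the loop bound, at least `k + 1`, is itself
      -- a word.
      have e4 : k + 1 ≤ S := by
        have := hs.1 (2 * b)
        omega
      obtain ⟨s2, t2, h5, h6, h7, h8⟩ := (asg (S := S) (u := s1.user) (x := x) (e := .var x + 1)
        (Q := fun v => v = s1.user.setReg x (k + 1)) (by simp [e3]; omega)
        (by simp [e3])).frame s1 b1 rfl
      have b2 := h5.bounded b1
      have hF : Fr (WordRAM.forP x b P) u s2.user := by
        refine hv.trans (Fr.trans (h4.weaken fun l hl => by simp [hl]) (h8.weaken fun l hl => ?_))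
        simp only [uw_asg] at hl
        simp [hl]
      obtain ⟨s3, t3, h9, h10, h11⟩ := ih (k + 1) (by omega) s2.user hF (by
        rw [h7]; simp [Store.setReg]) (by rw [h7]; exact h3) s2 b2 rfl
      refine ⟨s3, _, .loopStep (by simp [Test.Holds, e1, e2, hkN]) (.seq h1 h5) h9, ?_, h11⟩
      rw [Finset.sum_eq_sum_Ico_succ_bot hkN]
      simp at h6
      omega
  have := seq (S := S) (P := WordRAM.asg x 0) (u := u) (R := fun v => v = u.setReg x 0)
    (asg (by simp) (by simp)) (fun v hv hF => by
      refine main N 0 (by omega) v ?_ ?_ ?_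
      · exact hF.weaken fun l hl => by simp at hl; simp [hl]
      · rw [hv]; simp [Store.setReg]
      · rw [hv]; exact h0)
  refine this.time ?_
  simp
  omega

/-- The rule for loops with a bound on the cost of a round. -/
theorem forP_const {x b : ℕ} (I : ℕ → Store → Prop) (C : ℕ) (hx : ¬ P.UW (.reg x))
    (hb : ¬ P.UW (.reg b)) (hxb : b ≠ x) (h0 : I 0 (u.setReg x 0))
    (hI : ∀ k < u.reg b, ∀ v, Fr (WordRAM.forP x b P) u v → v.reg x = k → I k v →
      Wp S P C v fun v' => I (k + 1) (v'.setReg x (k + 1)))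
    (hQ : ∀ v, Fr (WordRAM.forP x b P) u v → v.reg x = u.reg b → I (u.reg b) v → Q v) :
    Wp S (WordRAM.forP x b P) (u.reg b * (C + 5) + 3) u Q :=
  (forP I (fun _ => C) hx hb hxb h0 hI hQ).time (by simp)

end Wp

section simps
variable (u : Store) (x v a i : ℕ) (r : ℚ)
@[simp] theorem setReg_mem : (u.setReg x v).mem = u.mem := rfl
@[simp] theorem setReg_wreg : (u.setReg x v).wreg = u.wreg := rfl
@[simp] theorem setReg_wmem : (u.setReg x v).wmem = u.wmem := rfl
@[simp] theorem setReg_reg : (u.setReg x v).reg = Function.update u.reg x v := rfl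
@[simp] theorem setMem_reg : (u.setMem a i v).reg = u.reg := rfl
@[simp] theorem setMem_wreg : (u.setMem a i v).wreg = u.wreg := rfl
@[simp] theorem setMem_wmem : (u.setMem a i v).wmem = u.wmem := rfl
@[simp] theorem setMem_mem :
    (u.setMem a i v).mem = Function.update u.mem a (Function.update (u.mem a) i v) := rfl
@[simp] theorem setWReg_reg : (u.setWReg x r).reg = u.reg := rfl
@[simp] theorem setWReg_mem : (u.setWReg x r).mem = u.mem := rfl
@[simp] theorem setWReg_wmem : (u.setWReg x r).wmem = u.wmem := rfl
@[simp] theorem setWReg_wreg : (u.setWReg x r).wreg = Function.update u.wreg x r := rfl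
@[simp] theorem setWMem_reg : (u.setWMem a i r).reg = u.reg := rfl
@[simp] theorem setWMem_mem : (u.setWMem a i r).mem = u.mem := rfl
@[simp] theorem setWMem_wreg : (u.setWMem a i r).wreg = u.wreg := rfl
@[simp] theorem setWMem_wmem :
    (u.setWMem a i r).wmem = Function.update u.wmem a (Function.update (u.wmem a) i r) := rfl
end simps

end WordRAM

namespace WordRAM

/-! ## Renaming the registers and memories of a program -/

/-- The program with its registers and memories moved out of the way. -/
def Instr.shift : Instr → Instr
  | const x k => const (2 * (x + 100)) k
  | copy x y => copy (2 * (x + 100)) (2 * (y + 100))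
  | add x y z => add (2 * (x + 100)) (2 * (y + 100)) (2 * (z + 100))
  | sub x y z => sub (2 * (x + 100)) (2 * (y + 100)) (2 * (z + 100))
  | mul x y z => mul (2 * (x + 100)) (2 * (y + 100)) (2 * (z + 100))
  | div x y z => div (2 * (x + 100)) (2 * (y + 100)) (2 * (z + 100))
  | load x a i => load (2 * (x + 100)) (a + 100) (2 * (i + 100))
  | store a i x => store (a + 100) (2 * (i + 100)) (2 * (x + 100))
  | wzero p => wzero (p + 100)
  | wcopy p q => wcopy (p + 100) (q + 100)
  | wadd p q r => wadd (p + 100) (q + 100) (r + 100)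
  | wload p a i => wload (p + 100) (a + 100) (2 * (i + 100))
  | wstore a i p => wstore (a + 100) (2 * (i + 100)) (p + 100)

def Test.shift : Test → Test
  | eq x y => eq (2 * (x + 100)) (2 * (y + 100))
  | lt x y => lt (2 * (x + 100)) (2 * (y + 100))
  | wlt p q => wlt (p + 100) (q + 100)

def Prog.shift : Prog → Prog
  | skip => skip
  | instr i => instr i.shift
  | seq P Q => seq P.shift Q.shift
  | ite b P Q => ite b.shift P.shift Q.shift
  | loop b P => loop b.shift P.shift

/-- The part of a store that a shifted program sees. -/
def Store.part (s : Store) : Store where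
  reg x := s.reg (2 * (x + 100))
  mem a := s.mem (a + 100)
  wreg p := s.wreg (p + 100)
  wmem a := s.wmem (a + 100)

/-- The renaming is injective, so effects commute with the projection to the renamed part; this is
the single step of the simulation `Exec.shift`. -/
theorem Instr.part_effect_shift (i : Instr) (s : Store) :
    (i.shift.effect s).part = i.effect s.part := by
  have h1 : ∀ (f : ℕ → ℕ) (x v : ℕ), (fun y => Function.update f (2 * (x + 100)) v (2 * (y + 100)))
      = Function.update (fun y => f (2 * (y + 100))) x v := by
    intro f x v
    funext y
    by_cases h : y = x
    · subst h; simp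
    · rw [Function.update_of_ne h, Function.update_of_ne (by omega)]
  have h2 : ∀ {α : Type} (f : ℕ → α) (x : ℕ) (v : α),
      (fun y => Function.update f (x + 100) v (y + 100))
      = Function.update (fun y => f (y + 100)) x v := by
    intro α f x v
    funext y
    by_cases h : y = x
    · subst h; simp
    · rw [Function.update_of_ne h, Function.update_of_ne (by omega)]
  cases i <;> simp [Instr.shift, Instr.effect, Store.part, Store.setReg, Store.setMem,
    Store.setWReg, Store.setWMem, h1, h2]

/-- An instruction that writes a word register changes only that register, and its new value also
occurs in the unshifted run; a store copies a word that is already bounded. -/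
theorem Instr.bounded_effect_shift {S : ℕ} (i : Instr) (s : Store) (hs : s.Bounded S)
    (h : (i.effect s.part).Bounded S) : (i.shift.effect s).Bounded S := by
  cases i with
  | wzero | wcopy | wadd | wload | wstore => exact hs
  | store a k x => exact hs.setMem _ _ (hs.1 _)
  | const x | copy x | add x | sub x | mul x | div x | load x =>
    refine hs.setReg _ ?_
    have := h.1 x
    simpa [Instr.effect, Store.setReg, Store.part] using this

theorem Test.holds_shift (b : Test) (s : Store) : b.shift.Holds s ↔ b.Holds s.part := by
  cases b <;> rfl

theorem Exec.shift {S : ℕ} {P : Prog} {s s' : Store} {t : ℕ} (h : Exec S P s s' t) (r : Store)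
    (hr : r.Bounded S) (hrs : r.part = s) :
    ∃ r', Exec S P.shift r r' t ∧ r'.part = s' := by
  induction h generalizing r with
  | skip s => exact ⟨r, .skip r, hrs⟩
  | instr i s h =>
    subst hrs
    exact ⟨_, .instr _ _ (i.bounded_effect_shift r hr h), i.part_effect_shift r⟩
  | seq _ _ ih ih' =>
    obtain ⟨r1, h1, h2⟩ := ih r hr hrs
    obtain ⟨r2, h3, h4⟩ := ih' r1 (h1.bounded hr) h2
    exact ⟨r2, .seq h1 h3, h4⟩
  | iteTrue Q hb _ ih =>
    obtain ⟨r1, h1, h2⟩ := ih r hr hrs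
    exact ⟨r1, .iteTrue _ ((Test.holds_shift _ _).2 (hrs ▸ hb)) h1, h2⟩
  | iteFalse P hb _ ih =>
    obtain ⟨r1, h1, h2⟩ := ih r hr hrs
    exact ⟨r1, .iteFalse _ (fun h => hb (hrs ▸ (Test.holds_shift _ _).1 h)) h1, h2⟩
  | loopDone P hb =>
    exact ⟨r, .loopDone _ (fun h => hb (hrs ▸ (Test.holds_shift _ _).1 h)), hrs⟩
  | loopStep hb _ _ ih ih' =>
    obtain ⟨r1, h1, h2⟩ := ih r hr hrs
    obtain ⟨r2, h3, h4⟩ := ih' r1 (h1.bounded hr) h2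
    exact ⟨r2, .loopStep ((Test.holds_shift _ _).2 (hrs ▸ hb)) h1 h3, h4⟩

/-- The name of a register or of a memory. -/
def Loc.name : Loc → ℕ
  | reg x | mem x | wreg x | wmem x => x

theorem uw_shift (P : Prog) (l : Loc) (h : P.shift.UW l) : 100 ≤ l.name := by
  induction P with
  | skip => exact h.elim
  | instr i =>
    cases i <;> cases l <;> simp [Prog.UW, Prog.shift, Prog.Writes, Instr.shift, Instr.target,
      Loc.full, Loc.name] at h ⊢ <;> omega
  | seq P Q ihP ihQ => exact h.elim ihP ihQ
  | ite b P Q ihP ihQ => exact h.elim ihP ihQ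
  | loop b P ih => exact ih h

theorem not_uw_shift_reg (P : Prog) {x : ℕ} (hx : x < 100) : ¬ P.shift.UW (.reg x) :=
  fun h => absurd (uw_shift P _ h) (by simpa [Loc.name] using hx)

theorem not_uw_shift_mem (P : Prog) {x : ℕ} (hx : x < 100) : ¬ P.shift.UW (.mem x) :=
  fun h => absurd (uw_shift P _ h) (by simpa [Loc.name] using hx)

theorem not_uw_shift_wmem (P : Prog) {x : ℕ} (hx : x < 100) : ¬ P.shift.UW (.wmem x) :=
  fun h => absurd (uw_shift P _ h) (by simpa [Loc.name] using hx)

/-! ## Matrix multiplication -/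

/-- `P` multiplies two `m × m` matrices over `GF(2)` in `time m` steps on words up to
`(m + 1) ^ c`. -/
def Multiplies (P : Prog) (c : ℕ) (time : ℕ → ℕ) : Prop :=
  ∀ m : ℕ, 1 ≤ m → ∀ (A B : Matrix (Fin m) (Fin m) (ZMod 2)) (S : ℕ), (m + 1) ^ c ≤ S →
    ∀ s : Store, s.Bounded S → s.reg 0 = m → HoldsMatrix s 0 A → HoldsMatrix s 1 B →
    ∃ (s' : Store) (t : ℕ), Exec S P s s' t ∧ t ≤ time m ∧ HoldsMatrix s' 2 (A * B)

/-- The multiplication program tolerates arbitrary contents outside its input, so it can be called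
again and again without clearing its memories, and the renaming keeps it away from the caller's
locations below 100. -/
theorem Multiplies.wp {P : Prog} {c : ℕ} {time : ℕ → ℕ} (hP : Multiplies P c time) {S m : ℕ}
    (hm : 1 ≤ m) (hS : (m + 1) ^ c ≤ S) (A B : Matrix (Fin m) (Fin m) (ZMod 2)) {u : Store}
    (hu : u.reg 100 = m) (hA : HoldsMatrix u 100 A) (hB : HoldsMatrix u 101 B) :
    Wp S P.shift (time m) u fun v => HoldsMatrix v 102 (A * B) := by
  intro s hs hsu
  subst hsu
  obtain ⟨s', t, h1, h2, h3⟩ := hP m hm A B S hS s.part ⟨fun x => hs.1 _, fun a i => hs.2 _ _⟩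
    hu hA hB
  obtain ⟨r', h4, h5⟩ := h1.shift s hs rfl
  subst h5
  exact ⟨r', t, h4, h2, h3⟩

/-- Passing to `max C 0` gives a nonnegative constant, and an integral number of steps below a real
bound is below its floor. -/
theorem MatMulExponent.multiplies {ω : ℝ} (h : MatMulExponent ω) :
    ∃ (P : Prog) (c : ℕ) (C : ℝ), 0 ≤ C ∧ Multiplies P c fun m => ⌊C * (m : ℝ) ^ ω⌋₊ := by
  obtain ⟨P, c, C, h⟩ := h
  refine ⟨P, c, max C 0, le_max_right _ _, fun m hm A B S hS s hs h0 hA hB => ?_⟩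
  obtain ⟨s', t, h1, h2, h3⟩ := h m hm A B S hS s hs h0 hA hB
  refine ⟨s', t, h1, Nat.le_floor (h2.trans ?_), h3⟩
  gcongr
  exact le_max_left _ _

/-- A program changes at most one cell of a memory in each step. -/
theorem Exec.encard_changed_le {S : ℕ} {P : Prog} {s s' : Store} {t : ℕ} (h : Exec S P s s' t)
    (a : ℕ) : {i | s'.mem a i ≠ s.mem a i}.encard ≤ t := by
  -- A cell changed by a composition is changed by one of its two parts.
  have tr : ∀ {s s' s'' : Store} {t t' : ℕ}, {i | s'.mem a i ≠ s.mem a i}.encard ≤ t →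
      {i | s''.mem a i ≠ s'.mem a i}.encard ≤ t' →
      {i | s''.mem a i ≠ s.mem a i}.encard ≤ (t + t' : ℕ) := by
    intro s s' s'' t t' h h'
    have : {i | s''.mem a i ≠ s.mem a i} ⊆
        {i | s'.mem a i ≠ s.mem a i} ∪ {i | s''.mem a i ≠ s'.mem a i} := by
      intro i hi
      by_contra hc
      simp only [Set.mem_union, Set.mem_ofPred_eq, not_or, not_not] at hc
      exact hi (hc.2.trans hc.1)
    refine (Set.encard_le_encard this).trans ((Set.encard_union_le _ _).trans ?_)
    push_cast
    exact add_le_add h h'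
  have mono : ∀ {x : ℕ∞} {t t' : ℕ}, x ≤ t → t ≤ t' → x ≤ t' := fun h h' =>
    h.trans (by exact_mod_cast h')
  induction h with
  | skip s => simp
  | loopDone P _ => simp
  | instr i s _ =>
    have : ∃ k, {j | (i.effect s).mem a j ≠ s.mem a j} ⊆ {k} := by
      cases i with
      | store b k x =>
        refine ⟨s.reg k, fun j hj => ?_⟩
        by_contra hc
        apply hj
        by_cases hab : a = b
        · subst hab
          simp only [Set.mem_singleton_iff] at hc
          simp [Instr.effect, hc]
        · simp [Instr.effect, Function.update_of_ne hab]
      | _ => exact ⟨0, fun j hj => (hj rfl).elim⟩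
    obtain ⟨k, hk⟩ := this
    exact (Set.encard_le_encard hk).trans (by simp)
  | seq _ _ ih ih' => exact tr ih ih'
  | iteTrue Q _ _ ih => exact mono ih (by omega)
  | iteFalse P _ _ ih => exact mono ih (by omega)
  | loopStep _ _ _ ih ih' => exact mono (tr ih ih') (by omega)

/-- Matrix multiplication takes at least quadratic time: the result has to be written. -/
theorem MatMulExponent.two_le {ω : ℝ} (h : MatMulExponent ω) : 2 ≤ ω := by
  obtain ⟨P, c, C, hC, h⟩ := h.multiplies
  have key : ∀ m : ℕ, 1 ≤ m → (m : ℝ) ^ 2 ≤ C * (m : ℝ) ^ ω := by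
    intro m hm
    set S := (m + 1) ^ c + m + 2 with hS
    -- Memory 2 starts filled with `2`, which is no entry over GF(2), so each of the `m * m` cells
    -- of the product must be overwritten. The other memories hold zero matrices.
    let s : Store := ⟨fun _ => m, fun a _ => if a = 2 then 2 else 0, fun _ => 0, fun _ _ => 0⟩
    have hs : s.Bounded S := ⟨fun _ => by simp [s, hS]; omega, fun a i => by
      simp only [s]; split_ifs <;> omega⟩
    obtain ⟨s', t, h1, h2, h3⟩ := h m hm 0 0 S (by omega) s hs rfl (fun i j => by simp [s])
      (fun i j => by simp [s])
    have h4 := h1.encard_changed_le 2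
    have h5 : ((Finset.range (m * m) : Finset ℕ) : Set ℕ) ⊆ {i | s'.mem 2 i ≠ s.mem 2 i} := by
      intro i hi
      simp only [Finset.coe_range, Set.mem_Iio] at hi
      have hlt : i / m < m := Nat.div_lt_of_lt_mul hi
      have := h3 ⟨i / m, hlt⟩ ⟨i % m, Nat.mod_lt _ hm⟩
      simp only [Nat.div_add_mod'] at this
      simp [this, s]
    have h6 := (Set.encard_le_encard h5).trans h4
    rw [Set.encard_coe_eq_coe_finsetCard, Finset.card_range] at h6
    have h7 : m * m ≤ t := by exact_mod_cast h6
    have h8 : ((m * m : ℕ) : ℝ) ≤ C * (m : ℝ) ^ ω :=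
      (Nat.cast_le.2 (h7.trans h2)).trans (Nat.floor_le (by positivity))
    rw [sq]
    exact_mod_cast h8
  by_contra! hlt
  -- If `ω < 2`, then `m ^ (2 - ω)` outgrows the constant `C`.
  have hlim : Filter.Tendsto (fun m : ℕ => (m : ℝ) ^ (2 - ω)) Filter.atTop Filter.atTop :=
    (tendsto_rpow_atTop (by linarith)).comp tendsto_natCast_atTop_atTop
  obtain ⟨m, hm, hm1⟩ := ((hlim.eventually_gt_atTop C).and
    (Filter.eventually_ge_atTop 1)).exists
  have hpos : (0 : ℝ) < m := by exact_mod_cast hm1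
  have h1 := key m hm1
  rw [Real.rpow_sub hpos, lt_div_iff₀ (by positivity)] at hm
  have : (m : ℝ) ^ (2 : ℝ) = (m : ℝ) ^ 2 := by norm_cast
  rw [this] at hm
  linarith

end WordRAM

namespace WordRAM

/-! ## Truth values -/

/-- `k` is the truth value of `p`. -/
def Flag (k : ℕ) (p : Prop) : Prop := k = 1 ∧ p ∨ k = 0 ∧ ¬ p

namespace Flag
variable {k l : ℕ} {p q : Prop}

theorem le_one (h : Flag k p) : k ≤ 1 := by rcases h with h | h <;> omega
theorem pos_iff (h : Flag k p) : 0 < k ↔ p := by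
  rcases h with ⟨rfl, h⟩ | ⟨rfl, h⟩ <;> simp [h]
theorem eq_zero_iff (h : Flag k p) : k = 0 ↔ ¬ p := by
  rcases h with ⟨rfl, h⟩ | ⟨rfl, h⟩ <;> simp [h]
theorem eq_one_iff (h : Flag k p) : k = 1 ↔ p := by
  rcases h with ⟨rfl, h⟩ | ⟨rfl, h⟩ <;> simp [h]
theorem eq_one (h : Flag k p) (hp : p) : k = 1 := h.eq_one_iff.2 hp
theorem eq_zero (h : Flag k p) (hp : ¬ p) : k = 0 := h.eq_zero_iff.2 hp
theorem congr (h : Flag k p) (hpq : p ↔ q) : Flag k q := by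
  rwa [Flag, ← hpq]
theorem and (h : Flag k p) (h' : Flag l q) : Flag (k * l) (p ∧ q) := by
  rcases h with ⟨rfl, h⟩ | ⟨rfl, h⟩ <;> rcases h' with ⟨rfl, h'⟩ | ⟨rfl, h'⟩ <;> simp [Flag, h, h']
theorem not (h : Flag k p) : Flag (1 - k) (¬ p) := by
  rcases h with ⟨rfl, h⟩ | ⟨rfl, h⟩ <;> simp [Flag, h]
theorem of_ite [Decidable p] (h : k = if p then 1 else 0) : Flag k p := by
  by_cases hp : p <;> simp [Flag, h, hp]
theorem eq_ite [Decidable p] (h : Flag k p) : k = if p then 1 else 0 := by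
  rcases h with ⟨rfl, h⟩ | ⟨rfl, h⟩ <;> simp [h]
theorem lt (k l : ℕ) : Flag (1 - (1 - (l - k))) (k < l) := by
  rcases lt_or_ge k l with h | h
  · exact .inl ⟨by omega, h⟩
  · exact .inr ⟨by omega, by omega⟩
end Flag

namespace Ex

/-- Conjunction of truth values. -/
def and (e f : Ex) : Ex := e * f
/-- Negation of a truth value. -/
def not (e : Ex) : Ex := 1 - e
/-- Disjunction of truth values. -/
def or (e f : Ex) : Ex := not (and (not e) (not f))
/-- The truth value of `e < f`. -/
def lt (e f : Ex) : Ex := 1 - (1 - (f - e))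
/-- The truth value of `e = f`. -/
def eq (e f : Ex) : Ex := and (not (lt e f)) (not (lt f e))

@[simp] theorem cost_and (e f : Ex) : (and e f).cost = e.cost + (f.cost + 1) := rfl
@[simp] theorem cost_not (e : Ex) : (not e).cost = 1 + (e.cost + 1) := rfl
@[simp] theorem cost_or (e f : Ex) :
    (or e f).cost = 1 + ((1 + (e.cost + 1)) + ((1 + (f.cost + 1)) + 1) + 1) := rfl
@[simp] theorem cost_lt (e f : Ex) :
    (lt e f).cost = 1 + ((1 + (f.cost + (e.cost + 1) + 1)) + 1) := rfl
@[simp] theorem cost_eq (e f : Ex) :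
    (eq e f).cost = (1 + ((lt e f).cost + 1)) + ((1 + ((lt f e).cost + 1)) + 1) := rfl

end Ex

/-- In the store `u`, the expression `e` evaluates to the truth value of `p`. -/
structure EFlag (S : ℕ) (u : Store) (e : Ex) (p : Prop) : Prop where
  one : 1 ≤ S
  ok : e.Ok S u
  flag : Flag (e.eval u) p

namespace EFlag
variable {S : ℕ} {u : Store} {e f : Ex} {p q : Prop}

theorem and (h : EFlag S u e p) (h' : EFlag S u f q) : EFlag S u (e.and f) (p ∧ q) :=
  ⟨h.one, ⟨h.ok, h'.ok, (h.flag.and h'.flag).le_one.trans h.one⟩, h.flag.and h'.flag⟩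
theorem not (h : EFlag S u e p) : EFlag S u e.not (¬ p) := ⟨h.one, ⟨h.one, h.ok⟩, h.flag.not⟩
theorem congr (h : EFlag S u e p) (hpq : p ↔ q) : EFlag S u e q := ⟨h.one, h.ok, h.flag.congr hpq⟩
theorem or (h : EFlag S u e p) (h' : EFlag S u f q) : EFlag S u (e.or f) (p ∨ q) :=
  (h.not.and h'.not).not.congr (by tauto)
theorem lt (hS : 1 ≤ S) (he : e.Ok S u) (hf : f.Ok S u) :
    EFlag S u (e.lt f) (e.eval u < f.eval u) :=
  ⟨hS, ⟨hS, hS, hf, he⟩, .lt _ _⟩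
theorem eq (hS : 1 ≤ S) (he : e.Ok S u) (hf : f.Ok S u) :
    EFlag S u (e.eq f) (e.eval u = f.eval u) :=
  ((lt hS he hf).not.and (lt hS hf he).not).congr (by omega)
theorem of (hS : 1 ≤ S) (he : e.Ok S u) (h : Flag (e.eval u) p) : EFlag S u e p := ⟨hS, he, h⟩

end EFlag

/-! ## Double loops -/

/-- A double loop. -/
def for2 (i b j c : ℕ) (P : Prog) : Prog := forP i b (forP j c P)

@[simp] theorem uw_for2 (i b j c : ℕ) (P : Prog) (l : Loc) :
    (for2 i b j c P).UW l ↔ l = .reg i ∨ l = .reg j ∨ P.UW l := by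
  simp [for2]

/-- The registers of a double loop do not interfere. -/
structure For2 (i b j c : ℕ) (P : Prog) : Prop where
  ui : ¬ P.UW (.reg i)
  uj : ¬ P.UW (.reg j)
  ub : ¬ P.UW (.reg b)
  uc : ¬ P.UW (.reg c)
  bi : b ≠ i
  bj : b ≠ j
  ci : c ≠ i
  cj : c ≠ j
  ij : i ≠ j

/-- The pairs before `(I, J)` in the lexicographic order. -/
def LexBefore (I J I' J' : ℕ) : Prop := I' < I ∨ I' = I ∧ J' < J

namespace Wp
variable {S : ℕ} {P : Prog} {u : Store} {Q : Store → Prop}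

/-- `K I J` is the invariant when the pairs before `(I, J)` in lexicographic order are done; `hnext`
identifies the end of a row with the start of the next, and `hK` makes `K` insensitive to the
counters. -/
theorem for2 {i b j c : ℕ} (h : For2 i b j c P) (C : ℕ) (K : ℕ → ℕ → Store → Prop)
    (hK : ∀ I J x n v, x = i ∨ x = j → K I J v → K I J (v.setReg x n))
    (hnext : ∀ I v, K I (u.reg c) v → K (I + 1) 0 v)
    (h0 : K 0 0 u)
    (hbody : ∀ I < u.reg b, ∀ J < u.reg c, ∀ v, Fr (for2 i b j c P) u v → v.reg i = I →
      v.reg j = J → K I J v → Wp S P C v (K I (J + 1)))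
    (hQ : ∀ v, Fr (WordRAM.for2 i b j c P) u v → K (u.reg b) 0 v → Q v) :
    Wp S (WordRAM.for2 i b j c P) (u.reg b * (u.reg c * (C + 5) + 8) + 3) u Q := by
  refine (forP_const (fun I => K I 0) (u.reg c * (C + 5) + 3) (by simp [h.ui, h.ij])
    (by simp [h.ub, h.bj]) h.bi (hK _ _ _ _ _ (.inl rfl) h0) ?_ fun v hv _ => hQ v hv)
  intro I hI v hv hvi hKv
  have hc : v.reg c = u.reg c := hv.reg c (by simp [h.ci, h.cj, h.uc])
  rw [← hc]
  refine forP_const (fun J => K I J) C h.uj h.uc h.cj (hK _ _ _ _ _ (.inr rfl) hKv) ?_ ?_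
  · intro J hJ v' hv' hvj hKv'
    refine (hbody I hI J (hc ▸ hJ) v' (hv.trans (hv'.weaken ?_)) ?_ hvj hKv').post fun v'' h'' => ?_
    · intro l hl; simp at hl ⊢; tauto
    · rw [hv'.reg i (by simp [h.ui, h.ij]), hvi]
    · exact hK _ _ _ _ _ (.inr rfl) h''
  · intro v' hv' _ hKv'
    rw [hc] at hKv'
    exact hK _ _ _ _ _ (.inl rfl) (hnext _ _ hKv')

/-- Fill the cells `adr I J` of the memory `a`. -/
theorem fill2 {i b j c a : ℕ} (h : For2 i b j c P) (C : ℕ) (adr val : ℕ → ℕ → ℕ)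
    (hinj : ∀ I < u.reg b, ∀ J < u.reg c, ∀ I' < u.reg b, ∀ J' < u.reg c,
      adr I J = adr I' J' → I = I' ∧ J = J')
    (hbody : ∀ I < u.reg b, ∀ J < u.reg c, ∀ v, Fr (WordRAM.for2 i b j c P) u v → v.reg i = I →
      v.reg j = J → v.mem a (adr I J) = u.mem a (adr I J) →
      (∀ x, (∀ I < u.reg b, ∀ J < u.reg c, adr I J ≠ x) → v.mem a x = u.mem a x) →
      Wp S P C v fun v' => v'.mem a = Function.update (v.mem a) (adr I J) (val I J))
    (hQ : ∀ v, Fr (WordRAM.for2 i b j c P) u v →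
      (∀ I < u.reg b, ∀ J < u.reg c, v.mem a (adr I J) = val I J) →
      (∀ x, (∀ I < u.reg b, ∀ J < u.reg c, adr I J ≠ x) → v.mem a x = u.mem a x) → Q v) :
    Wp S (WordRAM.for2 i b j c P) (u.reg b * (u.reg c * (C + 5) + 8) + 3) u Q := by
  -- Visited cells hold their final values and all others the original ones; injectivity of `adr`
  -- puts the current cell among the others.
  refine for2 h C (fun I J v =>
    (∀ I' < u.reg b, ∀ J' < u.reg c, LexBefore I J I' J' → v.mem a (adr I' J') = val I' J') ∧
    (∀ x, (∀ I' < u.reg b, ∀ J' < u.reg c, LexBefore I J I' J' → adr I' J' ≠ x) →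
      v.mem a x = u.mem a x)) (fun I J x n v _ hv => hv) ?_ ?_ ?_ ?_
  · intro I v hv
    refine ⟨fun I' hI' J' hJ' hl => hv.1 I' hI' J' hJ' ?_, fun x hx => hv.2 x fun I' hI' J' hJ' hl =>
      hx I' hI' J' hJ' ?_⟩ <;> unfold LexBefore at * <;> omega
  · refine ⟨fun I' _ J' _ hl => ?_, fun x _ => rfl⟩
    unfold LexBefore at hl
    omega
  · intro I hI J hJ v hF hi hj hv
    refine (hbody I hI J hJ v hF hi hj ?_ ?_).post fun v' hv' => ⟨?_, ?_⟩
    · refine hv.2 _ fun I' hI' J' hJ' hl heq => ?_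
      have := hinj _ hI' _ hJ' _ hI _ hJ heq
      unfold LexBefore at hl
      omega
    · exact fun x hx => hv.2 x fun I' hI' J' hJ' _ => hx I' hI' J' hJ'
    · intro I' hI' J' hJ' hl
      rw [hv']
      by_cases he : adr I' J' = adr I J
      · obtain ⟨rfl, rfl⟩ := hinj _ hI' _ hJ' _ hI _ hJ he
        simp
      · rw [Function.update_of_ne he]
        refine hv.1 I' hI' J' hJ' ?_
        have : ¬ (I' = I ∧ J' = J) := fun h => he (by rw [h.1, h.2])
        unfold LexBefore at *
        omega
    · intro x hx
      rw [hv', Function.update_of_ne (hx I hI J hJ (.inr ⟨rfl, by omega⟩)).symm]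
      refine hv.2 x fun I' hI' J' hJ' hl => hx I' hI' J' hJ' ?_
      unfold LexBefore at *
      omega
  · intro v hF hv
    refine hQ v hF (fun I hI J hJ => hv.1 I hI J hJ (.inl hI)) fun x hx => hv.2 x ?_
    exact fun I hI J hJ _ => hx I hI J hJ

end Wp

/-- Compute in the register `x` whether `e` is true for some values of the registers `i`, `j`. -/
def any2 (x i b j c : ℕ) (e : Ex) : Prog :=
  asg x 0 ;; for2 i b j c (asg x (Ex.or (.var x) e))

@[simp] theorem uw_any2 (x i b j c : ℕ) (e : Ex) (l : Loc) :
    (any2 x i b j c e).UW l ↔ l = .reg x ∨ l = .reg i ∨ l = .reg j := by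
  simp [any2]; tauto

theorem Wp.any2 {S : ℕ} {u : Store} {Q : Store → Prop} {x i b j c : ℕ} {e : Ex}
    (h : For2 i b j c (WordRAM.asg x e)) (hS : 1 ≤ S) (B : ℕ → ℕ → Prop)
    (he : ∀ I < u.reg b, ∀ J < u.reg c, ∀ v, Fr (any2 x i b j c e) u v → v.reg i = I →
      v.reg j = J → EFlag S v e (B I J))
    (hQ : ∀ v, Fr (WordRAM.any2 x i b j c e) u v →
      Flag (v.reg x) (∃ I < u.reg b, ∃ J < u.reg c, B I J) → Q v) :
    Wp S (WordRAM.any2 x i b j c e)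
      (u.reg b * (u.reg c * (e.cost + 15) + 8) + 5) u Q := by
  have hx1 : x ≠ i := by have := h.ui; simp at this; omega
  have hx2 : x ≠ j := by have := h.uj; simp at this; omega
  have hx3 : x ≠ b := by have := h.ub; simp at this; omega
  have hx4 : x ≠ c := by have := h.uc; simp at this; omega
  have hb : (u.setReg x 0).reg b = u.reg b := by simp [Function.update_of_ne hx3.symm]
  have hc : (u.setReg x 0).reg c = u.reg c := by simp [Function.update_of_ne hx4.symm]
  refine (Wp.seq (R := fun v => v = u.setReg x 0) (Wp.asg (by simp) (by simp)) fun v hv hF => ?_).time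
    (T := 2 + (u.reg b * (u.reg c * ((e.cost + 10) + 5) + 8) + 3)) (by ring_nf; omega)
  subst hv
  have h' : For2 i b j c (WordRAM.asg x (Ex.or (.var x) e)) :=
    ⟨by simp; omega, by simp; omega, by simp; omega, by simp; omega, h.bi, h.bj, h.ci, h.cj, h.ij⟩
  rw [← hb, ← hc]
  refine Wp.for2 h' _ (fun I J v => Flag (v.reg x)
    (∃ I' < u.reg b, ∃ J' < u.reg c, LexBefore I J I' J' ∧ B I' J')) ?_ ?_ ?_ ?_ ?_
  · rintro I J y n v (rfl | rfl) hv
    · simpa [Function.update_of_ne hx1] using hv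
    · simpa [Function.update_of_ne hx2] using hv
  · intro I v hv
    rw [hc] at hv
    refine hv.congr ?_
    constructor <;> rintro ⟨I', hI', J', hJ', hl, hB⟩ <;> refine ⟨I', hI', J', hJ', ?_, hB⟩ <;>
      unfold LexBefore at * <;> omega
  · refine .inr ⟨by simp, ?_⟩
    rintro ⟨I', hI', J', hJ', hl, hB⟩
    unfold LexBefore at hl
    omega
  · intro I hI J hJ v hF' hi hj hv
    rw [hb] at hI
    rw [hc] at hJ
    have hE := he I hI J hJ v ((hF.weaken (by simp)).trans (hF'.weaken (by
      intro l; simp; tauto))) hi hj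
    have hE' := (EFlag.of (e := .var x) hS (by simp) hv).or hE
    refine (Wp.asg hE'.ok ?_).time (by simp; omega)
    simp only [setReg_reg, Function.update_self]
    refine hE'.flag.congr ?_
    constructor
    · rintro (⟨I', hI', J', hJ', hl, hB⟩ | hB)
      · refine ⟨I', hI', J', hJ', ?_, hB⟩
        unfold LexBefore at *
        omega
      · exact ⟨I, hI, J, hJ, .inr ⟨rfl, by omega⟩, hB⟩
    · rintro ⟨I', hI', J', hJ', hl, hB⟩
      by_cases hc : I' = I ∧ J' = J
      · obtain ⟨rfl, rfl⟩ := hc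
        exact .inr hB
      · refine .inl ⟨I', hI', J', hJ', ?_, hB⟩
        unfold LexBefore at *
        omega
  · intro v hF' hv
    refine hQ v ((hF.weaken (by simp)).trans (hF'.weaken (by intro l; simp; tauto))) (hv.congr ?_)
    rw [hb]
    constructor
    · rintro ⟨I', hI', J', hJ', -, hB⟩
      exact ⟨I', hI', J', hJ', hB⟩
    · rintro ⟨I', hI', J', hJ', hB⟩
      exact ⟨I', hI', J', hJ', .inl hI', hB⟩

namespace Wp
variable {S : ℕ} {P : Prog} {u : Store} {Q : Store → Prop}

/-- `Wp.forP` with a name for the number of rounds. -/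
theorem forP_of {x b N : ℕ} (I : ℕ → Store → Prop) (C : ℕ → ℕ) (hN : u.reg b = N)
    (hx : ¬ P.UW (.reg x)) (hb : ¬ P.UW (.reg b)) (hxb : b ≠ x) (h0 : I 0 (u.setReg x 0))
    (hI : ∀ k < N, ∀ v, Fr (WordRAM.forP x b P) u v → v.reg x = k → I k v →
      Wp S P (C k) v fun v' => I (k + 1) (v'.setReg x (k + 1)))
    (hQ : ∀ v, Fr (WordRAM.forP x b P) u v → I N v → Q v) :
    Wp S (WordRAM.forP x b P) (∑ k ∈ Finset.range N, (C k + 5) + 3) u Q := by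
  subst hN
  exact forP I C hx hb hxb h0 hI fun v h1 _ h2 => hQ v h1 h2

/-- `Wp.forP_const` with a name for the number of rounds. -/
theorem forP_const_of {x b N : ℕ} (I : ℕ → Store → Prop) (C : ℕ) (hN : u.reg b = N)
    (hx : ¬ P.UW (.reg x)) (hb : ¬ P.UW (.reg b)) (hxb : b ≠ x) (h0 : I 0 (u.setReg x 0))
    (hI : ∀ k < N, ∀ v, Fr (WordRAM.forP x b P) u v → v.reg x = k → I k v →
      Wp S P C v fun v' => I (k + 1) (v'.setReg x (k + 1)))
    (hQ : ∀ v, Fr (WordRAM.forP x b P) u v → I N v → Q v) :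
    Wp S (WordRAM.forP x b P) (N * (C + 5) + 3) u Q := by
  subst hN
  exact forP_const I C hx hb hxb h0 hI fun v h1 _ h2 => hQ v h1 h2

/-- `Wp.fill2` with names for the numbers of rounds. -/
theorem fill2_of {i b j c a N M : ℕ} (hN : u.reg b = N) (hM : u.reg c = M) (h : For2 i b j c P)
    (C : ℕ) (adr val : ℕ → ℕ → ℕ)
    (hinj : ∀ I < N, ∀ J < M, ∀ I' < N, ∀ J' < M, adr I J = adr I' J' → I = I' ∧ J = J')
    (hbody : ∀ I < N, ∀ J < M, ∀ v, Fr (WordRAM.for2 i b j c P) u v → v.reg i = I →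
      v.reg j = J → v.mem a (adr I J) = u.mem a (adr I J) →
      (∀ x, (∀ I < N, ∀ J < M, adr I J ≠ x) → v.mem a x = u.mem a x) →
      Wp S P C v fun v' => v'.mem a = Function.update (v.mem a) (adr I J) (val I J))
    (hQ : ∀ v, Fr (WordRAM.for2 i b j c P) u v →
      (∀ I < N, ∀ J < M, v.mem a (adr I J) = val I J) →
      (∀ x, (∀ I < N, ∀ J < M, adr I J ≠ x) → v.mem a x = u.mem a x) → Q v) :
    Wp S (WordRAM.for2 i b j c P) (N * (M * (C + 5) + 8) + 3) u Q := by
  subst hN hM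
  exact fill2 h C adr val hinj hbody hQ

/-- `Wp.any2` with names for the numbers of rounds. -/
theorem any2_of {x i b j c N M : ℕ} {e : Ex} (hN : u.reg b = N) (hM : u.reg c = M)
    (h : For2 i b j c (WordRAM.asg x e)) (hS : 1 ≤ S) (B : ℕ → ℕ → Prop)
    (he : ∀ I < N, ∀ J < M, ∀ v, Fr (WordRAM.any2 x i b j c e) u v → v.reg i = I →
      v.reg j = J → EFlag S v e (B I J))
    (hQ : ∀ v, Fr (WordRAM.any2 x i b j c e) u v →
      Flag (v.reg x) (∃ I < N, ∃ J < M, B I J) → Q v) :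
    Wp S (WordRAM.any2 x i b j c e) (N * (M * (e.cost + 15) + 8) + 5) u Q := by
  subst hN hM
  exact any2 h hS B he hQ

end Wp

end WordRAM

/-! ## Block elimination over `GF(2)` -/

namespace Elim

open Submodule

/-- Vectors over `GF(2)`; only finitely many coordinates will matter. -/
abbrev Vec : Type := ℕ → ZMod 2

/-- Row `r` vanishes in the pivot columns of the rows before `h` (other than `r`). Here `pc k` is
`p + 1` if row `k` has its pivot in column `p`, and `0` if it has none. -/
def Clear (pc : ℕ → ℕ) (W : ℕ → Vec) (r h : ℕ) : Prop :=
  ∀ k < h, k ≠ r → ∀ p, pc k = p + 1 → W r p = 0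

theorem Clear.mono {pc : ℕ → ℕ} {W : ℕ → Vec} {r h h' : ℕ} (hc : Clear pc W r h) (hh : h' ≤ h) :
    Clear pc W r h' := fun k hk => hc k (hk.trans_le hh)

/-- The coefficient with which row `k` has to be added to row `r`. -/
def coef (pc : ℕ → ℕ) (W : ℕ → Vec) (r k : ℕ) : ZMod 2 :=
  if pc k = 0 then 0 else W r (pc k - 1)

/-- The rows `d, …, d + s - 1` are cleared with the rows `c, …, c + s - 1`. -/
def step (pc : ℕ → ℕ) (W : ℕ → Vec) (c d s : ℕ) : ℕ → Vec := fun r =>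
  if d ≤ r ∧ r < d + s then W r + ∑ b ∈ Finset.range s, coef pc W r (c + b) • W (c + b) else W r

theorem step_of_not {pc : ℕ → ℕ} {W : ℕ → Vec} {c d s r : ℕ} (h : ¬ (d ≤ r ∧ r < d + s)) :
    step pc W c d s r = W r := if_neg h

/-- The invariant of the elimination of the rows `v 0, v 1, …`: the first `e` rows have been
processed, and the clearing is on the schedule of the first `i` rows. -/
structure Inv (R : ℕ) (v : ℕ → Vec) (pc : ℕ → ℕ) (W : ℕ → Vec) (i e : ℕ) : Prop where
  done : ∀ t q, (q + 1) * 2 ^ t ≤ i → ∀ r < R, q * 2 ^ t ≤ r → r < (q + 1) * 2 ^ t →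
    Clear pc W r ((q + 1) * 2 ^ t)
  ahead : ∀ t q, q * 2 ^ t ≤ i → ∀ r < R, q * 2 ^ t ≤ r → r < (q + 1) * 2 ^ t →
    Clear pc W r (q * 2 ^ t)
  pivot : ∀ r < e, ∀ p, pc r = p + 1 → W r p = 1
  zero : ∀ r < e, pc r = 0 → W r = 0
  mem : ∀ r < e, W r ∈ span (ZMod 2) (v '' Set.Iio e)
  sub : ∀ r < R, e ≤ r → W r - v r ∈ span (ZMod 2) (v '' Set.Iio e)
  iff : ∀ r < e, pc r = 0 ↔ v r ∈ span (ZMod 2) (v '' Set.Iio r)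
  inj : ∀ x ∈ span (ZMod 2) (v '' Set.Iio e), (∀ k < e, ∀ p, pc k = p + 1 → x p = 0) → x = 0

namespace Inv
variable {R : ℕ} {v : ℕ → Vec} {pc : ℕ → ℕ} {W : ℕ → Vec} {i e : ℕ}

theorem init (R : ℕ) (v : ℕ → Vec) (pc : ℕ → ℕ) : Inv R v pc v 0 0 where
  done t q h := by simp at h
  ahead t q h r _ _ _ k hk := by omega
  pivot r hr := by omega
  zero r hr := by omega
  mem r hr := by omega
  sub r _ _ := by simp
  iff r hr := by omega
  inj x hx _ := by simpa using hx

/-- The invariant looks only at rows below `R`. This allows passing from the abstract rows of `step`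
to those in memory, which agree with them only there. -/
theorem congr_rows (h : Inv R v pc W i e) (he : e ≤ R) {W' : ℕ → Vec}
    (hW : ∀ r < R, W' r = W r) : Inv R v pc W' i e where
  done t q hq r hr h1 h2 k hk hkr p hp := by rw [hW r hr]; exact h.done t q hq r hr h1 h2 k hk hkr p hp
  ahead t q hq r hr h1 h2 k hk hkr p hp := by
    rw [hW r hr]; exact h.ahead t q hq r hr h1 h2 k hk hkr p hp
  pivot r hr := by rw [hW r (by omega)]; exact h.pivot r hr
  zero r hr := by rw [hW r (by omega)]; exact h.zero r hr
  mem r hr := by rw [hW r (by omega)]; exact h.mem r hr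
  sub r hr := by rw [hW r hr]; exact h.sub r hr
  iff := h.iff
  inj := h.inj

/-- In the pivot column of a row before `c`, source and destination rows vanish already. In the
pivot column of a source row, this row has entry 1 and the other source rows have 0, so the
destination entry is added to itself, which gives 0 in characteristic two. -/
theorem clear_step (h : Inv R v pc W i e) {c d s : ℕ} (hcs : c + s = e)
    (hsrc : ∀ r, c ≤ r → r < c + s → Clear pc W r e)
    (hdst : ∀ r, d ≤ r → r < d + s → Clear pc W r c) :
    ∀ r, d ≤ r → r < d + s → Clear pc (step pc W c d s) r e := by
  intro r h1 h2 k hk hkr p hp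
  rw [step, if_pos ⟨h1, h2⟩, Pi.add_apply, Finset.sum_apply]
  simp only [Pi.smul_apply, smul_eq_mul]
  by_cases hkc : k < c
  · rw [hdst r h1 h2 k hkc hkr p hp, Finset.sum_eq_zero, add_zero]
    intro b hb
    rw [hsrc (c + b) (by omega) (by simp at hb; omega) k hk (by omega) p hp, mul_zero]
  · rw [Finset.sum_eq_single (k - c)]
    · have : c + (k - c) = k := by omega
      rw [this, h.pivot k hk p hp, mul_one, coef, if_neg (by omega), hp, Nat.add_sub_cancel]
      exact CharTwo.add_self_eq_zero _
    · intro b hb hbk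
      rw [hsrc (c + b) (by omega) (by simp at hb; omega) k hk (by omega) p hp, mul_zero]
    · intro hb
      simp at hb
      omega

/-- Destination rows change by combinations of processed rows, which respects the spans. Their own
pivot entries survive since the source rows, being different rows, vanish there; and a zero row gets
only zero coefficients. -/
theorem step (h : Inv R v pc W i e) {c d s : ℕ} (hie : i ≤ e) (hcs : c + s = e)
    (hdis : d + s ≤ c ∨ c + s ≤ d)
    (hsrc : ∀ r, c ≤ r → r < c + s → Clear pc W r e)
    (hdst : ∀ r, d ≤ r → r < d + s → Clear pc W r c) :
    Inv R v pc (step pc W c d s) i e := by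
  have key : ∀ r h', h' ≤ e → Clear pc W r h' → Clear pc (Elim.step pc W c d s) r h' := by
    intro r h' hh hc
    by_cases hr : d ≤ r ∧ r < d + s
    · exact (h.clear_step hcs hsrc hdst r hr.1 hr.2).mono hh
    · intro k hk hkr p hp
      rw [step_of_not hr]
      exact hc k hk hkr p hp
  have hmem : ∀ r, ∑ b ∈ Finset.range s, coef pc W r (c + b) • W (c + b) ∈
      span (ZMod 2) (v '' Set.Iio e) := fun r =>
    sum_mem fun b hb => smul_mem _ _ (h.mem _ (by simp at hb; omega))
  refine ⟨fun t q hq r hr h1 h2 => key _ _ (hq.trans hie) (h.done t q hq r hr h1 h2),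
    fun t q hq r hr h1 h2 => key _ _ (hq.trans hie) (h.ahead t q hq r hr h1 h2),
    fun r hr p hp => ?_, fun r hr hp => ?_, fun r hr => ?_, fun r hr hr' => ?_, h.iff, h.inj⟩
  · by_cases hrd : d ≤ r ∧ r < d + s
    · rw [Elim.step, if_pos hrd, Pi.add_apply, Finset.sum_apply, h.pivot r hr p hp,
        Finset.sum_eq_zero, add_zero]
      intro b hb
      simp only [Pi.smul_apply, smul_eq_mul]
      simp at hb
      rw [hsrc (c + b) (by omega) (by omega) r hr (by omega) p hp, mul_zero]
    · rw [step_of_not hrd]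
      exact h.pivot r hr p hp
  · by_cases hrd : d ≤ r ∧ r < d + s
    · rw [Elim.step, if_pos hrd, h.zero r hr hp, Finset.sum_eq_zero, add_zero]
      intro b hb
      simp [coef, h.zero r hr hp]
    · rw [step_of_not hrd]
      exact h.zero r hr hp
  · by_cases hrd : d ≤ r ∧ r < d + s
    · rw [Elim.step, if_pos hrd]
      exact add_mem (h.mem r hr) (hmem r)
    · rw [step_of_not hrd]
      exact h.mem r hr
  · by_cases hrd : d ≤ r ∧ r < d + s
    · rw [Elim.step, if_pos hrd, add_sub_right_comm]
      exact add_mem (h.sub r hr hr') (hmem r)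
    · rw [step_of_not hrd]
      exact h.sub r hr hr'

/-- Row `i` vanishes at all earlier pivots and differs from `v i` by an element of the earlier span.
By `inj`, it is therefore zero exactly if `v i` lies in that span; otherwise any column with entry 1
can serve as its pivot. -/
theorem leaf (h : Inv R v pc W i i) (hi : i < R) {x : ℕ}
    (hx : x = 0 ∧ W i = 0 ∨ ∃ p, x = p + 1 ∧ W i p = 1) :
    Inv R v (Function.update pc i x) W i (i + 1) := by
  set pc' := Function.update pc i x with hpc'
  have hlt : ∀ k, k < i → pc' k = pc k := fun k hk => Function.update_of_ne hk.ne _ _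
  have hself : pc' i = x := Function.update_self _ _ _
  have hclear : ∀ r h', h' ≤ i → Clear pc W r h' → Clear pc' W r h' := by
    intro r h' hh hc k hk hkr p hp
    exact hc k hk hkr p (by rwa [hlt k (by omega)] at hp)
  have hIio : Set.Iio (i + 1) = insert i (Set.Iio i) := by
    ext; simp only [Set.mem_Iio, Set.mem_insert_iff]; omega
  have hle : span (ZMod 2) (v '' Set.Iio i) ≤ span (ZMod 2) (v '' Set.Iio (i + 1)) :=
    span_mono (Set.image_mono (Set.Iio_subset_Iio (by omega)))
  have hi0 : Clear pc W i i := by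
    have := h.ahead 0 i (by simp) i hi (by simp) (by simp)
    simpa using this
  refine ⟨fun t q hq r hr h1 h2 => hclear _ _ hq (h.done t q hq r hr h1 h2),
    fun t q hq r hr h1 h2 => hclear _ _ hq (h.ahead t q hq r hr h1 h2),
    fun r hr p hp => ?_, fun r hr hp => ?_, fun r hr => ?_, fun r hr hr' => ?_, fun r hr => ?_,
    fun y hy hy0 => ?_⟩
  · rcases Nat.lt_succ_iff_lt_or_eq.1 hr with hr | rfl
    · exact h.pivot r hr p (by rwa [hlt r hr] at hp)
    · rw [hself] at hp
      rcases hx with ⟨rfl, _⟩ | ⟨p', rfl, hp'⟩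
      · omega
      · obtain rfl : p' = p := by omega
        exact hp'
  · rcases Nat.lt_succ_iff_lt_or_eq.1 hr with hr | rfl
    · exact h.zero r hr (by rwa [hlt r hr] at hp)
    · rw [hself] at hp
      rcases hx with ⟨_, h0⟩ | ⟨p', rfl, hp'⟩
      · exact h0
      · omega
  · rcases Nat.lt_succ_iff_lt_or_eq.1 hr with hr | rfl
    · exact hle (h.mem r hr)
    · have := add_mem (hle (h.sub r hi le_rfl)) (subset_span (s := v '' Set.Iio (r + 1))
        (R := ZMod 2) ⟨r, by simp, rfl⟩)
      simpa using this
  · exact hle (h.sub r hr (by omega))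
  · rcases Nat.lt_succ_iff_lt_or_eq.1 hr with hr | rfl
    · rw [hlt r hr]
      exact h.iff r hr
    · rw [hself]
      have hs := h.sub r hi le_rfl
      rcases hx with ⟨rfl, h0⟩ | ⟨p', rfl, hp'⟩
      · simpa [h0] using hs
      · refine ⟨by omega, fun hv => ?_⟩
        have hW : W r = 0 := by
          refine h.inj _ ?_ fun k hk p hp => hi0 k hk hk.ne p hp
          simpa using add_mem hs hv
        simp [hW] at hp'
  · rw [hIio, Set.image_insert_eq, mem_span_insert] at hy
    obtain ⟨a, z, hz, rfl⟩ := hy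
    have hs := h.sub i hi le_rfl
    -- Write the vector as a multiple of the reduced row `W i` plus an element of the earlier span;
    -- the latter vanishes at the earlier pivots and is zero by `inj`.
    set z' := z - a • (W i - v i) with hz'
    have hz'm : z' ∈ span (ZMod 2) (v '' Set.Iio i) := sub_mem hz (smul_mem _ _ hs)
    have heq : a • v i + z = a • W i + z' := by rw [hz', smul_sub]; abel
    rw [heq] at hy0 ⊢
    have hz0 : z' = 0 := h.inj _ hz'm fun k hk p hp => by
      have h1 := hy0 k (by omega) p (by rwa [hlt k hk])
      have h2 := hi0 k hk hk.ne p hp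
      simpa [h2] using h1
    rcases hx with ⟨_, h0⟩ | ⟨p', hxp, hp'⟩
    · rw [h0, hz0]; simp
    · have h1 := hy0 i (by omega) p' (by rw [hself, hxp])
      rw [hz0] at h1 ⊢
      simp [hp'] at h1
      simp [h1]

theorem clear_self (h : Inv R v pc W i (i + 1)) (hi : i < R) : Clear pc W i (i + 1) := by
  have := h.ahead 0 i (by simp) i hi (by simp) (by simp)
  simp at this
  intro k hk hki
  exact this k (by omega) hki

/-- As `2 ^ (t + 1)` divides `i + 1`, these rows form the complete aligned block of length `2 ^ t`
just before the last one, and `done` applies to it. -/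
theorem back (h : Inv R v pc W i (i + 1)) (hi : i < R) {t : ℕ} (ht : 2 ^ (t + 1) ∣ i + 1) {r : ℕ}
    (h1 : i + 1 - 2 * 2 ^ t ≤ r) (h2 : r < i + 1 - 2 ^ t) : Clear pc W r (i + 1 - 2 ^ t) := by
  obtain ⟨q, hq⟩ := ht
  have hp : 0 < 2 ^ t := by positivity
  rcases q with _ | q
  · omega
  have e1 : (2 * q + 0 + 1) * 2 ^ t = i + 1 - 2 ^ t := by
    rw [hq, pow_succ]; ring_nf; omega
  have e2 : (2 * q + 0) * 2 ^ t = i + 1 - 2 * 2 ^ t := by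
    rw [hq, pow_succ]; ring_nf; omega
  rw [← e1]
  exact h.done t (2 * q + 0) (by omega) r (by omega) (by omega) (by omega)

/-- As `i + 1` is an odd multiple of `2 ^ t`, these rows are the second half of the aligned block of
length `2 ^ (t + 1)` that starts at `i + 1 - 2 ^ t`, and `ahead` applies at level `t + 1`. -/
theorem forward (h : Inv R v pc W i (i + 1)) {t : ℕ} (ht : 2 ^ t ∣ i + 1)
    (ht' : ¬ 2 ^ (t + 1) ∣ i + 1) {r : ℕ} (hr : r < R) (h1 : i + 1 ≤ r)
    (h2 : r < i + 1 + 2 ^ t) : Clear pc W r (i + 1 - 2 ^ t) := by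
  obtain ⟨q, hq⟩ := ht
  have hp : 0 < 2 ^ t := by positivity
  obtain ⟨a, rfl | rfl⟩ : ∃ a, q = 2 * a ∨ q = 2 * a + 1 := ⟨q / 2, by omega⟩
  · exact absurd ⟨a, by rw [hq, pow_succ]; ring⟩ ht'
  have e1 : a * 2 ^ (t + 1) = i + 1 - 2 ^ t := by
    rw [hq, pow_succ]; ring_nf; omega
  have e2 : (a + 1) * 2 ^ (t + 1) = i + 1 + 2 ^ t := by
    rw [hq, pow_succ]; ring
  rw [← e1]
  exact h.ahead (t + 1) a (by omega) r hr (by omega) (by omega)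

/-- An aligned dyadic block that ends or starts at `i + 1` has length at most `2 ^ t`, so the two
cleared blocks cover all new obligations of `done` and `ahead`. -/
theorem next (h : Inv R v pc W i (i + 1)) {t : ℕ} (ht' : ¬ 2 ^ (t + 1) ∣ i + 1)
    (hsrc : ∀ r, i + 1 - 2 ^ t ≤ r → r < i + 1 → Clear pc W r (i + 1))
    (hdst : ∀ r < R, i + 1 ≤ r → r < i + 1 + 2 ^ t → Clear pc W r (i + 1)) :
    Inv R v pc W (i + 1) (i + 1) := by
  have key : ∀ t' q, q * 2 ^ t' = i + 1 → 2 ^ t' ≤ 2 ^ t := by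
    intro t' q hq
    by_contra! hlt
    have : t < t' := (Nat.pow_lt_pow_iff_right (by norm_num)).1 hlt
    exact ht' ((pow_dvd_pow 2 this).trans ⟨q, by rw [← hq]; ring⟩)
  refine ⟨fun t' q hq r hr h1 h2 => ?_, fun t' q hq r hr h1 h2 => ?_, h.pivot, h.zero, h.mem,
    h.sub, h.iff, h.inj⟩
  · rcases hq.lt_or_eq with hq | hq
    · exact h.done t' q (by omega) r hr h1 h2
    · have := key _ _ hq
      rw [hq]
      have e : (q + 1) * 2 ^ t' = q * 2 ^ t' + 2 ^ t' := by ring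
      exact hsrc r (by omega) (by omega)
  · rcases hq.lt_or_eq with hq | hq
    · exact h.ahead t' q (by omega) r hr h1 h2
    · have := key _ _ hq
      rw [hq]
      have e : (q + 1) * 2 ^ t' = q * 2 ^ t' + 2 ^ t' := by ring
      exact hdst r hr (by omega) (by omega)

end Inv

end Elim

/-! ### Clearing a block of rows by matrix products. -/

namespace WordRAM

open Elim

theorem idx_lt {a b A B : ℕ} (ha : a < A) (hb : b < B) : a * B + b < A * B := by
  calc a * B + b < a * B + B := by omega
    _ = (a + 1) * B := by ring
    _ ≤ A * B := Nat.mul_le_mul_right _ ha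

theorem idx_inj {a b a' b' B : ℕ} (hb : b < B) (hb' : b' < B) (h : a * B + b = a' * B + b') :
    a = a' ∧ b = b' := by
  have h1 : (a * B + b) / B = a := by
    rw [mul_comm, Nat.mul_add_div (by omega), Nat.div_eq_of_lt hb, add_zero]
  have h2 : (a' * B + b') / B = a' := by
    rw [mul_comm, Nat.mul_add_div (by omega), Nat.div_eq_of_lt hb', add_zero]
  have : a = a' := by rw [← h1, ← h2, h]
  subst this
  exact ⟨rfl, by omega⟩

theorem bit_val {x : ℕ} (hx : x ≤ 1) : ((x : ℕ) : ZMod 2).val = x := by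
  interval_cases x <;> rfl

theorem val_le_one (x : ZMod 2) : x.val ≤ 1 := by
  have := ZMod.val_lt x
  omega

/-- Exclusive or in word arithmetic: this is how memory cells are added over GF(2). -/
theorem bit_xor {x y : ℕ} (hx : x ≤ 1) (hy : y ≤ 1) :
    x + y - 2 * (x * y) ≤ 1 ∧ ((x + y - 2 * (x * y) : ℕ) : ZMod 2) = x + y := by
  interval_cases x <;> interval_cases y <;> decide

/-- Row `r` of the matrix with `M` columns that is stored row by row. -/
def rowVec (f : ℕ → ℕ) (M r : ℕ) : Vec := fun c => if c < M then (f (r * M + c) : ZMod 2) else 0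

/-- The coefficients of the row operations. -/
def coefProg : Prog :=
  for2 29 22 30 22 (st 23 (.var 29 * .var 22 + .var 30)
    ((Ex.lt 0 (.ld 22 (.var 25 + .var 30))).and
      (.ld 21 ((.var 26 + .var 29) * .var 3 + (.ld 22 (.var 25 + .var 30) - 1)))))

/-- The factor `1 - (1 - pc)` masks rows without a pivot; for them the truncated `pc - 1` is column
0, so the address stays inside the matrix. -/
theorem coefProg_wp {S M s c d R : ℕ} {u : Store} (h3 : u.reg 3 = M) (h22 : u.reg 22 = s)
    (h25 : u.reg 25 = c) (h26 : u.reg 26 = d) (hM : 1 ≤ M) (hc : c + s ≤ R) (hd : d + s ≤ R)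
    (hS : 2 * R * M + 4 * R + M + 4 ≤ S) (hsM : s ≤ M)
    (hbit : ∀ x < R * M, u.mem 21 x ≤ 1) (hpc : ∀ r, c ≤ r → r < c + s → u.mem 22 r ≤ M) :
    Wp S coefProg (s * (s * 43 + 8) + 3) u fun v =>
      ∀ a < s, ∀ b < s, v.mem 23 (a * s + b) ≤ 1 ∧
        (v.mem 23 (a * s + b) : ZMod 2) = coef (u.mem 22) (rowVec (u.mem 21) M) (d + a) (c + b) := by
  refine (Wp.fill2_of (a := 23) h22 h22 (by constructor <;> simp) 38 (fun a b => a * s + b)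
    (fun a b => (1 - (1 - (u.mem 22 (c + b) - 0))) *
      u.mem 21 ((d + a) * M + (u.mem 22 (c + b) - 1))) ?_ ?_ ?_)
  · intro I _ J hJ I' _ J' hJ' h
    exact idx_inj hJ hJ' h
  · intro I hI J hJ v hF h29 h30 _ _
    have e3 : v.reg 3 = M := by rw [hF.reg 3 (by simp), h3]
    have e22 : v.reg 22 = s := by rw [hF.reg 22 (by simp), h22]
    have e25 : v.reg 25 = c := by rw [hF.reg 25 (by simp), h25]
    have e26 : v.reg 26 = d := by rw [hF.reg 26 (by simp), h26]
    have m21 : v.mem 21 = u.mem 21 := hF.mem 21 (by simp)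
    have m22 : v.mem 22 = u.mem 22 := hF.mem 22 (by simp)
    have hb1 : u.mem 22 (c + J) ≤ M := hpc _ (by omega) (by omega)
    have i1 := idx_lt (show d + I < R by omega) (show u.mem 22 (c + J) - 1 < M by omega)
    have i2 := idx_lt hI hJ
    have i3 : s * s ≤ R * M := Nat.mul_le_mul (by omega) hsM
    have i4 : I * s ≤ s * s := Nat.mul_le_mul_right _ hI.le
    have i5 : (d + I) * M ≤ R * M := Nat.mul_le_mul_right _ (by omega)
    have i7 : 2 * R * M = 2 * (R * M) := by ring
    have i6 := hbit _ i1
    have i8 : (1 - (1 - u.mem 22 (c + J))) * u.mem 21 ((d + I) * M + (u.mem 22 (c + J) - 1)) ≤ 1 :=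
      Nat.mul_le_mul (by omega : _ ≤ 1) i6
    refine (Wp.st ?_ ?_ ?_).time ?_
    · simp [h29, h30, e22]
      omega
    · simp [Ex.and, Ex.lt, h29, h30, e25, e26, e3, m21, m22]
      omega
    · simp [Ex.and, Ex.lt, h29, h30, e25, e26, e22, e3, m21, m22]
    · simp
  · intro v hF hv _ a ha b hb
    have hb1 : u.mem 22 (c + b) ≤ M := hpc _ (by omega) (by omega)
    have i1 := idx_lt (show d + a < R by omega) (show u.mem 22 (c + b) - 1 < M by omega)
    rw [hv a ha b hb]
    have i6 := hbit _ i1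
    refine ⟨Nat.mul_le_mul (by omega : _ ≤ 1) i6, ?_⟩
    by_cases h0 : u.mem 22 (c + b) = 0
    · simp [coef, h0]
    · have e1 : 1 - (1 - (u.mem 22 (c + b) - 0)) = 1 := by omega
      rw [coef, if_neg h0, rowVec, if_pos (by omega), e1, one_mul]

/-- Multiply the coefficients with a block of columns, and add the product. -/
def blockProg (P : Prog) : Prog :=
  asg 100 (.var 22) ;;
  for2 29 22 30 22 (st 100 (.var 29 * .var 22 + .var 30) (.ld 23 (.var 29 * .var 22 + .var 30))) ;;
  for2 29 22 30 22 (st 101 (.var 29 * .var 22 + .var 30)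
    (.ld 21 ((.var 25 + .var 29) * .var 3 + (.var 28 * .var 22 + .var 30)))) ;;
  P.shift ;;
  for2 29 22 30 22 (st 21 ((.var 26 + .var 29) * .var 3 + (.var 28 * .var 22 + .var 30))
    (.ld 21 ((.var 26 + .var 29) * .var 3 + (.var 28 * .var 22 + .var 30)) +
      .ld 102 (.var 29 * .var 22 + .var 30) -
      2 * (.ld 21 ((.var 26 + .var 29) * .var 3 + (.var 28 * .var 22 + .var 30)) *
        .ld 102 (.var 29 * .var 22 + .var 30))))

theorem not_uw_blockProg_reg (P : Prog) {x : ℕ} (hx : x < 100) (h1 : x ≠ 29) (h2 : x ≠ 30) :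
    ¬ (blockProg P).UW (.reg x) := by
  have := not_uw_shift_reg P hx
  simp [blockProg, this, h1, h2]
  omega

theorem not_uw_blockProg_mem (P : Prog) {x : ℕ} (hx : x < 100) (h1 : x ≠ 21) :
    ¬ (blockProg P).UW (.mem x) := by
  have := not_uw_shift_mem P hx
  simp [blockProg, this, h1]
  omega

/-- Both factors are copied before memory 21 is written, so the new entries are expressed by the old
ones, and only the window of rows from `d` and columns from `k * s` changes. -/
theorem blockProg_wp {P : Prog} {c₀ : ℕ} {time : ℕ → ℕ} (hP : Multiplies P c₀ time)
    {S M s c d R k : ℕ} {u : Store} (h3 : u.reg 3 = M) (h22 : u.reg 22 = s)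
    (h25 : u.reg 25 = c) (h26 : u.reg 26 = d) (h28 : u.reg 28 = k) (hs1 : 1 ≤ s)
    (hc : c + s ≤ R) (hd : d + s ≤ R)
    (hS : 2 * R * M + 4 * R + M + 4 ≤ S) (hS' : (s + 1) ^ c₀ ≤ S) (hsM : s ≤ M)
    (hk : (k + 1) * s ≤ M)
    (hbit : ∀ x < R * M, u.mem 21 x ≤ 1) (A : ℕ → ℕ → ZMod 2)
    (hA : ∀ a < s, ∀ b < s, u.mem 23 (a * s + b) ≤ 1 ∧
        (u.mem 23 (a * s + b) : ZMod 2) = A a b) :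
    Wp S (blockProg P) (s * (s * 108 + 24) + 11 + time s) u fun v =>
      (∀ x < R * M, v.mem 21 x ≤ 1) ∧
      ∀ r < R, ∀ p < M, (v.mem 21 (r * M + p) : ZMod 2) =
        if (d ≤ r ∧ r < d + s) ∧ (k * s ≤ p ∧ p < (k + 1) * s) then
          u.mem 21 (r * M + p) + ∑ b ∈ Finset.range s, A (r - d) b * u.mem 21 ((c + b) * M + p)
        else (u.mem 21 (r * M + p) : ZMod 2) := by
  have i3 : s * s ≤ R * M := Nat.mul_le_mul (by omega) hsM
  have i7 : 2 * R * M = 2 * (R * M) := by ring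
  have i9 : (k + 1) * s = k * s + s := by ring
  refine (Wp.seq (T := 2) (R := fun v => v = u.setReg 100 s)
    (Wp.asg (by simp) (by simp [h22])) ?_).time (T := 2 + ((s * (s * (12 + 5) + 8) + 3) +
      ((s * (s * (20 + 5) + 8) + 3) + (time s + (s * (s * (57 + 5) + 8) + 3))))) ?_
  swap
  · ring_nf; omega
  rintro u0 hu0 -
  have f0 : ∀ x, x ≠ 100 → u0.reg x = u.reg x := fun x hx => by
    simp [hu0, Function.update_of_ne hx]
  have f1 : u0.mem = u.mem := by simp [hu0]
  have g22 : u0.reg 22 = s := by rw [f0 22 (by simp), h22]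
  refine Wp.seq (Wp.fill2_of (a := 100) g22 g22 (by constructor <;> simp) 12 (fun a b => a * s + b)
    (fun a b => u.mem 23 (a * s + b)) ?_ ?_ fun v hF hv _ => hv) ?_
  · intro I _ J hJ I' _ J' hJ' h
    exact idx_inj (by omega) (by omega) h
  · intro I hI J hJ v hF h29 h30 _ _
    have e22 : v.reg 22 = s := by rw [hF.reg 22 (by simp), g22]
    have m23 : v.mem 23 = u.mem 23 := by rw [hF.mem 23 (by simp), f1]
    have i2 := idx_lt hI hJ
    refine (Wp.st ?_ ?_ ?_).time ?_
    · simp [h29, h30, e22]; omega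
    · simp [h29, h30, e22]; omega
    · simp [h29, h30, e22, m23]
    · simp
  intro u1 hm100 hF1
  have g22' : u1.reg 22 = s := by rw [hF1.reg 22 (by simp), g22]
  refine Wp.seq (Wp.fill2_of (a := 101) g22' g22' (by constructor <;> simp) 20 (fun a b => a * s + b)
    (fun a b => u.mem 21 ((c + a) * M + (k * s + b))) ?_ ?_ fun v hF hv _ => hv) ?_
  · intro I _ J hJ I' _ J' hJ' h
    exact idx_inj (by omega) (by omega) h
  · intro I hI J hJ v hF h29 h30 _ _
    have e22 : v.reg 22 = s := by rw [hF.reg 22 (by simp), g22']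
    have e3 : v.reg 3 = M := by rw [hF.reg 3 (by simp), hF1.reg 3 (by simp), f0 3 (by simp), h3]
    have e25 : v.reg 25 = c := by
      rw [hF.reg 25 (by simp), hF1.reg 25 (by simp), f0 25 (by simp), h25]
    have e28 : v.reg 28 = k := by
      rw [hF.reg 28 (by simp), hF1.reg 28 (by simp), f0 28 (by simp), h28]
    have m21 : v.mem 21 = u.mem 21 := by rw [hF.mem 21 (by simp), hF1.mem 21 (by simp), f1]
    have i2 := idx_lt hI hJ
    have i1 := idx_lt (show c + I < R by omega) (show k * s + J < M by omega)
    refine (Wp.st ?_ ?_ ?_).time ?_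
    · simp [h29, h30, e22]; omega
    · simp [h29, h30, e22, e3, e25, e28]; omega
    · simp [h29, h30, e22, e3, e25, e28, m21]
    · simp
  intro u2 hm101 hF2
  have g22'' : u2.reg 22 = s := by rw [hF2.reg 22 (by simp), g22']
  have hF12 := fun a (h : a ≠ 100) (h' : a ≠ 101) => (show u2.mem a = u.mem a by
    rw [hF2.mem a (by simp [h']), hF1.mem a (by simp [h]), f1])
  have hF12r := fun a (h : a ≠ 100) (h' : a ≠ 29) (h'' : a ≠ 30) => (show u2.reg a = u.reg a by
    rw [hF2.reg a (by simp [h', h'']), hF1.reg a (by simp [h', h'']), f0 a h])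
  refine Wp.seq (hP.wp hs1 hS' (Matrix.of fun a b => A a b)
    (Matrix.of fun a b => (u.mem 21 ((c + a) * M + (k * s + b)) : ZMod 2)) ?_ ?_ ?_) ?_
  · rw [hF2.reg 100 (by simp), hF1.reg 100 (by simp), hu0]
    simp
  · intro a b
    have := hA a a.2 b b.2
    rw [hF2.mem 100 (by simp), hm100 a a.2 b b.2, Matrix.of_apply, ← this.2, bit_val this.1]
  · intro a b
    have i1 := idx_lt (show c + (a : ℕ) < R by omega) (show k * s + (b : ℕ) < M by omega)
    rw [hm101 a a.2 b b.2, Matrix.of_apply, bit_val (hbit _ i1)]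
  intro u3 hm102 hF3
  have hF3r := fun a (h : a < 100) => hF3.reg a (not_uw_shift_reg P h)
  have hF3m := fun a (h : a < 100) => hF3.mem a (not_uw_shift_mem P h)
  have g22''' : u3.reg 22 = s := by rw [hF3r 22 (by simp), g22'']
  have m21 : u3.mem 21 = u.mem 21 := by
    rw [hF3m 21 (by simp), hF12 21 (by simp) (by simp)]
  have hle : ∀ a b : Fin s, u3.mem 102 (a * s + b) ≤ 1 := fun a b => by
    rw [hm102 a b]; exact val_le_one _
  refine Wp.fill2_of (a := 21) g22''' g22''' (by constructor <;> simp) 57 (fun a b => (d + a) * M + (k * s + b))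
    (fun a b => u.mem 21 ((d + a) * M + (k * s + b)) + u3.mem 102 (a * s + b) -
      2 * (u.mem 21 ((d + a) * M + (k * s + b)) * u3.mem 102 (a * s + b))) ?_ ?_ ?_
  · intro I _ J hJ I' _ J' hJ' h
    have := idx_inj (by omega) (by omega) h
    omega
  · intro I hI J hJ v hF h29 h30 hv _
    have hg := fun a (h1 : a < 100) (h' : a ≠ 29) (h'' : a ≠ 30) =>
      (show v.reg a = u.reg a by
      rw [hF.reg a (by simp [h', h'']), hF3r a h1, hF12r a (by omega) h' h''])
    have e22 : v.reg 22 = s := by rw [hg 22 (by simp) (by simp) (by simp), h22]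
    have e3 : v.reg 3 = M := by rw [hg 3 (by simp) (by simp) (by simp), h3]
    have e26 : v.reg 26 = d := by rw [hg 26 (by simp) (by simp) (by simp), h26]
    have e28 : v.reg 28 = k := by rw [hg 28 (by simp) (by simp) (by simp), h28]
    have m102 : v.mem 102 = u3.mem 102 := hF.mem 102 (by simp)
    rw [m21] at hv
    have i2 := idx_lt hI hJ
    have i1 := idx_lt (show d + I < R by omega) (show k * s + J < M by omega)
    have b1 := hbit _ i1
    have b2 := hle ⟨I, hI⟩ ⟨J, hJ⟩
    simp only at b2
    have b3 : u.mem 21 ((d + I) * M + (k * s + J)) * u3.mem 102 (I * s + J) ≤ 1 :=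
      Nat.mul_le_mul b1 b2
    refine (Wp.st ?_ ?_ ?_).time ?_
    · simp [h29, h30, e22, e3, e26, e28]; omega
    · simp [h29, h30, e22, e3, e26, e28, hv, m102]; omega
    · simp [h29, h30, e22, e3, e26, e28, hv, m102]
    · simp
  · intro v hF hv hv'
    have hval : ∀ r < R, ∀ p < M, (d ≤ r ∧ r < d + s) ∧ (k * s ≤ p ∧ p < (k + 1) * s) →
        v.mem 21 (r * M + p) = u.mem 21 (r * M + p) + u3.mem 102 ((r - d) * s + (p - k * s)) -
          2 * (u.mem 21 (r * M + p) * u3.mem 102 ((r - d) * s + (p - k * s))) := by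
      intro r hr p hp hrp
      have := hv (r - d) (by omega) (p - k * s) (by omega)
      rwa [show d + (r - d) = r by omega, show k * s + (p - k * s) = p by omega] at this
    have hval' : ∀ r < R, ∀ p < M, ¬ ((d ≤ r ∧ r < d + s) ∧ (k * s ≤ p ∧ p < (k + 1) * s)) →
        v.mem 21 (r * M + p) = u.mem 21 (r * M + p) := by
      intro r hr p hp hrp
      rw [hv', m21]
      intro a ha b hb h
      have := idx_inj (by omega) hp h
      omega
    have hprod : ∀ r p, (d ≤ r ∧ r < d + s) ∧ (k * s ≤ p ∧ p < (k + 1) * s) →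
        u3.mem 102 ((r - d) * s + (p - k * s)) ≤ 1 ∧
        (u3.mem 102 ((r - d) * s + (p - k * s)) : ZMod 2) =
          ∑ b ∈ Finset.range s, A (r - d) b * u.mem 21 ((c + b) * M + p) := by
      intro r p hrp
      have h1 := hm102 ⟨r - d, by omega⟩ ⟨p - k * s, by omega⟩
      simp only at h1
      rw [h1]
      refine ⟨val_le_one _, ?_⟩
      rw [ZMod.natCast_val, ZMod.cast_id, Matrix.mul_apply, Finset.sum_range]
      refine Finset.sum_congr rfl fun b _ => ?_
      rw [Matrix.of_apply, Matrix.of_apply, show k * s + (p - k * s) = p by omega]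
    constructor
    · intro x hx
      have hM : 0 < M := by omega
      have e : x = x / M * M + x % M := (Nat.div_add_mod' x M).symm
      have hr : x / M < R := Nat.div_lt_of_lt_mul (by rwa [mul_comm])
      have hp : x % M < M := Nat.mod_lt _ hM
      rw [e]
      by_cases h : (d ≤ x / M ∧ x / M < d + s) ∧ (k * s ≤ x % M ∧ x % M < (k + 1) * s)
      · rw [hval _ hr _ hp h]
        exact (bit_xor (hbit _ (by rwa [← e])) (hprod _ _ h).1).1
      · rw [hval' _ hr _ hp h]
        exact hbit _ (by rwa [← e])
    · intro r hr p hp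
      split_ifs with h
      · rw [hval _ hr _ hp h, (bit_xor (hbit _ (idx_lt hr hp)) (hprod _ _ h).1).2,
          (hprod _ _ h).2]
      · rw [hval' _ hr _ hp h]

end WordRAM

namespace WordRAM

open Elim

/-- Clear the rows from register 26 on with the rows from register 25 on; register 22 holds the
number of rows. -/
def clearProg (P : Prog) : Prog :=
  coefProg ;; asg 27 (.var 3 / .var 22) ;; forP 28 27 (blockProg P)

theorem not_uw_clearProg_reg (P : Prog) {x : ℕ} (hx : x < 27) : ¬ (clearProg P).UW (.reg x) := by
  have := not_uw_blockProg_reg P (x := x) (by omega) (by omega) (by omega)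
  simp [clearProg, coefProg, this]
  omega

theorem not_uw_clearProg_mem (P : Prog) {x : ℕ} (hx : x < 100) (h1 : x ≠ 21) (h2 : x ≠ 23) :
    ¬ (clearProg P).UW (.mem x) := by
  have := not_uw_blockProg_mem P (x := x) (by omega) (by omega)
  simp [clearProg, coefProg, this, h2]

/-- The coefficients are computed once, from the unmodified rows. Each block of `s` columns is then
treated on its own, which makes `M / s` products of `s × s` matrices; `hE` bounds their cost by `s *
E`. -/
theorem clearProg_wp {P : Prog} {c₀ : ℕ} {time : ℕ → ℕ} (hP : Multiplies P c₀ time)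
    {S M s c d R E : ℕ} {u : Store} (h3 : u.reg 3 = M) (h22 : u.reg 22 = s)
    (h25 : u.reg 25 = c) (h26 : u.reg 26 = d) (hs1 : 1 ≤ s)
    (hc : c + s ≤ R) (hd : d + s ≤ R) (hdis : d + s ≤ c ∨ c + s ≤ d)
    (hS : 2 * R * M + 4 * R + M + 4 ≤ S) (hS' : (M + 1) ^ c₀ ≤ S) (hsM : s ∣ M) (hM : 1 ≤ M)
    (hE : M / s * time s ≤ s * E)
    (hbit : ∀ x < R * M, u.mem 21 x ≤ 1) (hpc : ∀ r, c ≤ r → r < c + s → u.mem 22 r ≤ M) :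
    Wp S (clearProg P) (s * (300 * M + E)) u fun v =>
      (∀ x < R * M, v.mem 21 x ≤ 1) ∧
      ∀ r < R, rowVec (v.mem 21) M r = step (u.mem 22) (rowVec (u.mem 21) M) c d s r := by
  have hle : s ≤ M := Nat.le_of_dvd hM hsM
  obtain ⟨nb, rfl⟩ := hsM
  have hnb : s * nb / s = nb := Nat.mul_div_cancel_left _ hs1
  rw [hnb] at hE
  set M := s * nb with hMd
  have hnb1 : 1 ≤ nb := by
    rcases Nat.eq_zero_or_pos nb with h | h
    · rw [h] at hMd; omega
    · exact h
  have hS'' : (s + 1) ^ c₀ ≤ S := (Nat.pow_le_pow_left (by omega) _).trans hS'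
  refine (Wp.seq (coefProg_wp h3 h22 h25 h26 hM hc hd hS hle hbit hpc)
    (T' := 4 + (nb * ((s * (s * 108 + 24) + 11 + time s) + 5) + 3)) ?_).time ?_
  swap
  · have e1 : nb * (s * (s * 108 + 24) + 11 + time s + 5) =
        M * (s * 108 + 24) + 16 * nb + nb * time s := by rw [hMd]; ring
    have e2 : s * (300 * M + E) = 300 * (s * M) + s * E := by ring
    have e3 : s * s ≤ s * M := Nat.mul_le_mul_left _ hle
    have e4 : nb ≤ s * M := by rw [hMd]; nlinarith
    have e5 : M ≤ s * M := by nlinarith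
    have e6 : s ≤ s * M := by nlinarith
    have e7 : M * (s * 108 + 24) = 108 * (s * M) + 24 * M := by ring
    have e8 : s * (s * 43 + 8) = 43 * (s * s) + 8 * s := by ring
    omega
  intro u1 hK hF1
  have r1 := fun x (h1 : x ≠ 29) (h2 : x ≠ 30) => hF1.reg x (by simp [coefProg, h1, h2])
  have m1 := fun x (h1 : x ≠ 23) => hF1.mem x (by simp [coefProg, h1])
  refine Wp.seq (T := 4) (R := fun v => v = u1.setReg 27 nb) (Wp.asg (by simp) ?_) ?_
  · simp [r1, h3, h22, hnb]
  rintro u2 hu2 -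
  have r2 := fun x (h1 : x ≠ 29) (h2 : x ≠ 30) (h3 : x ≠ 27) => (show u2.reg x = u.reg x by
    rw [hu2, setReg_reg, Function.update_of_ne h3, r1 x h1 h2])
  have m2 := fun x (h1 : x ≠ 23) => (show u2.mem x = u.mem x by rw [hu2, setReg_mem, m1 x h1])
  have k2 : u2.mem 23 = u1.mem 23 := by rw [hu2, setReg_mem]
  have h27 : u2.reg 27 = nb := by simp [hu2]
  -- Columns before `k * s` are finished and the others untouched, so the source entries of the
  -- current block are still the original ones.
  refine Wp.forP_const_of (N := nb) (fun k v => (∀ x < R * M, v.mem 21 x ≤ 1) ∧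
    ∀ r < R, ∀ p < M, (v.mem 21 (r * M + p) : ZMod 2) =
      if p < k * s then step (u.mem 22) (rowVec (u.mem 21) M) c d s r p
      else (u.mem 21 (r * M + p) : ZMod 2)) _ h27
    (not_uw_blockProg_reg P (by simp) (by simp) (by simp))
    (not_uw_blockProg_reg P (by simp) (by simp) (by simp)) (by simp) ?_ ?_ ?_
  · simp [m2]
    exact hbit
  · intro k hk v hF hv28 ⟨hb, hI⟩
    have r3 := fun x (h1 : x < 27) => (show v.reg x = u.reg x by
      rw [hF.reg x ?_, r2 x (by omega) (by omega) (by omega)]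
      simp [not_uw_blockProg_reg P (show x < 100 by omega) (by omega) (by omega)]
      omega)
    have k3 : v.mem 23 = u1.mem 23 := by
      rw [hF.mem 23 ?_, k2]
      simp [not_uw_blockProg_mem P (show 23 < 100 by omega) (by omega)]
    have hks : (k + 1) * s ≤ M := by rw [hMd, mul_comm s]; exact Nat.mul_le_mul_right _ hk
    refine (blockProg_wp hP (A := fun a b => coef (u.mem 22) (rowVec (u.mem 21) M) (d + a) (c + b))
      (by rw [r3 3 (by simp), h3]) (by rw [r3 22 (by simp), h22]) (by rw [r3 25 (by simp), h25])
      (by rw [r3 26 (by simp), h26]) hv28 hs1 hc hd hS hS'' hle hks hb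
      (by rw [k3]; exact hK)).post fun w hw => ⟨hw.1, fun r hr p hp => ?_⟩
    have e1 : (k + 1) * s = k * s + s := by ring
    rw [setReg_mem, hw.2 r hr p hp, hI r hr p hp]
    by_cases hrd : d ≤ r ∧ r < d + s
    · by_cases hpk : p < k * s
      · rw [if_neg (by omega), if_pos hpk, if_pos (by omega)]
      · rw [if_neg hpk]
        by_cases hpk' : p < (k + 1) * s
        · rw [if_pos ⟨hrd, by omega, hpk'⟩, if_pos hpk', step, if_pos hrd, Pi.add_apply,
            Finset.sum_apply, rowVec, if_pos hp]
          congr 1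
          refine Finset.sum_congr rfl fun b hb => ?_
          have hb' : b < s := by simpa using hb
          rw [hI _ (by omega) p hp, if_neg hpk, Pi.smul_apply, smul_eq_mul, rowVec, if_pos hp,
            show d + (r - d) = r by omega]
        · rw [if_neg (by omega), if_neg hpk']
    · rw [if_neg (by tauto), step_of_not hrd, rowVec, if_pos hp]
      simp
  · rintro v - ⟨hb, hI⟩
    refine ⟨hb, fun r hr => funext fun p => ?_⟩
    by_cases hp : p < M
    · rw [rowVec, if_pos hp, hI r hr p hp, if_pos (by rwa [mul_comm nb])]
    · rw [rowVec, if_neg hp, step]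
      split_ifs with hrd
      · simp [rowVec, hp]
      · simp [rowVec, hp]

/-- Find a column in which row `i` does not vanish. -/
def leafProg : Prog :=
  st 22 (.var 20) 0 ;;
  forP 21 3 (st 22 (.var 20) (.ld 21 (.var 20 * .var 3 + .var 21) * (.var 21 + 1) +
    (1 - .ld 21 (.var 20 * .var 3 + .var 21)) * .ld 22 (.var 20)))

/-- The update is free of branches: a 1 in column `p` stores `p + 1`, a 0 keeps the previous value.
The scan ends with the last nonzero column, but any would do. -/
theorem leafProg_wp {S M R i : ℕ} {u : Store} (h3 : u.reg 3 = M) (h20 : u.reg 20 = i) (hi : i < R)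
    (hS : 2 * R * M + 4 * R + M + 4 ≤ S) (hbit : ∀ x < R * M, u.mem 21 x ≤ 1) :
    Wp S leafProg (M * 35 + 6) u fun v => ∃ x, x ≤ M ∧
      v.mem 22 = Function.update (u.mem 22) i x ∧
      (x = 0 ∧ rowVec (u.mem 21) M i = 0 ∨ ∃ p, x = p + 1 ∧ rowVec (u.mem 21) M i p = 1) := by
  refine (Wp.seq (T := 3) (R := fun v => v = u.setMem 22 i 0)
    (Wp.st (by simp) (by simp) (by simp [h20])) ?_).time (T := 3 + (M * (30 + 5) + 3))
    (by omega)
  rintro u1 hu1 -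
  have r1 : u1.reg = u.reg := by simp [hu1]
  have m1 : u1.mem 21 = u.mem 21 := by simp [hu1]
  refine Wp.forP_const_of (N := M) (fun k v => ∃ x, x ≤ M ∧
      v.mem 22 = Function.update (u.mem 22) i x ∧
      (x = 0 ∧ (∀ p < k, u.mem 21 (i * M + p) = 0) ∨
        ∃ p < M, x = p + 1 ∧ u.mem 21 (i * M + p) = 1)) _ (by rw [r1, h3]) (by simp) (by simp)
      (by simp) ?_ ?_ ?_
  · exact ⟨0, by simp, by simp [hu1], .inl ⟨rfl, by simp⟩⟩
  · rintro k hk v hF h21 ⟨x, hxM, hx, hcase⟩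
    have e3 : v.reg 3 = M := by rw [hF.reg 3 (by simp), r1, h3]
    have e20 : v.reg 20 = i := by rw [hF.reg 20 (by simp), r1, h20]
    have m21 : v.mem 21 = u.mem 21 := by rw [hF.mem 21 (by simp), m1]
    have i1 := idx_lt hi hk
    have i2 := hbit _ i1
    have i7 : 2 * R * M = 2 * (R * M) := by ring
    have hx22 : v.mem 22 i = x := by rw [hx]; simp
    have i3 : u.mem 21 (i * M + k) * (k + 1) ≤ k + 1 := by nlinarith
    have i4 : (1 - u.mem 21 (i * M + k)) * x ≤ x := by
      have : 1 - u.mem 21 (i * M + k) ≤ 1 := by omega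
      nlinarith
    refine (Wp.st ?_ ?_ ?_).time ?_
    · simp
    · simp [e3, e20, h21, m21, hx22]
      omega
    · refine ⟨u.mem 21 (i * M + k) * (k + 1) + (1 - u.mem 21 (i * M + k)) * x, ?_, ?_, ?_⟩
      · rcases Nat.le_one_iff_eq_zero_or_eq_one.1 i2 with h | h <;> rw [h] <;> omega
      · simp [e3, e20, h21, m21, hx22, hx]
      · rcases Nat.le_one_iff_eq_zero_or_eq_one.1 i2 with h | h
        · rw [h]
          simp only [zero_mul, Nat.sub_zero, one_mul, zero_add]
          refine hcase.imp (fun ⟨h1, h2⟩ => ⟨h1, fun p hp => ?_⟩) id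
          rcases Nat.lt_succ_iff_lt_or_eq.1 hp with hp | rfl
          · exact h2 p hp
          · exact h
        · exact .inr ⟨k, hk, by rw [h]; simp, h⟩
    · simp
  · rintro v hF ⟨x, hxM, hx, hcase⟩
    refine ⟨x, hxM, hx, ?_⟩
    rcases hcase with ⟨h1, h2⟩ | ⟨p, hp, h1, h2⟩
    · refine .inl ⟨h1, funext fun p => ?_⟩
      simp only [rowVec, Pi.zero_apply]
      split_ifs with hp
      · simp [h2 p hp]
      · rfl
    · exact .inr ⟨p, h1, by simp [rowVec, hp, h2]⟩

end WordRAM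

/-! ### The dyadic schedule of the elimination. -/

namespace WordRAM

open Elim

/-- The memories satisfy the invariant of the elimination. -/
structure ElimState (M R : ℕ) (V : ℕ → Vec) (i e : ℕ) (v : Store) : Prop where
  bit : ∀ x < R * M, v.mem 21 x ≤ 1
  col : ∀ r < e, v.mem 22 r ≤ M
  inv : Inv R V (v.mem 22) (rowVec (v.mem 21) M) i e

/-- The rows from `c` up to `d` are cleared by the rows before `e`. -/
def Cleared (M c d e : ℕ) (v : Store) : Prop :=
  ∀ r, c ≤ r → r < d → Clear (v.mem 22) (rowVec (v.mem 21) M) r e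

/-- `Inv.step` and `Inv.clear_step` on the machine, with the `s` most recent rows as source. The
pivots in memory 22 are not touched, so clearedness before and after refers to the same columns. -/
theorem clearProg_wp_elimState {P : Prog} {c₀ : ℕ} {time : ℕ → ℕ} (hP : Multiplies P c₀ time)
    {S M s d R E i : ℕ} {V : ℕ → Vec} {u : Store} (h3 : u.reg 3 = M) (h22 : u.reg 22 = s)
    (h25 : u.reg 25 = i + 1 - s) (h26 : u.reg 26 = d) (hs1 : 1 ≤ s) (hsi : s ≤ i + 1)
    (hi : i < R) (hd : d + s ≤ R) (hdis : d + s ≤ i + 1 - s ∨ i + 1 ≤ d)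
    (hS : 2 * R * M + 4 * R + M + 4 ≤ S) (hS' : (M + 1) ^ c₀ ≤ S) (hsM : s ∣ M) (hM : 1 ≤ M)
    (hE : M / s * time s ≤ s * E) (hu : ElimState M R V i (i + 1) u)
    (hsrc : Cleared M (i + 1 - s) (i + 1) (i + 1) u)
    (hdst : Cleared M d (d + s) (i + 1 - s) u) :
    Wp S (clearProg P) (s * (300 * M + E)) u fun v => ElimState M R V i (i + 1) v ∧
      Cleared M (i + 1 - s) (i + 1) (i + 1) v ∧ Cleared M d (d + s) (i + 1) v := by
  have e1 : i + 1 - s + s = i + 1 := by omega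
  refine (clearProg_wp hP (c := i + 1 - s) (R := R) h3 h22 h25 h26 hs1 (by omega) hd (by omega) hS hS' hsM hM hE hu.bit
    fun r h1 h2 => hu.col r (by omega)).frame.post ?_
  rintro v ⟨⟨hb, hW⟩, hF⟩
  have m22 : v.mem 22 = u.mem 22 :=
    hF.mem 22 (not_uw_clearProg_mem P (by simp) (by simp) (by simp))
  have hsrc' : ∀ r, i + 1 - s ≤ r → r < i + 1 - s + s → Clear (u.mem 22) (rowVec (u.mem 21) M) r
    (i + 1) := fun r h1 h2 => hsrc r h1 (by omega)
  have hclr : ∀ r < R, ∀ h, Clear (u.mem 22) (step (u.mem 22) (rowVec (u.mem 21) M) (i + 1 - s) d s)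
      r h → Clear (v.mem 22) (rowVec (v.mem 21) M) r h := by
    intro r hr h hc k hk hkr p hp
    rw [hW r hr]
    rw [m22] at hp
    exact hc k hk hkr p hp
  refine ⟨⟨hb, fun r hr => by rw [m22]; exact hu.col r hr, ?_⟩, fun r h1 h2 => hclr r (by omega) _ ?_,
    fun r h1 h2 => hclr r (by omega) _ ?_⟩
  · rw [m22]
    exact (hu.inv.step (by omega) e1 (by omega) hsrc' hdst).congr_rows (by omega) hW
  · intro k hk hkr p hp
    rw [step_of_not (by omega)]
    exact hsrc r h1 h2 k hk hkr p hp
  · exact hu.inv.clear_step e1 hsrc' hdst r h1 h2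

/-- Merge completed blocks of rows. -/
def mergeProg (P : Prog) : Prog :=
  forP 23 5 (asg 24 (Ex.eq ((.var 20 + 1) / (2 * .var 22) * (2 * .var 22)) (.var 20 + 1)) ;;
    cond (.var 24) (asg 25 (.var 20 + 1 - .var 22) ;; asg 26 (.var 20 + 1 - 2 * .var 22) ;;
      clearProg P ;; asg 22 (2 * .var 22)) .skip)

/-- Clear the next block of rows. -/
def aheadProg (P : Prog) : Prog :=
  cond (Ex.lt (.var 20 + 1) (.var 4)) (asg 25 (.var 20 + 1 - .var 22) ;; asg 26 (.var 20 + 1) ;;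
    clearProg P) .skip

theorem not_uw_mergeProg_reg (P : Prog) {x : ℕ} (hx : x < 22) : ¬ (mergeProg P).UW (.reg x) := by
  have := not_uw_clearProg_reg P (x := x) (by omega)
  simp [mergeProg, this]
  omega

theorem not_uw_aheadProg_reg (P : Prog) {x : ℕ} (hx : x < 22) : ¬ (aheadProg P).UW (.reg x) := by
  have := not_uw_clearProg_reg P (x := x) (by omega)
  simp [aheadProg, this]
  omega

/-- As long as the processed rows end with two aligned blocks of equal length that together form an
aligned block, back substitution clears the first with the second and the length doubles. This stops
at the largest power of two dividing `i + 1`, with a fully reduced last block. -/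
theorem mergeProg_wp {P : Prog} {c₀ : ℕ} {time : ℕ → ℕ} (hP : Multiplies P c₀ time)
    {S M R E i κ τ : ℕ} {V : ℕ → Vec} {u : Store} (h3 : u.reg 3 = M)
    (h5 : u.reg 5 = κ + 1) (h20 : u.reg 20 = i) (h22 : u.reg 22 = 1)
    (hMκ : M = 2 ^ κ) (hR : R = 2 * M) (hi : i < R)
    (hτ : 2 ^ τ ∣ i + 1) (hτ' : ¬ 2 ^ (τ + 1) ∣ i + 1)
    (hS : 2 * R * M + 4 * R + M + 4 ≤ S) (hS' : (M + 1) ^ c₀ ≤ S)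
    (hE : ∀ t ≤ κ, M / 2 ^ t * time (2 ^ t) ≤ 2 ^ t * E) (hu : ElimState M R V i (i + 1) u) :
    Wp S (mergeProg P) (2 ^ τ * (300 * M + E) + (κ + 1) * 85 + 3) u fun v =>
      v.reg 22 = 2 ^ τ ∧ ElimState M R V i (i + 1) v ∧
      Cleared M (i + 1 - 2 ^ τ) (i + 1) (i + 1) v := by
  have hM1 : 1 ≤ M := by rw [hMκ]; exact Nat.one_le_two_pow
  -- There are only `2 ^ (κ + 1)` rows, so `κ + 1` rounds suffice to reach level `τ`.
  have hle : ∀ t, 2 ^ t ∣ i + 1 → t ≤ κ + 1 := by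
    intro t ht
    have h1 := Nat.le_of_dvd (by omega) ht
    have h2 : 2 ^ (κ + 1) = R := by rw [hR, hMκ, pow_succ]; ring
    exact (Nat.pow_le_pow_iff_right (by norm_num : 1 < 2)).1 (by omega)
  have hτκ := hle τ hτ
  have hi7 : R ≤ 2 * R * M := by nlinarith
  refine (Wp.forP_of (N := κ + 1) (fun t v => v.reg 22 = 2 ^ (min t τ) ∧
    ElimState M R V i (i + 1) v ∧ Cleared M (i + 1 - 2 ^ (min t τ)) (i + 1) (i + 1) v)
    (fun t => if t < τ then 2 ^ t * (300 * M + E) + 80 else 80) h5 ?_ ?_ (by simp) ?_ ?_ ?_).time ?_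
  · simp [not_uw_clearProg_reg P (show 23 < 27 by simp)]
  · simp [not_uw_clearProg_reg P (show 5 < 27 by simp)]
  · refine ⟨by simp [h22], ⟨hu.bit, hu.col, hu.inv⟩, fun r h1 h2 => ?_⟩
    obtain rfl : r = i := by simp at h1; omega
    exact hu.inv.clear_self hi
  · rintro t ht v hF hv23 ⟨hv22, hvE, hvC⟩
    have r3 := fun x (h1 : x < 22) => (show v.reg x = u.reg x from
      hF.reg x (by simpa [mergeProg] using not_uw_mergeProg_reg P h1))
    have e3 : v.reg 3 = M := by rw [r3 3 (by simp), h3]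
    have e20 : v.reg 20 = i := by rw [r3 20 (by simp), h20]
    have hsd : 2 ^ (min t τ) ∣ i + 1 := (pow_dvd_pow 2 (min_le_right _ _)).trans hτ
    have hsle := Nat.le_of_dvd (by omega) hsd
    set s := 2 ^ (min t τ) with hs
    have hs1 : 1 ≤ s := Nat.one_le_two_pow
    have hdm : (i + 1) / (2 * s) * (2 * s) ≤ i + 1 := Nat.div_mul_le_self _ _
    have hflag : (i + 1) / (2 * s) * (2 * s) = i + 1 ↔ t < τ := by
      rw [← Nat.dvd_iff_div_mul_eq, hs, ← pow_succ']
      constructor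
      · intro h
        by_contra! hlt
        rw [min_eq_right hlt] at h
        exact hτ' h
      · intro h
        exact (pow_dvd_pow 2 (by omega)).trans hτ
    have hEF : EFlag S v (Ex.eq ((.var 20 + 1) / (2 * .var 22) * (2 * .var 22)) (.var 20 + 1))
        (t < τ) := by
      refine (EFlag.eq (by omega) ?_ ?_).congr ?_
      · simp [e20, hv22]; omega
      · simp [e20]; omega
      · simpa [e20, hv22] using hflag
    refine (Wp.seq (R := fun w => ∃ f, w = v.setReg 24 f ∧ Flag f (t < τ)) (Wp.asg hEF.ok
      ⟨_, rfl, hEF.flag⟩) (T' := if t < τ then 2 ^ t * (300 * M + E) + 30 else 30) ?_).time ?_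
    swap
    · split_ifs
      · simp; omega
      · simp
    rintro w1 ⟨f, hw1, hf⟩ -
    refine (Wp.cond (T := if t < τ then 2 ^ t * (300 * M + E) + 26 else 26)
      (P' := .skip)
      (by simp) ?_ ?_).time ?_
    · intro hpos
      have htτ : t < τ := hf.pos_iff.1 (by simpa [hw1] using hpos)
      have hst : s = 2 ^ t := by rw [hs, min_eq_left htτ.le]
      have hs2 : 2 * s ∣ i + 1 := by
        rw [hst, ← pow_succ']
        exact (pow_dvd_pow 2 (by omega)).trans hτ
      have hs2le := Nat.le_of_dvd (by omega) hs2
      rw [if_pos htτ]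
      refine (Wp.seq (T := 6) (R := fun w => w = w1.setReg 25 (i + 1 - s)) (Wp.asg ?_ ?_)
        (T' := 8 + (2 ^ t * (300 * M + E) + 4)) ?_).time (by omega)
      · simp [hw1, e20]; omega
      · simp [hw1, e20, hv22]
      rintro w2 hw2 -
      refine Wp.seq (T := 8) (R := fun w => w = w2.setReg 26 (i + 1 - 2 * s)) (Wp.asg ?_ ?_) ?_
      · simp [hw1, hw2, e20, hv22]; omega
      · simp [hw1, hw2, e20, hv22]
      rintro w3 hw3 -
      have m3 : w3.mem = v.mem := by simp [hw3, hw2, hw1]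
      have hdst : Cleared M (i + 1 - 2 * s) (i + 1 - 2 * s + s) (i + 1 - s) w3 := by
        intro r h1 h2
        rw [m3]
        rw [hst] at h1 h2 ⊢
        refine hvE.inv.back hi (t := t) ?_ h1 (by omega)
        rw [pow_succ', ← hst]
        exact hs2
      have := (clearProg_wp_elimState hP (S := S) (M := M) (R := R) (E := E) (s := s) (i := i)
        (d := i + 1 - 2 * s) (V := V) (u := w3) (by simp [hw3, hw2, hw1, e3])
        (by simp [hw3, hw2, hw1, hv22])
        (by simp [hw3, hw2, hw1]) (by simp [hw3]) hs1 hsle hi (by omega) (by omega) hS hS'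
        (by rw [hMκ, hst]; exact pow_dvd_pow 2 (by omega)) hM1
        (by rw [hst]; exact hE t (by omega))
        ⟨by rw [m3]; exact hvE.bit, by rw [m3]; exact hvE.col, by rw [m3]; exact hvE.inv⟩
        (by intro r h1 h2; rw [m3]; exact hvC r h1 h2) hdst)
      rw [hst] at this
      refine Wp.seq this ?_
      rintro w4 ⟨h4E, h4s, h4d⟩ hF4
      have r4 : w4.reg 22 = s := by
        rw [hF4.reg 22 (not_uw_clearProg_reg P (by simp))]
        simp [hw3, hw2, hw1, hv22]
      have e4 : 2 ^ min (t + 1) τ = 2 * s := by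
        rw [min_eq_left (by omega), hst, pow_succ']
      refine (Wp.asg ?_ ?_).time (by simp)
      · simp [r4]; omega
      · refine ⟨by simp [r4, e4], ⟨h4E.bit, h4E.col, h4E.inv⟩, fun r h1 h2 => ?_⟩
        rw [e4] at h1
        by_cases hr : i + 1 - 2 ^ t ≤ r
        · exact h4s r hr h2
        · exact h4d r (by omega) (by omega)
    · intro hz
      have htτ : ¬ t < τ := hf.eq_zero_iff.1 (by simpa [hw1] using hz)
      rw [if_neg htτ]
      refine (Wp.skip ?_).time (by omega)
      have e4 : min (t + 1) τ = min t τ := by omega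
      refine ⟨by simp [hw1, hv22, e4, hs], ?_, ?_⟩
      · rw [hw1]; exact ⟨hvE.bit, hvE.col, hvE.inv⟩
      · rw [hw1, e4]; exact hvC
    · split_ifs
      · simp; omega
      · simp
  · rintro v hF ⟨h1, h2, h3⟩
    rw [min_eq_right hτκ] at h1 h3
    exact ⟨h1, h2, h3⟩
  -- The merges of lengths 1, 2, 4, … cost a geometric sum, dominated by the final length `2 ^ τ`.
  · have h1 : ∀ n, ∑ k ∈ Finset.range n, ((if k < τ then 2 ^ k * (300 * M + E) + 80 else 80) + 5) ≤
        2 ^ (min n τ) * (300 * M + E) + n * 85 := by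
      intro n
      induction n with
      | zero => simp
      | succ n ih =>
        rw [Finset.sum_range_succ]
        split_ifs with h
        · rw [min_eq_left (by omega)] at ih ⊢
          rw [pow_succ]
          nlinarith
        · rw [min_eq_right (by omega)] at ih ⊢
          nlinarith
    have := h1 (κ + 1)
    rw [min_eq_right hτκ] at this
    omega

/-- By `Inv.forward`, the next `2 ^ τ` rows lack only the pivots of the last `2 ^ τ` rows, and these
are fully reduced; one clearing step restores `ahead`. -/
theorem aheadProg_wp {P : Prog} {c₀ : ℕ} {time : ℕ → ℕ} (hP : Multiplies P c₀ time)
    {S M R E i κ τ : ℕ} {V : ℕ → Vec} {u : Store} (h3 : u.reg 3 = M) (h4 : u.reg 4 = R)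
    (h20 : u.reg 20 = i) (h22 : u.reg 22 = 2 ^ τ)
    (hMκ : M = 2 ^ κ) (hR : R = 2 * M) (hi : i < R)
    (hτ : 2 ^ τ ∣ i + 1) (hτ' : ¬ 2 ^ (τ + 1) ∣ i + 1)
    (hS : 2 * R * M + 4 * R + M + 4 ≤ S) (hS' : (M + 1) ^ c₀ ≤ S)
    (hE : ∀ t ≤ κ, M / 2 ^ t * time (2 ^ t) ≤ 2 ^ t * E) (hu : ElimState M R V i (i + 1) u)
    (hsrc : Cleared M (i + 1 - 2 ^ τ) (i + 1) (i + 1) u) :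
    Wp S (aheadProg P) (2 ^ τ * (300 * M + E) + 30) u fun v =>
      ElimState M R V (i + 1) (i + 1) v := by
  have hM1 : 1 ≤ M := by rw [hMκ]; exact Nat.one_le_two_pow
  have hi7 : R ≤ 2 * R * M := by nlinarith
  set s := 2 ^ τ with hs
  have hs1 : 1 ≤ s := Nat.one_le_two_pow
  have hsle := Nat.le_of_dvd (by omega) hτ
  have hEF : EFlag S u (Ex.lt (.var 20 + 1) (.var 4)) (i + 1 < R) := by
    refine (EFlag.lt (by omega) ?_ (by simp)).congr ?_
    · simp [h20]; omega
    · simp [h20, h4]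
  refine (Wp.cond (T := s * (300 * M + E) + 12) (P' := .skip) hEF.ok ?_ ?_).time ?_
  · intro hpos
    have hlt : i + 1 < R := hEF.flag.pos_iff.1 hpos
    have h2R : R = 2 ^ (κ + 1) := by rw [hR, hMκ, pow_succ']
    have hτκ : τ ≤ κ := by
      have h1 : 2 ^ τ < 2 ^ (κ + 1) := by omega
      have := (Nat.pow_lt_pow_iff_right (by norm_num : 1 < 2)).1 h1
      omega
    have hsM : s ∣ M := by rw [hMκ]; exact pow_dvd_pow 2 hτκ
    have hsR : s ∣ R := by rw [hR]; exact hsM.mul_left 2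
    -- Both `i + 1` and `R` are multiples of `s`, so a whole block of `s` rows still fits.
    have hend : i + 1 + s ≤ R := by
      obtain ⟨a, ha⟩ := hτ
      obtain ⟨b, hb⟩ := hsR
      rw [ha, hb] at hlt ⊢
      have : a < b := lt_of_mul_lt_mul_left hlt (Nat.zero_le _)
      calc s * a + s = s * (a + 1) := by ring
        _ ≤ s * b := Nat.mul_le_mul_left _ this
    refine (Wp.seq (T := 6) (R := fun w => w = u.setReg 25 (i + 1 - s)) (Wp.asg ?_ ?_)
      (T' := 4 + (s * (300 * M + E))) ?_).time (by omega)
    · simp [h20]; omega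
    · simp [h20, h22]
    rintro w2 hw2 -
    refine Wp.seq (T := 4) (R := fun w => w = w2.setReg 26 (i + 1)) (Wp.asg ?_ ?_) ?_
    · simp [hw2, h20]; omega
    · simp [hw2, h20]
    rintro w3 hw3 -
    have m3 : w3.mem = u.mem := by simp [hw3, hw2]
    have hdst : Cleared M (i + 1) (i + 1 + s) (i + 1 - s) w3 := by
      intro r h1 h2
      rw [m3]
      exact hu.inv.forward hτ hτ' (by omega) h1 h2
    refine (clearProg_wp_elimState hP (S := S) (M := M) (R := R) (E := E) (s := s) (i := i)
      (d := i + 1) (V := V) (u := w3) (by simp [hw3, hw2, h3])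
      (by simp [hw3, hw2, h22])
      (by simp [hw3, hw2]) (by simp [hw3]) hs1 hsle hi (by omega) (by omega) hS hS'
      hsM hM1 (hE τ hτκ)
      ⟨by rw [m3]; exact hu.bit, by rw [m3]; exact hu.col, by rw [m3]; exact hu.inv⟩
      (by intro r h1 h2; rw [m3]; exact hsrc r h1 h2) hdst).post ?_
    rintro v ⟨h1, h2, h3⟩
    exact ⟨h1.bit, h1.col, h1.inv.next hτ' h2 fun r _ => h3 r⟩
  · intro hz
    have hlt : ¬ i + 1 < R := hEF.flag.eq_zero_iff.1 hz
    exact (Wp.skip ⟨hu.bit, hu.col, hu.inv.next hτ' hsrc fun r hr h1 => by omega⟩).time (by omega)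
  · simp
    omega

end WordRAM

namespace WordRAM

open Elim

/-- The largest power of two that divides `i + 1` is at most the sum of all that do. After
exchanging the sums, each of the `K + 1` levels contributes at most `2 ^ K`; this is the origin of
the logarithmic factor. -/
theorem sum_two_pow_padicValNat_le (K : ℕ) :
    ∑ i ∈ Finset.range (2 ^ K), 2 ^ padicValNat 2 (i + 1) ≤ 2 ^ K * (K + 1) := by
  calc ∑ i ∈ Finset.range (2 ^ K), 2 ^ padicValNat 2 (i + 1)
      ≤ ∑ i ∈ Finset.range (2 ^ K), ∑ t ∈ Finset.range (K + 1),
          if 2 ^ t ∣ i + 1 then 2 ^ t else 0 := by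
        refine Finset.sum_le_sum fun i hi => ?_
        have h1 : 2 ^ padicValNat 2 (i + 1) ∣ i + 1 := pow_padicValNat_dvd
        have h2 := Nat.le_of_dvd (by omega) h1
        simp only [Finset.mem_range] at hi
        have h3 : padicValNat 2 (i + 1) ≤ K :=
          (Nat.pow_le_pow_iff_right (by norm_num : 1 < 2)).1 (by omega)
        refine le_trans (le_of_eq ?_) (Finset.single_le_sum (f := fun t =>
          if 2 ^ t ∣ i + 1 then 2 ^ t else 0) (fun _ _ => Nat.zero_le _)
          (Finset.mem_range.2 (Nat.lt_succ_of_le h3)))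
        simp [h1]
    _ = ∑ t ∈ Finset.range (K + 1), ∑ i ∈ Finset.range (2 ^ K),
          if 2 ^ t ∣ i + 1 then 2 ^ t else 0 := Finset.sum_comm
    _ ≤ ∑ _t ∈ Finset.range (K + 1), 2 ^ K := by
        refine Finset.sum_le_sum fun t _ => ?_
        rw [← Finset.sum_filter, Finset.sum_const, Nat.card_multiples, smul_eq_mul]
        exact Nat.div_mul_le_self _ _
    _ = 2 ^ K * (K + 1) := by simp [mul_comm]

/-- Process a row. -/
def rowProg (P : Prog) : Prog := leafProg ;; asg 22 1 ;; mergeProg P ;; aheadProg P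

/-- Find out which rows of the matrix in memory 21 depend on earlier rows. -/
def elimProg (P : Prog) : Prog := forP 20 4 (rowProg P)

theorem not_uw_rowProg_reg (P : Prog) {x : ℕ} (hx : x < 21) : ¬ (rowProg P).UW (.reg x) := by
  have h1 := not_uw_mergeProg_reg P (x := x) (by omega)
  have h2 := not_uw_aheadProg_reg P (x := x) (by omega)
  simp [rowProg, leafProg, h1, h2]
  omega

theorem not_uw_elimProg_reg (P : Prog) {x : ℕ} (hx : x < 20) : ¬ (elimProg P).UW (.reg x) := by
  have h1 := not_uw_rowProg_reg P (x := x) (by omega)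
  simp [elimProg, h1]
  omega

theorem not_uw_elimProg_mem (P : Prog) {x : ℕ} (hx : x < 21) : ¬ (elimProg P).UW (.mem x) := by
  have h1 := not_uw_clearProg_mem P (x := x) (by omega) (by omega) (by omega)
  simp [elimProg, rowProg, mergeProg, aheadProg, leafProg, h1]
  omega

theorem not_uw_clearProg_wmem (P : Prog) {x : ℕ} (hx : x < 100) :
    ¬ (clearProg P).UW (.wmem x) := by
  simp [clearProg, coefProg, blockProg, not_uw_shift_wmem P hx]

theorem not_uw_elimProg_wmem (P : Prog) {x : ℕ} (hx : x < 100) : ¬ (elimProg P).UW (.wmem x) := by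
  have h1 := not_uw_clearProg_wmem P (x := x) (by omega)
  simp [elimProg, rowProg, mergeProg, aheadProg, leafProg, h1]

/-- Apart from lower order terms, row `i` causes work proportional to the exact power of two in `i +
1`, and these powers sum to the number of rows times a logarithm. The answer is the clause `iff` of
the final invariant. -/
theorem elimProg_wp {P : Prog} {c₀ : ℕ} {time : ℕ → ℕ} (hP : Multiplies P c₀ time)
    {S M R E κ : ℕ} {u : Store} (h3 : u.reg 3 = M) (h4 : u.reg 4 = R)
    (h5 : u.reg 5 = κ + 1) (hMκ : M = 2 ^ κ) (hR : R = 2 * M)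
    (hS : 2 * R * M + 4 * R + M + 4 ≤ S) (hS' : (M + 1) ^ c₀ ≤ S)
    (hE : ∀ t ≤ κ, M / 2 ^ t * time (2 ^ t) ≤ 2 ^ t * E)
    (hbit : ∀ x < R * M, u.mem 21 x ≤ 1) :
    Wp S (elimProg P) (R * ((κ + 2) * (1000 * M + 2 * E))) u fun v => ∀ r < R,
      (v.mem 22 r = 0 ↔ rowVec (u.mem 21) M r ∈
        Submodule.span (ZMod 2) (rowVec (u.mem 21) M '' Set.Iio r)) := by
  have hM1 : 1 ≤ M := by rw [hMκ]; exact Nat.one_le_two_pow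
  have h2R : R = 2 ^ (κ + 1) := by rw [hR, hMκ, pow_succ']
  refine (Wp.forP_of (N := R) (fun i v => ElimState M R (rowVec (u.mem 21) M) i i v)
    (fun i => 2 ^ padicValNat 2 (i + 1) * (2 * (300 * M + E)) + (M * 35 + (κ + 1) * 85 + 41)) h4
    (not_uw_rowProg_reg P (by simp)) (not_uw_rowProg_reg P (by simp)) (by simp)
    ⟨hbit, fun r hr => by omega, .init _ _ _⟩ ?_ fun v _ h => h.inv.iff).time ?_
  · intro i hi v hF hv20 hv
    have r3 := fun x (h1 : x < 20) => (show v.reg x = u.reg x from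
      hF.reg x (not_uw_elimProg_reg P h1))
    have hτ : 2 ^ padicValNat 2 (i + 1) ∣ i + 1 := pow_padicValNat_dvd
    have hτ' : ¬ 2 ^ (padicValNat 2 (i + 1) + 1) ∣ i + 1 :=
      pow_succ_padicValNat_not_dvd (by omega)
    set τ := padicValNat 2 (i + 1) with hτdef
    refine (Wp.seq (leafProg_wp (R := R) (by rw [r3 3 (by simp), h3]) hv20 hi hS hv.bit)
      (T' := 2 + ((2 ^ τ * (300 * M + E) + (κ + 1) * 85 + 3) +
        (2 ^ τ * (300 * M + E) + 30))) ?_).time (by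
          have : 2 ^ τ * (2 * (300 * M + E)) = 2 * (2 ^ τ * (300 * M + E)) := by ring
          omega)
    rintro v1 ⟨x, hxM, hx22, hx⟩ hF1
    have r1 := fun x (h1 : x < 21) => (show v1.reg x = v.reg x from
      hF1.reg x (by simp [leafProg]; omega))
    have m1 : v1.mem 21 = v.mem 21 := hF1.mem 21 (by simp [leafProg])
    have hE1 : ElimState M R (rowVec (u.mem 21) M) i (i + 1) v1 := by
      refine ⟨by rw [m1]; exact hv.bit, fun r hr => ?_, ?_⟩
      · rw [hx22]
        rcases Nat.lt_succ_iff_lt_or_eq.1 hr with hr | rfl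
        · rw [Function.update_of_ne hr.ne]
          exact hv.col r hr
        · simpa using hxM
      · rw [hx22, m1]
        exact hv.inv.leaf hi hx
    refine Wp.seq (T := 2) (R := fun w => w = v1.setReg 22 1) (Wp.asg (by simp; omega)
      (by simp)) ?_
    rintro v2 hv2 -
    have m2 : v2.mem = v1.mem := by simp [hv2]
    have r2 := fun x (h1 : x < 21) => (show v2.reg x = v.reg x by
      rw [hv2, setReg_reg, Function.update_of_ne (by omega), r1 x h1])
    have hE2 : ElimState M R (rowVec (u.mem 21) M) i (i + 1) v2 :=
      ⟨by rw [m2]; exact hE1.bit, by rw [m2]; exact hE1.col, by rw [m2]; exact hE1.inv⟩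
    refine Wp.seq (mergeProg_wp hP (by rw [r2 3 (by simp), r3 3 (by simp), h3])
      (by rw [r2 5 (by simp), r3 5 (by simp), h5]) (by rw [r2 20 (by simp), hv20])
      (by simp [hv2]) hMκ hR hi hτ hτ' hS hS' hE hE2) ?_
    rintro v4 ⟨h422, h4E, h4C⟩ hF4
    have r4 := fun x (h1 : x < 21) => (show v4.reg x = v.reg x by
      rw [hF4.reg x (not_uw_mergeProg_reg P (by omega)), r2 x h1])
    refine (aheadProg_wp hP (by rw [r4 3 (by simp), r3 3 (by simp), h3])
      (by rw [r4 4 (by simp), r3 4 (by simp), h4])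
      (by rw [r4 20 (by simp), hv20]) h422 hMκ hR hi hτ hτ' hS hS' hE h4E h4C).post ?_
    exact fun w hw => ⟨hw.bit, hw.col, hw.inv⟩
  · rw [Finset.sum_add_distrib, Finset.sum_add_distrib, ← Finset.sum_mul]
    have hs := sum_two_pow_padicValNat_le (κ + 1)
    rw [← h2R] at hs
    simp only [Finset.sum_const, Finset.card_range, smul_eq_mul]
    have e1 := Nat.mul_le_mul_right (2 * (300 * M + E)) hs
    have e2 : R * (κ + 1 + 1) * (2 * (300 * M + E)) =
      R * ((κ + 2) * (600 * M + 2 * E)) := by ring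
    have e3 : R * ((κ + 2) * (1000 * M + 2 * E)) = R * ((κ + 2) * (600 * M + 2 * E)) +
      R * ((κ + 2) * (400 * M)) := by ring
    have e4 : R * (M * 35 + (κ + 1) * 85 + 41) + R * 5 + 3 ≤ R * ((κ + 2) * (400 * M)) := by
      have : M * 35 + (κ + 1) * 85 + 41 + 5 + 3 ≤ (κ + 2) * (400 * M) := by
        nlinarith
      calc _ ≤ R * (M * 35 + (κ + 1) * 85 + 41 + 5 + 3) := by nlinarith
        _ ≤ _ := Nat.mul_le_mul_left _ this
    omega

end WordRAM

namespace WordRAM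

open Elim

/-! ## Sorting -/

/-- The weight, negated if weights are maximized: small keys are preferred. -/
def sortKey : Opt → ℚ → ℚ
  | .max, w => -w
  | .min, w => w

/-- The entries of `g` before `len` are a rearrangement of those of `f`, without repetitions. -/
structure Rearr (f g : ℕ → ℕ) (len : ℕ) : Prop where
  inj : Set.InjOn g (Set.Iio len)
  image : g '' Set.Iio len = f '' Set.Iio len

theorem Rearr.swap {f g : ℕ → ℕ} {len a b : ℕ} (h : Rearr f g len) (ha : a < len) (hb : b < len) :
    Rearr f (Function.update (Function.update g a (g b)) b (g a)) len := by
  have e : Function.update (Function.update g a (g b)) b (g a) = g ∘ Equiv.swap a b := by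
    funext x
    simp only [Function.comp, Equiv.swap_apply_def, Function.update_apply]
    split_ifs <;> simp_all
  have hmaps : Equiv.swap a b '' Set.Iio len = Set.Iio len := by
    have hsub : Equiv.swap a b '' Set.Iio len ⊆ Set.Iio len := by
      rintro _ ⟨x, hx, rfl⟩
      rw [Equiv.swap_apply_def]
      split_ifs
      · exact hb
      · exact ha
      · exact hx
    refine hsub.antisymm fun x hx => ⟨Equiv.swap a b x, hsub ⟨x, hx, rfl⟩, by simp⟩
  rw [e]
  refine ⟨?_, by rw [Set.image_comp, hmaps, h.image]⟩
  refine h.inj.comp (Equiv.injective _).injOn fun x hx => ?_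
  rw [← hmaps]
  exact ⟨x, hx, rfl⟩

/-- Exchange two entries of the list in memory 20 if they are in the wrong order. -/
def compareProg (o : Opt) : Prog :=
  wld 0 1 (.ld 20 (.var 11)) ;; wld 1 1 (.ld 20 (.var 13)) ;;
  .ite (match o with | .min => .wlt 0 1 | .max => .wlt 1 0)
    (asg 14 (.ld 20 (.var 11)) ;; st 20 (.var 11) (.ld 20 (.var 13)) ;; st 20 (.var 13) (.var 14))
    .skip

@[simp] theorem uw_compareProg (o : Opt) (l : Loc) : (compareProg o).UW l ↔
    l = .wreg 0 ∨ l = .wreg 1 ∨ l = .reg 14 ∨ l = .mem 20 := by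
  simp [compareProg]

theorem compareProg_wp {S a b : ℕ} {o : Opt} {u : Store} (h11 : u.reg 11 = a) (h13 : u.reg 13 = b) :
    Wp S (compareProg o) 20 u fun v =>
      (sortKey o (u.wmem 1 (u.mem 20 a)) < sortKey o (u.wmem 1 (u.mem 20 b)) ∧
        v.mem 20 = Function.update (Function.update (u.mem 20) a (u.mem 20 b)) b (u.mem 20 a)) ∨
      (¬ sortKey o (u.wmem 1 (u.mem 20 a)) < sortKey o (u.wmem 1 (u.mem 20 b)) ∧
        v.mem 20 = u.mem 20) := by
  refine (Wp.seq (T := 3) (R := fun v => v = u.setWReg 0 (u.wmem 1 (u.mem 20 a))) (Wp.wld (by simp)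
    (by simp [h11])) (T' := 3 + 14) ?_).time (by simp)
  rintro v1 hv1 -
  refine Wp.seq (T := 3) (R := fun v => v = v1.setWReg 1 (u.wmem 1 (u.mem 20 b))) (Wp.wld (by simp)
    (by simp [h13, hv1])) ?_
  rintro v2 hv2 -
  have w0 : v2.wreg 0 = u.wmem 1 (u.mem 20 a) := by simp [hv2, hv1]
  have w1 : v2.wreg 1 = u.wmem 1 (u.mem 20 b) := by simp [hv2]
  have r2 : v2.reg = u.reg := by simp [hv2, hv1]
  have m2 : v2.mem = u.mem := by simp [hv2, hv1]
  have hswap : ∀ Q : Store → Prop, (∀ v, v.mem 20 = Function.update (Function.update (u.mem 20) a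
      (u.mem 20 b)) b (u.mem 20 a) → Q v) → Wp S (asg 14 (.ld 20 (.var 11)) ;;
      st 20 (.var 11) (.ld 20 (.var 13)) ;; st 20 (.var 13) (.var 14)) 10 v2 Q := by
    intro Q hQ
    refine (Wp.seq (T := 3) (R := fun v => v = v2.setReg 14 (u.mem 20 a)) (Wp.asg (by simp)
      (by simp [r2, m2, h11])) (T' := 4 + 3) ?_)
    rintro v3 hv3 -
    refine Wp.seq (T := 4) (R := fun v => v = v3.setMem 20 a (u.mem 20 b)) (Wp.st (by simp) (by simp)
      (by simp [hv3, r2, m2, h11, h13])) ?_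
    rintro v4 hv4 -
    refine Wp.st (by simp) (by simp) (hQ _ ?_)
    simp [hv4, hv3, r2, m2, h13]
  cases o with
  | min =>
    refine (Wp.wcond (T := 10) (P' := .skip) (fun h => ?_) fun h => ?_).time (by norm_num)
    · exact hswap _ fun v hv => .inl ⟨by simpa [sortKey, w0, w1] using h, hv⟩
    · exact (Wp.skip (.inr ⟨by simpa [sortKey, w0, w1] using h, by rw [m2]⟩)).time (by norm_num)
  | max =>
    refine (Wp.wcond (T := 10) (P' := .skip) (fun h => ?_) fun h => ?_).time (by norm_num)
    · exact hswap _ fun v hv => .inl ⟨by simpa [sortKey, w0, w1] using h, hv⟩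
    · exact (Wp.skip (.inr ⟨by simpa [sortKey, w0, w1] using h, by rw [m2]⟩)).time (by norm_num)

/-- Sort the list in memory 20 by insertion; register 12 holds its length. -/
def sortProg (o : Opt) : Prog := forP 11 12 (forP 13 11 (compareProg o))

/-- The entry at position `a` meets the earlier ones from left to right and is exchanged whenever it
is smaller, so it dominates all that it has passed. Quadratic time is affordable: lists have length
at most `2 * M`, and the bound for the elimination is larger. -/
theorem sortProg_wp {S len : ℕ} {o : Opt} {u : Store} (h12 : u.reg 12 = len)
    (hinj : Set.InjOn (u.mem 20) (Set.Iio len)) :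
    Wp S (sortProg o) (len * (len * 25 + 8) + 3) u fun v => Rearr (u.mem 20) (v.mem 20) len ∧
      ∀ i j, i < j → j < len →
        sortKey o (u.wmem 1 (v.mem 20 i)) ≤ sortKey o (u.wmem 1 (v.mem 20 j)) := by
  refine Wp.forP_const_of (N := len) (fun a v => Rearr (u.mem 20) (v.mem 20) len ∧
      ∀ i j, i < j → j < a →
        sortKey o (u.wmem 1 (v.mem 20 i)) ≤ sortKey o (u.wmem 1 (v.mem 20 j))) (len * 25 + 3) h12
    (by simp) (by simp) (by simp) ⟨⟨hinj, rfl⟩, by simp⟩ ?_ fun v _ hv => hv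
  rintro a ha v hF h11 ⟨hR, hs⟩
  have w1 : v.wmem 1 = u.wmem 1 := hF.wmem 1 (by simp)
  refine (Wp.forP_const_of (N := a) (fun b v => Rearr (u.mem 20) (v.mem 20) len ∧
      (∀ i j, i < j → j < a →
        sortKey o (u.wmem 1 (v.mem 20 i)) ≤ sortKey o (u.wmem 1 (v.mem 20 j))) ∧
      ∀ i < b, sortKey o (u.wmem 1 (v.mem 20 i)) ≤ sortKey o (u.wmem 1 (v.mem 20 a))) 20 h11
    (by simp) (by simp) (by simp) ⟨hR, hs, by simp⟩ ?_ ?_).time (by nlinarith)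
  · rintro b hb v' hF' h13 ⟨hR', hs', hx'⟩
    have h11' : v'.reg 11 = a := by rw [hF'.reg 11 (by simp), h11]
    have w1' : v'.wmem 1 = u.wmem 1 := by rw [hF'.wmem 1 (by simp), w1]
    refine (compareProg_wp h11' h13).post fun w hw => ?_
    rw [w1'] at hw
    simp only [setReg_mem]
    set g := v'.mem 20
    have hba : b ≠ a := hb.ne
    rcases hw with ⟨hlt, hw⟩ | ⟨hlt, hw⟩
    · have ga : Function.update (Function.update g a (g b)) b (g a) a = g b := by
        rw [Function.update_of_ne hba.symm, Function.update_self]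
      have gb : Function.update (Function.update g a (g b)) b (g a) b = g a := by
        rw [Function.update_self]
      have gi : ∀ i, i ≠ a → i ≠ b →
          Function.update (Function.update g a (g b)) b (g a) i = g i := fun i h1 h2 => by
        rw [Function.update_of_ne h2, Function.update_of_ne h1]
      rw [hw]
      refine ⟨hR'.swap ha (by omega), fun i j hij hj => ?_, fun i hi => ?_⟩
      · by_cases hi : i = b
        · subst hi
          rw [gb, gi j (by omega) (by omega)]
          exact hlt.le.trans (hs' _ _ hij hj)
        · rw [gi i (by omega) hi]
          by_cases hj' : j = b
          · subst hj'
            rw [gb]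
            exact hx' i hij
          · rw [gi j (by omega) hj']
            exact hs' _ _ hij hj
      · rw [ga]
        rcases Nat.lt_succ_iff_lt_or_eq.1 hi with hi | rfl
        · rw [gi i (by omega) (by omega)]
          exact hs' _ _ hi hb
        · rw [gb]
          exact hlt.le
    · rw [hw]
      refine ⟨hR', hs', fun i hi => ?_⟩
      rcases Nat.lt_succ_iff_lt_or_eq.1 hi with hi | rfl
      · exact hx' i hi
      · exact not_lt.1 hlt
  · rintro w - ⟨h1, h2, h3⟩
    refine ⟨h1, fun i j hij hj => ?_⟩
    simp only [setReg_mem] at *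
    rcases Nat.lt_succ_iff_lt_or_eq.1 hj with hj | rfl
    · exact h2 i j hij hj
    · exact h3 i hij

/-! ## Compaction of a list -/

/-- Keep those entries of the list in memory 20 whose entry in memory 22 is positive. -/
def compactProg : Prog :=
  asg 6 0 ;; forP 11 12 (st 20 (.var 6) (.ld 20 (.var 11)) ;;
    asg 6 (.var 6 + Ex.lt 0 (.ld 22 (.var 11))))

/-- The first `k` entries of `h` are the entries `g r` with `r < len` and `p r`, in this order. -/
structure Compacted (g h : ℕ → ℕ) (p : ℕ → Prop) (len k : ℕ) (σ : ℕ → ℕ) : Prop where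
  mono : ∀ i j, i < j → j < k → σ i < σ j
  lt : ∀ i < k, σ i < len
  sat : ∀ i < k, p (σ i)
  eq : ∀ i < k, h i = g (σ i)
  surj : ∀ r < len, p r → ∃ i < k, σ i = r

/-- Working in place is safe because the write position never exceeds the read position. Each entry
is written, but the write position advances only past entries that are kept. -/
theorem compactProg_wp {S len : ℕ} {u : Store} (h12 : u.reg 12 = len) (hS : len + 1 ≤ S) :
    Wp S compactProg (len * 22 + 5) u fun v =>
      ∃ σ, Compacted (u.mem 20) (v.mem 20) (fun r => u.mem 22 r ≠ 0) len (v.reg 6) σ := by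
  refine (Wp.seq (T := 2) (R := fun v => v = u.setReg 6 0) (Wp.asg (by simp) (by simp))
    (T' := len * (17 + 5) + 3) ?_).time (by omega)
  rintro u1 hu1 -
  refine Wp.forP_const_of (N := len) (fun a v => v.reg 6 ≤ a ∧
      (∀ i, a ≤ i → v.mem 20 i = u.mem 20 i) ∧
      ∃ σ, Compacted (u.mem 20) (v.mem 20) (fun r => u.mem 22 r ≠ 0) a (v.reg 6) σ) 17
    (by simp [hu1, h12]) (by simp) (by simp) (by simp) ?_ ?_ fun v _ hv => hv.2.2
  · refine ⟨by simp [hu1], by simp [hu1], id, ?_⟩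
    simp only [setReg_reg, hu1]
    constructor <;> simp
  · rintro a ha v hF h11 ⟨h6, hrest, σ, hσ⟩
    have m22 : v.mem 22 = u.mem 22 := by rw [hF.mem 22 (by simp)]; simp [hu1]
    set k := v.reg 6 with hk
    have hka : v.mem 20 a = u.mem 20 a := hrest a le_rfl
    refine (Wp.seq (T := 4) (R := fun w => w = v.setMem 20 k (u.mem 20 a)) (Wp.st (by simp) (by simp)
      (by simp [h11, hka, hk])) (T' := 13) ?_)
    rintro w hw -
    have e6 : w.reg 6 = k := by simp [hw, hk]
    have e11 : w.reg 11 = a := by simp [hw, h11]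
    have m22w : w.mem 22 = u.mem 22 := by simp [hw, m22]
    have m20w : w.mem 20 = Function.update (v.mem 20) k (u.mem 20 a) := by simp [hw]
    have hflag := Flag.lt 0 (u.mem 22 a)
    have hle := hflag.le_one
    refine Wp.time (T' := 13) (Wp.asg (e := .var 6 + Ex.lt 0 (.ld 22 (.var 11))) ?_ ?_) (by simp)
    · simp [Ex.lt, e6, e11, m22w]
      omega
    · have hnew : (Ex.var 6 + Ex.lt 0 (.ld 22 (.var 11))).eval w =
          k + (1 - (1 - (u.mem 22 a - 0))) := by
        simp [Ex.lt, e6, e11, m22w]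
      rw [hnew]
      have hcell : ∀ i < k, Function.update (v.mem 20) k (u.mem 20 a) i = v.mem 20 i := fun i hi =>
        Function.update_of_ne hi.ne _ _
      simp only [setReg_reg, setReg_mem, m20w]
      rw [Function.update_of_ne (by simp), Function.update_self]
      refine ⟨by omega, fun i hi => ?_, ?_⟩
      · rw [Function.update_of_ne (by omega)]
        exact hrest i (by omega)
      · by_cases hp : u.mem 22 a ≠ 0
        · rw [hflag.eq_one (by omega)]
          refine ⟨Function.update σ k a, ?_, ?_, ?_, ?_, ?_⟩
          · intro i j hij hj
            rw [Function.update_of_ne (by omega : i ≠ k)]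
            rcases Nat.lt_succ_iff_lt_or_eq.1 hj with hj | rfl
            · rw [Function.update_of_ne (by omega : j ≠ k)]
              exact hσ.mono i j hij hj
            · rw [Function.update_self]
              exact hσ.lt i hij
          · intro i hi
            rcases Nat.lt_succ_iff_lt_or_eq.1 hi with hi | rfl
            · rw [Function.update_of_ne (by omega : i ≠ k)]
              have := hσ.lt i hi
              omega
            · rw [Function.update_self]; omega
          · intro i hi
            rcases Nat.lt_succ_iff_lt_or_eq.1 hi with hi | rfl
            · rw [Function.update_of_ne (by omega : i ≠ k)]
              exact hσ.sat i hi
            · rw [Function.update_self]; exact hp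
          · intro i hi
            rcases Nat.lt_succ_iff_lt_or_eq.1 hi with hi | rfl
            · rw [Function.update_of_ne (by omega : i ≠ k), Function.update_of_ne (by omega : i ≠ k)]
              exact hσ.eq i hi
            · rw [Function.update_self, Function.update_self]
          · intro r hr hpr
            rcases Nat.lt_succ_iff_lt_or_eq.1 hr with hr | rfl
            · obtain ⟨i, hi, h⟩ := hσ.surj r hr hpr
              exact ⟨i, by omega, by rw [Function.update_of_ne (by omega : i ≠ k), h]⟩
            · exact ⟨k, by omega, by rw [Function.update_self]⟩
        · rw [hflag.eq_zero (by omega), add_zero]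
          refine ⟨σ, hσ.mono, fun i hi => (hσ.lt i hi).trans (by omega), hσ.sat, fun i hi => ?_, ?_⟩
          · rw [hcell i hi]
            exact hσ.eq i hi
          · intro r hr hpr
            rcases Nat.lt_succ_iff_lt_or_eq.1 hr with hr | rfl
            · exact hσ.surj r hr hpr
            · exact absurd hpr hp

end WordRAM

/-! ### Linear algebra of the greedy selection. -/

namespace Elim

open Submodule

/-- Strong induction: a dependent row is a combination of earlier rows, hence of the pivots among or
before these. -/
theorem mem_span_pivots {ρ : ℕ → Vec} {p : ℕ → Prop} {L : ℕ}
    (h : ∀ r < L, ¬ p r → ρ r ∈ span (ZMod 2) (ρ '' Set.Iio r)) :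
    ∀ r < L, ρ r ∈ span (ZMod 2) (ρ '' {j | j ≤ r ∧ p j}) := by
  intro r
  induction r using Nat.strong_induction_on with
  | _ r ih =>
    intro hr
    by_cases hp : p r
    · exact subset_span ⟨r, ⟨le_rfl, hp⟩, rfl⟩
    · refine span_le.2 ?_ (h r hr hp)
      rintro _ ⟨j, hj, rfl⟩
      have hj' : j < r := hj
      refine span_mono (Set.image_mono ?_) (ih j hj' (by omega))
      rintro i ⟨h1, h2⟩
      exact ⟨h1.trans hj'.le, h2⟩

theorem linearIndependent_of_notMem_span {ρ : ℕ → Vec} :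
    ∀ k : ℕ, (∀ i < k, ρ i ∉ span (ZMod 2) (ρ '' Set.Iio i)) →
      LinearIndependent (ZMod 2) fun i : Fin k => ρ i := by
  intro k
  induction k with
  | zero => intro _; exact linearIndependent_empty_type
  | succ k ih =>
    intro h
    rw [linearIndependent_finSucc']
    refine ⟨ih fun i hi => h i (by omega), ?_⟩
    have : Set.range (Fin.init fun i : Fin (k + 1) => ρ i) = ρ '' Set.Iio k := by
      ext x
      constructor
      · rintro ⟨i, rfl⟩
        exact ⟨i, i.2, rfl⟩
      · rintro ⟨i, hi, rfl⟩
        exact ⟨⟨i, hi⟩, rfl⟩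
    rw [this]
    exact h k (by omega)

/-- Restriction to the first `q` coordinates is injective on the span, hence preserves independence.
-/
theorem card_le_of_support {k q : ℕ} {x : Fin k → Vec} (hx : LinearIndependent (ZMod 2) x)
    (hq : ∀ i c, q ≤ c → x i c = 0) : k ≤ q := by
  let F : Vec →ₗ[ZMod 2] (Fin q → ZMod 2) := LinearMap.funLeft (ZMod 2) (ZMod 2) (Fin.val)
  have hF : LinearIndependent (ZMod 2) (F ∘ x) := by
    refine hx.map ?_
    rw [Submodule.disjoint_def]
    intro y hy hy0
    have hsup : ∀ y ∈ span (ZMod 2) (Set.range x), ∀ c, q ≤ c → y c = 0 := by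
      intro y hy
      induction hy using Submodule.span_induction with
      | mem y hy => obtain ⟨i, rfl⟩ := hy; exact hq i
      | zero => simp
      | add a b _ _ ha hb => intro c hc; simp [ha c hc, hb c hc]
      | smul a b _ hb => intro c hc; simp [hb c hc]
    funext c
    by_cases hc : c < q
    · exact congrFun (LinearMap.mem_ker.1 hy0) ⟨c, hc⟩
    · exact hsup y hy c (by omega)
  simpa using hF.fintype_card_le_finrank

/-- The entries of `f` before `k` select a set of vectors that spans `V 0, …, V (next - 1)` and
contains enough vectors with small keys. -/
structure Selection (V : ℕ → Vec) (key : ℕ → ℚ) (f : ℕ → ℕ) (k next : ℕ) : Prop where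
  lt : ∀ i < k, f i < next
  inj : Set.InjOn f (Set.Iio k)
  span : ∀ m < next, V m ∈ span (ZMod 2) {x | ∃ i < k, key (f i) ≤ key m ∧ x = V (f i)}

open WordRAM

/-- The greedy argument for matroids. Since the rows are sorted, the pivots spanning a row have keys
no larger than its own. A vector discarded in an earlier round is spanned by old selected vectors of
no larger key, and each of these by pivots of the new round; the bounds on the keys compose. -/
theorem Selection.round {V : ℕ → Vec} {key : ℕ → ℚ} {f f' g h : ℕ → ℕ} {k add next k' R : ℕ}
    {p : ℕ → Prop} {σ : ℕ → ℕ} {ρ : ℕ → Vec} (hs : Selection V key f k next)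
    (hf : ∀ i < k, f' i = f i) (hf' : ∀ i < add, f' (k + i) = next + i)
    (hg : Rearr f' g (k + add))
    (hsort : ∀ i j, i < j → j < k + add → key (g i) ≤ key (g j))
    (hρ : ∀ r < k + add, ρ r = V (g r)) (hR : k + add ≤ R)
    (hp : ∀ r < R, ¬ p r ↔ ρ r ∈ Submodule.span (ZMod 2) (ρ '' Set.Iio r))
    (hc : Compacted g h p (k + add) k' σ) :
    Selection V key h k' (next + add) ∧
      LinearIndependent (ZMod 2) fun i : Fin k' => V (h i) := by
  have hglt : ∀ r < k + add, g r < next + add := by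
    intro r hr
    obtain ⟨i, hi, hig⟩ : g r ∈ f' '' Set.Iio (k + add) := by rw [← hg.image]; exact ⟨r, hr, rfl⟩
    have hi' : i < k + add := hi
    rw [← hig]
    by_cases hik : i < k
    · rw [hf i hik]
      have := hs.lt i hik
      omega
    · have := hf' (i - k) (by omega)
      rw [show k + (i - k) = i by omega] at this
      omega
  have hgsurj : ∀ i < k + add, ∃ r < k + add, g r = f' i := by
    intro i hi
    obtain ⟨r, hr, h⟩ : f' i ∈ g '' Set.Iio (k + add) := by rw [hg.image]; exact ⟨i, hi, rfl⟩
    exact ⟨r, hr, h⟩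
  have hkey : ∀ r < k + add, V (g r) ∈
      Submodule.span (ZMod 2) {x | ∃ i < k', key (h i) ≤ key (g r) ∧ x = V (h i)} := by
    intro r hr
    have h1 := mem_span_pivots (fun r hr hpr => (hp r hr).1 hpr) r (by omega)
    rw [hρ r hr] at h1
    refine span_mono ?_ h1
    rintro _ ⟨j, ⟨hj, hpj⟩, rfl⟩
    obtain ⟨i, hi, rfl⟩ := hc.surj j (by omega) hpj
    refine ⟨i, hi, ?_, ?_⟩
    · rw [hc.eq i hi]
      rcases hj.lt_or_eq with hj | hj
      · exact hsort _ _ hj hr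
      · rw [hj]
    · rw [hρ _ (by omega), hc.eq i hi]
  refine ⟨⟨fun i hi => ?_, fun i hi j hj hij => ?_, fun m hm => ?_⟩, ?_⟩
  · rw [hc.eq i hi]
    exact hglt _ (hc.lt i hi)
  · have hi' : i < k' := hi
    have hj' : j < k' := hj
    rw [hc.eq i hi, hc.eq j hj] at hij
    have := hg.inj (hc.lt i hi) (hc.lt j hj) hij
    rcases lt_trichotomy i j with h | h | h
    · have := hc.mono i j h hj'; omega
    · exact h
    · have := hc.mono j i h hi'; omega
  · by_cases hmn : m < next
    · refine span_le.2 ?_ (hs.span m hmn)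
      rintro _ ⟨i, hi, hkm, rfl⟩
      obtain ⟨r, hr, hri⟩ := hgsurj i (by omega)
      rw [hf i hi] at hri
      rw [← hri]
      refine span_mono ?_ (hkey r hr)
      rintro _ ⟨j, hj, hjr, rfl⟩
      exact ⟨j, hj, hjr.trans (by rwa [hri]), rfl⟩
    · obtain ⟨r, hr, hri⟩ := hgsurj (k + (m - next)) (by omega)
      rw [hf' _ (by omega), show next + (m - next) = m by omega] at hri
      rw [← hri]
      exact hkey r hr
  · have : (fun i : Fin k' => V (h i)) = fun i : Fin k' => ρ (σ i) := by
      funext i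
      rw [hρ _ (hc.lt i i.2), hc.eq i i.2]
    rw [this]
    refine linearIndependent_of_notMem_span (ρ := fun i => ρ (σ i)) k' fun i hi hmem => ?_
    have h1 := hc.lt i hi
    refine (hp (σ i) (by omega)).not.1 (not_not.2 (hc.sat i hi)) (span_mono ?_ hmem)
    rintro _ ⟨j, hj, rfl⟩
    exact ⟨σ j, hc.mono j i hj hi, rfl⟩

end Elim

/-! ### Selection in batches. -/

namespace WordRAM

open Elim

/-- Append the next vectors to the list in memory 20. -/
def appendProg : Prog :=
  asg 10 (.var 3 - (.var 3 - (.var 1 - .var 7))) ;;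
  forP 11 10 (st 20 (.var 6 + .var 11) (.var 7 + .var 11)) ;;
  asg 12 (.var 6 + .var 10) ;;
  asg 7 (.var 7 + .var 10)

/-- Copy the listed rows to the memory 21. -/
def copyProg : Prog :=
  for2 11 4 13 3 (st 21 (.var 11 * .var 3 + .var 13) ((Ex.lt (.var 11) (.var 12)).and
    (.ld 17 (Ex.lt (.var 11) (.var 12) * .ld 20 (.var 11) * .var 3 + .var 13))))

/-- Process the next vectors. -/
def roundProg (P : Prog) (o : Opt) : Prog :=
  appendProg ;; sortProg o ;; copyProg ;; elimProg P ;; compactProg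

theorem appendProg_wp {S M N k next : ℕ} {u : Store} (h1 : u.reg 1 = N) (h3 : u.reg 3 = M)
    (h6 : u.reg 6 = k) (h7 : u.reg 7 = next) (hn : next ≤ N) (hS : k + M + N + 4 ≤ S) :
    Wp S appendProg (M * 13 + 19) u fun v =>
      v.reg 12 = k + min M (N - next) ∧ v.reg 7 = next + min M (N - next) ∧
      (∀ i < k, v.mem 20 i = u.mem 20 i) ∧
      ∀ i < min M (N - next), v.mem 20 (k + i) = next + i := by
  set add := min M (N - next) with hadd
  -- Truncated subtraction computes the minimum without a test.
  have hadd' : M - (M - (N - next)) = add := by omega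
  have haddM : add ≤ M := by omega
  refine (Wp.seq (T := 8) (R := fun v => v = u.setReg 10 add) (Wp.asg (by simp)
    (by simp [h1, h3, h7, hadd'])) (T' := (add * (8 + 5) + 3) + (4 + 4)) ?_).time (by omega)
  rintro u1 hu1 -
  have e6 : u1.reg 6 = k := by simp [hu1, h6]
  have e7 : u1.reg 7 = next := by simp [hu1, h7]
  refine Wp.seq (Wp.forP_const_of (N := add) (fun j v => (∀ i < k, v.mem 20 i = u.mem 20 i) ∧
      ∀ i < j, v.mem 20 (k + i) = next + i) 8 (by simp [hu1]) (by simp) (by simp) (by simp)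
      ?_ ?_ fun v _ h => h) ?_
  · simp [hu1]
  · rintro j hj v hF h11 ⟨hv1, hv2⟩
    have e6' : v.reg 6 = k := by rw [hF.reg 6 (by simp), e6]
    have e7' : v.reg 7 = next := by rw [hF.reg 7 (by simp), e7]
    refine (Wp.st ?_ ?_ ?_).time ?_
    · simp [e6', h11]; omega
    · simp [e7', h11]; omega
    · simp only [Ex.eval_add, Ex.eval_var, e6', e7', h11, setReg_mem, setMem_mem,
        Function.update_self]
      refine ⟨fun i hi => ?_, fun i hi => ?_⟩
      · rw [Function.update_of_ne (by omega)]
        exact hv1 i hi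
      · rcases Nat.lt_succ_iff_lt_or_eq.1 hi with hi | rfl
        · rw [Function.update_of_ne (by omega)]
          exact hv2 i hi
        · rw [Function.update_self]
    · simp
  rintro u2 ⟨hv1, hv2⟩ hF2
  have e6' : u2.reg 6 = k := by rw [hF2.reg 6 (by simp), e6]
  have e7' : u2.reg 7 = next := by rw [hF2.reg 7 (by simp), e7]
  have e10' : u2.reg 10 = add := by rw [hF2.reg 10 (by simp)]; simp [hu1]
  refine Wp.seq (T := 4) (R := fun v => v = u2.setReg 12 (k + add)) (Wp.asg ?_ ?_) ?_
  · simp [e6', e10']; omega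
  · simp [e6', e10']
  rintro u3 hu3 -
  refine Wp.asg (e := .var 7 + .var 10) ?_ ?_
  · simp [hu3, e7', e10']; omega
  · simp [hu3, e7', e10']
    exact ⟨hv1, hv2⟩

/-- Rows from `len` on are filled with zeros up to the fixed height `R`; they come last, so they do
not affect which listed rows depend on earlier ones. Multiplying the list entry by the truth value
of `r < len` keeps the address small there. -/
theorem copyProg_wp {S M N R len : ℕ} {u : Store} (h3 : u.reg 3 = M) (h4 : u.reg 4 = R)
    (h12 : u.reg 12 = len) (hlen : ∀ r < len, u.mem 20 r < N)
    (hS : 2 * R * M + 4 * R + M + 4 ≤ S) (hS2 : N * M + 2 * N + M + 4 ≤ S)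
    (hbit : ∀ x < N * M, u.mem 17 x ≤ 1) :
    Wp S copyProg (R * (M * 40 + 8) + 3) u fun v =>
      (∀ x < R * M, v.mem 21 x ≤ 1) ∧
      ∀ r < R, r < len → rowVec (v.mem 21) M r = rowVec (u.mem 17) M (u.mem 20 r) := by
  have i7 : 2 * R * M = 2 * (R * M) := by ring
  refine Wp.fill2_of (a := 21) (N := R) (M := M) h4 h3 (by constructor <;> simp) 35
    (fun r c => r * M + c)
    (fun r c => if r < len then u.mem 17 (u.mem 20 r * M + c) else 0) ?_ ?_ ?_
  · intro I _ J hJ I' _ J' hJ' h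
    exact idx_inj hJ hJ' h
  · intro I hI J hJ v hF h11 h13 _ _
    have e3 : v.reg 3 = M := by rw [hF.reg 3 (by simp), h3]
    have e12 : v.reg 12 = len := by rw [hF.reg 12 (by simp), h12]
    have m17 : v.mem 17 = u.mem 17 := hF.mem 17 (by simp)
    have m20 : v.mem 20 = u.mem 20 := hF.mem 20 (by simp)
    have i1 := idx_lt hI hJ
    have hle := (Flag.lt I len).le_one
    by_cases hIl : I < len
    · have hf := (Flag.lt I len).eq_one hIl
      have i2 := idx_lt (hlen I hIl) hJ
      have i3 := hbit _ i2
      have i4 := hlen I hIl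
      have i5 : u.mem 20 I * M ≤ N * M := Nat.mul_le_mul_right _ i4.le
      refine (Wp.st ?_ ?_ ?_).time ?_
      · simp [h11, e3, h13]; omega
      · simp [Ex.lt, Ex.and, h11, h13, e3, e12, m17, m20, hf]; omega
      · simp [Ex.lt, Ex.and, h11, h13, e3, e12, m17, m20, hf, hIl]
      · simp [Ex.lt]
    · have hf := (Flag.lt I len).eq_zero hIl
      refine (Wp.st ?_ ?_ ?_).time ?_
      · simp [h11, e3, h13]; omega
      · simp [Ex.lt, Ex.and, h11, h13, e3, e12, m17, m20, hf]; omega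
      · simp [Ex.lt, Ex.and, h11, h13, e3, e12, m17, m20, hf, hIl]
      · simp [Ex.lt]
  · intro v hF hv _
    constructor
    · intro x hx
      have hM : 0 < M := by
        rcases Nat.eq_zero_or_pos M with h | h
        · simp [h] at hx
        · exact h
      have hr : x / M < R := Nat.div_lt_of_lt_mul (by rwa [mul_comm])
      have hp : x % M < M := Nat.mod_lt _ hM
      have := hv _ hr _ hp
      rw [Nat.div_add_mod'] at this
      rw [this]
      split_ifs with h
      · exact hbit _ (idx_lt (hlen _ h) hp)
      · exact Nat.zero_le _
    · intro r hr hrl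
      funext c
      simp only [rowVec]
      split_ifs with hc
      · rw [hv r hr c hc, if_pos hrl]
      · rfl

theorem not_uw_roundProg_reg (P : Prog) (o : Opt) {x : ℕ} (hx : x < 20)
    (h : x ≤ 5 ∨ x = 8 ∨ x = 9 ∨ 15 ≤ x) : ¬ (roundProg P o).UW (.reg x) := by
  have h1 := not_uw_elimProg_reg P (x := x) (by omega)
  simp [roundProg, appendProg, sortProg, copyProg, compactProg, h1]
  omega

theorem not_uw_roundProg_mem (P : Prog) (o : Opt) {x : ℕ} (hx : x < 20) :
    ¬ (roundProg P o).UW (.mem x) := by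
  have h1 := not_uw_elimProg_mem P (x := x) (by omega)
  simp [roundProg, appendProg, sortProg, copyProg, compactProg, h1]
  omega

theorem not_uw_roundProg_wmem (P : Prog) (o : Opt) {x : ℕ} (hx : x < 100) :
    ¬ (roundProg P o).UW (.wmem x) := by
  have h1 := not_uw_elimProg_wmem P (x := x) (by omega)
  simp [roundProg, appendProg, sortProg, copyProg, compactProg, h1]

/-- One instance of `Selection.round`. The new selection has at most `M` members because it consists
of independent vectors supported on `M` coordinates. -/
theorem roundProg_wp {P : Prog} {c₀ : ℕ} {time : ℕ → ℕ} (hP : Multiplies P c₀ time) {o : Opt}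
    {S M N R E κ k next : ℕ} {u : Store} (h1 : u.reg 1 = N) (h3 : u.reg 3 = M) (h4 : u.reg 4 = R)
    (h5 : u.reg 5 = κ + 1) (h6 : u.reg 6 = k) (h7 : u.reg 7 = next) (hMκ : M = 2 ^ κ)
    (hR : R = 2 * M) (hS : 2 * R * M + 4 * R + M + 4 ≤ S) (hS' : (M + 1) ^ c₀ ≤ S)
    (hS2 : N * M + 2 * N + M + 4 ≤ S)
    (hE : ∀ t ≤ κ, M / 2 ^ t * time (2 ^ t) ≤ 2 ^ t * E)
    (hbit : ∀ x < N * M, u.mem 17 x ≤ 1) (hn : next ≤ N) (hk : k ≤ M)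
    (hsel : Selection (rowVec (u.mem 17) M) (fun i => sortKey o (u.wmem 1 i)) (u.mem 20) k next) :
    Wp S (roundProg P o) (M * ((κ + 2) * (2300 * M + 4 * E))) u fun v =>
      v.reg 6 ≤ M ∧ v.reg 7 = next + min M (N - next) ∧
      Selection (rowVec (u.mem 17) M) (fun i => sortKey o (u.wmem 1 i)) (v.mem 20) (v.reg 6)
        (next + min M (N - next)) ∧
      LinearIndependent (ZMod 2) fun i : Fin (v.reg 6) => rowVec (u.mem 17) M (v.mem 20 i) := by
  have hM1 : 1 ≤ M := by rw [hMκ]; exact Nat.one_le_two_pow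
  set add := min M (N - next) with hadd
  have hlenR : k + add ≤ R := by omega
  refine (Wp.seq (appendProg_wp h1 h3 h6 h7 hn (by omega)) (T' := ((k + add) * ((k + add) * 25 + 8) + 3)
    + ((R * (M * 40 + 8) + 3) + (R * ((κ + 2) * (1000 * M + 2 * E)) +
      ((k + add) * 22 + 5)))) ?_).time ?_
  swap
  · have e1 : (k + add) * ((k + add) * 25 + 8) ≤ R * (R * 25 + 8) := by gcongr
    have e2 : R * (R * 25 + 8) = 100 * (M * M) + 16 * M := by rw [hR]; ring
    have e3 : R * (M * 40 + 8) = 80 * (M * M) + 16 * M := by rw [hR]; ring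
    have e4 : R * ((κ + 2) * (1000 * M + 2 * E)) = M * ((κ + 2) * (2000 * M + 4 * E)) := by
      rw [hR]; ring
    have e5 : M * ((κ + 2) * (2300 * M + 4 * E)) = M * ((κ + 2) * (2000 * M + 4 * E)) +
      300 * ((κ + 2) * (M * M)) := by ring
    have e6 : 2 * (M * M) ≤ (κ + 2) * (M * M) := Nat.mul_le_mul_right _ (by omega)
    have e7 : M ≤ M * M := by nlinarith
    omega
  rintro u1 ⟨h12, h7', hold, hnew⟩ hF1
  have r1 := fun x (h : x ≤ 6) => hF1.reg x (by simp [appendProg]; omega)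
  have m1 := fun x (h : x ≠ 20) => hF1.mem x (by simp [appendProg, h])
  have w1 := fun x => hF1.wmem x (by simp [appendProg])
  -- Old entries are below `next` and appended ones are not, so nothing is listed twice.
  have hinj1 : Set.InjOn (u1.mem 20) (Set.Iio (k + add)) := by
    have hval : ∀ i < k + add, (i < k → u1.mem 20 i < next ∧ u1.mem 20 i = u.mem 20 i) ∧
        (k ≤ i → u1.mem 20 i = next + (i - k)) := by
      intro i hi
      refine ⟨fun h => ⟨hold i h ▸ hsel.lt i h, hold i h⟩, fun h => ?_⟩
      have := hnew (i - k) (by omega)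
      rwa [show k + (i - k) = i by omega] at this
    intro i hi j hj hij
    have hi' : i < k + add := hi
    have hj' : j < k + add := hj
    obtain ⟨a1, a2⟩ := hval i hi'
    obtain ⟨b1, b2⟩ := hval j hj'
    rcases lt_or_ge i k with h | h <;> rcases lt_or_ge j k with h' | h'
    · exact hsel.inj h h' (by rw [← (a1 h).2, ← (b1 h').2, hij])
    · have := (a1 h).1; have := b2 h'; omega
    · have := (b1 h').1; have := a2 h; omega
    · have := a2 h; have := b2 h'; omega
  have hlt1 : ∀ i < k + add, u1.mem 20 i < N := by
    intro i hi
    by_cases h : i < k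
    · rw [hold i h]
      exact (hsel.lt i h).trans_le hn
    · have := hnew (i - k) (by omega)
      rw [show k + (i - k) = i by omega] at this
      omega
  refine Wp.seq (sortProg_wp (o := o) h12 hinj1) ?_
  rintro u2 ⟨hR2, hs2⟩ hF2
  have r2 := fun x (h : x ≤ 10 ∨ x = 12) => hF2.reg x (by simp [sortProg]; omega)
  have m2 := fun x (h : x ≠ 20) => (show u2.mem x = u.mem x by
    rw [hF2.mem x (by simp [sortProg, h]), m1 x h])
  have w2 := fun x => (show u2.wmem x = u.wmem x by rw [hF2.wmem x (by simp [sortProg]), w1])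
  rw [w1] at hs2
  have hlt2 : ∀ i < k + add, u2.mem 20 i < N := by
    intro i hi
    obtain ⟨j, hj, h⟩ : u2.mem 20 i ∈ u1.mem 20 '' Set.Iio (k + add) := by
      rw [← hR2.image]; exact ⟨i, hi, rfl⟩
    rw [← h]
    exact hlt1 j hj
  refine Wp.seq (copyProg_wp (N := N) (R := R) (M := M) (by rw [r2 3 (by simp), r1 3 (by simp), h3])
    (by rw [r2 4 (by simp), r1 4 (by simp), h4]) (by rw [r2 12 (by simp), h12]) hlt2 hS hS2
    (by rw [m2 17 (by simp)]; exact hbit)) ?_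
  rintro u3 ⟨hb3, hrow3⟩ hF3
  have r3 := fun x (h : x ≤ 10 ∨ x = 12) => (show u3.reg x = u1.reg x by
    rw [hF3.reg x (by simp [copyProg]; omega), r2 x h])
  have m3 := fun x (h : x ≠ 21) => hF3.mem x (by simp [copyProg, h])
  rw [m2 17 (by simp)] at hrow3
  refine Wp.seq (elimProg_wp hP (E := E) (by rw [r3 3 (by simp), r1 3 (by simp), h3])
    (by rw [r3 4 (by simp), r1 4 (by simp), h4]) (by rw [r3 5 (by simp), r1 5 (by simp), h5]) hMκ hR
    hS hS' hE hb3) ?_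
  rintro u4 hel hF4
  have r4 := fun x (h : x ≤ 10 ∨ x = 12) => (show u4.reg x = u1.reg x by
    rw [hF4.reg x (not_uw_elimProg_reg P (by omega)), r3 x h])
  have m4 : u4.mem 20 = u2.mem 20 := by
    rw [hF4.mem 20 (not_uw_elimProg_mem P (by simp)), m3 20 (by simp)]
  refine (compactProg_wp (by rw [r4 12 (by simp), h12]) (by omega)).frame.post ?_
  rintro v ⟨⟨σ, hσ⟩, hF5⟩
  rw [m4] at hσ
  obtain ⟨hA, hB⟩ := hsel.round (R := R) (ρ := fun r => rowVec (u3.mem 21) M r) hold hnew hR2 hs2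
    (fun r hr => hrow3 r (by omega) hr) hlenR (fun r hr => by rw [not_not]; exact hel r hr) hσ
  refine ⟨?_, ?_, hA, hB⟩
  · exact card_le_of_support hB fun i c hc => by simp [rowVec, hc]
  · rw [hF5.reg 7 (by simp [compactProg]), r4 7 (by simp), h7']

end WordRAM

namespace WordRAM

open Elim

/-- Select vectors among the rows of the matrix in memory 17. -/
def selectProg (P : Prog) (o : Opt) : Prog :=
  asg 8 ((.var 1 - .var 6 + (.var 3 - 1)) / .var 3) ;; asg 7 (.var 6) ;; forP 9 8 (roundProg P o)

theorem not_uw_selectProg_reg (P : Prog) (o : Opt) {x : ℕ} (hx : x ≤ 5 ∨ 15 ≤ x ∧ x < 20) :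
    ¬ (selectProg P o).UW (.reg x) := by
  have h1 := not_uw_roundProg_reg P o (x := x) (by omega) (by omega)
  simp [selectProg, h1]
  omega

theorem not_uw_selectProg_mem (P : Prog) (o : Opt) {x : ℕ} (hx : x < 20) :
    ¬ (selectProg P o).UW (.mem x) := by
  have h1 := not_uw_roundProg_mem P o (x := x) (by omega)
  simp [selectProg, h1]

/-- The first `k` vectors are selected for free, being spanned by themselves; each round then deals
with up to `M` more. Independence is guaranteed only after some round has run, whence the
alternative. -/
theorem selectProg_wp {P : Prog} {c₀ : ℕ} {time : ℕ → ℕ} (hP : Multiplies P c₀ time) {o : Opt}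
    {S M N R E κ k : ℕ} {u : Store} (h1 : u.reg 1 = N) (h3 : u.reg 3 = M) (h4 : u.reg 4 = R)
    (h5 : u.reg 5 = κ + 1) (h6 : u.reg 6 = k) (hMκ : M = 2 ^ κ)
    (hR : R = 2 * M) (hS : 2 * R * M + 4 * R + M + 4 ≤ S) (hS' : (M + 1) ^ c₀ ≤ S)
    (hS2 : N * M + 2 * N + M + 4 ≤ S)
    (hE : ∀ t ≤ κ, M / 2 ^ t * time (2 ^ t) ≤ 2 ^ t * E)
    (hbit : ∀ x < N * M, u.mem 17 x ≤ 1) (hkN : k ≤ N) (hk : k ≤ M)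
    (hid : ∀ i < k, u.mem 20 i = i) :
    Wp S (selectProg P o)
      ((N - k + (M - 1)) / M * (M * ((κ + 2) * (2300 * M + 4 * E)) + 5) + 15) u fun v =>
      Selection (rowVec (u.mem 17) M) (fun i => sortKey o (u.wmem 1 i)) (v.mem 20) (v.reg 6) N ∧
      (k = N ∧ v.reg 6 = k ∨
        LinearIndependent (ZMod 2) fun i : Fin (v.reg 6) => rowVec (u.mem 17) M (v.mem 20 i)) := by
  have hM1 : 1 ≤ M := by rw [hMκ]; exact Nat.one_le_two_pow
  have hNM : N ≤ N * M := by nlinarith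
  -- Division rounded up, so that an incomplete last batch is included.
  set it := (N - k + (M - 1)) / M with hit
  refine (Wp.seq (T := 10) (R := fun v => v = u.setReg 8 it) (Wp.asg (by simp [h1, h3, h6]; omega)
    (by simp [h1, h3, h6, hit])) (T' := 2 + (it * (M * ((κ + 2) * (2300 * M + 4 * E)) + 5) + 3))
    ?_).time (by omega)
  rintro u1 hu1 -
  refine Wp.seq (T := 2) (R := fun v => v = u1.setReg 7 k) (Wp.asg (by simp)
    (by simp [hu1, h6])) ?_
  rintro u2 hu2 -
  have r2 := fun x (h : x ≠ 7) (h' : x ≠ 8) => (show u2.reg x = u.reg x by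
    simp [hu2, hu1, Function.update_of_ne h, Function.update_of_ne h'])
  have m2 : u2.mem = u.mem := by simp [hu2, hu1]
  have w2 : u2.wmem = u.wmem := by simp [hu2, hu1]
  refine Wp.forP_const_of (N := it) (fun j v => v.reg 6 ≤ M ∧ v.reg 7 = min N (k + j * M) ∧
    Selection (rowVec (u.mem 17) M) (fun i => sortKey o (u.wmem 1 i)) (v.mem 20) (v.reg 6)
      (min N (k + j * M)) ∧
    (j = 0 ∧ v.reg 6 = k ∨ LinearIndependent (ZMod 2) fun i : Fin (v.reg 6) =>
      rowVec (u.mem 17) M (v.mem 20 i))) _ (by simp [hu2, hu1])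
    (not_uw_roundProg_reg P o (by simp) (by simp)) (not_uw_roundProg_reg P o (by simp) (by simp))
    (by simp) ?_ ?_ ?_
  · have e6 : (u2.setReg 9 0).reg 6 = k := by simp [r2, h6]
    refine ⟨e6.trans_le hk, by simp [hu2, hkN], ?_, .inl ⟨rfl, e6⟩⟩
    rw [e6, setReg_mem, m2, zero_mul, add_zero, min_eq_right hkN]
    refine ⟨fun i hi => by rw [hid i hi]; exact hi, fun i hi j hj hij => ?_, fun m hm => ?_⟩
    · rwa [hid i hi, hid j hj] at hij
    · exact Submodule.subset_span ⟨m, hm, by rw [hid m hm], by rw [hid m hm]⟩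
  · rintro j hj v hF h9 ⟨a1, a2, a3, -⟩
    have r := fun x (h : x ≤ 5) => (show v.reg x = u.reg x by
      rw [hF.reg x (by simp [not_uw_roundProg_reg P o (show x < 20 by omega) (by omega)]; omega),
        r2 x (by omega) (by omega)])
    have m17 : v.mem 17 = u.mem 17 := by
      rw [hF.mem 17 (by simp [not_uw_roundProg_mem P o]), m2]
    have w1 : v.wmem 1 = u.wmem 1 := by
      rw [hF.wmem 1 (by simp [not_uw_roundProg_wmem P o]), w2]
    have := roundProg_wp hP (o := o) (S := S) (E := E) (u := v) (N := N) (M := M) (R := R) (κ := κ)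
      (k := v.reg 6) (next := min N (k + j * M)) (by rw [r 1 (by simp), h1])
      (by rw [r 3 (by simp), h3]) (by rw [r 4 (by simp), h4]) (by rw [r 5 (by simp), h5]) rfl a2 hMκ
      hR hS hS' hS2 hE (by rw [m17]; exact hbit) (min_le_left _ _) a1
      (by rw [m17, w1]; exact a3)
    refine this.post fun w ⟨b1, b2, b3, b4⟩ => ?_
    have en : min N (k + j * M) + min M (N - min N (k + j * M)) = min N (k + (j + 1) * M) := by
      have : (j + 1) * M = j * M + M := by ring
      omega
    rw [en] at b2 b3
    rw [m17, w1] at b3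
    rw [m17] at b4
    have e6 : (w.setReg 9 (j + 1)).reg 6 = w.reg 6 := by simp
    have e7 : (w.setReg 9 (j + 1)).reg 7 = w.reg 7 := by simp
    rw [e6, e7]
    exact ⟨b1, b2, b3, .inr b4⟩
  · rintro v - ⟨a1, a2, a3, a4⟩
    have hlast : min N (k + it * M) = N := by
      have h1 : N - k + (M - 1) < M * (it + 1) := by
        rw [hit, mul_comm]
        exact mul_comm M _ ▸ Nat.lt_mul_div_succ _ hM1
      have h2 : M * (it + 1) = it * M + M := by ring
      omega
    rw [hlast] at a3
    refine ⟨a3, a4.imp_left fun ⟨h, h'⟩ => ⟨?_, h'⟩⟩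
    rw [h] at hlast
    omega

end WordRAM

/-! ### Simple loops, the input, and traces of outside sets. -/

namespace WordRAM

/-- Compute in the register `x` whether `e` is true for some value of the register `j`. -/
def any1 (x j c : ℕ) (e : Ex) : Prog := asg x 0 ;; forP j c (asg x (Ex.or (.var x) e))

@[simp] theorem uw_any1 (x j c : ℕ) (e : Ex) (l : Loc) :
    (any1 x j c e).UW l ↔ l = .reg x ∨ l = .reg j := by
  simp [any1]; tauto

/-- The registers of a loop do not interfere. -/
structure Any1 (x j c : ℕ) : Prop where
  xj : x ≠ j
  xc : x ≠ c
  cj : c ≠ j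

namespace Wp
variable {S : ℕ} {P : Prog} {u : Store} {Q : Store → Prop}

theorem any1_of {x j c M : ℕ} {e : Ex} (hM : u.reg c = M) (h : Any1 x j c) (hS : 1 ≤ S)
    (B : ℕ → Prop)
    (he : ∀ J < M, ∀ v, Fr (WordRAM.any1 x j c e) u v → v.reg j = J → EFlag S v e (B J))
    (hQ : ∀ v, Fr (WordRAM.any1 x j c e) u v → Flag (v.reg x) (∃ J < M, B J) → Q v) :
    Wp S (WordRAM.any1 x j c e) (M * (e.cost + 15) + 5) u Q := by
  obtain ⟨h1, h2, h3⟩ := h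
  refine (Wp.seq (R := fun v => v = u.setReg x 0) (Wp.asg (by simp) (by simp)) fun v hv hF => ?_).time
    (T := 2 + (M * ((e.cost + 10) + 5) + 3)) (by ring_nf; omega)
  subst hv
  refine Wp.forP_const_of (N := M) (fun J v => Flag (v.reg x) (∃ J' < J, B J')) _
    (by simp [Function.update_of_ne h2.symm, hM]) (by simpa using h1.symm) (by simpa using h2.symm) h3
    (.inr ⟨by simp [Function.update_of_ne h1], by simp⟩) ?_ ?_
  · intro J hJ v hF' hj hv
    have hE := he J hJ v ((hF.weaken (by simp)).trans (hF'.weaken (by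
      intro l; simp; tauto))) hj
    have hE' := (EFlag.of (e := .var x) hS (by simp) hv).or hE
    refine (Wp.asg hE'.ok ?_).time (by simp; omega)
    simp only [setReg_reg, Function.update_of_ne h1, Function.update_self]
    refine hE'.flag.congr ⟨?_, ?_⟩
    · rintro (⟨J', hJ', hB⟩ | hB)
      · exact ⟨J', by omega, hB⟩
      · exact ⟨J, by omega, hB⟩
    · rintro ⟨J', hJ', hB⟩
      rcases Nat.lt_succ_iff_lt_or_eq.1 hJ' with h | rfl
      · exact .inl ⟨J', h, hB⟩
      · exact .inr hB
  · exact fun v hF' hv => hQ v ((hF.weaken (by simp)).trans (hF'.weaken (by intro l; simp; tauto))) hv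

/-- Fill the cells from address `p` on of the memory `a`. -/
theorem fill1_of {j c a M : ℕ} (hM : u.reg c = M) (hj : ¬ P.UW (.reg j)) (hc : ¬ P.UW (.reg c))
    (hcj : c ≠ j) (C p : ℕ) (val : ℕ → ℕ)
    (hbody : ∀ J < M, ∀ v, Fr (WordRAM.forP j c P) u v → v.reg j = J →
      v.mem a (p + J) = u.mem a (p + J) →
      (∀ x, (x < p ∨ p + M ≤ x) → v.mem a x = u.mem a x) →
      Wp S P C v fun v' => v'.mem a = Function.update (v.mem a) (p + J) (val J))
    (hQ : ∀ v, Fr (WordRAM.forP j c P) u v → (∀ J < M, v.mem a (p + J) = val J) →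
      (∀ x, (x < p ∨ p + M ≤ x) → v.mem a x = u.mem a x) → Q v) :
    Wp S (WordRAM.forP j c P) (M * (C + 5) + 3) u Q := by
  refine Wp.forP_const_of (N := M) (fun J v => (∀ J' < J, v.mem a (p + J') = val J') ∧
    ∀ x, (x < p ∨ p + J ≤ x) → v.mem a x = u.mem a x) C hM hj hc hcj ⟨by simp, by simp⟩ ?_ ?_
  · rintro J hJ v hF hvj ⟨h1, h2⟩
    refine (hbody J hJ v hF hvj (h2 _ (.inr le_rfl)) fun x hx => h2 x (by omega)).post fun v' hv' =>
      ⟨fun J' hJ' => ?_, fun x hx => ?_⟩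
    · rw [setReg_mem, hv']
      rcases Nat.lt_succ_iff_lt_or_eq.1 hJ' with h | rfl
      · rw [Function.update_of_ne (by omega), h1 _ h]
      · rw [Function.update_self]
    · rw [setReg_mem, hv', Function.update_of_ne (by omega)]
      exact h2 x (by omega)
  · exact fun v hF hv => hQ v hF hv.1 hv.2

end Wp

/-- The subset of `Fin n` whose characteristic vector is row `i` of the matrix `f`. -/
def bitSet (f : ℕ → ℕ) (n i : ℕ) : Finset (Fin n) := {v | f (i * n + v) = 1}

theorem mem_bitSet {f : ℕ → ℕ} {n i : ℕ} {v : Fin n} : v ∈ bitSet f n i ↔ f (i * n + v) = 1 := by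
  simp [bitSet]

theorem bitSet_congr {f g : ℕ → ℕ} {n i : ℕ} (h : ∀ v < n, f (i * n + v) = g (i * n + v)) :
    bitSet f n i = bitSet g n i := by
  ext v
  rw [mem_bitSet, mem_bitSet, h v v.2]

/-- The values are bits. -/
theorem Flag.self {k : ℕ} (h : k ≤ 1) : Flag k (k = 1) := by
  rcases Nat.le_one_iff_eq_zero_or_eq_one.1 h with rfl | rfl <;> simp [Flag]

/-- The input graph with its vertex bipartition and a list of vertex sets. -/
structure Inp (u : Store) {n : ℕ} (N : ℕ) (G : SimpleGraph (Fin n)) (w : Fin n → ℚ)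
    (A R' : Finset (Fin n)) (F : ℕ → Finset (Fin n)) : Prop where
  r0 : u.reg 0 = n
  r1 : u.reg 1 = N
  graph : ∀ a b : Fin n, Flag (u.mem 0 (a * n + b)) (G.Adj a b)
  side : ∀ a : Fin n, Flag (u.mem 1 a) (a ∈ A)
  cls : ∀ a : Fin n, Flag (u.mem 3 a) (a ∈ R')
  fam : ∀ k < N, ∀ a : Fin n, Flag (u.mem 4 (k * n + a)) (a ∈ F k)
  weights : ∀ a : Fin n, u.wmem 0 a = w a

/-- Nothing of the input is overwritten. -/
structure Keeps (P : Prog) : Prop where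
  r0 : ¬ P.UW (.reg 0)
  r1 : ¬ P.UW (.reg 1)
  m0 : ¬ P.UW (.mem 0)
  m1 : ¬ P.UW (.mem 1)
  m3 : ¬ P.UW (.mem 3)
  m4 : ¬ P.UW (.mem 4)
  w0 : ¬ P.UW (.wmem 0)

theorem Inp.fr {u v : Store} {n N : ℕ} {G : SimpleGraph (Fin n)} {w : Fin n → ℚ}
    {A R' : Finset (Fin n)} {F : ℕ → Finset (Fin n)} (h : Inp u N G w A R' F) {P : Prog}
    (hP : Keeps P) (hF : Fr P u v) : Inp v N G w A R' F where
  r0 := by rw [hF.reg 0 hP.r0, h.r0]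
  r1 := by rw [hF.reg 1 hP.r1, h.r1]
  graph := by rw [hF.mem 0 hP.m0]; exact h.graph
  side := by rw [hF.mem 1 hP.m1]; exact h.side
  cls := by rw [hF.mem 3 hP.m3]; exact h.cls
  fam := by rw [hF.mem 4 hP.m4]; exact h.fam
  weights := by rw [hF.wmem 0 hP.w0]; exact h.weights

open Classical in
/-- The vertices of `A` with a neighbour in `Y`. -/
noncomputable def trace {n : ℕ} (G : SimpleGraph (Fin n)) (A Y : Finset (Fin n)) :
    Finset (Fin n) :=
  {v ∈ A | ∃ y ∈ Y, G.Adj y v}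

theorem mem_trace {n : ℕ} {G : SimpleGraph (Fin n)} {A Y : Finset (Fin n)} {v : Fin n} :
    v ∈ trace G A Y ↔ v ∈ A ∧ ∃ y ∈ Y, G.Adj y v := by
  simp [trace]

theorem trace_union {n : ℕ} (G : SimpleGraph (Fin n)) (A Y Z : Finset (Fin n)) :
    trace G A (Y ∪ Z) = trace G A Y ∪ trace G A Z := by
  ext v
  simp only [mem_trace, Finset.mem_union, or_and_right, exists_or, and_or_left]

/-- The traces of the sets of vertices that are outside of `A` and less than `k`. -/
def tracesBelow {n : ℕ} (G : SimpleGraph (Fin n)) (A : Finset (Fin n)) (k : ℕ) :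
    Set (Finset (Fin n)) :=
  {T | ∃ Y ⊆ Aᶜ, (∀ y ∈ Y, y.1 < k) ∧ T = trace G A Y}

/-- The traces of the sets of vertices outside of `A`. -/
noncomputable def traces {n : ℕ} (G : SimpleGraph (Fin n)) (A : Finset (Fin n)) :
    Finset (Finset (Fin n)) :=
  Aᶜ.powerset.image (trace G A)

theorem tracesBelow_zero {n : ℕ} (G : SimpleGraph (Fin n)) (A : Finset (Fin n)) :
    tracesBelow G A 0 = {∅} := by
  ext T
  constructor
  · rintro ⟨Y, -, h, rfl⟩
    have : Y = ∅ := Finset.eq_empty_of_forall_notMem fun y hy => by simpa using h y hy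
    subst this
    ext v
    simp [mem_trace]
  · rintro rfl
    exact ⟨∅, by simp, by simp, by ext v; simp [mem_trace]⟩

theorem tracesBelow_eq {n : ℕ} (G : SimpleGraph (Fin n)) (A : Finset (Fin n)) :
    tracesBelow G A n = traces G A := by
  ext T
  simp only [tracesBelow, traces, Finset.coe_image, Set.mem_image, Finset.mem_coe,
    Finset.mem_powerset, Set.mem_ofPred_eq]
  exact ⟨fun ⟨Y, h, _, h'⟩ => ⟨Y, h, h'.symm⟩, fun ⟨Y, h, h'⟩ => ⟨Y, h, fun y _ => y.2, h'.symm⟩⟩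

theorem tracesBelow_subset {n : ℕ} (G : SimpleGraph (Fin n)) (A : Finset (Fin n)) (k : ℕ) :
    tracesBelow G A k ⊆ traces G A := by
  rintro T ⟨Y, h, -, rfl⟩
  simp only [traces, Finset.coe_image, Set.mem_image, Finset.mem_coe, Finset.mem_powerset]
  exact ⟨Y, h, rfl⟩

theorem tracesBelow_succ_of_mem {n : ℕ} (G : SimpleGraph (Fin n)) {A : Finset (Fin n)} {k : Fin n}
    (hk : k ∈ A) : tracesBelow G A (k + 1) = tracesBelow G A k := by
  ext T
  constructor
  · rintro ⟨Y, h, h', rfl⟩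
    refine ⟨Y, h, fun y hy => lt_of_le_of_ne (Nat.lt_succ_iff.1 (h' y hy)) fun he => ?_, rfl⟩
    rw [Fin.ext he] at hy
    exact Finset.mem_compl.1 (h hy) hk
  · rintro ⟨Y, h, h', rfl⟩
    exact ⟨Y, h, fun y hy => (h' y hy).trans (Nat.lt_succ_self _), rfl⟩

/-- An outside set either avoids `k` or arises by adding `k` to one below it, and traces turn unions
into unions. So the traces can be listed in time polynomial in their number instead of trying all
outside sets. -/
theorem tracesBelow_succ_of_notMem {n : ℕ} (G : SimpleGraph (Fin n)) {A : Finset (Fin n)}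
    {k : Fin n} (hk : k ∉ A) : tracesBelow G A (k + 1) =
      tracesBelow G A k ∪ (· ∪ trace G A {k}) '' tracesBelow G A k := by
  ext T
  constructor
  · rintro ⟨Y, h, h', rfl⟩
    by_cases hkY : k ∈ Y
    · refine .inr ⟨_, ⟨Y.erase k, (Finset.erase_subset _ _).trans h, fun y hy => ?_, rfl⟩, ?_⟩
      · obtain ⟨hy1, hy2⟩ := Finset.mem_erase.1 hy
        exact lt_of_le_of_ne (Nat.lt_succ_iff.1 (h' y hy2)) fun he => hy1 (Fin.ext he)
      · change _ ∪ _ = _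
        rw [← trace_union, Finset.union_comm, ← Finset.insert_eq, Finset.insert_erase hkY]
    · refine .inl ⟨Y, h, fun y hy => lt_of_le_of_ne (Nat.lt_succ_iff.1 (h' y hy)) fun he => ?_, rfl⟩
      rw [Fin.ext he] at hy
      exact hkY hy
  · rintro (⟨Y, h, h', rfl⟩ | ⟨_, ⟨Y, h, h', rfl⟩, rfl⟩)
    · exact ⟨Y, h, fun y hy => (h' y hy).trans (Nat.lt_succ_self _), rfl⟩
    · refine ⟨Y ∪ {k}, Finset.union_subset h (by simpa using hk), fun y hy => ?_,
        (trace_union ..).symm⟩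
      rcases Finset.mem_union.1 hy with hy | hy
      · exact (h' y hy).trans (Nat.lt_succ_self _)
      · rw [Finset.mem_singleton.1 hy]
        exact Nat.lt_succ_self _

end WordRAM

namespace WordRAM

/-! ## The list of the traces -/

/-- The first `cnt` rows of the matrix `f` are the members of the family, once each. -/
structure Lists (f : ℕ → ℕ) (n cnt : ℕ) (T : Set (Finset (Fin n))) : Prop where
  bit : ∀ i < cnt, ∀ v < n, f (i * n + v) ≤ 1
  inj : Set.InjOn (bitSet f n) (Set.Iio cnt)
  image : bitSet f n '' Set.Iio cnt = T

/-- The rows of the list are distinct, so the list never outgrows the family; this controls both the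
time and the addresses during the enumeration. -/
theorem Lists.card_le {f : ℕ → ℕ} {n cnt : ℕ} {T : Set (Finset (Fin n))} (h : Lists f n cnt T)
    {D : Finset (Finset (Fin n))} (hD : T ⊆ D) : cnt ≤ D.card := by
  rw [← Finset.card_range cnt]
  refine Finset.card_le_card_of_injOn (bitSet f n) (fun i hi => hD ?_) fun i hi j hj hij => ?_
  · rw [← h.image]
    exact ⟨i, by simpa using hi, rfl⟩
  · exact h.inj (by simpa using hi) (by simpa using hj) hij

theorem Lists.congr {f g : ℕ → ℕ} {n cnt : ℕ} {T : Set (Finset (Fin n))} (h : Lists f n cnt T)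
    (hfg : ∀ x < cnt * n, g x = f x) : Lists g n cnt T := by
  have e : ∀ i < cnt, ∀ v < n, g (i * n + v) = f (i * n + v) := fun i hi v hv =>
    hfg _ (idx_lt hi hv)
  have e' : ∀ i ∈ Set.Iio cnt, bitSet g n i = bitSet f n i := fun i hi => bitSet_congr (e i hi)
  refine ⟨fun i hi v hv => by rw [e i hi v hv]; exact h.bit i hi v hv, fun i hi j hj hij => ?_, ?_⟩
  · rw [e' i hi, e' j hj] at hij
    exact h.inj hi hj hij
  · rw [← h.image]
    exact Set.image_congr e'

theorem Lists.of_mem {f : ℕ → ℕ} {n cnt : ℕ} {T : Set (Finset (Fin n))} (h : Lists f n cnt T)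
    {X : Finset (Fin n)} (hX : X ∈ T) : Lists f n cnt (T ∪ {X}) := by
  rwa [Set.union_eq_self_of_subset_right (by simpa using hX)]

theorem Lists.succ {f : ℕ → ℕ} {n cnt : ℕ} {T : Set (Finset (Fin n))} (h : Lists f n cnt T)
    (hX : bitSet f n cnt ∉ T) (hbit : ∀ v < n, f (cnt * n + v) ≤ 1) :
    Lists f n (cnt + 1) (T ∪ {bitSet f n cnt}) := by
  have hI : Set.Iio (cnt + 1) = insert cnt (Set.Iio cnt) := by
    ext i; simp
  refine ⟨fun i hi v hv => ?_, ?_, ?_⟩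
  · rcases Nat.lt_succ_iff_lt_or_eq.1 hi with hi | rfl
    · exact h.bit i hi v hv
    · exact hbit v hv
  · rw [hI, Set.injOn_insert (by simp), h.image]
    exact ⟨h.inj, hX⟩
  · rw [hI, Set.image_insert_eq, h.image, Set.union_comm]
    rfl

/-- Append to the list of traces the union of member number `reg 34` and of the neighbourhood of
vertex number `reg 32`, unless it is in the list. -/
def insertProg : Prog :=
  forP 35 0 (st 10 (.var 31 * .var 0 + .var 35) (Ex.or (.ld 10 (.var 34 * .var 0 + .var 35))
    (Ex.and (.ld 0 (.var 32 * .var 0 + .var 35)) (.ld 1 (.var 35))))) ;;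
  asg 37 0 ;;
  forP 36 31 (any1 39 35 0 (Ex.not (Ex.eq (.ld 10 (.var 36 * .var 0 + .var 35))
    (.ld 10 (.var 31 * .var 0 + .var 35)))) ;; asg 37 (Ex.or (.var 37) (Ex.not (.var 39)))) ;;
  asg 31 (.var 31 + 1 - .var 37)

@[simp] theorem uw_insertProg (l : Loc) : insertProg.UW l ↔ l = .mem 10 ∨ l = .reg 31 ∨
    l = .reg 35 ∨ l = .reg 36 ∨ l = .reg 37 ∨ l = .reg 39 := by
  simp [insertProg]; tauto

/-- The candidate is written into row `cnt`, just behind the list, and compared with all members. It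
joins the list by an increase of the counter; if a member equals it, the row stays outside. -/
theorem insertProg_wp {u : Store} {n N : ℕ} {G : SimpleGraph (Fin n)} {w : Fin n → ℚ}
    {A R' : Finset (Fin n)} {F : ℕ → Finset (Fin n)} (h : Inp u N G w A R' F) {S D cnt i : ℕ}
    {y : Fin n} {T : Set (Finset (Fin n))} (hT : Lists (u.mem 10) n cnt T) (hi : i < cnt)
    (h31 : u.reg 31 = cnt) (h32 : u.reg 32 = y) (h34 : u.reg 34 = i) (hD : cnt ≤ D)
    (hS : (D + 1) * n + n * n + D + n + 2 ≤ S) :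
    Wp S insertProg (100 * (D + 1) * n + 60 * D + 50) u fun v =>
      (∀ x < cnt * n, v.mem 10 x = u.mem 10 x) ∧ cnt ≤ v.reg 31 ∧
      Lists (v.mem 10) n (v.reg 31) (T ∪ {bitSet (u.mem 10) n i ∪ trace G A {y}}) := by
  have a1 : cnt * n ≤ D * n := Nat.mul_le_mul_right _ hD
  have a2 : ∀ j < cnt, j * n ≤ D * n := fun j hj => Nat.mul_le_mul_right _ (hj.le.trans hD)
  have a3 : (D + 1) * n = D * n + n := by ring
  have a4 : y * n ≤ n * n := Nat.mul_le_mul_right _ y.2.le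
  have hy := y.2
  refine (Wp.seq (T := n * (50 + 5) + 3) (R := fun v =>
    (∀ x < cnt * n, v.mem 10 x = u.mem 10 x) ∧
    (∀ x : Fin n, Flag (v.mem 10 (cnt * n + x)) (x ∈ bitSet (u.mem 10) n i ∪ trace G A {y})))
    (Wp.fill1_of (a := 10) (M := n) h.r0 (by simp) (by simp) (by simp) 50 (cnt * n)
      (fun J => 1 - (1 - u.mem 10 (i * n + J)) * (1 - (u.mem 0 (y * n + J) * u.mem 1 J)))
      ?_ ?_) (T' := 2 + ((D * (n * 60 + 60) + 3) + 10)) ?_).time (by ring_nf; omega)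
  · intro J hJ v hF h35 hv hv'
    have r31 : v.reg 31 = cnt := by rw [hF.reg 31 (by simp), h31]
    have r32 : v.reg 32 = y := by rw [hF.reg 32 (by simp), h32]
    have r34 : v.reg 34 = i := by rw [hF.reg 34 (by simp), h34]
    have r0 : v.reg 0 = n := by rw [hF.reg 0 (by simp), h.r0]
    have m0 : v.mem 0 = u.mem 0 := hF.mem 0 (by simp)
    have m1 : v.mem 1 = u.mem 1 := hF.mem 1 (by simp)
    have hx : v.mem 10 (i * n + J) = u.mem 10 (i * n + J) := hv' _ (.inl (idx_lt hi hJ))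
    have ei := a2 i hi
    have E : EFlag S v (Ex.or (.ld 10 (.var 34 * .var 0 + .var 35))
      (Ex.and (.ld 0 (.var 32 * .var 0 + .var 35)) (.ld 1 (.var 35))))
      ((u.mem 10 (i * n + J) = 1) ∨ (G.Adj y ⟨J, hJ⟩ ∧ (⟨J, hJ⟩ : Fin n) ∈ A)) := by
      refine .or (.of (by omega) (by simp [r0, r34, h35]; omega) ?_) (.and
        (.of (by omega) (by simp [r0, r32, h35]; omega) ?_)
        (.of (by omega) (by simp) ?_))
      · simp [r0, r34, h35, hx]
        exact .self (hT.bit i hi J hJ)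
      · simp [r0, r32, h35, m0]
        exact h.graph y ⟨J, hJ⟩
      · simp [h35, m1]
        exact h.side ⟨J, hJ⟩
    refine (Wp.st (by simp [r31, r0, h35]; omega) E.ok ?_).time (by simp)
    simp [r31, r0, h35, r34, r32, hx, m0, m1, Ex.or, Ex.not, Ex.and]
  · intro v hF hv1 hv2
    refine ⟨fun x hx => hv2 x (.inl hx), fun x => ?_⟩
    rw [hv1 x x.2]
    have E := ((Flag.self (hT.bit i hi x x.2)).not.and ((h.graph y x).and (h.side x)).not).not
    refine E.congr ?_
    simp only [Finset.mem_union, mem_bitSet, mem_trace, Finset.mem_singleton, exists_eq_left]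
    tauto
  rintro v1 ⟨hv1, hv1'⟩ hF1
  refine Wp.seq (T := 2) (R := fun v => v = v1.setReg 37 0) (Wp.asg (by simp) (by simp)) ?_
  rintro v2 hv2 hF2
  have m2 : v2.mem 10 = v1.mem 10 := by simp [hv2]
  have s31 : v2.reg 31 = cnt := by rw [hF2.reg 31 (by simp), hF1.reg 31 (by simp), h31]
  have s0 : v2.reg 0 = n := by rw [hF2.reg 0 (by simp), hF1.reg 0 (by simp), h.r0]
  have hT1 : Lists (v1.mem 10) n cnt T := hT.congr hv1
  have hb1 : ∀ J < n, v1.mem 10 (cnt * n + J) ≤ 1 := fun J hJ => (hv1' ⟨J, hJ⟩).le_one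
  have hnew : bitSet (v1.mem 10) n cnt = bitSet (u.mem 10) n i ∪ trace G A {y} := by
    ext x
    rw [mem_bitSet, (hv1' x).eq_one_iff]
  refine Wp.seq (T := D * (n * 60 + 60) + 3) (R := fun v => Flag (v.reg 37)
    (∃ j < cnt, bitSet (v1.mem 10) n j = bitSet (v1.mem 10) n cnt)) ((Wp.forP_const_of (N := cnt)
    (fun k v => Flag (v.reg 37) (∃ j < k, bitSet (v1.mem 10) n j = bitSet (v1.mem 10) n cnt))
    (n * 60 + 55) s31 (by simp) (by simp) (by simp) (by simp [hv2, Flag]) ?_ ?_).time (by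
      exact Nat.add_le_add_right (Nat.mul_le_mul_right _ hD) 3)) ?_
  · intro k hk v hF h36 hv
    have r31 : v.reg 31 = cnt := by rw [hF.reg 31 (by simp), s31]
    have r0 : v.reg 0 = n := by rw [hF.reg 0 (by simp), s0]
    have m10 : v.mem 10 = v1.mem 10 := by rw [hF.mem 10 (by simp), m2]
    have ek := a2 k hk
    refine (Wp.seq (T := n * 60 + 5) (R := fun v' => Flag (v'.reg 39)
      (∃ J < n, ¬ v1.mem 10 (k * n + J) = v1.mem 10 (cnt * n + J)) ∧ v'.reg 37 = v.reg 37)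
      ((Wp.any1_of (M := n) r0 (by constructor <;> simp) (by omega) _ (fun J hJ w hw h35 => ?_)
      fun w hw hB => ⟨hB, ?_⟩).time (by simp; omega)) (T' := 20) ?_).time (by omega)
    · have q31 : w.reg 31 = cnt := by rw [hw.reg 31 (by simp), r31]
      have q0 : w.reg 0 = n := by rw [hw.reg 0 (by simp), r0]
      have q36 : w.reg 36 = k := by rw [hw.reg 36 (by simp), h36]
      have qm : w.mem 10 = v1.mem 10 := by rw [hw.mem 10 (by simp), m10]
      refine ((EFlag.eq (by omega) (by simp [q36, q0, h35]; omega)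
        (by simp [q31, q0, h35]; omega)).not).congr ?_
      simp [q36, q0, h35, q31, qm]
    · rintro v' ⟨hv', e37⟩ hF'
      have E := (EFlag.of (S := S) (u := v') (e := .var 37) (by omega) (by simp) (e37 ▸ hv)).or
        (EFlag.of (S := S) (u := v') (e := .var 39) (by omega) (by simp) hv').not
      refine (Wp.asg E.ok ?_).time (by simp)
      simp only [setReg_reg]
      rw [Function.update_of_ne (by simp), Function.update_self]
      refine E.flag.congr ?_
      have hk' : (¬ ∃ J < n, ¬ v1.mem 10 (k * n + J) = v1.mem 10 (cnt * n + J)) ↔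
          bitSet (v1.mem 10) n k = bitSet (v1.mem 10) n cnt := by
        push Not
        constructor
        · intro H
          ext x
          rw [mem_bitSet, mem_bitSet, H x x.2]
        · intro H J hJ
          have H' := Finset.ext_iff.1 H ⟨J, hJ⟩
          rw [mem_bitSet, mem_bitSet] at H'
          have b1 := hT1.bit k hk J hJ
          have b2 := hb1 J hJ
          dsimp only at H'
          omega
      rw [hk']
      constructor
      · rintro (⟨j, hj, H⟩ | H)
        · exact ⟨j, by omega, H⟩
        · exact ⟨k, by omega, H⟩
      · rintro ⟨j, hj, H⟩
        rcases Nat.lt_succ_iff_lt_or_eq.1 hj with hj | rfl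
        · exact .inl ⟨j, hj, H⟩
        · exact .inr H
    · rw [hw.reg 37 (by simp)]
  · exact fun v _ hv => hv
  rintro v3 hv3 hF3
  have m3 : v3.mem 10 = v1.mem 10 := by rw [hF3.mem 10 (by simp), m2]
  have t31 : v3.reg 31 = cnt := by rw [hF3.reg 31 (by simp), s31]
  refine (Wp.asg (by simp [t31]; omega) ?_).time (by simp)
  simp only [setReg_mem, setReg_reg, Function.update_self, m3, Ex.eval_sub, Ex.eval_add, Ex.eval_var,
    t31, Ex.eval_ofNat]
  rw [← hnew]
  refine ⟨hv1, ?_, ?_⟩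
  · have := hv3.le_one
    omega
  · rcases hv3 with ⟨e, j, hj, hjc⟩ | ⟨e, hne⟩
    · rw [e, Nat.add_sub_cancel]
      refine hT1.of_mem ?_
      rw [← hjc, ← hT1.image]
      exact ⟨j, hj, rfl⟩
    · rw [e, Nat.sub_zero]
      refine hT1.succ ?_ hb1
      rw [← hT1.image]
      rintro ⟨j, hj, hjc⟩
      exact hne ⟨j, hj, hjc⟩

/-- List the traces of the sets of vertices outside of `A`. -/
def listProg : Prog :=
  asg 31 1 ;; forP 35 0 (st 10 (.var 35) 0) ;;
  forP 32 0 (asg 33 (.var 31 * (1 - .ld 1 (.var 32))) ;; forP 34 33 insertProg)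

@[simp] theorem uw_listProg (l : Loc) : listProg.UW l ↔ l = .mem 10 ∨ l = .reg 31 ∨ l = .reg 32 ∨
    l = .reg 33 ∨ l = .reg 34 ∨ l = .reg 35 ∨ l = .reg 36 ∨ l = .reg 37 ∨ l = .reg 39 := by
  simp [listProg]; tauto

/-- An outside vertex adds the union of its neighbourhood in `A` with each trace found so far. The
number of these traces is frozen in register 33 before the list starts to grow; it is set to 0 for
vertices of `A`, which contribute nothing. -/
theorem listProg_wp {u : Store} {n N : ℕ} {G : SimpleGraph (Fin n)} {w : Fin n → ℚ}
    {A R' : Finset (Fin n)} {F : ℕ → Finset (Fin n)} (h : Inp u N G w A R' F) {S D : ℕ}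
    (hD : (traces G A).card ≤ D) (hS : (D + 1) * n + n * n + D + n + 2 ≤ S) :
    Wp S listProg (n * (D * (100 * (D + 1) * n + 60 * D + 55) + 30) + 20 * n + 20) u fun v =>
      v.reg 31 ≤ D ∧ 1 ≤ v.reg 31 ∧ Lists (v.mem 10) n (v.reg 31) (traces G A) := by
  have hkeep : Keeps listProg := by constructor <;> simp
  refine (Wp.seq (T := 2) (R := fun v => v.reg 31 = 1) (Wp.asg (by simp; omega) (by simp))
    (T' := (n * (3 + 5) + 3) +
      (n * ((D * (100 * (D + 1) * n + 60 * D + 55) + 20) + 5) + 3)) ?_).time (by ring_nf; omega)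
  intro v1 h1 hF1
  refine Wp.seq (T := n * (3 + 5) + 3) (R := fun v => Lists (v.mem 10) n 1 (tracesBelow G A 0))
    (Wp.fill1_of (a := 10) (M := n) (by rw [hF1.reg 0 (by simp), h.r0]) (by simp) (by simp) (by simp)
      3 0 (fun _ => 0) (fun J hJ v hF h35 _ _ => ?_) fun v hF hv hv' => ?_) ?_
  · refine (Wp.st (by simp) (by simp) ?_).time (by simp)
    simp [h35]
  · rw [tracesBelow_zero]
    refine ⟨fun i hi x hx => ?_, fun i hi j hj _ => ?_, ?_⟩
    · obtain rfl : i = 0 := by omega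
      simpa using (hv x hx).trans_le (Nat.zero_le 1)
    · simp only [Set.mem_Iio] at hi hj
      omega
    · have : Set.Iio 1 = {0} := by ext; simp
      rw [this, Set.image_singleton]
      congr 1
      refine Finset.eq_empty_of_forall_notMem fun x hx => ?_
      rw [mem_bitSet] at hx
      simp only [zero_mul, hv x x.2] at hx
      omega
  intro v2 h2 hF2
  have hI2 : Inp v2 N G w A R' F :=
    h.fr hkeep ((hF1.weaken (by simp)).trans (hF2.weaken (by simp)))
  have h31 : v2.reg 31 = 1 := by rw [hF2.reg 31 (by simp), h1]
  refine Wp.forP_const_of (N := n) (fun k v => 1 ≤ v.reg 31 ∧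
    Lists (v.mem 10) n (v.reg 31) (tracesBelow G A k)) (D * (100 * (D + 1) * n + 60 * D + 55) + 20)
    hI2.r0 (by simp) (by simp) (by simp) (by simpa [h31] using h2) ?_ ?_
  · rintro k hk v hF h32 ⟨hv, hv'⟩
    have hI : Inp v N G w A R' F := hI2.fr hkeep (hF.weaken (by simp))
    set cnt := v.reg 31 with hcnt
    have hb : Lists (v.mem 10) n cnt (tracesBelow G A k) → cnt ≤ D := fun hl =>
      (hl.card_le (tracesBelow_subset G A k)).trans hD
    have hcD := hb hv'
    have hside := hI.side ⟨k, hk⟩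
    simp only [setReg_reg, setReg_mem, Function.update_of_ne (show 31 ≠ 32 by simp)]
    have hle : cnt * (1 - v.mem 1 k) ≤ cnt := by
      have : 1 - v.mem 1 k ≤ 1 := by omega
      nlinarith
    refine (Wp.seq (T := 7) (R := fun v' => v' = v.setReg 33 (cnt * (1 - v.mem 1 k)))
      (Wp.asg (by simp [h32, ← hcnt]; omega) (by simp [h32, ← hcnt]))
      (T' := D * ((100 * (D + 1) * n + 60 * D + 50) + 5) + 3) ?_).time (by ring_nf; omega)
    rintro v3 rfl -
    have hI3 : Inp (v.setReg 33 (cnt * (1 - v.mem 1 k))) N G w A R' F := by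
      refine hI.fr (P := asg 33 0) (by constructor <;> simp) ⟨?_⟩
      rintro (x | x | x | x) hx <;> simp [Loc.Same] at hx ⊢
      rw [Function.update_of_ne hx]
    have t31 : (v.setReg 33 (cnt * (1 - v.mem 1 k))).reg 31 = cnt := by simp [← hcnt]
    have t32 : (v.setReg 33 (cnt * (1 - v.mem 1 k))).reg 32 = k := by simp [h32]
    generalize hv3 : v.setReg 33 (cnt * (1 - v.mem 1 k)) = v3 at hI3 t31 t32
    have m3 : v3.mem = v.mem := by simp [← hv3]
    refine (Wp.forP_const_of (N := cnt * (1 - v.mem 1 k)) (fun i v' => cnt ≤ v'.reg 31 ∧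
      (∀ x < cnt * n, v'.mem 10 x = v.mem 10 x) ∧
      Lists (v'.mem 10) n (v'.reg 31) (tracesBelow G A k ∪
        (fun j => bitSet (v.mem 10) n j ∪ trace G A {⟨k, hk⟩}) '' Set.Iio i))
      (100 * (D + 1) * n + 60 * D + 50) (by simp [← hv3]) (by simp) (by simp) (by simp) ?_ ?_ ?_).time
      (by gcongr; omega)
    · simp only [setReg_reg, setReg_mem, Function.update_of_ne (show 31 ≠ 34 by simp), t31, m3]
      exact ⟨le_rfl, fun _ _ => trivial, by simpa using hv'⟩
    · rintro i hi w hw h34 ⟨q1, q2, q3⟩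
      have hicnt : i < cnt := hi.trans_le hle
      have hside' : (⟨k, hk⟩ : Fin n) ∉ A := by
        rw [← hside.eq_zero_iff]
        rcases Nat.eq_zero_or_pos (v.mem 1 k) with h' | h'
        · exact h'
        · rw [show 1 - v.mem 1 k = 0 by omega, mul_zero] at hi
          omega
      -- Every intermediate list consists of traces, so its length stays at most `D` even within a
      -- round.
      have hsub : tracesBelow G A k ∪
          (fun j => bitSet (v.mem 10) n j ∪ trace G A {⟨k, hk⟩}) '' Set.Iio i ⊆ traces G A := by
        refine Set.union_subset (tracesBelow_subset G A k) ?_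
        rintro _ ⟨j, hj, rfl⟩
        refine tracesBelow_subset G A (k + 1) ?_
        rw [show k + 1 = (⟨k, hk⟩ : Fin n).1 + 1 from rfl, tracesBelow_succ_of_notMem G hside']
        refine .inr ⟨_, ?_, rfl⟩
        rw [← hv'.image]
        exact ⟨j, lt_trans hj hicnt, rfl⟩
      refine (insertProg_wp (hI3.fr hkeep (hw.weaken (by simp))) (y := ⟨k, hk⟩) q3
        (hicnt.trans_le q1) rfl (by rw [hw.reg 32 (by simp), t32]) h34
        ((q3.card_le hsub).trans hD) hS).post ?_
      rintro x ⟨p1, p2, p3⟩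
      simp only [setReg_reg, setReg_mem, Function.update_of_ne (show 31 ≠ 34 by simp)]
      refine ⟨q1.trans p2, fun y hy => ?_, ?_⟩
      · rw [p1 y (hy.trans_le (Nat.mul_le_mul_right _ q1)), q2 y hy]
      · have e1 : bitSet (w.mem 10) n i = bitSet (v.mem 10) n i :=
          bitSet_congr fun z hz => q2 _ (idx_lt hicnt hz)
        have e2 : Set.Iio (i + 1) = insert i (Set.Iio i) := by ext z; simp
        rw [e1, Set.union_assoc] at p3
        rw [e2, Set.image_insert_eq, Set.insert_eq, Set.union_comm {_} _]
        exact p3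
    · rintro w - ⟨q1, q2, q3⟩
      refine ⟨hv.trans q1, ?_⟩
      rcases hside with ⟨e, hA⟩ | ⟨e, hA⟩
      · dsimp only at e
        rw [show k + 1 = (⟨k, hk⟩ : Fin n).1 + 1 from rfl, tracesBelow_succ_of_mem G hA]
        simpa [e] using q3
      · dsimp only at e
        rw [show k + 1 = (⟨k, hk⟩ : Fin n).1 + 1 from rfl, tracesBelow_succ_of_notMem G hA]
        rw [e, Nat.sub_zero, mul_one] at q3
        rw [← hv'.image, Set.image_image, hv'.image]
        exact q3
  · rintro v - ⟨hv, hv'⟩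
    rw [tracesBelow_eq] at hv'
    exact ⟨(hv'.card_le subset_rfl).trans hD, hv, hv'⟩

end WordRAM

namespace WordRAM

/-! ## Parameters -/

/-- Compute the trace of `R'`. -/
def traceProg : Prog :=
  forP 32 0 (any1 39 35 0 (Ex.and (.ld 3 (.var 35)) (Ex.and (.ld 0 (.var 35 * .var 0 + .var 32))
    (.ld 1 (.var 32)))) ;; st 11 (.var 32) (.var 39))

@[simp] theorem uw_traceProg (l : Loc) : traceProg.UW l ↔ l = .mem 11 ∨ l = .reg 32 ∨
    l = .reg 35 ∨ l = .reg 39 := by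
  simp [traceProg]; tauto

theorem traceProg_wp {u : Store} {n N : ℕ} {G : SimpleGraph (Fin n)} {w : Fin n → ℚ}
    {A R' : Finset (Fin n)} {F : ℕ → Finset (Fin n)} (h : Inp u N G w A R' F) {S : ℕ}
    (hS : n * n + n + 2 ≤ S) :
    Wp S traceProg (n * (n * 40 + 20) + 3) u fun v =>
      ∀ a : Fin n, Flag (v.mem 11 a) (a ∈ trace G A R') := by
  classical
  refine Wp.fill1_of (a := 11) (M := n) h.r0 (by simp) (by simp) (by simp) (n * 40 + 15) 0
    (fun J => if ∃ a : Fin n, a.1 = J ∧ a ∈ trace G A R' then 1 else 0) ?_ ?_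
  · intro J hJ v hF h32 _ _
    have hI : Inp v N G w A R' F := h.fr (P := traceProg) (by constructor <;> simp) hF
    have hJn : J * n ≤ n * n := Nat.mul_le_mul_right _ hJ.le
    refine (Wp.seq (T := n * 40 + 5) (R := fun v' => Flag (v'.reg 39)
      (⟨J, hJ⟩ ∈ trace G A R') ∧ v'.reg 32 = J ∧ v'.mem 11 = v.mem 11)
      ((Wp.any1_of (M := n) (B := fun K => ∃ hK : K < n, (⟨K, hK⟩ : Fin n) ∈ R' ∧
        G.Adj ⟨K, hK⟩ ⟨J, hJ⟩ ∧ (⟨J, hJ⟩ : Fin n) ∈ A) hI.r0 (by constructor <;> simp) (by omega)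
        (fun K hK v' hF' h35 => ?_) fun v' hF' hv' => ⟨hv'.congr ?_, ?_, ?_⟩).time
        (by simp; omega))
      (T' := 10) ?_).time (by omega)
    · have hI' := hI.fr (by constructor <;> simp) hF'
      have h32' : v'.reg 32 = J := by rw [hF'.reg 32 (by simp), h32]
      have hKn : K * n ≤ n * n := Nat.mul_le_mul_right _ hK.le
      refine EFlag.congr ((EFlag.of (p := (⟨K, hK⟩ : Fin n) ∈ R') (by omega) (by simp) ?_).and
        ((EFlag.of (p := G.Adj ⟨K, hK⟩ ⟨J, hJ⟩) (by omega) ?_ ?_).and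
        (EFlag.of (p := (⟨J, hJ⟩ : Fin n) ∈ A) (by omega) (by simp) ?_))) ⟨fun H => ⟨hK, H⟩,
        fun ⟨_, H⟩ => H⟩
      · simpa [h35] using hI'.cls ⟨K, hK⟩
      · simp [h35, hI'.r0, h32']
        omega
      · simpa [h35, hI'.r0, h32'] using hI'.graph ⟨K, hK⟩ ⟨J, hJ⟩
      · simpa [h32'] using hI'.side ⟨J, hJ⟩
    · rintro v' ⟨h1, h2, h3⟩ -
      refine (Wp.st (by simp) (by simp) ?_).time (by simp)
      simp only [setMem_mem, Function.update_self, Ex.eval_var, h2, zero_add]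
      rw [h1.eq_ite]
      congr 1
      refine if_congr ⟨fun H => ⟨_, rfl, H⟩, ?_⟩ rfl rfl
      rintro ⟨a, rfl, H⟩
      exact H
    · rw [mem_trace]
      constructor
      · rintro ⟨K, -, hK, h1, h2, h3⟩
        exact ⟨h3, _, h1, h2⟩
      · rintro ⟨h3, K, h1, h2⟩
        exact ⟨K, K.2, K.2, h1, h2, h3⟩
    · rw [hF'.reg 32 (by simp), h32]
    · rw [hF'.mem 11 (by simp)]
  · intro v _ hv _ a
    have := hv a a.2
    rw [zero_add] at this
    refine (Flag.of_ite this).congr ⟨?_, fun H => ⟨a, rfl, H⟩⟩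
    rintro ⟨b, hb, H⟩
    rwa [← Fin.ext hb]

/-- Compute the width of the vectors and the least power of two above it. -/
def sizeProg : Prog :=
  any1 40 35 0 (.ld 11 (.var 35)) ;; any1 41 35 0 (Ex.not (.ld 1 (.var 35))) ;;
  asg 42 (.var 40 * .var 31 * .var 31 + (1 - .var 40) * 2) ;;
  asg 3 1 ;; asg 5 1 ;;
  forP 35 42 (asg 39 (Ex.lt (.var 3) (.var 42)) ;; asg 5 (.var 5 + .var 39) ;;
    asg 3 (.var 3 + .var 3 * .var 39)) ;;
  asg 4 (.var 3 + .var 3)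

@[simp] theorem uw_sizeProg (l : Loc) : sizeProg.UW l ↔ l = .reg 3 ∨ l = .reg 4 ∨ l = .reg 5 ∨
    l = .reg 35 ∨ l = .reg 39 ∨ l = .reg 40 ∨ l = .reg 41 ∨ l = .reg 42 := by
  simp [sizeProg]; tauto

/-- The width of the vectors. -/
noncomputable def width (cnt : ℕ) (e : Prop) [Decidable e] : ℕ := if e then cnt * cnt else 2

/-- The parameters that are determined by the input and by the number of traces. -/
structure Params (v : Store) {n : ℕ} (A T' : Finset (Fin n)) (cnt κ M : ℕ) : Prop where
  hits : Flag (v.reg 40) T'.Nonempty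
  notFull : Flag (v.reg 41) (A ≠ Finset.univ)
  wid : v.reg 42 = width cnt T'.Nonempty
  r3 : v.reg 3 = M
  r4 : v.reg 4 = 2 * M
  r5 : v.reg 5 = κ + 1
  pow : M = 2 ^ κ
  le : width cnt T'.Nonempty ≤ M
  le_two : M ≤ 2 * width cnt T'.Nonempty

theorem sizeProg_wp {u : Store} {n N : ℕ} {G : SimpleGraph (Fin n)} {w : Fin n → ℚ}
    {A R' T' : Finset (Fin n)} {F : ℕ → Finset (Fin n)} (h : Inp u N G w A R' F) {S cnt D : ℕ}
    (hT' : ∀ a : Fin n, Flag (u.mem 11 a) (a ∈ T')) (h31 : u.reg 31 = cnt) (hcnt : 1 ≤ cnt)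
    (hD : cnt ≤ D) (hS : 5 * (D * D) + 10 ≤ S) :
    Wp S sizeProg (n * 50 + D * D * 50 + 200) u fun v => ∃ κ M, Params v A T' cnt κ M := by
  have hDD : cnt * cnt ≤ D * D := Nat.mul_le_mul hD hD
  have hD1 : 1 ≤ cnt * cnt := Nat.mul_le_mul hcnt hcnt
  set q := width cnt T'.Nonempty with hq
  have hq1 : 1 ≤ q := by rw [hq, width]; split_ifs <;> omega
  have hqD : q ≤ D * D + 2 := by rw [hq, width]; split_ifs <;> omega
  refine (Wp.seq (T := n * 18 + 5) (R := fun v => Flag (v.reg 40) T'.Nonempty)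
    ((Wp.any1_of (M := n) (B := fun K => ∃ hK : K < n, (⟨K, hK⟩ : Fin n) ∈ T') h.r0
      (by constructor <;> simp) (by omega) (fun K hK v hF h35 => ?_) fun v hF hv =>
      hv.congr ?_).time (by simp; omega)) (T' := (n * 22 + 5) + (15 + (2 + (2 + (((q * (20 + 5) + 3)) + 4)))))
      ?_).time (by omega)
  · refine .of (by omega) (by simp) ?_
    have := hT' ⟨K, hK⟩
    simp only [Ex.eval_ld, Ex.eval_var, h35, hF.mem 11 (by simp)]
    exact this.congr ⟨fun H => ⟨hK, H⟩, fun ⟨_, H⟩ => H⟩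
  · constructor
    · rintro ⟨K, hK, _, H⟩
      exact ⟨_, H⟩
    · rintro ⟨K, H⟩
      exact ⟨K, K.2, K.2, H⟩
  intro v1 h1 hF1
  have hI1 := h.fr (by constructor <;> simp) hF1
  refine Wp.seq (T := n * 22 + 5) (R := fun v => Flag (v.reg 41) (A ≠ Finset.univ))
    ((Wp.any1_of (M := n) (B := fun K => ∃ hK : K < n, (⟨K, hK⟩ : Fin n) ∉ A) hI1.r0
      (by constructor <;> simp) (by omega) (fun K hK v hF h35 => ?_) fun v hF hv =>
      hv.congr ?_).time (by simp; omega)) ?_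
  · have hI := hI1.fr (by constructor <;> simp) hF
    refine ((EFlag.of (by omega) (by simp) ?_).not).congr
      (p := ¬ (⟨K, hK⟩ : Fin n) ∈ A) ⟨fun H => ⟨hK, H⟩, fun ⟨_, H⟩ => H⟩
    simpa [h35] using hI.side ⟨K, hK⟩
  · rw [Ne, Finset.eq_univ_iff_forall]
    push Not
    constructor
    · rintro ⟨K, hK, _, H⟩
      exact ⟨_, H⟩
    · rintro ⟨K, H⟩
      exact ⟨K, K.2, K.2, H⟩
  intro v2 h2 hF2
  have h40 : Flag (v2.reg 40) T'.Nonempty := by rw [hF2.reg 40 (by simp)]; exact h1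
  have h31' : v2.reg 31 = cnt := by rw [hF2.reg 31 (by simp), hF1.reg 31 (by simp), h31]
  have hval : v2.reg 40 * cnt * cnt + (1 - v2.reg 40) * 2 = q := by
    rw [h40.eq_ite, hq, width]
    split_ifs <;> simp
  have b1 : v2.reg 40 * cnt ≤ cnt * cnt := Nat.mul_le_mul_right _ (h40.le_one.trans hcnt)
  have b2 : v2.reg 40 * cnt * cnt ≤ cnt * cnt := by
    have := h40.le_one
    rw [mul_assoc]
    nlinarith
  refine Wp.seq (T := 15) (R := fun v => v = v2.setReg 42 q) ((Wp.asg (by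
    simp only [Ex.ok_add, Ex.ok_mul, Ex.ok_sub, Ex.ok_var, Ex.ok_ofNat, Ex.eval_mul,
      Ex.eval_sub, Ex.eval_var, Ex.eval_ofNat, h31', true_and, and_true]
    omega)
    (by simp [h31', hval])).time (by simp)) ?_
  rintro v3 hv3 hF3
  refine Wp.seq (T := 2) (R := fun v => v = v3.setReg 3 1) (Wp.asg (by simp; omega) (by simp)) ?_
  rintro v4 hv4 hF4
  refine Wp.seq (T := 2) (R := fun v => v = v4.setReg 5 1) (Wp.asg (by simp; omega) (by simp)) ?_
  rintro v5 hv5 hF5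
  have r5 : v5.reg 42 = q := by simp [hv5, hv4, hv3]
  -- Doubling takes place only below `q`, hence the bound `2 * q`. After `k` rounds the power has
  -- reached `q` or is at least `k + 1`, so `q` rounds are enough.
  refine Wp.seq (T := q * (20 + 5) + 3) (R := fun v => v.reg 42 = q ∧
    v.reg 40 = v2.reg 40 ∧ v.reg 41 = v2.reg 41 ∧ ∃ κ, v.reg 3 = 2 ^ κ ∧ v.reg 5 = κ + 1 ∧
      q ≤ 2 ^ κ ∧ 2 ^ κ ≤ 2 * q)
    (Wp.forP_const_of (N := q) (fun k v => ∃ κ, v.reg 3 = 2 ^ κ ∧ v.reg 5 = κ + 1 ∧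
      (q ≤ 2 ^ κ ∨ k + 1 ≤ 2 ^ κ) ∧ 2 ^ κ ≤ 2 * q) 20 r5 (by simp) (by simp) (by simp)
      ⟨0, by simp [hv5, hv4], by simp [hv5], by simp, by simp; omega⟩ ?_ ?_) ?_
  · rintro k hk v hF - ⟨κ, e1, e2, e3, e4⟩
    have e42 : v.reg 42 = q := by rw [hF.reg 42 (by simp), r5]
    have hκ : κ + 1 ≤ 2 ^ κ := Nat.lt_two_pow_self
    have E := EFlag.lt (S := S) (u := v) (e := .var 3) (f := .var 42) (by omega) (by simp) (by simp)
    refine (Wp.seq (T := 8) (R := fun v' => Flag (v'.reg 39) (2 ^ κ < q) ∧ v'.reg 3 = 2 ^ κ ∧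
      v'.reg 5 = κ + 1) ((Wp.asg E.ok ⟨?_, by simp [e1], by simp [e2]⟩).time (by simp))
      (T' := 4 + 6) ?_).time (by norm_num)
    swap
    · simpa [e1, e42] using E.flag
    rintro v' ⟨g1, g2, g3⟩ -
    have hle := g1.le_one
    refine Wp.seq (T := 4) (R := fun v'' => v'' = v'.setReg 5 (κ + 1 + v'.reg 39))
      (Wp.asg (by simp [g3]; omega) (by simp [g3])) ?_
    rintro v'' hv'' -
    have s3 : v''.reg 3 = 2 ^ κ := by simp [hv'', g2]
    have s39 : v''.reg 39 = v'.reg 39 := by simp [hv'']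
    have hm : 2 ^ κ * v'.reg 39 ≤ 2 ^ κ := by nlinarith
    refine (Wp.asg (by simp [s3, s39]; omega) ?_).time (by simp)
    simp only [setReg_reg, Ex.eval_add, Ex.eval_mul, Ex.eval_var, s3, s39]
    rcases g1 with ⟨e, hlt⟩ | ⟨e, hge⟩
    · refine ⟨κ + 1, ?_, ?_, ?_, ?_⟩
      · simp [e, pow_succ]; omega
      · simp [hv'', e]
      · rw [pow_succ]; omega
      · rw [pow_succ]; omega
    · exact ⟨κ, by simp [e], by simp [hv'', e], by omega, e4⟩
  · rintro v hF ⟨κ, e1, e2, e3, e4⟩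
    refine ⟨?_, ?_, ?_, κ, e1, e2, by omega, e4⟩
    · rw [hF.reg 42 (by simp), r5]
    · rw [hF.reg 40 (by simp)]; simp [hv5, hv4, hv3]
    · rw [hF.reg 41 (by simp)]; simp [hv5, hv4, hv3]
  rintro v6 ⟨e42, e40, e41, κ, e3, e5, e6, e7⟩ -
  refine (Wp.asg (by simp [e3]; omega) ?_).time (by simp)
  refine ⟨κ, 2 ^ κ, ?_, ?_, ?_, ?_, ?_, ?_, rfl, e6, e7⟩
  · simpa [e40] using h40
  · simpa [e41] using h2
  · simp [e42, hq]
  · simp [e3]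
  · simp [e3]; ring
  · simp [e5]

end WordRAM

namespace WordRAM

/-! ## Components -/

/-- The vertices are adjacent members of `X`. -/
def Linked {n : ℕ} (G : SimpleGraph (Fin n)) (X : Finset (Fin n)) (a b : Fin n) : Prop :=
  a ∈ X ∧ b ∈ X ∧ G.Adj a b

/-- The vertices are connected by a walk inside of `X`. -/
def Joined {n : ℕ} (G : SimpleGraph (Fin n)) (X : Finset (Fin n)) : Fin n → Fin n → Prop :=
  Relation.ReflTransGen (Linked G X)

theorem Linked.symm {n : ℕ} {G : SimpleGraph (Fin n)} {X : Finset (Fin n)} {a b : Fin n}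
    (h : Linked G X a b) : Linked G X b a := ⟨h.2.1, h.1, h.2.2.symm⟩

theorem Joined.symm {n : ℕ} {G : SimpleGraph (Fin n)} {X : Finset (Fin n)} {a b : Fin n}
    (h : Joined G X a b) : Joined G X b a :=
  by
  induction h with
  | refl => exact .refl
  | tail _ h2 ih => exact .head h2.symm ih

/-- The labels describe the components of `X` among the vertices below `v`. -/
structure Labels {n : ℕ} (G : SimpleGraph (Fin n)) (X : Finset (Fin n)) (v : ℕ) (lab : ℕ → ℕ) :
    Prop where
  lt : ∀ a < v, lab a < v
  eq : ∀ a b : Fin n, a.1 < v → b.1 < v → Linked G X a b → lab a = lab b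
  joined : ∀ a b : Fin n, a.1 < v → b.1 < v → lab a = lab b → Joined G X a b

theorem Labels.iff {n : ℕ} {G : SimpleGraph (Fin n)} {X : Finset (Fin n)} {lab : ℕ → ℕ}
    (h : Labels G X n lab) (a b : Fin n) : lab a = lab b ↔ Joined G X a b := by
  refine ⟨h.joined a b a.2 b.2, fun H => ?_⟩
  induction H with
  | refl => rfl
  | tail _ h2 ih => exact ih.trans (h.eq _ _ (Fin.is_lt _) (Fin.is_lt _) h2)

/-- Adding `v` merges with it exactly the components in which it has a neighbour. Its number is a
fresh label, since all earlier labels are smaller; so relabelled vertices cannot be confused with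
the others. -/
theorem Labels.succ {n : ℕ} {G : SimpleGraph (Fin n)} {X : Finset (Fin n)} {v : Fin n}
    {lab lab' : ℕ → ℕ} (h : Labels G X v lab)
    (hm : ∀ a : Fin n, a.1 < v → (∃ u : Fin n, u.1 < v ∧ lab u = lab a ∧ Linked G X u v) →
      lab' a = v)
    (hm' : ∀ a : Fin n, a.1 < v → (¬ ∃ u : Fin n, u.1 < v ∧ lab u = lab a ∧ Linked G X u v) →
      lab' a = lab a)
    (hv : lab' v = v) : Labels G X (v + 1) lab' := by
  have cases : ∀ a : Fin n, a.1 < v.1 + 1 → a = v ∨ a.1 < v := fun a ha => by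
    rcases Nat.lt_succ_iff_lt_or_eq.1 ha with h | h
    · exact .inr h
    · exact .inl (Fin.ext h)
  have marked : ∀ a : Fin n, a.1 < v → lab' a = v → Joined G X a v := by
    intro a ha e
    by_cases H : ∃ u : Fin n, u.1 < v ∧ lab u = lab a ∧ Linked G X u v
    · obtain ⟨u, hu, e', hL⟩ := H
      exact (h.joined a u ha hu e'.symm).tail hL
    · have := h.lt a ha
      rw [hm' a ha H] at e
      omega
  refine ⟨fun a ha => ?_, fun a b ha hb hL => ?_, fun a b ha hb e => ?_⟩
  · rcases Nat.lt_succ_iff_lt_or_eq.1 ha with h' | rfl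
    · have ha' : a < n := h'.trans v.2
      by_cases H : ∃ u : Fin n, u.1 < v ∧ lab u = lab a ∧ Linked G X u v
      · rw [hm ⟨a, ha'⟩ h' H]
        omega
      · rw [hm' ⟨a, ha'⟩ h' H]
        exact (h.lt a h').trans (by simp)
    · rw [hv]
      omega
  · rcases cases a ha with rfl | ha' <;> rcases cases b hb with rfl | hb'
    · rfl
    · rw [hv, hm b hb' ⟨b, hb', rfl, hL.symm⟩]
    · rw [hv, hm a ha' ⟨a, ha', rfl, hL⟩]
    · have e := h.eq a b ha' hb' hL
      by_cases H : ∃ u : Fin n, u.1 < v ∧ lab u = lab a ∧ Linked G X u v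
      · rw [hm a ha' H, hm b hb' (by rwa [e] at H)]
      · rw [hm' a ha' H, hm' b hb' (by rwa [e] at H), e]
  · rcases cases a ha with rfl | ha' <;> rcases cases b hb with rfl | hb'
    · exact .refl
    · exact (marked b hb' (by rw [← e, hv])).symm
    · exact marked a ha' (by rw [e, hv])
    · by_cases H : ∃ u : Fin n, u.1 < v ∧ lab u = lab a ∧ Linked G X u v
      · have e' := hm a ha' H
        exact (marked a ha' e').trans (marked b hb' (by rw [← e, e'])).symm
      · by_cases H' : ∃ u : Fin n, u.1 < v ∧ lab u = lab b ∧ Linked G X u v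
        · have e' := hm b hb' H'
          exact (marked a ha' (by rw [e, e'])).trans (marked b hb' e').symm
        · rw [hm' a ha' H, hm' b hb' H'] at e
          exact h.joined a b ha' hb' e

/-- Add vertex number `reg 44` to the components of set number `reg 43`. -/
def joinProg : Prog :=
  forP 45 0 (st 13 (.var 45) 0) ;;
  forP 45 44 (st 13 (.ld 12 (.var 43 * .var 0 + .var 45))
    (Ex.or (.ld 13 (.ld 12 (.var 43 * .var 0 + .var 45))) (Ex.and (.ld 4 (.var 43 * .var 0 + .var 45))
      (Ex.and (.ld 4 (.var 43 * .var 0 + .var 44)) (.ld 0 (.var 45 * .var 0 + .var 44)))))) ;;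
  forP 45 44 (st 12 (.var 43 * .var 0 + .var 45)
    (.ld 13 (.ld 12 (.var 43 * .var 0 + .var 45)) * .var 44 +
      (1 - .ld 13 (.ld 12 (.var 43 * .var 0 + .var 45))) *
        .ld 12 (.var 43 * .var 0 + .var 45))) ;;
  st 12 (.var 43 * .var 0 + .var 44) (.var 44)

@[simp] theorem uw_joinProg (l : Loc) : joinProg.UW l ↔ l = .mem 12 ∨ l = .mem 13 ∨ l = .reg 45 := by
  simp [joinProg]; tauto

/-- Memory 13, indexed by labels, marks the components that get merged. All marks are set before any
label changes, and the relabelling then replaces marked labels by `v` without branching. -/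
theorem joinProg_wp {u : Store} {n N : ℕ} {G : SimpleGraph (Fin n)} {w : Fin n → ℚ}
    {A R' : Finset (Fin n)} {F : ℕ → Finset (Fin n)} (h : Inp u N G w A R' F) {S k : ℕ}
    (hS : N * n + n * n + 2 * n + 2 ≤ S) (hk : k < N) {v : Fin n} (h43 : u.reg 43 = k)
    (h44 : u.reg 44 = v) (hlab : Labels G (F k) v fun a => u.mem 12 (k * n + a)) :
    Wp S joinProg (150 * n + 30) u fun v' =>
      Labels G (F k) (v + 1) (fun a => v'.mem 12 (k * n + a)) ∧
      ∀ x, (x < k * n ∨ k * n + n ≤ x) → v'.mem 12 x = u.mem 12 x := by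
  have hv := v.2
  have hkn : k * n + n ≤ N * n := by nlinarith
  have a4 : ∀ y < n, y * n ≤ n * n := fun y hy => Nat.mul_le_mul_right _ hy.le
  have keep : Keeps joinProg := by constructor <;> simp
  set lab := fun a => u.mem 12 (k * n + a) with hlabdef
  have hlab' : ∀ a, u.mem 12 (k * n + a) = lab a := fun a => rfl
  refine (Wp.seq (T := n * (3 + 5) + 3) (R := fun v' => ∀ l < n, v'.mem 13 l = 0)
    (Wp.fill1_of (a := 13) (M := n) h.r0 (by simp) (by simp) (by simp) 3 0 (fun _ => 0)
      (fun J hJ v' hF h45 _ _ => (Wp.st (by simp) (by simp) (by simp [h45])).time (by simp))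
      fun v' hF hv _ l hl => by simpa using hv l hl)
    (T' := (n * (60 + 5) + 3) + ((n * (60 + 5) + 3) + 10)) ?_).time (by omega)
  intro v1 h1 hF1
  have hI1 := h.fr (by constructor <;> simp) hF1
  have r43 : v1.reg 43 = k := by rw [hF1.reg 43 (by simp), h43]
  have r44 : v1.reg 44 = v := by rw [hF1.reg 44 (by simp), h44]
  have m12 : v1.mem 12 = u.mem 12 := hF1.mem 12 (by simp)
  refine Wp.seq (T := n * (60 + 5) + 3) (R := fun v' => ∀ l < n, Flag (v'.mem 13 l)
    (∃ a : Fin n, a.1 < v ∧ lab a = l ∧ Linked G (F k) a v))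
    ((Wp.forP_const_of (N := v) (fun J v' => ∀ l < n, Flag (v'.mem 13 l)
    (∃ a : Fin n, a.1 < J ∧ lab a = l ∧ Linked G (F k) a v)) 60 r44 (by simp) (by simp) (by simp)
    ?_ ?_ fun v' _ hv => hv).time (by gcongr)) ?_
  · intro l hl
    exact .inr ⟨h1 l hl, by simp⟩
  · intro J hJ v' hF h45 hv'
    have hI := hI1.fr (by constructor <;> simp) hF
    have hJn : J < n := hJ.trans hv
    have s43 : v'.reg 43 = k := by rw [hF.reg 43 (by simp), r43]
    have s44 : v'.reg 44 = v := by rw [hF.reg 44 (by simp), r44]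
    have n12 : v'.mem 12 = u.mem 12 := by rw [hF.mem 12 (by simp), m12]
    have hl : lab J < n := (hlab.lt J hJ).trans hv
    have := a4 J hJn
    have E : EFlag S v' (Ex.or (.ld 13 (.ld 12 (.var 43 * .var 0 + .var 45)))
        (Ex.and (.ld 4 (.var 43 * .var 0 + .var 45)) (Ex.and (.ld 4 (.var 43 * .var 0 + .var 44))
          (.ld 0 (.var 45 * .var 0 + .var 44)))))
        ((∃ a : Fin n, a.1 < J ∧ lab a = lab J ∧ Linked G (F k) a v) ∨
          (⟨J, hJn⟩ ∈ F k ∧ v ∈ F k ∧ G.Adj ⟨J, hJn⟩ v)) := by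
      refine .or (.of (by omega) ?_ ?_) (.and (.of (by omega) ?_ ?_) (.and (.of (by omega) ?_ ?_)
        (.of (by omega) ?_ ?_)))
      · simp [s43, hI.r0, h45]; omega
      · simpa [s43, hI.r0, h45, n12, hlab'] using hv' _ hl
      · simp [s43, hI.r0, h45]; omega
      · simpa [s43, hI.r0, h45] using hI.fam k hk ⟨J, hJn⟩
      · simp [s43, hI.r0, s44]; omega
      · simpa [s43, hI.r0, s44] using hI.fam k hk v
      · simp [s44, hI.r0, h45]; omega
      · simpa [s44, hI.r0, h45] using hI.graph ⟨J, hJn⟩ v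
    refine (Wp.st (by simp [s43, hI.r0, h45]; omega) E.ok ?_).time (by simp)
    intro l hl'
    have hadr : (Ex.ld 12 (.var 43 * .var 0 + .var 45)).eval v' = lab J := by
      simp [s43, hI.r0, h45, n12, hlab']
    rw [hadr]
    simp only [setReg_mem, setMem_mem, Function.update_self]
    by_cases hlJ : l = lab J
    · subst hlJ
      rw [Function.update_self]
      refine E.flag.congr ⟨?_, ?_⟩
      · rintro (⟨a, ha, H⟩ | H)
        · exact ⟨a, by omega, H⟩
        · exact ⟨⟨J, hJn⟩, by simp, rfl, H⟩
      · rintro ⟨a, ha, e, H⟩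
        rcases Nat.lt_succ_iff_lt_or_eq.1 ha with ha | rfl
        · exact .inl ⟨a, ha, e, H⟩
        · exact .inr H
    · rw [Function.update_of_ne hlJ]
      refine (hv' l hl').congr ⟨fun ⟨a, ha, H⟩ => ⟨a, by omega, H⟩, ?_⟩
      rintro ⟨a, ha, e, H⟩
      rcases Nat.lt_succ_iff_lt_or_eq.1 ha with ha | rfl
      · exact ⟨a, ha, e, H⟩
      · exact absurd e.symm hlJ
  intro v2 h2 hF2
  have hI2 := hI1.fr (by constructor <;> simp) hF2
  have s43 : v2.reg 43 = k := by rw [hF2.reg 43 (by simp), r43]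
  have s44 : v2.reg 44 = v := by rw [hF2.reg 44 (by simp), r44]
  have n12 : v2.mem 12 = u.mem 12 := by rw [hF2.mem 12 (by simp), m12]
  refine Wp.seq (T := n * (60 + 5) + 3) (R := fun v' =>
    (∀ J < v.1, v'.mem 12 (k * n + J) = v2.mem 13 (lab J) * v + (1 - v2.mem 13 (lab J)) * lab J) ∧
    ∀ x, (x < k * n ∨ k * n + v.1 ≤ x) → v'.mem 12 x = u.mem 12 x)
    ((Wp.fill1_of (a := 12) (M := v.1) s44 (by simp) (by simp) (by simp) 60 (k * n)
      (fun J => v2.mem 13 (lab J) * v + (1 - v2.mem 13 (lab J)) * lab J)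
      (fun J hJ v' hF h45 hvJ _ => ?_) fun v' hF hv hv' => ⟨hv, by rwa [n12] at hv'⟩).time
      (by gcongr)) ?_
  · have hI := hI2.fr (by constructor <;> simp) hF
    have t43 : v'.reg 43 = k := by rw [hF.reg 43 (by simp), s43]
    have t44 : v'.reg 44 = v := by rw [hF.reg 44 (by simp), s44]
    have t13 : v'.mem 13 = v2.mem 13 := hF.mem 13 (by simp)
    rw [n12, hlab'] at hvJ
    have hl : lab J < v := hlab.lt J hJ
    have hb := (h2 (lab J) (hl.trans hv)).le_one
    have b1 : v2.mem 13 (lab J) * v ≤ v := by nlinarith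
    have b2 : (1 - v2.mem 13 (lab J)) * lab J ≤ lab J := by
      have : 1 - v2.mem 13 (lab J) ≤ 1 := by omega
      nlinarith
    refine (Wp.st (by simp [t43, hI.r0, h45]; omega) ?_ ?_).time (by simp)
    · simp [t43, hI.r0, h45, hvJ, t13, t44]
      omega
    · simp [t43, hI.r0, h45, hvJ, t13, t44]
  rintro v3 ⟨h3, h3'⟩ hF3
  have t0 : v3.reg 0 = n := by rw [hF3.reg 0 (by simp), hI2.r0]
  have t43 : v3.reg 43 = k := by rw [hF3.reg 43 (by simp), s43]
  have t44 : v3.reg 44 = v := by rw [hF3.reg 44 (by simp), s44]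
  refine (Wp.st (by simp [t43, t0, t44]; omega) (by simp) ?_).time (by simp)
  simp only [setMem_mem, Function.update_self, Ex.eval_add, Ex.eval_mul, Ex.eval_var, t43, t0, t44]
  refine ⟨hlab.succ (fun a ha H => ?_) (fun a ha H => ?_) (by simp), fun x hx => ?_⟩
  · rw [Function.update_of_ne (by omega), h3 a ha, (h2 _ ((hlab.lt a ha).trans hv)).eq_one H]
    simp
  · rw [Function.update_of_ne (by omega), h3 a ha, (h2 _ ((hlab.lt a ha).trans hv)).eq_zero H]
    simp
  · rw [Function.update_of_ne (by omega)]
    exact h3' x (by omega)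

/-- Label the components of the sets. -/
def labelProg : Prog := forP 43 1 (forP 44 0 joinProg)

@[simp] theorem uw_labelProg (l : Loc) : labelProg.UW l ↔ l = .mem 12 ∨ l = .mem 13 ∨
    l = .reg 43 ∨ l = .reg 44 ∨ l = .reg 45 := by
  simp [labelProg]; tauto

theorem labelProg_wp {u : Store} {n N : ℕ} {G : SimpleGraph (Fin n)} {w : Fin n → ℚ}
    {A R' : Finset (Fin n)} {F : ℕ → Finset (Fin n)} (h : Inp u N G w A R' F) {S : ℕ}
    (hS : N * n + n * n + 2 * n + 2 ≤ S) :
    Wp S labelProg (N * (n * (150 * n + 35) + 8) + 3) u fun v =>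
      ∀ k < N, Labels G (F k) n fun a => v.mem 12 (k * n + a) := by
  refine Wp.forP_const_of (N := N) (fun k v => ∀ j < k, Labels G (F j) n fun a =>
    v.mem 12 (j * n + a)) (n * (150 * n + 35) + 3) h.r1 (by simp) (by simp) (by simp) (by simp) ?_
    fun v _ hv => hv
  intro k hk v hF h43 hv
  have hI := h.fr (P := labelProg) (by constructor <;> simp) hF
  refine Wp.forP_const_of (N := n) (fun J v' => (∀ j < k, Labels G (F j) n fun a =>
    v'.mem 12 (j * n + a)) ∧ Labels G (F k) J fun a => v'.mem 12 (k * n + a)) (150 * n + 30)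
    hI.r0 (by simp) (by simp) (by simp) ⟨hv, by simp, by simp, by simp⟩ ?_ ?_
  · rintro J hJ v' hF' h44 ⟨hv1, hv2⟩
    have hI' := hI.fr (by constructor <;> simp) hF'
    refine (joinProg_wp hI' hS hk (v := ⟨J, hJ⟩) (by rw [hF'.reg 43 (by simp), h43]) h44 hv2).post ?_
    rintro v'' ⟨g1, g2⟩
    refine ⟨fun j hj => ?_, g1⟩
    have hjk : j * n + n ≤ k * n := by nlinarith
    have e : ∀ a < n, v''.mem 12 (j * n + a) = v'.mem 12 (j * n + a) := fun a ha =>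
      g2 _ (by omega)
    have := hv1 j hj
    refine ⟨fun a ha => ?_, fun a b ha hb hL => ?_, fun a b ha hb hL => this.joined a b ha hb ?_⟩
    · simpa [e a ha] using this.lt a ha
    · simpa [e a ha, e b hb] using this.eq a b ha hb hL
    · simpa [e a ha, e b hb] using hL
  · rintro v' - ⟨g1, g2⟩ j hj
    rcases Nat.lt_succ_iff_lt_or_eq.1 hj with hj | rfl
    · exact g1 j hj
    · exact g2

/-- Mark the vertices whose component meets the set in memory 11. -/
def hitProg : Prog :=
  for2 43 1 44 0 (any1 46 45 0 (Ex.and (Ex.eq (.ld 12 (.var 43 * .var 0 + .var 44))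
    (.ld 12 (.var 43 * .var 0 + .var 45))) (Ex.and (.ld 4 (.var 43 * .var 0 + .var 45))
    (.ld 11 (.var 45)))) ;; st 15 (.var 43 * .var 0 + .var 44) (.var 46))

@[simp] theorem uw_hitProg (l : Loc) : hitProg.UW l ↔ l = .mem 15 ∨
    l = .reg 43 ∨ l = .reg 44 ∨ l = .reg 45 ∨ l = .reg 46 := by
  simp [hitProg]; tauto

/-- The component of the vertex meets `T`. -/
def Hit {n : ℕ} (G : SimpleGraph (Fin n)) (X T : Finset (Fin n)) (a : Fin n) : Prop :=
  ∃ b ∈ X, Joined G X a b ∧ b ∈ T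

theorem hitProg_wp {u : Store} {n N : ℕ} {G : SimpleGraph (Fin n)} {w : Fin n → ℚ}
    {A R' T' : Finset (Fin n)} {F : ℕ → Finset (Fin n)} (h : Inp u N G w A R' F) {S : ℕ}
    (hS : N * n + n + 2 ≤ S) (hT' : ∀ a : Fin n, Flag (u.mem 11 a) (a ∈ T'))
    (hlab : ∀ k < N, Labels G (F k) n fun a => u.mem 12 (k * n + a)) :
    Wp S hitProg (N * (n * (n * 80 + 25) + 8) + 3) u fun v =>
      ∀ k < N, ∀ a : Fin n, Flag (v.mem 15 (k * n + a)) (Hit G (F k) T' a) := by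
  classical
  have hkn : ∀ k < N, k * n + n ≤ N * n := fun k hk => by nlinarith
  refine Wp.fill2_of (a := 15) h.r1 h.r0 (by constructor <;> simp) (n * 80 + 20) (fun k a => k * n + a)
    (fun k a => if ∃ a' : Fin n, a'.1 = a ∧ Hit G (F k) T' a' then 1 else 0)
    (fun I hI J hJ I' hI' J' hJ' e => idx_inj hJ hJ' e) ?_ ?_
  · intro k hk J hJ v hF h43 h44 _ _
    have hI := h.fr (P := hitProg) (by constructor <;> simp) hF
    have hkk := hkn k hk
    have n12 : v.mem 12 = u.mem 12 := hF.mem 12 (by simp)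
    have n11 : v.mem 11 = u.mem 11 := hF.mem 11 (by simp)
    refine (Wp.seq (T := n * 80 + 5) (R := fun v' => Flag (v'.reg 46) (Hit G (F k) T' ⟨J, hJ⟩))
      ((Wp.any1_of (M := n) (B := fun K => ∃ hK : K < n, u.mem 12 (k * n + J) = u.mem 12 (k * n + K) ∧
        ⟨K, hK⟩ ∈ F k ∧ (⟨K, hK⟩ : Fin n) ∈ T') hI.r0 (by constructor <;> simp) (by omega)
        (fun K hK v' hF' h45 => ?_) fun v' hF' hv' => hv'.congr ?_).time (by simp; omega))
      (T' := 10) ?_).time (by omega)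
    · have hI' := hI.fr (by constructor <;> simp) hF'
      have s43 : v'.reg 43 = k := by rw [hF'.reg 43 (by simp), h43]
      have s44 : v'.reg 44 = J := by rw [hF'.reg 44 (by simp), h44]
      have s12 : v'.mem 12 = u.mem 12 := by rw [hF'.mem 12 (by simp), n12]
      have s11 : v'.mem 11 = u.mem 11 := by rw [hF'.mem 11 (by simp), n11]
      refine EFlag.congr ((EFlag.eq (by omega) ?_ ?_).and ((EFlag.of (p := ⟨K, hK⟩ ∈ F k) (by omega)
        ?_ ?_).and (EFlag.of (p := (⟨K, hK⟩ : Fin n) ∈ T') (by omega) (by simp) ?_))) ?_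
      · simp [s43, hI'.r0, s44]; omega
      · simp [s43, hI'.r0, h45]; omega
      · simp [s43, hI'.r0, h45]; omega
      · simpa [s43, hI'.r0, h45] using hI'.fam k hk ⟨K, hK⟩
      · simpa [h45, s11] using hT' ⟨K, hK⟩
      · simp [s43, s44, h45, hI'.r0, s12, hK]
    · constructor
      · rintro ⟨K, -, hK, h1, h2, h3⟩
        exact ⟨⟨K, hK⟩, h2, (hlab k hk).joined ⟨J, hJ⟩ ⟨K, hK⟩ hJ hK h1, h3⟩
      · rintro ⟨K, h1, h2, h3⟩
        exact ⟨K, K.2, K.2, ((hlab k hk).iff ⟨J, hJ⟩ K).2 h2, h1, h3⟩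
    · rintro v' h1 hF'
      have hI' := hI.fr (by constructor <;> simp) hF'
      have s43 : v'.reg 43 = k := by rw [hF'.reg 43 (by simp), h43]
      have s44 : v'.reg 44 = J := by rw [hF'.reg 44 (by simp), h44]
      refine (Wp.st (by simp [s43, s44, hI'.r0]; omega) (by simp) ?_).time (by simp)
      simp only [setMem_mem, Function.update_self, Ex.eval_add, Ex.eval_mul, Ex.eval_var, s43, s44,
        hI'.r0, hF'.mem 15 (by simp)]
      rw [h1.eq_ite]
      congr 1
      refine if_congr ⟨fun H => ⟨_, rfl, H⟩, ?_⟩ rfl rfl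
      rintro ⟨a, rfl, H⟩
      exact H
  · intro v _ hv _ k hk a
    refine (Flag.of_ite (hv k hk a a.2)).congr ⟨?_, fun H => ⟨a, rfl, H⟩⟩
    rintro ⟨b, hb, H⟩
    rwa [← Fin.ext hb]

end WordRAM

namespace WordRAM

/-! ## The vectors of the sets -/

/-- Compute the weights of the sets. -/
def weightProg : Prog :=
  forP 43 1 (.instr (.wzero 0) ;; forP 44 0 (cond (.ld 4 (.var 43 * .var 0 + .var 44))
    (wld 1 0 (.var 44) ;; .instr (.wadd 0 0 1)) .skip) ;; wst 1 (.var 43) 0)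

@[simp] theorem uw_weightProg (l : Loc) : weightProg.UW l ↔ l = .wmem 1 ∨ l = .wreg 0 ∨ l = .wreg 1 ∨
    l = .reg 43 ∨ l = .reg 44 := by
  simp [weightProg]; tauto

theorem weightProg_wp {u : Store} {n N : ℕ} {G : SimpleGraph (Fin n)} {w : Fin n → ℚ}
    {A R' : Finset (Fin n)} {F : ℕ → Finset (Fin n)} (h : Inp u N G w A R' F) {S : ℕ}
    (hS : N * n + n + 2 ≤ S) :
    Wp S weightProg (N * (n * 25 + 15) + 3) u fun v => ∀ k < N, v.wmem 1 k = ∑ a ∈ F k, w a := by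
  refine Wp.forP_const_of (N := N) (fun k v => ∀ j < k, v.wmem 1 j = ∑ a ∈ F j, w a)
    (n * 25 + 10) h.r1 (by simp) (by simp) (by simp) (by simp) ?_ fun v _ hv => hv
  intro k hk v hF h43 hv
  have hI := h.fr (P := weightProg) (by constructor <;> simp) hF
  have hkn : k * n + n ≤ N * n := by nlinarith
  refine (Wp.seq (T := 1) (R := fun v' => v' = v.setWReg 0 0) (Wp.wzero rfl)
    (T' := (n * (20 + 5) + 3) + 6) ?_).time (by omega)
  rintro v1 hv1 hF1
  have hI1 := hI.fr (by constructor <;> simp) hF1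
  have r43 : v1.reg 43 = k := by rw [hF1.reg 43 (by simp), h43]
  refine Wp.seq (T := n * (20 + 5) + 3) (R := fun v' => v'.wreg 0 = ∑ a ∈ F k, w a)
    (Wp.forP_const_of (N := n) (fun J v' => v'.wreg 0 = ∑ a ∈ (F k).filter (fun a => a.1 < J), w a)
    20 hI1.r0 (by simp) (by simp) (by simp) (by simp [hv1]) ?_ ?_) ?_
  · intro J hJ v' hF' h44 hv'
    have hI' := hI1.fr (by constructor <;> simp) hF'
    have s43 : v'.reg 43 = k := by rw [hF'.reg 43 (by simp), r43]
    have hfl := hI'.fam k hk ⟨J, hJ⟩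
    refine (Wp.cond (T := 3) (by simp [s43, hI'.r0, h44]; omega) (fun hp => ?_)
      fun hp => ?_).time (by simp)
    · have hmem : (⟨J, hJ⟩ : Fin n) ∈ F k := hfl.pos_iff.1 (by simpa [s43, hI'.r0, h44] using hp)
      refine (Wp.seq (T := 2) (R := fun v'' => v'' = v'.setWReg 1 (w ⟨J, hJ⟩)) (Wp.wld (by simp)
        (by simp [h44, ← hI'.weights ⟨J, hJ⟩])) (T' := 1) ?_).time (by norm_num)
      rintro v'' hv'' -
      refine Wp.wadd ?_
      have e : (F k).filter (fun a => a.1 < J + 1) =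
          insert ⟨J, hJ⟩ ((F k).filter fun a => a.1 < J) := by
        ext a
        simp only [Finset.mem_filter, Finset.mem_insert, Fin.ext_iff, Nat.lt_succ_iff_lt_or_eq]
        constructor
        · rintro ⟨h1, h2 | h2⟩
          · exact .inr ⟨h1, h2⟩
          · exact .inl h2
        · rintro (h2 | ⟨h1, h2⟩)
          · refine ⟨?_, .inr h2⟩
            rwa [show a = ⟨J, hJ⟩ from Fin.ext h2]
          · exact ⟨h1, .inl h2⟩
      rw [e, Finset.sum_insert (by simp)]
      simp [hv'', hv', add_comm]
    · have hmem : (⟨J, hJ⟩ : Fin n) ∉ F k :=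
        hfl.eq_zero_iff.1 (by simpa [s43, hI'.r0, h44] using hp)
      refine (Wp.skip ?_).time (by norm_num)
      have e : (F k).filter (fun a => a.1 < J + 1) = (F k).filter fun a => a.1 < J := by
        refine Finset.filter_congr fun a ha => ⟨fun h' => ?_, fun h' => by omega⟩
        rcases Nat.lt_succ_iff_lt_or_eq.1 h' with h' | h'
        · exact h'
        · rw [show a = ⟨J, hJ⟩ from Fin.ext h'] at ha
          exact absurd ha hmem
      rw [e]
      exact hv'
  · intro v' _ hv'
    rw [hv', Finset.filter_true_of_mem fun a _ => a.2]
  intro v2 h2 hF2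
  have s43 : v2.reg 43 = k := by rw [hF2.reg 43 (by simp), r43]
  have sw : v2.wmem 1 = v.wmem 1 := by rw [hF2.wmem 1 (by simp), hF1.wmem 1 (by simp)]
  refine (Wp.wst (by simp) ?_).time (by simp)
  intro j hj
  simp only [Store.setReg, setWMem_wmem, Function.update_self, Ex.eval_var, s43, sw]
  rcases Nat.lt_succ_iff_lt_or_eq.1 hj with hj | rfl
  · rw [Function.update_of_ne hj.ne, hv j hj]
  · rw [Function.update_self, h2]

/-- The meaning of the bits of the vector of `X`. -/
def Entry {n : ℕ} (G : SimpleGraph (Fin n)) (A T' : Finset (Fin n)) (t : ℕ → Finset (Fin n))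
    (cnt q : ℕ) (X : Finset (Fin n)) (c : ℕ) : Prop :=
  c < q ∧ (T'.Nonempty ∧ (¬ ∃ a ∈ X, ¬ Hit G X T' a) ∧
      (¬ ∃ a ∈ X, ∃ b ∈ X, a ∈ t (c / cnt) ∧ b ∈ t (c % cnt) ∧ Joined G X a b) ∨
    ¬ T'.Nonempty ∧ (c = 0 ∧ X.Nonempty ∧ (¬ ∃ a ∈ X, ∃ b ∈ X, ¬ Joined G X a b) ∨
      c = 1 ∧ ¬ X.Nonempty ∧ A ≠ Finset.univ))

/-- The address of the bit for vertex number `reg j` in set number `reg 43`. -/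
def cell (j : ℕ) : Ex := .var 43 * .var 0 + .var j

/-- Compute bit number `reg 47` of the vector of set number `reg 43`. -/
def entryProg : Prog :=
  asg 49 (.var 47 - .var 47 / .var 31 * .var 31) ;;
  asg 48 (.var 47 / .var 31 * Ex.lt (.var 47 / .var 31) (.var 31)) ;;
  any1 50 44 0 (Ex.and (.ld 4 (cell 44)) (Ex.not (.ld 15 (cell 44)))) ;;
  any2 51 44 0 45 0 (Ex.and (Ex.and (.ld 4 (cell 44)) (.ld 10 (.var 48 * .var 0 + .var 44)))
    (Ex.and (Ex.and (.ld 4 (cell 45)) (.ld 10 (.var 49 * .var 0 + .var 45)))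
    (Ex.eq (.ld 12 (cell 44)) (.ld 12 (cell 45))))) ;;
  any1 52 44 0 (.ld 4 (cell 44)) ;;
  any2 53 44 0 45 0 (Ex.and (.ld 4 (cell 44)) (Ex.and (.ld 4 (cell 45))
    (Ex.not (Ex.eq (.ld 12 (cell 44)) (.ld 12 (cell 45)))))) ;;
  st 17 (.var 43 * .var 3 + .var 47) (Ex.and (Ex.lt (.var 47) (.var 42))
    (Ex.or (Ex.and (.var 40) (Ex.and (Ex.not (.var 50)) (Ex.not (.var 51))))
      (Ex.and (Ex.not (.var 40)) (Ex.or
        (Ex.and (Ex.eq (.var 47) 0) (Ex.and (.var 52) (Ex.not (.var 53))))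
        (Ex.and (Ex.eq (.var 47) 1) (Ex.and (Ex.not (.var 52)) (.var 41)))))))

@[simp] theorem uw_entryProg (l : Loc) : entryProg.UW l ↔ l = .mem 17 ∨ l = .reg 44 ∨ l = .reg 45 ∨
    l = .reg 48 ∨ l = .reg 49 ∨ l = .reg 50 ∨ l = .reg 51 ∨ l = .reg 52 ∨ l = .reg 53 := by
  simp [entryProg]; tauto

/-- What the computation of the vectors uses. -/
structure Tables (u : Store) {n : ℕ} (N : ℕ) (G : SimpleGraph (Fin n)) (A T' : Finset (Fin n))
    (t : ℕ → Finset (Fin n)) (cnt q M : ℕ) (F : ℕ → Finset (Fin n)) : Prop where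
  r0 : u.reg 0 = n
  r1 : u.reg 1 = N
  r3 : u.reg 3 = M
  r31 : u.reg 31 = cnt
  r40 : Flag (u.reg 40) T'.Nonempty
  r41 : Flag (u.reg 41) (A ≠ Finset.univ)
  r42 : u.reg 42 = q
  fam : ∀ k < N, ∀ a : Fin n, Flag (u.mem 4 (k * n + a)) (a ∈ F k)
  list : ∀ i < cnt, ∀ a : Fin n, Flag (u.mem 10 (i * n + a)) (a ∈ t i)
  labels : ∀ k < N, ∀ a b : Fin n, u.mem 12 (k * n + a) = u.mem 12 (k * n + b) ↔ Joined G (F k) a b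
  hit : ∀ k < N, ∀ a : Fin n, Flag (u.mem 15 (k * n + a)) (Hit G (F k) T' a)

theorem Tables.fr {u v : Store} {n N : ℕ} {G : SimpleGraph (Fin n)} {A T' : Finset (Fin n)}
    {t : ℕ → Finset (Fin n)} {cnt q M : ℕ} {F : ℕ → Finset (Fin n)}
    (h : Tables u N G A T' t cnt q M F) {P : Prog} (hF : Fr P u v)
    (hP : ∀ l, P.UW l → (for2 43 1 47 3 entryProg).UW l) :
    Tables v N G A T' t cnt q M F := by
  have hF' := hF.weaken hP
  constructor
  · rw [hF'.reg 0 (by simp), h.r0]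
  · rw [hF'.reg 1 (by simp), h.r1]
  · rw [hF'.reg 3 (by simp), h.r3]
  · rw [hF'.reg 31 (by simp), h.r31]
  · rw [hF'.reg 40 (by simp)]; exact h.r40
  · rw [hF'.reg 41 (by simp)]; exact h.r41
  · rw [hF'.reg 42 (by simp), h.r42]
  · rw [hF'.mem 4 (by simp)]; exact h.fam
  · rw [hF'.mem 10 (by simp)]; exact h.list
  · rw [hF'.mem 12 (by simp)]; exact h.labels
  · rw [hF'.mem 15 (by simp)]; exact h.hit

theorem exists_lt_and_exists {n : ℕ} {B : Fin n → Prop} :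
    (∃ J < n, ∃ h : J < n, B ⟨J, h⟩) ↔ ∃ a, B a :=
  ⟨fun ⟨_, _, _, H⟩ => ⟨_, H⟩, fun ⟨a, H⟩ => ⟨a, a.2, a.2, H⟩⟩

theorem EFlag.ex {S : ℕ} {u : Store} {e : Ex} {n J : ℕ} {B : Fin n → Prop} {hJ : J < n}
    (h : EFlag S u e (B ⟨J, hJ⟩)) : EFlag S u e (∃ h : J < n, B ⟨J, h⟩) :=
  h.congr ⟨fun H => ⟨hJ, H⟩, fun ⟨_, H⟩ => H⟩

/-- The quantifiers over pairs of vertices become double loops, whence a factor `n * n` for each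
bit. The conditions for empty and for nonempty `T'` are both evaluated, and the flag in register 40
decides which one counts. -/
theorem entryProg_wp {u : Store} {n N : ℕ} {G : SimpleGraph (Fin n)} {A T' : Finset (Fin n)}
    {t : ℕ → Finset (Fin n)} {cnt q M : ℕ} {F : ℕ → Finset (Fin n)}
    (h : Tables u N G A T' t cnt q M F) {S : ℕ} (hq : q = width cnt T'.Nonempty) (hn : 1 ≤ n)
    (hcnt : 1 ≤ cnt) (hS : N * n + N * M + cnt * n + n + M + 3 ≤ S) {k c : ℕ} (hk : k < N)
    (hc : c < M) (h43 : u.reg 43 = k) (h47 : u.reg 47 = c) :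
    ∃ b, Flag b (Entry G A T' t cnt q (F k) c) ∧
      Wp S entryProg (n * (n * 200 + 200) + 400) u fun v =>
        v.mem 17 = Function.update (u.mem 17) (k * M + c) b := by
  classical
  refine ⟨if Entry G A T' t cnt q (F k) c then 1 else 0, .of_ite rfl, ?_⟩
  have hkn : k * n + n ≤ N * n := by nlinarith
  have hkM : k * M + M ≤ N * M := by nlinarith
  have hdm := Nat.div_add_mod' c cnt
  have hmod := Nat.mod_lt c hcnt
  have hdiv : c / cnt ≤ c := Nat.div_le_self _ _
  have mono : ∀ P : Prog, (∀ l, P.UW l → entryProg.UW l) →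
      ∀ l, P.UW l → (for2 43 1 47 3 entryProg).UW l := fun P hP l hl => by
    rw [uw_for2]; exact .inr (.inr (hP l hl))
  -- In padding columns and for vectors of width 2, the quotient need not be the number of a trace.
  -- Trace 0 is then read to keep the address in range; the value read is irrelevant, as another
  -- conjunct masks it.
  set i1 := if c / cnt < cnt then c / cnt else 0 with hi1
  have hi1' : i1 < cnt := by rw [hi1]; split_ifs <;> omega
  have b1 : i1 * n + n ≤ cnt * n := by nlinarith
  have b2 : c % cnt * n + n ≤ cnt * n := by nlinarith
  refine (Wp.seq (T := 10) (R := fun v => v = u.setReg 49 (c % cnt)) ((Wp.asg (by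
      simp [h47, h.r31]; omega) (by
        simp only [Ex.eval_sub, Ex.eval_mul, Ex.eval_div, Ex.eval_var, h47, h.r31]
        rw [show c - c / cnt * cnt = c % cnt by omega])).time (by simp))
    (T' := 20 + ((n * 50 + 5) + ((n * (n * 100 + 8) + 5) + ((n * 30 + 5) + ((n * (n * 100 + 8) + 5) + 200)))))
    ?_).time (by nlinarith)
  rintro v1 hv1 hF1
  have h1 := h.fr hF1 (mono _ (by simp))
  have p43 : v1.reg 43 = k := by rw [hF1.reg 43 (by simp), h43]
  have p47 : v1.reg 47 = c := by rw [hF1.reg 47 (by simp), h47]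
  have p49 : v1.reg 49 = c % cnt := by simp [hv1]
  have E := EFlag.lt (S := S) (u := v1) (e := .var 47 / .var 31) (f := .var 31) (by omega) (by simp)
    (by simp)
  have E1 : (Ex.var 47 / Ex.var 31).eval v1 * (Ex.lt (.var 47 / .var 31) (.var 31)).eval v1 = i1 := by
    rw [E.flag.eq_ite]
    simp [h1.r31, p47, hi1]
  refine Wp.seq (T := 20) (R := fun v => v = v1.setReg 48 i1) ((Wp.asg (by
    refine ⟨by simp, E.ok, ?_⟩
    rw [E1]
    nlinarith) (by rw [Ex.eval_mul, E1])).time (by simp)) ?_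
  rintro v2 hv2 hF2
  have h2 := h1.fr hF2 (mono _ (by simp))
  have q43 : v2.reg 43 = k := by rw [hF2.reg 43 (by simp), p43]
  have q47 : v2.reg 47 = c := by rw [hF2.reg 47 (by simp), p47]
  have q49 : v2.reg 49 = c % cnt := by rw [hF2.reg 49 (by simp), p49]
  have q48 : v2.reg 48 = i1 := by simp [hv2]
  have fam : ∀ v, Tables v N G A T' t cnt q M F → v.reg 43 = k → ∀ j J (hJ : J < n), v.reg j = J →
      EFlag S v (.ld 4 (cell j)) (⟨J, hJ⟩ ∈ F k) := fun v hv e43 j J hJ ej => by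
    refine .of (by omega) (by simp [cell, e43, hv.r0, ej]; omega) ?_
    simpa [cell, e43, hv.r0, ej] using hv.fam k hk ⟨J, hJ⟩
  have lab : ∀ v, Tables v N G A T' t cnt q M F → v.reg 43 = k → ∀ j J (hJ : J < n) j' J'
      (hJ' : J' < n), v.reg j = J → v.reg j' = J' →
      EFlag S v (Ex.eq (.ld 12 (cell j)) (.ld 12 (cell j'))) (Joined G (F k) ⟨J, hJ⟩ ⟨J', hJ'⟩) :=
    fun v hv e43 j J hJ j' J' hJ' ej ej' => by
    refine (EFlag.eq (by omega) (by simp [cell, e43, hv.r0, ej]; omega)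
      (by simp [cell, e43, hv.r0, ej']; omega)).congr ?_
    simpa [cell, e43, hv.r0, ej, ej'] using hv.labels k hk ⟨J, hJ⟩ ⟨J', hJ'⟩
  refine Wp.seq (T := n * 50 + 5) (R := fun v => Flag (v.reg 50) (∃ a ∈ F k, ¬ Hit G (F k) T' a))
    ((Wp.any1_of (M := n) h2.r0 (by constructor <;> simp) (by omega)
      (fun J => ∃ hJ : J < n, ⟨J, hJ⟩ ∈ F k ∧ ¬ Hit G (F k) T' ⟨J, hJ⟩)
      (fun J hJ v hF h44 => ?_) fun v hF hv => hv.congr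
        (exists_lt_and_exists (B := fun a => a ∈ F k ∧ ¬ Hit G (F k) T' a))).time
      (by simp [cell]; omega)) ?_
  · have hv := h2.fr hF (mono _ (by simp))
    have e43 : v.reg 43 = k := by rw [hF.reg 43 (by simp), q43]
    refine EFlag.ex (B := fun a => a ∈ F k ∧ ¬ Hit G (F k) T' a) (hJ := hJ)
      ((fam v hv e43 44 J hJ h44).and (EFlag.not (.of (by omega) ?_ ?_)))
    · simp [cell, e43, hv.r0, h44]; omega
    · simpa [cell, e43, hv.r0, h44] using hv.hit k hk ⟨J, hJ⟩
  rintro v3 f50 hF3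
  have h3 := h2.fr hF3 (mono _ (by simp))
  have r43 : v3.reg 43 = k := by rw [hF3.reg 43 (by simp), q43]
  refine Wp.seq (T := n * (n * 100 + 8) + 5) (R := fun v => Flag (v.reg 51)
      (∃ a b, (a ∈ F k ∧ a ∈ t i1) ∧ (b ∈ F k ∧ b ∈ t (c % cnt)) ∧ Joined G (F k) a b))
    ((Wp.any2_of (N := n) (M := n) h3.r0 h3.r0 (by constructor <;> simp) (by omega)
      (fun I J => ∃ hI : I < n, ∃ hJ : J < n, (⟨I, hI⟩ ∈ F k ∧ ⟨I, hI⟩ ∈ t i1) ∧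
        (⟨J, hJ⟩ ∈ F k ∧ ⟨J, hJ⟩ ∈ t (c % cnt)) ∧ Joined G (F k) ⟨I, hI⟩ ⟨J, hJ⟩)
      (fun I hI J hJ v hF h44 h45 => ?_) fun v hF hv => hv.congr ?_).time
      (by simp [cell]; gcongr; norm_num)) ?_
  · have hv := h3.fr hF (mono _ (by simp))
    have e43 : v.reg 43 = k := by rw [hF.reg 43 (by simp), r43]
    have e48 : v.reg 48 = i1 := by rw [hF.reg 48 (by simp), hF3.reg 48 (by simp), q48]
    have e49 : v.reg 49 = c % cnt := by rw [hF.reg 49 (by simp), hF3.reg 49 (by simp), q49]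
    refine EFlag.congr (((fam v hv e43 44 I hI h44).and (.of (p := ⟨I, hI⟩ ∈ t i1) (by omega) ?_
      ?_)).and (((fam v hv e43 45 J hJ h45).and (.of (p := ⟨J, hJ⟩ ∈ t (c % cnt)) (by omega) ?_
      ?_)).and (lab v hv e43 44 I hI 45 J hJ h44 h45)))
      ⟨fun H => ⟨hI, hJ, H⟩, fun ⟨_, _, H⟩ => H⟩
    · simp [e48, hv.r0, h44]; omega
    · simpa [e48, hv.r0, h44] using hv.list i1 hi1' ⟨I, hI⟩
    · simp [e49, hv.r0, h45]; omega
    · simpa [e49, hv.r0, h45] using hv.list _ hmod ⟨J, hJ⟩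
  · constructor
    · rintro ⟨I, _, J, _, hI, hJ, H⟩
      exact ⟨_, _, H⟩
    · rintro ⟨a, b, H⟩
      exact ⟨a, a.2, b, b.2, a.2, b.2, H⟩
  rintro v4 f51 hF4
  have h4 := h3.fr hF4 (mono _ (by simp))
  have s43 : v4.reg 43 = k := by rw [hF4.reg 43 (by simp), r43]
  refine Wp.seq (T := n * 30 + 5) (R := fun v => Flag (v.reg 52) (∃ a, a ∈ F k))
    ((Wp.any1_of (M := n) h4.r0 (by constructor <;> simp) (by omega)
      (fun J => ∃ hJ : J < n, ⟨J, hJ⟩ ∈ F k)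
      (fun J hJ v hF h44 => ?_) fun v hF hv => hv.congr exists_lt_and_exists).time
      (by simp [cell]; omega)) ?_
  · have hv := h4.fr hF (mono _ (by simp))
    have e43 : v.reg 43 = k := by rw [hF.reg 43 (by simp), s43]
    exact EFlag.ex (B := fun a => a ∈ F k) (hJ := hJ) (fam v hv e43 44 J hJ h44)
  rintro v5 f52 hF5
  have h5 := h4.fr hF5 (mono _ (by simp))
  have t43 : v5.reg 43 = k := by rw [hF5.reg 43 (by simp), s43]
  refine Wp.seq (T := n * (n * 100 + 8) + 5) (R := fun v => Flag (v.reg 53)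
      (∃ a b, a ∈ F k ∧ b ∈ F k ∧ ¬ Joined G (F k) a b))
    ((Wp.any2_of (N := n) (M := n) h5.r0 h5.r0 (by constructor <;> simp) (by omega)
      (fun I J => ∃ hI : I < n, ∃ hJ : J < n, ⟨I, hI⟩ ∈ F k ∧
        ⟨J, hJ⟩ ∈ F k ∧ ¬ Joined G (F k) ⟨I, hI⟩ ⟨J, hJ⟩)
      (fun I hI J hJ v hF h44 h45 => ?_) fun v hF hv => hv.congr ?_).time
      (by simp [cell]; gcongr; norm_num)) ?_
  · have hv := h5.fr hF (mono _ (by simp))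
    have e43 : v.reg 43 = k := by rw [hF.reg 43 (by simp), t43]
    exact EFlag.congr ((fam v hv e43 44 I hI h44).and ((fam v hv e43 45 J hJ h45).and
      (lab v hv e43 44 I hI 45 J hJ h44 h45).not)) ⟨fun H => ⟨hI, hJ, H⟩, fun ⟨_, _, H⟩ => H⟩
  · constructor
    · rintro ⟨I, _, J, _, hI, hJ, H⟩
      exact ⟨_, _, H⟩
    · rintro ⟨a, b, H⟩
      exact ⟨a, a.2, b, b.2, a.2, b.2, H⟩
  rintro v6 f53 hF6
  have h6 := h5.fr hF6 (mono _ (by simp))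
  have w43 : v6.reg 43 = k := by rw [hF6.reg 43 (by simp), t43]
  have w47 : v6.reg 47 = c := by
    rw [hF6.reg 47 (by simp), hF5.reg 47 (by simp), hF4.reg 47 (by simp), hF3.reg 47 (by simp), q47]
  rw [← hF5.reg 51 (by simp), ← hF6.reg 51 (by simp)] at f51
  rw [← hF4.reg 50 (by simp), ← hF5.reg 50 (by simp), ← hF6.reg 50 (by simp)] at f50
  rw [← hF6.reg 52 (by simp)] at f52
  have m17 : v6.mem 17 = u.mem 17 := by
    rw [hF6.mem 17 (by simp), hF5.mem 17 (by simp), hF4.mem 17 (by simp), hF3.mem 17 (by simp),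
      hF2.mem 17 (by simp), hF1.mem 17 (by simp)]
  have hvar : ∀ {x p}, Flag (v6.reg x) p → EFlag S v6 (.var x) p := fun hf =>
    .of (by omega) (by simp) hf
  have hS1 : 1 ≤ S := by omega
  have E2 := (EFlag.lt (S := S) (u := v6) (e := .var 47) (f := .var 42) hS1 (by simp) (by simp)).and
    (((hvar h6.r40).and ((hvar f50).not.and (hvar f51).not)).or ((hvar h6.r40).not.and
      (((EFlag.eq (S := S) (u := v6) (e := .var 47) (f := 0) hS1 (by simp) (by simp)).and
        ((hvar f52).and (hvar f53).not)).or
      ((EFlag.eq (S := S) (u := v6) (e := .var 47) (f := 1) hS1 (by simp) (by simp; omega)).and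
        ((hvar f52).not.and (hvar h6.r41))))))
  refine (Wp.st (by simp [w43, h6.r3, w47]; omega) E2.ok ?_).time (by simp)
  have hadr : (Ex.var 43 * Ex.var 3 + Ex.var 47).eval v6 = k * M + c := by simp [w43, h6.r3, w47]
  simp only [setMem_mem, Function.update_self, hadr, m17]
  congr 1
  rw [← Flag.eq_ite]
  refine E2.flag.congr ?_
  simp only [Ex.eval_var, Ex.eval_ofNat, w47, h6.r42, Entry]
  by_cases hcq : c < q
  · by_cases hT : T'.Nonempty
    · have : i1 = c / cnt := by
        rw [hi1, if_pos]
        rw [hq, width, if_pos hT] at hcq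
        exact Nat.div_lt_of_lt_mul hcq
      rw [this]
      simp only [hcq, hT, true_and, not_true_eq_false, false_and, or_false]
      refine and_congr_right fun _ => not_congr ⟨?_, ?_⟩
      · rintro ⟨a, b, ⟨h1, h2⟩, ⟨h3, h4⟩, h5⟩
        exact ⟨a, h1, b, h3, h2, h4, h5⟩
      · rintro ⟨a, h1, b, h3, h2, h4, h5⟩
        exact ⟨a, b, ⟨h1, h2⟩, ⟨h3, h4⟩, h5⟩
    · simp only [hcq, hT, true_and, false_and, not_false_eq_true, false_or]
      have e : (∃ a b, a ∈ F k ∧ b ∈ F k ∧ ¬ Joined G (F k) a b) ↔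
          ∃ a ∈ F k, ∃ b ∈ F k, ¬ Joined G (F k) a b :=
        ⟨fun ⟨a, b, h1, h2, h3⟩ => ⟨a, h1, b, h2, h3⟩, fun ⟨a, h1, b, h2, h3⟩ => ⟨a, b, h1, h2, h3⟩⟩
      rw [e]
      rfl
  · simp only [hcq, false_and]

/-- Compute the vectors of the sets. -/
def vecProg : Prog := for2 43 1 47 3 entryProg

theorem vecProg_wp {u : Store} {n N : ℕ} {G : SimpleGraph (Fin n)} {A T' : Finset (Fin n)}
    {t : ℕ → Finset (Fin n)} {cnt q M : ℕ} {F : ℕ → Finset (Fin n)}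
    (h : Tables u N G A T' t cnt q M F) {S : ℕ} (hq : q = width cnt T'.Nonempty) (hn : 1 ≤ n)
    (hcnt : 1 ≤ cnt) (hS : N * n + N * M + cnt * n + n + M + 3 ≤ S) :
    Wp S vecProg (N * (M * (n * (n * 200 + 200) + 405) + 8) + 3) u fun v =>
      ∀ k < N, ∀ c < M, Flag (v.mem 17 (k * M + c)) (Entry G A T' t cnt q (F k) c) := by
  classical
  refine Wp.fill2_of (a := 17) h.r1 h.r3 (by constructor <;> simp) (n * (n * 200 + 200) + 400)
    (fun k c => k * M + c) (fun k c => if Entry G A T' t cnt q (F k) c then 1 else 0)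
    (fun I hI J hJ I' hI' J' hJ' e => idx_inj hJ hJ' e) ?_ ?_
  · intro k hk c hc v hF h43 h47 _ _
    have hv := h.fr hF fun _ => id
    obtain ⟨b, hb, hW⟩ := entryProg_wp hv hq hn hcnt hS hk hc h43 h47
    rwa [hb.eq_ite] at hW
  · exact fun v _ hv _ k hk c hc => .of_ite (hv k hk c hc)

end WordRAM

/-! ### Assembly of the matrix of vectors. -/

namespace WordRAM

open Elim

open Classical in
/-- The vector of `X`. -/
noncomputable def entryVec {n : ℕ} (G : SimpleGraph (Fin n)) (A T' : Finset (Fin n))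
    (t : ℕ → Finset (Fin n)) (cnt q : ℕ) (X : Finset (Fin n)) : Vec := fun c =>
  if Entry G A T' t cnt q X c then 1 else 0

theorem Lists.eq_card {f : ℕ → ℕ} {n cnt : ℕ} {D : Finset (Finset (Fin n))}
    (h : Lists f n cnt (D : Set (Finset (Fin n)))) : cnt = D.card := by
  have := h.inj.ncard_image
  rw [h.image, Set.ncard_coe_finset] at this
  rw [this]
  simp [← Finset.coe_Iio, Set.ncard_coe_finset]

theorem _root_.Elim.Selection.congr {V V' : ℕ → Vec} {key key' : ℕ → ℚ} {f : ℕ → ℕ} {k next : ℕ}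
    (h : Selection V key f k next) (hV : ∀ m < next, V' m = V m)
    (hk : ∀ m < next, key' m = key m) : Selection V' key' f k next := by
  refine ⟨h.lt, h.inj, fun m hm => ?_⟩
  rw [hV m hm]
  refine Submodule.span_mono ?_ (h.span m hm)
  rintro x ⟨i, hi, h1, h2⟩
  exact ⟨i, hi, by rwa [hk _ (h.lt i hi), hk m hm], by rw [hV _ (h.lt i hi), h2]⟩

/-- Compute the vectors and the weights of the sets. -/
def prepareProg : Prog :=
  listProg ;; traceProg ;; sizeProg ;; labelProg ;; hitProg ;; weightProg ;; vecProg

theorem traces_card_pos {n : ℕ} (G : SimpleGraph (Fin n)) (A : Finset (Fin n)) :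
    1 ≤ (traces G A).card :=
  Finset.card_pos.2 ⟨_, Finset.mem_image_of_mem _ (Finset.empty_mem_powerset _)⟩

/-- Two terms dominate: comparing each candidate for a trace with the whole list, and the double
loops for each bit of each vector. The rest is absorbed because `n`, `cnt` and `q` are positive. -/
theorem prepareProg_time {n N cnt q : ℕ} (hn : 1 ≤ n) (hcnt : 1 ≤ cnt) (hq : 1 ≤ q) :
    n * (cnt * (100 * (cnt + 1) * n + 60 * cnt + 55) + 30) + 20 * n + 20 +
      ((n * (n * 40 + 20) + 3) + ((n * 50 + cnt * cnt * 50 + 200) +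
    ((N * (n * (150 * n + 35) + 8) + 3) + ((N * (n * (n * 80 + 25) + 8) + 3) +
      ((N * (n * 25 + 15) + 3) + (N * (2 * q * (n * (n * 200 + 200) + 405) + 8) + 3)))))) ≤
    2000 * (cnt * n * (cnt * n) + N * (q * (n * n))) := by
  have m1 : cnt ≤ cnt * n := Nat.le_mul_of_pos_right _ hn
  have m2 : n ≤ cnt * n := Nat.le_mul_of_pos_left _ hcnt
  have m3 : cnt * cnt ≤ cnt * n * (cnt * n) := Nat.mul_le_mul m1 m1
  have m4 : n * n ≤ cnt * n * (cnt * n) := Nat.mul_le_mul m2 m2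
  have m5 : n ≤ n * n := Nat.le_mul_self n
  have m6 : n * n ≤ q * (n * n) := Nat.le_mul_of_pos_left _ hq
  have e1 : n * (cnt * (100 * (cnt + 1) * n + 60 * cnt + 55) + 30) ≤
      345 * (cnt * n * (cnt * n)) := by
    have h1 : 100 * (cnt + 1) * n + 60 * cnt + 55 ≤ 315 * (cnt * n) := by
      have : 100 * (cnt + 1) * n = 100 * (cnt * n) + 100 * n := by ring
      omega
    have h2 : cnt * (100 * (cnt + 1) * n + 60 * cnt + 55) + 30 ≤ cnt * (345 * (cnt * n)) := by
      have h3 := Nat.mul_le_mul_left cnt h1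
      have h4 : 1 ≤ cnt * (cnt * n) := Nat.mul_pos hcnt (by omega)
      have h5 : cnt * (345 * (cnt * n)) = 345 * (cnt * (cnt * n)) := by ring
      have h6 : cnt * (315 * (cnt * n)) = 315 * (cnt * (cnt * n)) := by ring
      omega
    calc _ ≤ n * (cnt * (345 * (cnt * n))) := Nat.mul_le_mul_left _ h2
      _ = _ := by ring
  have e2 : n * (n * 40 + 20) = 40 * (n * n) + 20 * n := by ring
  have e3 : N * (n * (150 * n + 35) + 8) ≤ N * (193 * (q * (n * n))) := by
    refine Nat.mul_le_mul_left _ ?_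
    have : n * (150 * n + 35) = 150 * (n * n) + 35 * n := by ring
    omega
  have e4 : N * (n * (n * 80 + 25) + 8) ≤ N * (113 * (q * (n * n))) := by
    refine Nat.mul_le_mul_left _ ?_
    have : n * (n * 80 + 25) = 80 * (n * n) + 25 * n := by ring
    omega
  have e5 : N * (n * 25 + 15) ≤ N * (40 * (q * (n * n))) := by
    refine Nat.mul_le_mul_left _ ?_
    omega
  have e6 : N * (2 * q * (n * (n * 200 + 200) + 405) + 8) ≤ N * (1618 * (q * (n * n))) := by
    refine Nat.mul_le_mul_left _ ?_
    have h1 : n * (n * 200 + 200) + 405 ≤ 805 * (n * n) := by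
      have : n * (n * 200 + 200) = 200 * (n * n) + 200 * n := by ring
      omega
    have h2 := Nat.mul_le_mul_left (2 * q) h1
    have h3 : 2 * q * (805 * (n * n)) = 1610 * (q * (n * n)) := by ring
    rw [h3] at h2
    exact (Nat.add_le_add_right h2 8).trans (by omega)
  have e7 : ∀ c : ℕ, N * (c * (q * (n * n))) = c * (N * (q * (n * n))) := fun c => by ring
  rw [e7] at e3 e4 e5 e6
  omega

theorem prepareProg_wp {u : Store} {n N : ℕ} {G : SimpleGraph (Fin n)} {w : Fin n → ℚ}
    {A R' T' : Finset (Fin n)} {F : ℕ → Finset (Fin n)} (h : Inp u N G w A R' F) {S cnt q B : ℕ}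
    (hn : 1 ≤ n) (hT' : T' = trace G A R') (hcnt : cnt = (traces G A).card)
    (hq : q = width cnt T'.Nonempty) (hB : B = n + N + q + cnt + 1) (hS : 50 * (B * B) ≤ S) :
    Wp S prepareProg (2000 * (cnt * n * (cnt * n) + N * (q * (n * n)))) u fun v => ∃ t κ M,
      Set.InjOn t (Set.Iio cnt) ∧ t '' Set.Iio cnt = (traces G A : Set (Finset (Fin n))) ∧
      Params v A T' cnt κ M ∧ Inp v N G w A R' F ∧ v.mem 4 = u.mem 4 ∧
      (∀ x < N * M, v.mem 17 x ≤ 1) ∧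
      (∀ k < N, rowVec (v.mem 17) M k = entryVec G A T' t cnt q (F k)) ∧
      ∀ k < N, v.wmem 1 k = ∑ a ∈ F k, w a := by
  have hc1 : 1 ≤ cnt := hcnt ▸ traces_card_pos G A
  have hcc : 1 ≤ cnt * cnt := Nat.mul_pos hc1 hc1
  have hq1 : 1 ≤ q := by rw [hq, width]; split_ifs <;> omega
  have p1 : n * n ≤ B * B := Nat.mul_le_mul (by omega) (by omega)
  have p2 : cnt * n ≤ B * B := Nat.mul_le_mul (by omega) (by omega)
  have p3 : N * n ≤ B * B := Nat.mul_le_mul (by omega) (by omega)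
  have p4 : N * q ≤ B * B := Nat.mul_le_mul (by omega) (by omega)
  have p5 : cnt * cnt ≤ B * B := Nat.mul_le_mul (by omega) (by omega)
  have p6 : B ≤ B * B := Nat.le_mul_self B
  have p7 : (cnt + 1) * n = cnt * n + n := by ring
  refine (Wp.seq (listProg_wp (S := S) (D := cnt) h (hcnt ▸ le_rfl) (by omega)) ?_).time
    (prepareProg_time hn hc1 hq1)
  rintro v1 ⟨-, -, a2⟩ hF1
  have h1 := h.fr (by constructor <;> simp) hF1
  have r31 : v1.reg 31 = cnt := hcnt ▸ a2.eq_card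
  rw [r31] at a2
  refine Wp.seq (traceProg_wp h1 (by omega)) ?_
  rintro v2 b1 hF2
  rw [← hT'] at b1
  have h2 := h1.fr (by constructor <;> simp) hF2
  refine Wp.seq (sizeProg_wp h2 b1 (by rw [hF2.reg 31 (by simp), r31]) hc1 le_rfl (by omega)) ?_
  rintro v3 ⟨κ, M, hP⟩ hF3
  have h3 := h2.fr (by constructor <;> simp) hF3
  have hM2 : M ≤ 2 * q := hq ▸ hP.le_two
  have hqM : q ≤ M := hq ▸ hP.le
  have hNM : N * M ≤ 2 * (N * q) := by
    calc N * M ≤ N * (2 * q) := Nat.mul_le_mul_left _ hM2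
      _ = _ := by ring
  refine Wp.seq (labelProg_wp h3 (by omega)) ?_
  rintro v4 d1 hF4
  have h4 := h3.fr (by constructor <;> simp) hF4
  refine Wp.seq (hitProg_wp h4 (by omega) (T' := T')
    (by rw [hF4.mem 11 (by simp), hF3.mem 11 (by simp)]; exact b1) d1) ?_
  rintro v5 e1 hF5
  have h5 := h4.fr (by constructor <;> simp) hF5
  refine Wp.seq (weightProg_wp h5 (by omega)) ?_
  rintro v6 f1 hF6
  have h6 := h5.fr (by constructor <;> simp) hF6
  have hP6 : Params v6 A T' cnt κ M := by
    constructor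
    · rw [hF6.reg 40 (by simp), hF5.reg 40 (by simp), hF4.reg 40 (by simp)]; exact hP.hits
    · rw [hF6.reg 41 (by simp), hF5.reg 41 (by simp), hF4.reg 41 (by simp)]; exact hP.notFull
    · rw [hF6.reg 42 (by simp), hF5.reg 42 (by simp), hF4.reg 42 (by simp)]; exact hP.wid
    · rw [hF6.reg 3 (by simp), hF5.reg 3 (by simp), hF4.reg 3 (by simp)]; exact hP.r3
    · rw [hF6.reg 4 (by simp), hF5.reg 4 (by simp), hF4.reg 4 (by simp)]; exact hP.r4
    · rw [hF6.reg 5 (by simp), hF5.reg 5 (by simp), hF4.reg 5 (by simp)]; exact hP.r5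
    · exact hP.pow
    · exact hP.le
    · exact hP.le_two
  have m10 : v6.mem 10 = v1.mem 10 := by
    rw [hF6.mem 10 (by simp), hF5.mem 10 (by simp), hF4.mem 10 (by simp), hF3.mem 10 (by simp),
      hF2.mem 10 (by simp)]
  have hT : Tables v6 N G A T' (bitSet (v1.mem 10) n) cnt q M F :=
    { r0 := h6.r0
      r1 := h6.r1
      r3 := hP6.r3
      r31 := by
        rw [hF6.reg 31 (by simp), hF5.reg 31 (by simp), hF4.reg 31 (by simp), hF3.reg 31 (by simp),
          hF2.reg 31 (by simp), r31]
      r40 := hP6.hits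
      r41 := hP6.notFull
      r42 := by rw [hP6.wid, hq]
      fam := h6.fam
      list := fun i hi a => by
        rw [m10]
        exact (Flag.self (a2.bit i hi a a.2)).congr mem_bitSet.symm
      labels := fun k hk a b => by
        rw [hF6.mem 12 (by simp), hF5.mem 12 (by simp)]
        exact (d1 k hk).iff a b
      hit := by
        rw [hF6.mem 15 (by simp)]
        exact e1 }
  refine ((vecProg_wp hT hq hn hc1 (by omega)).frame.time (by gcongr)).post ?_
  rintro v7 ⟨g1, hF7⟩
  have hkeep : Keeps vecProg := by constructor <;> simp [vecProg]
  refine ⟨bitSet (v1.mem 10) n, κ, M, a2.inj, a2.image, ?_, h6.fr hkeep hF7, ?_, ?_, ?_, ?_⟩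
  · constructor
    · rw [hF7.reg 40 (by simp [vecProg])]; exact hP6.hits
    · rw [hF7.reg 41 (by simp [vecProg])]; exact hP6.notFull
    · rw [hF7.reg 42 (by simp [vecProg])]; exact hP6.wid
    · rw [hF7.reg 3 (by simp [vecProg])]; exact hP6.r3
    · rw [hF7.reg 4 (by simp [vecProg])]; exact hP6.r4
    · rw [hF7.reg 5 (by simp [vecProg])]; exact hP6.r5
    · exact hP.pow
    · exact hP.le
    · exact hP.le_two
  · rw [hF7.mem 4 (by simp [vecProg]), hF6.mem 4 (by simp), hF5.mem 4 (by simp),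
      hF4.mem 4 (by simp), hF3.mem 4 (by simp), hF2.mem 4 (by simp), hF1.mem 4 (by simp)]
  · intro x hx
    have hM : 0 < M := by omega
    have := (g1 (x / M) (Nat.div_lt_of_lt_mul (by rwa [mul_comm])) (x % M)
      (Nat.mod_lt _ hM)).le_one
    rwa [Nat.div_add_mod'] at this
  · intro k hk
    funext c
    simp only [rowVec, entryVec]
    by_cases hc : c < M
    · classical
      rw [if_pos hc, (g1 k hk c hc).eq_ite]
      split_ifs <;> simp
    -- Beyond the matrix both vectors vanish, as an `Entry` requires `c < q ≤ M`.
    · rw [if_neg hc, if_neg fun H => hc (H.1.trans_le hqM)]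
  · intro k hk
    rw [hF7.wmem 1 (by simp [vecProg]), f1 k hk]

end WordRAM

/-! ### The program that selects a representing subfamily. -/

namespace WordRAM

open Elim

/-- Compute a representative subfamily of the family in memory 4. -/
def representProg (P : Prog) (o : Opt) : Prog :=
  prepareProg ;; asg 6 (.var 40 * (.var 1 - (.var 1 - .var 42))) ;;
  forP 35 6 (st 20 (.var 35) (.var 35)) ;; selectProg P o ;;
  for2 16 6 17 0 (st 5 (.var 16 * .var 0 + .var 17)
    (.ld 4 (.ld 20 (.var 16) * .var 0 + .var 17))) ;; asg 2 (.var 6)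

/-- An incomplete batch costs as much as a full one and has to be charged to the family. If vectors
remain after a start with `min N q` of them, then `q < N` and so `M < 2 * N`; if the start is empty,
then `M ≤ 4`. -/
theorem rounds_mul_le {N k M q : ℕ} (hM : 1 ≤ M) (hMq : M ≤ 2 * q)
    (h : k = min N q ∨ k = 0 ∧ q ≤ 2) : (N - k + (M - 1)) / M * M ≤ 4 * N := by
  have h1 := Nat.div_mul_le_self (N - k + (M - 1)) M
  by_cases h0 : N - k = 0
  · rw [h0, zero_add, Nat.div_eq_of_lt (by omega)]
    omega
  · omega

/-- By `rounds_mul_le`, the total cost of the rounds is charged to the `N` members: each pays for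
one row of an elimination, up to a constant. The selected numbers finally serve to copy members of
the family to memory 5. -/
theorem representProg_wp {P : Prog} {c₀ : ℕ} {time : ℕ → ℕ} (hP : Multiplies P c₀ time) {o : Opt}
    {u : Store} {n N : ℕ} {G : SimpleGraph (Fin n)} {w : Fin n → ℚ}
    {A R' T' : Finset (Fin n)} {F : ℕ → Finset (Fin n)} (h : Inp u N G w A R' F)
    {S cnt q B L E : ℕ} (hn : 1 ≤ n) (hT' : T' = trace G A R') (hcnt : cnt = (traces G A).card)
    (hq : q = width cnt T'.Nonempty) (hB : B = n + N + q + cnt + 1) (hS : 50 * (B * B) ≤ S)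
    (hS' : (2 * q + 1) ^ c₀ ≤ S) (hL : 2 * q < 2 ^ (L + 1))
    (hE : ∀ κ, 2 ^ κ ≤ 2 * q → ∀ t ≤ κ, 2 ^ κ / 2 ^ t * time (2 ^ t) ≤ 2 ^ t * E) :
    Wp S (representProg P o) (2000 * (cnt * n * (cnt * n) + N * (q * (n * n))) +
      N * (4 * ((L + 2) * (4600 * q + 4 * E)) + 20 * n + 50) + 100) u fun v =>
      ∃ t : ℕ → Finset (Fin n),
      Set.InjOn t (Set.Iio cnt) ∧ t '' Set.Iio cnt = (traces G A : Set (Finset (Fin n))) ∧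
      ∃ (sel : ℕ → ℕ) (len : ℕ), v.reg 2 = len ∧
        (∀ i < len, ∀ a < n, v.mem 5 (i * n + a) = u.mem 4 (sel i * n + a)) ∧
        Selection (fun k => entryVec G A T' t cnt q (F k)) (fun k => sortKey o (∑ a ∈ F k, w a))
          sel len N ∧
        (len = N ∧ N ≤ q ∧ T'.Nonempty ∨
          LinearIndependent (ZMod 2) fun i : Fin len => entryVec G A T' t cnt q (F (sel i))) := by
  have hc1 : 1 ≤ cnt := hcnt ▸ traces_card_pos G A
  have hcc : 1 ≤ cnt * cnt := Nat.mul_pos hc1 hc1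
  have hq1 : 1 ≤ q := by rw [hq, width]; split_ifs <;> omega
  have p3 : N * n ≤ B * B := Nat.mul_le_mul (by omega) (by omega)
  have p4 : N * q ≤ B * B := Nat.mul_le_mul (by omega) (by omega)
  have p5 : q * q ≤ B * B := Nat.mul_le_mul (by omega) (by omega)
  have p6 : B ≤ B * B := Nat.le_mul_self B
  refine (Wp.seq (prepareProg_wp h hn hT' hcnt hq hB hS) (T' := 10 + ((N * 8 + 3) +
    ((4 * (N * ((L + 2) * (4600 * q + 4 * E) + 5)) + 15) + ((N * (n * 20 + 8) + 3) + 2)))) ?_).time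
    (by
      have e1 : N * (4 * ((L + 2) * (4600 * q + 4 * E)) + 20 * n + 50) =
        4 * (N * ((L + 2) * (4600 * q + 4 * E))) + 20 * (N * n) + 50 * N := by ring
      have e2 : N * ((L + 2) * (4600 * q + 4 * E) + 5) =
        N * ((L + 2) * (4600 * q + 4 * E)) + 5 * N := by ring
      have e3 : N * (n * 20 + 8) = 20 * (N * n) + 8 * N := by ring
      rw [e1, e2, e3]
      omega)
  rintro v1 ⟨t, κ, M, t1, t2, hPar, h1, m4, hbit, hrow, hw⟩ hF1
  have hM2 : M ≤ 2 * q := hq ▸ hPar.le_two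
  have hqM : q ≤ M := hq ▸ hPar.le
  have hNM : N * M ≤ 2 * (N * q) := by
    calc N * M ≤ N * (2 * q) := Nat.mul_le_mul_left _ hM2
      _ = _ := by ring
  have hMM : M * M ≤ 4 * (q * q) := by
    calc M * M ≤ (2 * q) * (2 * q) := Nat.mul_le_mul hM2 hM2
      _ = _ := by ring
  have hκL : κ ≤ L := by
    rw [hPar.pow] at hM2
    exact Nat.lt_succ_iff.1 ((Nat.pow_lt_pow_iff_right (by norm_num)).1 (hM2.trans_lt hL))
  -- For nonempty `T'`, the first `min N q` members are a free start, which avoids paying for a full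
  -- batch when the family is small. For empty `T'` the start is empty, because the required size
  -- bound can be smaller than the width 2 and only elimination enforces it.
  obtain ⟨kc, hkc, hkcN, hkcM, hkc', hkc''⟩ : ∃ kc, v1.reg 40 * (N - (N - q)) = kc ∧ kc ≤ N ∧ kc ≤ M ∧
      (kc = min N q ∨ kc = 0 ∧ q ≤ 2) ∧ (kc = N → N ≤ q ∧ T'.Nonempty ∨ N = 0) := by
    refine ⟨_, rfl, ?_⟩
    rcases hPar.hits with ⟨e, he⟩ | ⟨e, he⟩
    · rw [e, one_mul]
      refine ⟨by omega, by omega, .inl (by omega), fun _ => .inl ⟨by omega, he⟩⟩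
    · rw [e, zero_mul]
      refine ⟨by omega, by omega, .inr ⟨rfl, ?_⟩, fun h0 => .inr h0.symm⟩
      rw [hq, width, if_neg he]
  refine Wp.seq (T := 10) (R := fun v => v = v1.setReg 6 kc) ((Wp.asg (by
    simp only [Ex.ok_mul, Ex.ok_sub, Ex.ok_var, true_and, Ex.eval_sub, Ex.eval_var,
      h1.r1, hPar.wid, ← hq, hkc]
    omega) (by simp [h1.r1, hPar.wid, ← hq, hkc])).time (by simp)) ?_
  rintro v2 hv2 hF2
  have e6 : v2.reg 6 = kc := by simp [hv2]
  refine Wp.seq (T := N * 8 + 3) (R := fun v => ∀ i < kc, v.mem 20 i = i)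
    ((Wp.fill1_of (a := 20) (M := kc) e6 (by simp) (by simp) (by simp) 3 0 (fun i => i)
    (fun J hJ v hF h35 _ _ => (Wp.st (by simp) (by simp) (by simp [h35])).time (by simp))
    fun v _ hv _ i hi => by simpa using hv i hi).time (by
      have := Nat.mul_le_mul_right 8 hkcN
      omega)) ?_
  rintro v3 h3 hF3
  have r3 : ∀ x, x ≠ 6 → x ≠ 35 → v3.reg x = v1.reg x := fun x hx hx' => by
    rw [hF3.reg x (by simp [hx']), hF2.reg x (by simp [hx])]
  have m3 : ∀ x, x ≠ 20 → v3.mem x = v1.mem x := fun x hx => by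
    rw [hF3.mem x (by simp [hx]), hF2.mem x (by simp)]
  have w3 : v3.wmem 1 = v1.wmem 1 := by rw [hF3.wmem 1 (by simp), hF2.wmem 1 (by simp)]
  have hsel := selectProg_wp hP (o := o) (S := S) (E := E) (u := v3) (N := N) (M := M) (R := 2 * M)
    (κ := κ) (k := kc) (by rw [r3 1 (by simp) (by simp), h1.r1])
    (by rw [r3 3 (by simp) (by simp), hPar.r3]) (by rw [r3 4 (by simp) (by simp), hPar.r4])
    (by rw [r3 5 (by simp) (by simp), hPar.r5]) (by rw [hF3.reg 6 (by simp), e6]) hPar.pow rfl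
    (by
      have : 2 * (2 * M) * M = 4 * (M * M) := by ring
      omega)
    ((Nat.pow_le_pow_left (by omega) _).trans hS') (by omega)
    (by rw [hPar.pow]; exact hE κ (by rw [← hPar.pow]; exact hM2))
    (by rw [m3 17 (by simp)]; exact hbit) hkcN hkcM h3
  rw [m3 17 (by simp), w3] at hsel
  refine Wp.seq (hsel.time ?_) ?_
  · have hit := rounds_mul_le (by omega : 1 ≤ M) hM2 hkc'
    refine Nat.add_le_add_right ?_ 15
    have hX : (κ + 2) * (2300 * M + 4 * E) ≤ (L + 2) * (4600 * q + 4 * E) :=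
      Nat.mul_le_mul (by omega) (by omega)
    set it := (N - kc + (M - 1)) / M
    have h5 : M * ((κ + 2) * (2300 * M + 4 * E)) + 5 ≤
        M * ((L + 2) * (4600 * q + 4 * E) + 5) := by
      have := Nat.mul_le_mul_left M hX
      rw [mul_add M _ 5]
      omega
    calc _ ≤ it * (M * ((L + 2) * (4600 * q + 4 * E) + 5)) := Nat.mul_le_mul_left _ h5
      _ = it * M * ((L + 2) * (4600 * q + 4 * E) + 5) := by ring
      _ ≤ 4 * N * ((L + 2) * (4600 * q + 4 * E) + 5) := Nat.mul_le_mul_right _ hit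
      _ = _ := by ring
  rintro v4 ⟨s1, s2⟩ hF4
  have hlen : v4.reg 6 ≤ N := by
    have := Finset.card_le_card_of_injOn (s := Finset.range (v4.reg 6)) (t := Finset.range N)
      (v4.mem 20) (fun i hi => by simpa using s1.lt i (by simpa using hi)) (by
        intro i hi j hj hij
        exact s1.inj (by simpa using hi) (by simpa using hj) hij)
    simpa using this
  have r40 : v4.reg 0 = n := by
    rw [hF4.reg 0 (not_uw_selectProg_reg P o (by simp)), r3 0 (by simp) (by simp), h1.r0]
  have m44 : v4.mem 4 = u.mem 4 := by
    rw [hF4.mem 4 (not_uw_selectProg_mem P o (by simp)), m3 4 (by simp), m4]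
  have hNn : ∀ i < N, i * n + n ≤ N * n := fun i hi => by nlinarith
  refine Wp.seq (T := N * (n * 20 + 8) + 3) (R := fun v =>
    (∀ i < v4.reg 6, ∀ a < n, v.mem 5 (i * n + a) = u.mem 4 (v4.mem 20 i * n + a)) ∧
    v.reg 6 = v4.reg 6) ((Wp.fill2_of (a := 5) rfl r40 (by constructor <;> simp) 15
      (fun i a => i * n + a) (fun i a => u.mem 4 (v4.mem 20 i * n + a))
      (fun I hI J hJ I' hI' J' hJ' e => idx_inj hJ hJ' e) (fun i hi a ha v hF h16 h17 _ _ => ?_)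
      fun v hF hv _ => ⟨hv, hF.reg 6 (by simp)⟩).time (by gcongr)) ?_
  · have i1 := hNn i (by omega)
    have i2 := hNn (v4.mem 20 i) (s1.lt i hi)
    have m20 : v.mem 20 = v4.mem 20 := hF.mem 20 (by simp)
    have r0 : v.reg 0 = n := by rw [hF.reg 0 (by simp), r40]
    have m4' : v.mem 4 = u.mem 4 := by rw [hF.mem 4 (by simp), m44]
    refine (Wp.st (by simp [h16, h17, r0]; omega) (by simp [h16, h17, r0, m20]; omega) ?_).time
      (by simp)
    simp [h16, h17, r0, m20, m4']
  rintro v5 ⟨g1, g2⟩ hF5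
  refine Wp.asg (by simp) ⟨t, t1, t2, v4.mem 20, v4.reg 6, by simp [g2], by simpa using g1, ?_, ?_⟩
  · exact s1.congr (fun m hm => (hrow m hm).symm) fun m hm => by rw [hw m hm]
  · have hr : (fun i : Fin (v4.reg 6) => entryVec G A T' t cnt q (F (v4.mem 20 i))) =
        fun i : Fin (v4.reg 6) => rowVec (v1.mem 17) M (v4.mem 20 i) := by
      funext i
      exact (hrow _ (s1.lt i i.2)).symm
    rw [hr]
    rcases s2 with ⟨e, e'⟩ | s2
    · rcases hkc'' e with ⟨h7, h8⟩ | h0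
      · exact .inl ⟨by omega, h7, h8⟩
      · right
        have : IsEmpty (Fin (v4.reg 6)) := by
          rw [e', e, h0]
          infer_instance
        exact linearIndependent_empty_type
    · exact .inr s2

end WordRAM

/-! ### Connectedness as a linear functional. -/

namespace WordRAM

open Elim

section Graph
variable {n : ℕ} {G : SimpleGraph (Fin n)}

theorem Joined.mono {X Y : Finset (Fin n)} (hXY : X ⊆ Y) {a b : Fin n} (h : Joined G X a b) :
    Joined G Y a b :=
  Relation.ReflTransGen.mono (fun _ _ h => ⟨hXY h.1, hXY h.2.1, h.2.2⟩) _ _ h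

theorem induce_connected_iff (W : Finset (Fin n)) : (G.induce {v | v ∈ W}).Connected ↔
    W.Nonempty ∧ ∀ a ∈ W, ∀ b ∈ W, Joined G W a b := by
  rw [SimpleGraph.connected_iff]
  constructor
  · rintro ⟨h1, ⟨a, ha⟩⟩
    refine ⟨⟨a, ha⟩, fun a ha b hb => ?_⟩
    have := (SimpleGraph.reachable_iff_reflTransGen _ _).1 (h1 ⟨a, ha⟩ ⟨b, hb⟩)
    refine Relation.ReflTransGen.lift (r := (G.induce {v | v ∈ W}).Adj) (fun v => v.1)
      (fun c d hcd => ?_) _ _ this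
    exact ⟨c.2, d.2, hcd⟩
  · rintro ⟨⟨a, ha⟩, h⟩
    refine ⟨fun a b => ?_, ⟨⟨a, ha⟩⟩⟩
    have key : ∀ c, Joined G W a c → ∀ hc : c ∈ W,
        (G.induce {v | v ∈ W}).Reachable a ⟨c, hc⟩ := by
      intro c hc
      induction hc with
      | refl => exact fun _ => .refl _
      | @tail b c _ h2 ih =>
        intro hc
        refine (ih h2.1).trans (SimpleGraph.Adj.reachable ?_)
        exact h2.2.2
    exact key b (h a a.2 b b.2) b.2

/-- `Z` is a union of components of `Y`, and no component of `X` has edges to both `Z` and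
`Y \ Z`. -/
def Splits (G : SimpleGraph (Fin n)) (A X Y Z : Finset (Fin n)) : Prop :=
  (∀ a b, Linked G Y a b → a ∈ Z → b ∈ Z) ∧
    ¬ ∃ a ∈ X, ∃ b ∈ X, a ∈ trace G A Z ∧ b ∈ trace G A (Y \ Z) ∧ Joined G X a b

/-- A walk in `X ∪ Y` between `Z` and `Y \ Z` has to cross along an edge inside `Y` or through a
component of `X` with neighbours on both sides; `Splits` forbids precisely these two. -/
theorem splits_iff {A X Y Z : Finset (Fin n)} (hX : X ⊆ A) (hY : Y ⊆ Aᶜ) (hZ : Z ⊆ Y) :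
    Splits G A X Y Z ↔ ∀ a ∈ Z, ∀ b ∈ Y, Joined G (X ∪ Y) a b → b ∈ Z := by
  have hdisj : ∀ v ∈ X, v ∉ Y := fun v hv hv' => Finset.mem_compl.1 (hY hv') (hX hv)
  constructor
  · rintro ⟨h1, h2⟩ a ha b hb hab
    -- The second clause carries the induction through `X`: a vertex of `X` on the walk lies in a
    -- component of `X` with a neighbour in `Z`.
    have main : (b ∈ Y → b ∈ Z) ∧ (b ∈ X → ∃ c ∈ X, c ∈ trace G A Z ∧ Joined G X c b) := by
      clear hb
      induction hab with
      | refl => exact ⟨fun _ => ha, fun h => absurd (hZ ha) (hdisj _ h)⟩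
      | @tail b c _ hbc ih =>
        obtain ⟨hb, hc, hadj⟩ := hbc
        rcases Finset.mem_union.1 hb with hb | hb <;> rcases Finset.mem_union.1 hc with hc | hc
        · refine ⟨fun h => absurd h (hdisj _ hc), fun _ => ?_⟩
          obtain ⟨d, hd, h3, h4⟩ := ih.2 hb
          exact ⟨d, hd, h3, h4.tail ⟨hb, hc, hadj⟩⟩
        · refine ⟨fun _ => ?_, fun h => absurd hc (hdisj _ h)⟩
          obtain ⟨d, hd, h3, h4⟩ := ih.2 hb
          by_contra hcZ
          exact h2 ⟨d, hd, b, hb, h3, mem_trace.2 ⟨hX hb, c, Finset.mem_sdiff.2 ⟨hc, hcZ⟩,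
            hadj.symm⟩, h4⟩
        · exact ⟨fun h => absurd h (hdisj _ hc), fun _ =>
            ⟨c, hc, mem_trace.2 ⟨hX hc, b, ih.1 hb, hadj⟩, .refl⟩⟩
        · exact ⟨fun _ => h1 _ _ ⟨hb, hc, hadj⟩ (ih.1 hb), fun h => absurd hc (hdisj _ h)⟩
    exact main.1 hb
  · intro h
    refine ⟨fun a b hab ha => h a ha b hab.2.1 (.single
      ⟨Finset.mem_union_right _ hab.1, Finset.mem_union_right _ hab.2.1, hab.2.2⟩), ?_⟩
    rintro ⟨a, ha, b, hb, h1, h2, h3⟩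
    obtain ⟨-, z, hz, hza⟩ := mem_trace.1 h1
    obtain ⟨-, y, hy, hyb⟩ := mem_trace.1 h2
    obtain ⟨hyY, hyZ⟩ := Finset.mem_sdiff.1 hy
    refine hyZ (h z hz y hyY ?_)
    refine Relation.ReflTransGen.head (b := a) ⟨Finset.mem_union_right _ (hZ hz),
      Finset.mem_union_left _ ha, hza⟩ ?_
    exact (h3.mono Finset.subset_union_left).tail ⟨Finset.mem_union_left _ hb,
      Finset.mem_union_right _ hyY, hyb.symm⟩

open Classical in
/-- Connectedness is the parity of the number of cuts. -/
theorem card_splits {A X Y : Finset (Fin n)} (hX : X ⊆ A) (hY : Y ⊆ Aᶜ) {y : Fin n} (hy : y ∈ Y)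
    (hhit : ∀ a ∈ X, Hit G X (trace G A Y) a) :
    (∑ Z ∈ Y.powerset.filter (fun Z => y ∈ Z), if Splits G A X Y Z then (1 : ZMod 2) else 0) =
      if (G.induce {v | v ∈ X ∪ Y}).Connected then 1 else 0 := by
  rw [← Finset.sum_filter]
  have hmem : ∀ Z, Z ∈ (Y.powerset.filter fun Z => y ∈ Z).filter (fun Z => Splits G A X Y Z) ↔
      Z ⊆ Y ∧ y ∈ Z ∧ ∀ a ∈ Z, ∀ b ∈ Y, Joined G (X ∪ Y) a b → b ∈ Z := by
    intro Z
    simp only [Finset.mem_filter, Finset.mem_powerset, and_assoc]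
    exact and_congr_right fun h => by rw [splits_iff hX hY h]
  -- If all of `Y` is joined to `y`, then `Y` is the only cut and `hhit` attaches the components of
  -- `X`; otherwise the cuts are paired off.
  by_cases hc : ∀ b ∈ Y, Joined G (X ∪ Y) y b
  · have hall : ∀ a ∈ X ∪ Y, Joined G (X ∪ Y) y a := by
      intro a ha
      rcases Finset.mem_union.1 ha with ha | ha
      · obtain ⟨b, hb, h1, h2⟩ := hhit a ha
        obtain ⟨-, z, hz, hzb⟩ := mem_trace.1 h2
        refine (hc z hz).trans (.head ⟨Finset.mem_union_right _ hz, Finset.mem_union_left _ hb, hzb⟩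
          (h1.symm.mono Finset.subset_union_left))
      · exact hc a ha
    rw [if_pos ((induce_connected_iff _).2 ⟨⟨y, Finset.mem_union_right _ hy⟩,
      fun a ha b hb => (hall a ha).symm.trans (hall b hb)⟩)]
    have : (Y.powerset.filter fun Z => y ∈ Z).filter (fun Z => Splits G A X Y Z) = {Y} := by
      ext Z
      rw [hmem, Finset.mem_singleton]
      constructor
      · rintro ⟨h1, h2, h3⟩
        exact h1.antisymm fun b hb => h3 y h2 b hb (hc b hb)
      · rintro rfl
        exact ⟨subset_rfl, hy, fun _ _ _ h _ => h⟩
    rw [this, Finset.sum_singleton]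
  · rw [if_neg fun h => hc fun b hb => ((induce_connected_iff _).1 h).2 y
      (Finset.mem_union_right _ hy) b (Finset.mem_union_right _ hb)]
    push Not at hc
    obtain ⟨b, hb, hyb⟩ := hc
    set C := Y.filter fun a => ¬ Joined G (X ∪ Y) y a with hC
    have hyC : y ∉ C := fun h => (Finset.mem_filter.1 h).2 .refl
    have hbC : b ∈ C := Finset.mem_filter.2 ⟨hb, hyb⟩
    have hCc : ∀ a ∈ C, ∀ b ∈ Y, Joined G (X ∪ Y) a b → b ∈ C := fun a ha b hb hab =>
      Finset.mem_filter.2 ⟨hb, fun h => (Finset.mem_filter.1 ha).2 (h.trans hab.symm)⟩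
    -- Toggling `C`, the part of `Y` not joined to `y`, maps cuts to cuts and keeps `y`. It has no
    -- fixed point since `C` is nonempty, so the number of cuts is even.
    refine Finset.sum_involution (fun Z _ => symmDiff Z C) (fun _ _ => by decide)
      (fun Z _ _ h => ?_) (fun Z hZ => ?_) fun Z _ => by simp
    · have hCe : C = ∅ := by simpa using h
      rw [hCe] at hbC
      simp at hbC
    · rw [hmem] at hZ ⊢
      obtain ⟨h1, h2, h3⟩ := hZ
      refine ⟨fun a ha => ?_, ?_, fun a ha d hd had => ?_⟩
      · rcases Finset.mem_symmDiff.1 ha with h | h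
        · exact h1 h.1
        · exact (Finset.mem_filter.1 h.1).1
      · exact Finset.mem_symmDiff.2 (.inl ⟨h2, hyC⟩)
      · have haY : a ∈ Y := by
          rcases Finset.mem_symmDiff.1 ha with h | h
          · exact h1 h.1
          · exact (Finset.mem_filter.1 h.1).1
        rcases Finset.mem_symmDiff.1 ha with h | h
        · exact Finset.mem_symmDiff.2 (.inl ⟨h3 a h.1 d hd had, fun h' =>
            h.2 (hCc d h' a haY had.symm)⟩)
        · exact Finset.mem_symmDiff.2 (.inr ⟨hCc a h.1 d hd had, fun h' =>
            h.2 (h3 d h' a haY had.symm)⟩)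

open Classical in
/-- The functional that tells from the vector of `X` whether `X ∪ Y` is connected. -/
theorem exists_functional {A T' : Finset (Fin n)} {t : ℕ → Finset (Fin n)} {cnt q : ℕ}
    (ht : t '' Set.Iio cnt = (traces G A : Set (Finset (Fin n))))
    (hq : q = width cnt T'.Nonempty) {Y : Finset (Fin n)} (hY : Y ⊆ Aᶜ) (hYT : trace G A Y = T') :
    ∃ φ : Vec →ₗ[ZMod 2] ZMod 2, ∀ X ⊆ A, φ (entryVec G A T' t cnt q X) =
      if (G.induce {v | v ∈ X ∪ Y}).Connected then 1 else 0 := by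
  have hidx : ∀ Z, ∃ c, Z ⊆ Y → c < cnt ∧ t c = trace G A Z := by
    intro Z
    by_cases hZ : Z ⊆ Y
    · have : trace G A Z ∈ t '' Set.Iio cnt := by
        rw [ht]
        exact Finset.mem_coe.2 (Finset.mem_image_of_mem _ (Finset.mem_powerset.2 (hZ.trans hY)))
      obtain ⟨c, hc, h⟩ := this
      exact ⟨c, fun _ => ⟨hc, h⟩⟩
    · exact ⟨0, fun h => absurd h hZ⟩
  choose idx hidx using hidx
  by_cases hT : T'.Nonempty
  · obtain ⟨a0, ha0⟩ := hT
    rw [← hYT] at ha0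
    obtain ⟨-, y, hy, -⟩ := mem_trace.1 ha0
    have hT : T'.Nonempty := ⟨a0, hYT ▸ ha0⟩
    have hq' : q = cnt * cnt := by rw [hq, width, if_pos hT]
    -- The coefficient checks the half of `Splits` that concerns `Y` alone; the coordinate at the
    -- traces of `Z` and `Y \ Z` contributes the half that concerns `X`.
    refine ⟨∑ Z ∈ Y.powerset.filter (fun Z => y ∈ Z),
      (if ∀ a b, Linked G Y a b → a ∈ Z → b ∈ Z then (1 : ZMod 2) else 0) •
        LinearMap.proj (R := ZMod 2) (φ := fun _ : ℕ => ZMod 2) (idx Z * cnt + idx (Y \ Z)),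
      fun X hX => ?_⟩
    rw [LinearMap.sum_apply]
    by_cases hhit : ∀ a ∈ X, Hit G X (trace G A Y) a
    · rw [← card_splits hX hY hy hhit]
      refine Finset.sum_congr rfl fun Z hZ => ?_
      have hZY : Z ⊆ Y := Finset.mem_powerset.1 (Finset.mem_filter.1 hZ).1
      obtain ⟨i1, i2⟩ := hidx Z hZY
      obtain ⟨j1, j2⟩ := hidx (Y \ Z) Finset.sdiff_subset
      have d1 : (idx Z * cnt + idx (Y \ Z)) / cnt = idx Z := by
        rw [mul_comm, Nat.mul_add_div (by omega), Nat.div_eq_of_lt j1, add_zero]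
      have d2 : (idx Z * cnt + idx (Y \ Z)) % cnt = idx (Y \ Z) := by
        rw [mul_comm, Nat.mul_add_mod, Nat.mod_eq_of_lt j1]
      have hE : Entry G A T' t cnt q X (idx Z * cnt + idx (Y \ Z)) ↔
          ¬ ∃ a ∈ X, ∃ b ∈ X, a ∈ trace G A Z ∧ b ∈ trace G A (Y \ Z) ∧ Joined G X a b := by
        rw [Entry, d1, d2, i2, j2]
        have hlt : idx Z * cnt + idx (Y \ Z) < q := hq' ▸ idx_lt i1 j1
        have hno : ¬ ∃ a ∈ X, ¬ Hit G X T' a := by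
          rw [← hYT]
          push Not
          exact hhit
        constructor
        · rintro ⟨-, h | h⟩
          · exact h.2.2
          · exact absurd hT h.1
        · exact fun h => ⟨hlt, .inl ⟨hT, hno, h⟩⟩
      simp only [LinearMap.smul_apply, LinearMap.proj_apply, entryVec, smul_eq_mul]
      by_cases h1 : ∀ a b, Linked G Y a b → a ∈ Z → b ∈ Z
      · rw [if_pos h1, one_mul]
        exact if_congr (hE.trans ⟨fun h => ⟨h1, h⟩, fun h => h.2⟩) rfl rfl
      · rw [if_neg h1, zero_mul, if_neg fun h : Splits G A X Y Z => h1 h.1]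
    -- A component of `X` that misses `T'` makes the vector zero. It also has no edge to `Y`, so `y`
    -- cannot be reached from it.
    · push Not at hhit
      obtain ⟨a, ha, hna⟩ := hhit
      rw [if_neg, Finset.sum_eq_zero]
      · intro Z _
        have : ¬ Entry G A T' t cnt q X (idx Z * cnt + idx (Y \ Z)) := by
          rintro ⟨-, h | h⟩
          · exact h.2.1 ⟨a, ha, hYT ▸ hna⟩
          · exact h.1 hT
        have h0 : entryVec G A T' t cnt q X (idx Z * cnt + idx (Y \ Z)) = 0 := if_neg this
        rw [LinearMap.smul_apply, LinearMap.proj_apply, h0, smul_zero]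
      · intro hconn
        have hay := ((induce_connected_iff _).1 hconn).2 a (Finset.mem_union_left _ ha) y
          (Finset.mem_union_right _ hy)
        have key : ∀ b, Joined G (X ∪ Y) a b → b ∈ X ∧ Joined G X a b := by
          intro b hb
          induction hb with
          | refl => exact ⟨ha, .refl⟩
          | @tail b c _ h2 ih =>
            obtain ⟨-, hc, hadj⟩ := h2
            rcases Finset.mem_union.1 hc with hc | hc
            · exact ⟨hc, ih.2.tail ⟨ih.1, hc, hadj⟩⟩
            · exact absurd ⟨b, ih.1, ih.2, mem_trace.2 ⟨hX ih.1, c, hc, hadj.symm⟩⟩ hna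
        exact Finset.mem_compl.1 (hY hy) (hX (key y hay).1)
  -- Without edges between `X` and `Y`, their union can be connected only if one of them is empty.
  · have hq' : q = 2 := by rw [hq, width, if_neg hT]
    have hE0 : ∀ X, Entry G A T' t cnt q X 0 ↔
        X.Nonempty ∧ ∀ a ∈ X, ∀ b ∈ X, Joined G X a b := by
      intro X
      simp only [Entry, hq', hT, false_and, not_false_eq_true, true_and, false_or]
      constructor
      · rintro ⟨-, ⟨h1, h2⟩ | ⟨h, -⟩⟩
        · push Not at h2
          exact ⟨h1, h2⟩
        · omega
      · rintro ⟨h1, h2⟩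
        refine ⟨by norm_num, .inl ⟨h1, ?_⟩⟩
        push Not
        exact h2
    have hE1 : ∀ X, Entry G A T' t cnt q X 1 ↔ X = ∅ ∧ A ≠ Finset.univ := by
      intro X
      simp [Entry, hq', hT, Finset.not_nonempty_iff_eq_empty]
    rcases Y.eq_empty_or_nonempty with rfl | hYne
    · refine ⟨LinearMap.proj 0, fun X hX => ?_⟩
      simp only [LinearMap.proj_apply, entryVec, hE0, induce_connected_iff, Finset.union_empty]
    -- For nonempty `Y`, only the empty `X` can succeed, and then the answer depends on `Y` alone.
    · refine ⟨(if (G.induce {v | v ∈ Y}).Connected then (1 : ZMod 2) else 0) • LinearMap.proj 1,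
        fun X hX => ?_⟩
      have hA : A ≠ Finset.univ := by
        rintro rfl
        obtain ⟨y, hy⟩ := hYne
        simpa using hY hy
      simp only [LinearMap.smul_apply, LinearMap.proj_apply, entryVec, hE1, smul_eq_mul]
      rcases X.eq_empty_or_nonempty with rfl | hXne
      · rw [Finset.empty_union]
        simp [hA]
      · rw [if_neg (show ¬ (X = ∅ ∧ A ≠ Finset.univ) from fun h => hXne.ne_empty h.1), mul_zero,
          if_neg]
        intro hconn
        obtain ⟨a, ha⟩ := hXne
        obtain ⟨y, hy⟩ := hYne
        have hay := ((induce_connected_iff _).1 hconn).2 a (Finset.mem_union_left _ ha) y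
          (Finset.mem_union_right _ hy)
        have key : ∀ b, Joined G (X ∪ Y) a b → b ∈ X := by
          intro b hb
          induction hb with
          | refl => exact ha
          | @tail b c _ h2 ih =>
            obtain ⟨-, hc, hadj⟩ := h2
            rcases Finset.mem_union.1 hc with hc | hc
            · exact hc
            · exact absurd ⟨b, hYT ▸ mem_trace.2 ⟨hX ih, c, hc, hadj.symm⟩⟩ hT
        exact Finset.mem_compl.1 (hY hy) (hX (key y hay))

end Graph

end WordRAM

namespace WordRAM

open Elim

section Graph
variable {n : ℕ} {G : SimpleGraph (Fin n)}

/-! ## Representation and sizes -/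

/-- With threshold 1, the equivalence over `Aᶜ` records for each vertex of `A` just whether it has a
neighbour in the set, which is membership in the trace. -/
theorem trace_eq_of_neighborEquiv {A Y R' : Finset (Fin n)} (h : NeighborEquiv G 1 Aᶜ Y R') :
    trace G A Y = trace G A R' := by
  classical
  have key : ∀ Z : Finset (Fin n), ∀ v, (∃ y ∈ Z, G.Adj y v) ↔
      min 1 (Z.filter fun y => G.Adj v y).card = 1 := by
    intro Z v
    rw [show (∃ y ∈ Z, G.Adj y v) ↔ (Z.filter fun y => G.Adj v y).Nonempty by
      simp [Finset.Nonempty, G.adj_comm], ← Finset.card_pos]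
    omega
  ext v
  rw [mem_trace, mem_trace]
  refine and_congr_right fun hv => ?_
  rw [key, key]
  have := h v (by simpa using hv)
  convert Iff.of_eq (congrArg (· = 1) this)

/-- If the functional vanished on all selected vectors of key at most `key m`, its kernel would
contain their span and with it `V m`. -/
theorem _root_.Elim.Selection.exists_better {V : ℕ → Vec} {key : ℕ → ℚ} {f : ℕ → ℕ} {k N : ℕ}
    (h : Selection V key f k N) (φ : Vec →ₗ[ZMod 2] ZMod 2) {m : ℕ} (hm : m < N)
    (hφ : φ (V m) ≠ 0) : ∃ i < k, key (f i) ≤ key m ∧ φ (V (f i)) ≠ 0 := by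
  by_contra! H
  refine hφ (LinearMap.mem_ker.1 ((Submodule.span_le (p := LinearMap.ker φ)).2 ?_ (h.span m hm)))
  rintro x ⟨i, hi, h1, rfl⟩
  exact LinearMap.mem_ker.2 (H i hi h1)

theorem setWeight_le_of_sortKey_max {w : Fin n → ℚ} {X Y : Finset (Fin n)}
    (h : sortKey .max (∑ a ∈ Y, w a) ≤ sortKey .max (∑ a ∈ X, w a)) :
    setWeight w X ≤ setWeight w Y := by
  simp only [sortKey, neg_le_neg_iff] at h
  exact WithBot.coe_le_coe.2 (WithTop.coe_le_coe.2 h)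

theorem setWeight_le_of_sortKey_min {w : Fin n → ℚ} {X Y : Finset (Fin n)}
    (h : sortKey .min (∑ a ∈ Y, w a) ≤ sortKey .min (∑ a ∈ X, w a)) :
    setWeight w Y ≤ setWeight w X :=
  WithBot.coe_le_coe.2 (WithTop.coe_le_coe.2 h)

/-- Apply `exists_better` to the functional that tests connectedness with `Y`: a member that
completes `Y` yields a selected one that also completes `Y` and is no worse. The other inequality is
inclusion. -/
theorem represents_of_selection {o : Opt} {w : Fin n → ℚ} {A R' T' : Finset (Fin n)}
    {t : ℕ → Finset (Fin n)} {cnt q N len : ℕ} {F : ℕ → Finset (Fin n)} {sel : ℕ → ℕ}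
    (hT' : T' = trace G A R')
    (ht : t '' Set.Iio cnt = (traces G A : Set (Finset (Fin n))))
    (hq : q = width cnt T'.Nonempty) (hF : ∀ k < N, F k ⊆ A)
    (hsel : Selection (fun k => entryVec G A T' t cnt q (F k))
      (fun k => sortKey o (∑ a ∈ F k, w a)) sel len N) :
    Represents o G w A R' ((Finset.range len).image fun i => F (sel i))
      ((Finset.range N).image F) := by
  classical
  intro Y hY hYR
  obtain ⟨φ, hφ⟩ := exists_functional ht hq hY ((trace_eq_of_neighborEquiv hYR).trans hT'.symm)
  have hsub : (Finset.range len).image (fun i => F (sel i)) ⊆ (Finset.range N).image F := by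
    intro X hX
    obtain ⟨i, hi, rfl⟩ := Finset.mem_image.1 hX
    exact Finset.mem_image_of_mem _ (Finset.mem_range.2 (hsel.lt i (Finset.mem_range.1 hi)))
  have hbet : ∀ X ∈ (Finset.range N).image F, (G.induce {v | v ∈ X ∪ Y}).Connected →
      ∃ X' ∈ (Finset.range len).image (fun i => F (sel i)),
        (G.induce {v | v ∈ X' ∪ Y}).Connected ∧
        sortKey o (∑ a ∈ X', w a) ≤ sortKey o (∑ a ∈ X, w a) := by
    intro X hX hconn
    obtain ⟨k, hk, rfl⟩ := Finset.mem_image.1 hX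
    have hk := Finset.mem_range.1 hk
    obtain ⟨i, hi, h1, h2⟩ := hsel.exists_better φ hk (by
      rw [hφ _ (hF k hk), if_pos hconn]
      exact one_ne_zero)
    refine ⟨_, Finset.mem_image_of_mem _ (Finset.mem_range.2 hi), ?_, h1⟩
    by_contra hc
    rw [hφ _ (hF _ (hsel.lt i hi)), if_neg hc] at h2
    exact h2 rfl
  cases o with
  | max =>
    refine le_antisymm (Finset.sup_le fun X hX => ?_) (Finset.sup_mono (Finset.filter_subset_filter _ hsub))
    obtain ⟨hX1, hX2⟩ := Finset.mem_filter.1 hX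
    obtain ⟨X', h1, h2, h3⟩ := hbet X hX1 hX2
    exact (setWeight_le_of_sortKey_max h3).trans
      (Finset.le_sup (f := setWeight w) (Finset.mem_filter.2 ⟨h1, h2⟩))
  | min =>
    refine le_antisymm (Finset.inf_mono (Finset.filter_subset_filter _ hsub)) (Finset.le_inf fun X hX => ?_)
    obtain ⟨hX1, hX2⟩ := Finset.mem_filter.1 hX
    obtain ⟨X', h1, h2, h3⟩ := hbet X hX1 hX2
    exact (Finset.inf_le (f := setWeight w) (Finset.mem_filter.2 ⟨h1, h2⟩)).trans
      (setWeight_le_of_sortKey_min h3)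

theorem neighborEquiv_one_iff {A X Y : Finset (Fin n)} : NeighborEquiv G 1 A X Y ↔
    ∀ u, u ∉ A → ((∃ v ∈ X, G.Adj u v) ↔ ∃ v ∈ Y, G.Adj u v) := by
  classical
  have key : ∀ Z : Finset (Fin n), ∀ u, (∃ v ∈ Z, G.Adj u v) ↔
      0 < (Z.filter fun v => G.Adj u v).card := by
    intro Z u
    rw [Finset.card_pos]
    simp [Finset.Nonempty]
  refine forall₂_congr fun u _ => ?_
  rw [key, key]
  constructor
  · intro h
    have h' : min 1 (X.filter fun v => G.Adj u v).card = min 1 (Y.filter fun v => G.Adj u v).card := by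
      convert h
    omega
  · intro h
    have h' : min 1 (X.filter fun v => G.Adj u v).card = min 1 (Y.filter fun v => G.Adj u v).card := by
      omega
    convert h'

/-- Encode a trace `T` by the class of `A \ T`. An outside set with trace `T` has no neighbour in `A
\ T`; if `A \ T'` is equivalent, it has none there either, so `T ⊆ T'`. By symmetry the encoding is
injective. -/
theorem card_traces_le_nec (A : Finset (Fin n)) : (traces G A).card ≤ nec G 1 A := by
  rw [nec, ← Nat.card_eq_finsetCard]
  refine Nat.card_le_card_of_injective
    (fun T : {x // x ∈ traces G A} =>
      (Quotient.mk (neighborSetoid G 1 A) ⟨A \ T.1, Finset.sdiff_subset⟩)) ?_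
  have key : ∀ T ∈ traces G A, ∀ T' ∈ traces G A, NeighborEquiv G 1 A (A \ T) (A \ T') →
      T ⊆ T' := by
    intro T hT T' hT' h a ha
    obtain ⟨Y, hY, rfl⟩ := Finset.mem_image.1 hT
    obtain ⟨haA, y, hy, hya⟩ := mem_trace.1 ha
    by_contra haT'
    have hyA : y ∉ A := Finset.mem_compl.1 (Finset.mem_powerset.1 hY hy)
    obtain ⟨b, hb, hyb⟩ := (neighborEquiv_one_iff.1 h y hyA).2
      ⟨a, Finset.mem_sdiff.2 ⟨haA, haT'⟩, hya⟩
    obtain ⟨hbA, hbT⟩ := Finset.mem_sdiff.1 hb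
    exact hbT (mem_trace.2 ⟨hbA, y, hy, hyb⟩)
  rintro ⟨T, hT⟩ ⟨T', hT'⟩ h
  have h' : NeighborEquiv G 1 A (A \ T) (A \ T') := Quotient.exact h
  exact Subtype.ext ((key T hT T' hT' h').antisymm
    (key T' hT' T hT fun u hu => (h' u hu).symm))

/-- Bounds the logarithm of the width by a multiple of `n`, which turns the logarithmic factor of
the elimination into a factor `n`. -/
theorem card_traces_le_two_pow (A : Finset (Fin n)) : (traces G A).card ≤ 2 ^ n := by
  have : traces G A ⊆ Finset.univ := Finset.subset_univ _
  simpa using Finset.card_le_card this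

theorem one_le_nec (A : Finset (Fin n)) : 1 ≤ nec G 1 A :=
  (traces_card_pos G A).trans (card_traces_le_nec A)

/-- An edge across the cut separates the class of `∅` from that of its end in `A`. So the width 2
obeys the size bound as soon as such an edge exists. -/
theorem two_le_nec {A : Finset (Fin n)} {a b : Fin n} (ha : a ∈ A) (hb : b ∉ A) (hab : G.Adj a b) :
    2 ≤ nec G 1 A := by
  have : Nontrivial (Quotient (neighborSetoid G 1 A)) := by
    refine ⟨Quotient.mk _ ⟨∅, Finset.empty_subset _⟩,
      Quotient.mk _ ⟨{a}, Finset.singleton_subset_iff.2 ha⟩, fun h => ?_⟩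
    have h' : NeighborEquiv G 1 A ∅ {a} := Quotient.exact h
    obtain ⟨v, hv, -⟩ := (neighborEquiv_one_iff.1 h' b hb).2 ⟨a, by simp, hab.symm⟩
    simp at hv
  exact Finite.one_lt_card

theorem entryVec_eq_zero {A T' : Finset (Fin n)} {t : ℕ → Finset (Fin n)} {cnt q c : ℕ}
    {X : Finset (Fin n)} (h : ¬ Entry G A T' t cnt q X c) : entryVec G A T' t cnt q X c = 0 :=
  if_neg h

/-- The degenerate case. -/
def Degenerate (G : SimpleGraph (Fin n)) (A : Finset (Fin n)) (𝒜 : Finset (Finset (Fin n))) : Prop :=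
  ∅ ∈ 𝒜 ∧ A ≠ Finset.univ ∧ ∀ u ∈ A, ∀ v ∉ A, ¬ G.Adj u v

/-- The size never exceeds the width. If `T'` is nonempty, the width is the squared number of
traces. Otherwise it is 2, which is fine if some edge leaves `A`. If none does, only the bound 1 is
available for `nec`. In that case the second bit can be set only by `∅ ∈ 𝒜` with `A` not everything,
the degenerate case; outside of it, independent vectors on the first bit number at most one. -/
theorem len_le {A R' T' : Finset (Fin n)} {t : ℕ → Finset (Fin n)} {cnt q N len : ℕ}
    {F : ℕ → Finset (Fin n)} {sel : ℕ → ℕ} {𝒜 : Finset (Finset (Fin n))}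
    (hT' : T' = trace G A R') (hR' : R' ⊆ Aᶜ) (hcnt : cnt = (traces G A).card)
    (hq : q = width cnt T'.Nonempty) (hF : ∀ k < N, F k ∈ 𝒜) (hsel : ∀ i < len, sel i < N)
    (h : len = N ∧ N ≤ q ∧ T'.Nonempty ∨
      LinearIndependent (ZMod 2) fun i : Fin len => entryVec G A T' t cnt q (F (sel i))) :
    (¬ Degenerate G A 𝒜 → len ≤ nec G 1 A ^ 2) ∧ (Degenerate G A 𝒜 → len ≤ 2) := by
  have hlenq : len ≤ q := by
    rcases h with ⟨h1, h2, -⟩ | h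
    · omega
    · exact card_le_of_support h fun i c hc => entryVec_eq_zero fun hE => by
        have := hE.1
        omega
  have hcross : T'.Nonempty → ∃ a ∈ A, ∃ b ∉ A, G.Adj a b := by
    rintro ⟨a, ha⟩
    rw [hT'] at ha
    obtain ⟨haA, y, hy, hya⟩ := mem_trace.1 ha
    exact ⟨a, haA, y, Finset.mem_compl.1 (hR' hy), hya.symm⟩
  constructor
  · intro hD
    by_cases hT : T'.Nonempty
    · rw [hq, width, if_pos hT] at hlenq
      have := card_traces_le_nec (G := G) A
      rw [← hcnt] at this
      calc len ≤ cnt * cnt := hlenq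
        _ ≤ nec G 1 A ^ 2 := by rw [sq]; exact Nat.mul_le_mul this this
    · have hq2 : q = 2 := by rw [hq, width, if_neg hT]
      by_cases hx : ∃ a ∈ A, ∃ b ∉ A, G.Adj a b
      · obtain ⟨a, ha, b, hb, hab⟩ := hx
        have := two_le_nec ha hb hab
        nlinarith
      · push Not at hx
        have hLI := h.resolve_left fun h => hT h.2.2
        have : len ≤ 1 := card_le_of_support hLI fun i c hc => entryVec_eq_zero fun hE => by
          rcases hE with ⟨hcq, h1 | ⟨-, h1 | ⟨-, h2, h3⟩⟩⟩
          · exact hT h1.1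
          · omega
          · refine hD ⟨?_, h3, hx⟩
            rw [← Finset.not_nonempty_iff_eq_empty.1 h2]
            exact hF _ (hsel i i.2)
        have h1 := one_le_nec (G := G) A
        nlinarith
  · rintro ⟨-, -, hx⟩
    have hT : ¬ T'.Nonempty := fun h => by
      obtain ⟨a, ha, b, hb, hab⟩ := hcross h
      exact hx a ha b hb hab
    rwa [hq, width, if_neg hT] at hlenq

end Graph

end WordRAM

/-! ### Running time, word size and conclusion. -/

namespace WordRAM

open Elim

/-- The cost of a multiplication of blocks. -/
theorem blocks_mul_time_le {ω C : ℝ} (hω : 2 ≤ ω) (hC : 0 ≤ C) {q κ t : ℕ} (hκ : 2 ^ κ ≤ 2 * q)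
    (ht : t ≤ κ) : 2 ^ κ / 2 ^ t * ⌊C * ((2 ^ t : ℕ) : ℝ) ^ ω⌋₊ ≤
      2 ^ t * ⌈C * (2 * (q : ℝ)) ^ (ω - 1)⌉₊ := by
  have hdiv : (2 : ℕ) ^ κ / 2 ^ t = 2 ^ (κ - t) := Nat.pow_div ht (by norm_num)
  rw [hdiv]
  set s : ℝ := ((2 ^ t : ℕ) : ℝ) with hs
  set r : ℝ := ((2 ^ (κ - t) : ℕ) : ℝ) with hr
  have hs1 : 1 ≤ s := by rw [hs]; exact_mod_cast Nat.one_le_two_pow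
  have hr1 : 1 ≤ r := by rw [hr]; exact_mod_cast Nat.one_le_two_pow
  have hM : s * r ≤ 2 * q := by
    rw [hs, hr]
    have : 2 ^ t * 2 ^ (κ - t) = 2 ^ κ := by rw [← pow_add]; congr 1; omega
    exact_mod_cast this ▸ hκ
  have hs0 : 0 < s := by linarith
  have key : r * (C * s ^ ω) ≤ s * (C * (2 * (q : ℝ)) ^ (ω - 1)) := by
    have e1 : s ^ ω = s * s ^ (ω - 1) := by
      rw [← Real.rpow_one_add' hs0.le (by linarith)]
      congr 1
      ring
    have e2 : r * s ^ (ω - 1) ≤ (2 * (q : ℝ)) ^ (ω - 1) := by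
      -- This uses `2 ≤ ω`: then `r ≤ r ^ (ω - 1)`, and one estimate `E` serves all block sizes.
      calc r * s ^ (ω - 1) ≤ r ^ (ω - 1) * s ^ (ω - 1) := by
            gcongr
            exact Real.self_le_rpow_of_one_le hr1 (by linarith)
        _ = (s * r) ^ (ω - 1) := by
            rw [mul_comm, Real.mul_rpow hs0.le (by linarith)]
        _ ≤ _ := Real.rpow_le_rpow (by positivity) hM (by linarith)
    calc r * (C * s ^ ω) = s * (C * (r * s ^ (ω - 1))) := by rw [e1]; ring
      _ ≤ _ := by gcongr
  have h1 : ((2 ^ (κ - t) * ⌊C * s ^ ω⌋₊ : ℕ) : ℝ) ≤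
      ((2 ^ t * ⌈C * (2 * (q : ℝ)) ^ (ω - 1)⌉₊ : ℕ) : ℝ) := by
    rw [Nat.cast_mul, Nat.cast_mul, ← hr, ← hs]
    calc r * (⌊C * s ^ ω⌋₊ : ℝ) ≤ r * (C * s ^ ω) := by
          gcongr
          exact Nat.floor_le (by positivity)
      _ ≤ s * (C * (2 * (q : ℝ)) ^ (ω - 1)) := key
      _ ≤ _ := by
          gcongr
          exact Nat.le_ceil _
  exact_mod_cast h1

/-- The total time. -/
theorem time_le {ω C : ℝ} (hω : 2 ≤ ω) (hC : 0 ≤ C) {n N cnt q d : ℕ} (hn : 1 ≤ n) (hd : 1 ≤ d)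
    (hcnt : cnt ≤ d) (hq : q ≤ 2 * (d * d)) :
    ((2000 * (cnt * n * (cnt * n) + N * (q * (n * n))) + N * (4 * ((2 * n + 1 + 2) *
      (4600 * q + 4 * ⌈C * (2 * (q : ℝ)) ^ (ω - 1)⌉₊)) + 20 * n + 50) + 100 + 2 : ℕ) : ℝ) ≤
    (6172 + 20 * (9204 + 4 * (C * 4 ^ (ω - 1)))) * (max 1 N : ℕ) * (d : ℝ) ^ (2 * (ω - 1)) *
      (n : ℝ) ^ 2 := by
  set W : ℝ := (d : ℝ) ^ (2 * (ω - 1)) with hW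
  set E : ℕ := ⌈C * (2 * (q : ℝ)) ^ (ω - 1)⌉₊ with hE
  set K : ℝ := C * 4 ^ (ω - 1) with hK
  set μ : ℝ := ((max 1 N : ℕ) : ℝ) with hμ
  have hd1 : (1 : ℝ) ≤ d := by exact_mod_cast hd
  have hn1 : (1 : ℝ) ≤ n := by exact_mod_cast hn
  have hK0 : 0 ≤ K := by positivity
  have hμ1 : 1 ≤ μ := by rw [hμ]; exact_mod_cast le_max_left _ _
  have hNμ : (N : ℝ) ≤ μ := by rw [hμ]; exact_mod_cast le_max_right _ _
  -- Again because of `2 ≤ ω`; thus terms quadratic in `nec` are within the bound.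
  have hW2 : (d : ℝ) * d ≤ W := by
    rw [← sq, hW, ← Real.rpow_two]
    exact Real.rpow_le_rpow_of_exponent_le hd1 (by linarith)
  have hW1 : 1 ≤ W := by nlinarith
  have hcc : (cnt : ℝ) * cnt ≤ W := by
    have : (cnt : ℝ) ≤ d := by exact_mod_cast hcnt
    have h0 : (0 : ℝ) ≤ cnt := Nat.cast_nonneg _
    nlinarith
  have hqd : (q : ℝ) ≤ 2 * (d * d) := by exact_mod_cast hq
  have hqW : (q : ℝ) ≤ 2 * W := by linarith
  have hEW : (E : ℝ) ≤ K * W + 1 := by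
    have h1 : (E : ℝ) ≤ C * (2 * (q : ℝ)) ^ (ω - 1) + 1 := (Nat.ceil_lt_add_one (by positivity)).le
    have h2 : (2 * (q : ℝ)) ^ (ω - 1) ≤ (4 * (d * d : ℝ)) ^ (ω - 1) :=
      Real.rpow_le_rpow (by positivity) (by linarith) (by linarith)
    have h3 : (4 * (d * d : ℝ)) ^ (ω - 1) = 4 ^ (ω - 1) * W := by
      rw [Real.mul_rpow (by norm_num) (by positivity), hW, Real.rpow_mul (by positivity),
        Real.rpow_two, sq]
    have h4 := mul_le_mul_of_nonneg_left (h2.trans_eq h3) hC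
    rw [hK]
    linarith
  have hN0 : (0 : ℝ) ≤ N := Nat.cast_nonneg _
  have hn2 : (n : ℝ) ≤ n ^ 2 := by nlinarith
  have hU : 1 ≤ W * (n : ℝ) ^ 2 := by nlinarith
  have hU' : W * (n : ℝ) ^ 2 ≤ μ * (W * (n : ℝ) ^ 2) := by nlinarith
  have a1 : (cnt : ℝ) * n * (cnt * n) ≤ μ * (W * (n : ℝ) ^ 2) := by
    calc (cnt : ℝ) * n * (cnt * n) = cnt * cnt * n ^ 2 := by ring
      _ ≤ W * (n : ℝ) ^ 2 := by gcongr
      _ ≤ _ := hU'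
  have a2 : (N : ℝ) * (q * (n * n)) ≤ 2 * (μ * (W * (n : ℝ) ^ 2)) := by
    calc (N : ℝ) * (q * (n * n)) ≤ μ * (2 * W * (n * n)) := by gcongr
      _ = _ := by ring
  have a3 : (2 * (n : ℝ) + 1 + 2) * (4600 * q + 4 * E) ≤
      5 * (9204 + 4 * K) * (W * (n : ℝ) ^ 2) := by
    have b1 : 2 * (n : ℝ) + 1 + 2 ≤ 5 * n ^ 2 := by linarith
    -- `9204 = 4600 * 2 + 4`, where the 4 pays for rounding up `E`.
    have b2 : 4600 * (q : ℝ) + 4 * E ≤ (9204 + 4 * K) * W := by nlinarith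
    calc _ ≤ 5 * (n : ℝ) ^ 2 * ((9204 + 4 * K) * W) := by gcongr
      _ = _ := by ring
  have a4 : 20 * (n : ℝ) + 50 ≤ 70 * (W * (n : ℝ) ^ 2) := by nlinarith
  have a5 : (N : ℝ) * (4 * ((2 * (n : ℝ) + 1 + 2) * (4600 * q + 4 * E)) + 20 * n + 50) ≤
      μ * ((20 * (9204 + 4 * K) + 70) * (W * (n : ℝ) ^ 2)) := by
    refine mul_le_mul hNμ (by nlinarith) (by positivity) (by linarith)
  push_cast
  -- `6172 = 6000 + 70 + 102`: `2000 + 2 * 2000` for the preparation, 70 for `20 * n + 50`, and 102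
  -- for the additive constants.
  have e : (6172 + 20 * (9204 + 4 * K)) * μ * W * (n : ℝ) ^ 2 =
      6000 * (μ * (W * (n : ℝ) ^ 2)) + μ * ((20 * (9204 + 4 * K) + 70) * (W * (n : ℝ) ^ 2)) +
        102 * (μ * (W * (n : ℝ) ^ 2)) := by ring
  rw [e]
  nlinarith

/-- The base `b` is at least 2, so its powers absorb constants: `800 ≤ b ^ 10` and `8 ≤ b ^ 3`. This
explains `14 = 10 + 4` and `5 = 3 + 2`. -/
theorem word_size_le {n N d cnt q c₀ B S : ℕ} (hn : 1 ≤ n) (hd : 1 ≤ d) (hcnt : cnt ≤ d)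
    (hq : q ≤ 2 * (d * d)) (hB : B = n + N + q + cnt + 1)
    (hS : (n + N + d) ^ (14 + 5 * c₀) ≤ S) : 50 * (B * B) ≤ S ∧ (2 * q + 1) ^ c₀ ≤ S := by
  set b := n + N + d with hb
  have hb2 : 2 ≤ b := by omega
  have hbb : b ≤ b ^ 2 := by nlinarith
  have hdb : d * d ≤ b ^ 2 := by
    rw [sq]
    exact Nat.mul_le_mul (by omega) (by omega)
  have h1 : b ^ 14 ≤ b ^ (14 + 5 * c₀) := Nat.pow_le_pow_right (by omega) (by omega)
  have h2 : b ^ (5 * c₀) ≤ b ^ (14 + 5 * c₀) := Nat.pow_le_pow_right (by omega) (by omega)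
  constructor
  · have hB4 : B ≤ 4 * b ^ 2 := by omega
    have h3 : 2 ^ 10 ≤ b ^ 10 := Nat.pow_le_pow_left hb2 10
    calc 50 * (B * B) ≤ 50 * ((4 * b ^ 2) * (4 * b ^ 2)) :=
          Nat.mul_le_mul_left _ (Nat.mul_le_mul hB4 hB4)
      _ = 800 * b ^ 4 := by ring
      _ ≤ b ^ 10 * b ^ 4 := Nat.mul_le_mul_right _ (by omega)
      _ = b ^ 14 := by ring
      _ ≤ S := h1.trans hS
  · have h3 : 2 ^ 3 ≤ b ^ 3 := Nat.pow_le_pow_left hb2 3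
    have h4 : 2 * q + 1 ≤ b ^ 5 := by
      calc 2 * q + 1 ≤ 8 * b ^ 2 := by omega
        _ ≤ b ^ 3 * b ^ 2 := Nat.mul_le_mul_right _ (by omega)
        _ = b ^ 5 := by ring
    calc (2 * q + 1) ^ c₀ ≤ (b ^ 5) ^ c₀ := Nat.pow_le_pow_left h4 _
      _ = b ^ (5 * c₀) := by rw [pow_mul]
      _ ≤ S := h2.trans hS

/-- Every tree has a leaf, and its label is a vertex. -/
theorem _root_.BinTree.one_le_size {n : ℕ} (T : BinTree (Fin n)) : 1 ≤ n := by
  induction T with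
  | leaf v => exact v.pos
  | node _ _ h _ => exact h

/-- The whole algorithm. -/
def reduceProg (P : Prog) (o : Opt) : Prog :=
  -- The program logic sees only the even machine registers: its registers 1 and 2 are the machine
  -- registers 2 and 4. The two copies translate the conventions for input and output.
  .instr (.copy 2 1) ;; representProg P o ;; .instr (.copy 2 4)

theorem reduceProg_exec {ω : ℝ} (hω : 2 ≤ ω) {P : Prog} {c₀ : ℕ} {C : ℝ} (hC : 0 ≤ C)
    (hP : Multiplies P c₀ fun m => ⌊C * (m : ℝ) ^ ω⌋₊) (o : Opt) {n : ℕ} (hn : 1 ≤ n)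
    {G : SimpleGraph (Fin n)} {w : Fin n → ℚ} {A R R' : Finset (Fin n)} (hR' : R' ⊆ Aᶜ)
    {𝒜 : Finset (Finset (Fin n))} (h𝒜 : ∀ X ∈ 𝒜, X ⊆ A) {S : ℕ}
    (hS : (n + 𝒜.card + nec G 1 A) ^ (14 + 5 * c₀) ≤ S) {s : Store} (hs : s.Bounded S)
    (hin : HoldsInput s G w A R R' 𝒜) :
    ∃ (s' : Store) (t : ℕ) (ℬ : Finset (Finset (Fin n))), Exec S (reduceProg P o) s s' t ∧
      (t : ℝ) ≤ (6172 + 20 * (9204 + 4 * (C * 4 ^ (ω - 1)))) * (max 1 𝒜.card : ℕ) *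
        (nec G 1 A : ℝ) ^ (2 * (ω - 1)) * (n : ℝ) ^ 2 ∧
      HoldsFamily s' 2 5 ℬ ∧ ℬ ⊆ 𝒜 ∧ Represents o G w A R' ℬ 𝒜 ∧
      (¬ Degenerate G A 𝒜 → ℬ.card ≤ nec G 1 A ^ 2) ∧ (Degenerate G A 𝒜 → ℬ.card ≤ 2) := by
  classical
  obtain ⟨l, hl1, hl2, hl3, hl4⟩ := hin.family
  set N := l.length with hN
  have hNcard : 𝒜.card = N := by rw [← hl2, List.toFinset_card_of_nodup hl1]
  -- The default `∅` is never used, as all indices stay below `N`.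
  set F : ℕ → Finset (Fin n) := fun k => l.getD k ∅ with hF
  have hFget : ∀ k (hk : k < N), F k = l.get ⟨k, hk⟩ := fun _ hk =>
    List.getD_eq_getElem l ∅ hk
  have hFmem : ∀ k < N, F k ∈ 𝒜 := fun k hk => by
    rw [hFget k hk, ← hl2]
    exact List.mem_toFinset.2 (List.get_mem _ _)
  have hFinj : Set.InjOn F (Set.Iio N) := fun i hi j hj hij => by
    rw [hFget i hi, hFget j hj] at hij
    exact Fin.mk.inj_iff.1 ((List.nodup_iff_injective_get.1 hl1) hij)
  have h𝒜F : 𝒜 = (Finset.range N).image F := by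
    ext X
    rw [← hl2, List.mem_toFinset, List.mem_iff_get]
    constructor
    · rintro ⟨k, rfl⟩
      exact Finset.mem_image.2 ⟨k, Finset.mem_range.2 k.2, hFget k k.2⟩
    · intro hX
      obtain ⟨k, hk, rfl⟩ := Finset.mem_image.1 hX
      exact ⟨⟨k, Finset.mem_range.1 hk⟩, (hFget k (Finset.mem_range.1 hk)).symm⟩
  set s1 := (Instr.copy 2 1).effect s with hs1
  have b1 : s1.Bounded S := hs.setReg _ (hs.1 _)
  have hInp : Inp s1.user N G w A R' F := by
    constructor
    · simpa [hs1, Instr.effect, Store.user] using hin.size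
    · simpa [hs1, Instr.effect, Store.user] using hl3
    · exact fun a b => .of_ite (hin.graph a b)
    · exact fun a => .of_ite (by simpa [hs1, Instr.effect, Store.user] using hin.side a)
    · exact fun a => .of_ite (by simpa [hs1, Instr.effect, Store.user] using hin.cls' a)
    · intro k hk a
      rw [hFget k hk]
      exact .of_ite (hl4 ⟨k, hk⟩ a)
    · exact hin.weights
  set T' := trace G A R' with hT'
  set cnt := (traces G A).card with hcnt
  set q := width cnt T'.Nonempty with hq
  set d := nec G 1 A with hd
  have hcd : cnt ≤ d := card_traces_le_nec A
  have hd1 : 1 ≤ d := one_le_nec A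
  have hdd : 1 ≤ d * d := Nat.mul_pos hd1 hd1
  -- The factor 2 is for empty `T'`, when the width is 2 although `d` may be 1.
  have hqd : q ≤ 2 * (d * d) := by
    rw [hq, width]
    split_ifs
    · have := Nat.mul_le_mul hcd hcd
      omega
    · omega
  rw [hNcard] at hS
  obtain ⟨hS1, hS2⟩ := word_size_le hn hd1 hcd hqd rfl hS
  -- The width is at most `4 ^ n`, so `2 * n + 1` bounds the exponent `κ` of the padded width.
  have hL : 2 * q < 2 ^ (2 * n + 1 + 1) := by
    have h2 : cnt * cnt ≤ 2 ^ n * 2 ^ n :=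
      Nat.mul_le_mul (card_traces_le_two_pow A) (card_traces_le_two_pow A)
    have h3 : 2 ^ (2 * n + 1 + 1) = 4 * (2 ^ n * 2 ^ n) := by ring
    have h4 : 2 ≤ 2 ^ n := by
      calc 2 = 2 ^ 1 := by norm_num
        _ ≤ 2 ^ n := Nat.pow_le_pow_right (by norm_num) hn
    have h5 : 2 * 2 ≤ 2 ^ n * 2 ^ n := Nat.mul_le_mul h4 h4
    rw [h3, hq, width]
    split_ifs <;> omega
  obtain ⟨s2, t2, hexec, ht2, t, -, htr, sel, len, hlen, hout, hsel, hsize⟩ :=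
    representProg_wp hP (o := o) hInp hn hT' hcnt hq rfl hS1 hS2 hL
      (fun κ hκ t ht => blocks_mul_time_le hω hC hκ ht) s1 b1 rfl
  have b2 := hexec.bounded b1
  set s3 := (Instr.copy 2 4).effect s2 with hs3
  have b3 : s3.Bounded S := b2.setReg _ (b2.1 _)
  have hselinj : Set.InjOn (fun i => F (sel i)) (Set.Iio len) := fun i hi j hj hij =>
    hsel.inj hi hj (hFinj (hsel.lt i hi) (hsel.lt j hj) hij)
  have hsub : (Finset.range len).image (fun i => F (sel i)) ⊆ 𝒜 := by
    intro X hX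
    obtain ⟨i, hi, rfl⟩ := Finset.mem_image.1 hX
    exact hFmem _ (hsel.lt i (Finset.mem_range.1 hi))
  have hcard : ((Finset.range len).image fun i => F (sel i)).card ≤ len := by
    simpa using Finset.card_image_le (s := Finset.range len) (f := fun i => F (sel i))
  obtain ⟨hc1, hc2⟩ := len_le (𝒜 := 𝒜) hT' hR' hcnt hq hFmem hsel.lt hsize
  refine ⟨s3, 1 + (t2 + 1), (Finset.range len).image fun i => F (sel i),
    .seq (.instr _ _ b1) (.seq hexec (.instr _ _ b3)), ?_, ?_, hsub, ?_,
    fun h => hcard.trans (hc1 h), fun h => hcard.trans (hc2 h)⟩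
  · rw [hNcard]
    exact le_trans (Nat.cast_le.2 (by omega)) (time_le hω hC (N := N) hn hd1 hcd hqd)
  · refine ⟨(List.range len).map fun i => F (sel i), ?_, ?_, ?_, ?_⟩
    · refine List.Nodup.map_on (fun i hi j hj hij => hselinj ?_ ?_ hij) List.nodup_range
      · simpa using hi
      · simpa using hj
    · ext X
      simp
    · simpa [hs3, Instr.effect, Store.setReg, Store.user] using hlen
    · rintro ⟨i, hi⟩ a
      have hi' : i < len := by simpa using hi
      have h1 := hout i hi' a a.2
      have h2 := (hInp.fam (sel i) (hsel.lt i hi') a).eq_ite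
      have h3 : s3.mem 5 (i * n + a) = s2.user.mem 5 (i * n + a) := rfl
      rw [h3, h1, h2]
      simp
  · rw [h𝒜F]
    exact represents_of_selection hT' htr hq (fun k hk => h𝒜 _ (hFmem k hk)) hsel

end WordRAM

open WordRAM in
theorem theorem3p2 (ω : ℝ) (hω : MatMulExponent ω) (o : Opt) :
    ∃ (reduce : Prog) (c : ℕ) (C : ℝ),
      ∀ (n : ℕ) (G : SimpleGraph (Fin n)) (w : Fin n → ℚ)
        (T x : BinTree (Fin n)), T.IsLayout → x.IsNode T →
      ∀ R ∈ RepSet G 1 x.verts, ∀ R' ⊆ x.vertsᶜ,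
      ∀ 𝒜 : Finset (Finset (Fin n)),
        (∀ X ∈ 𝒜, X ⊆ x.verts ∧ NeighborEquiv G 1 x.verts X R) →
      ∀ S : ℕ, (n + 𝒜.card + nec G 1 x.verts) ^ c ≤ S →
      ∀ s : Store, s.Bounded S → HoldsInput s G w x.verts R R' 𝒜 →
      ∃ (s' : Store) (t : ℕ) (ℬ : Finset (Finset (Fin n))),
        Exec S reduce s s' t ∧
        (t : ℝ) ≤ C * (max 1 𝒜.card : ℕ) * (nec G 1 x.verts : ℝ) ^ (2 * (ω - 1)) * (n : ℝ) ^ 2 ∧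
        HoldsFamily s' 2 5 ℬ ∧
        ℬ ⊆ 𝒜 ∧
        Represents o G w x.verts R' ℬ 𝒜 ∧
        (¬ (∅ ∈ 𝒜 ∧ x.verts ≠ Finset.univ ∧ ∀ u ∈ x.verts, ∀ v ∉ x.verts, ¬ G.Adj u v) →
          ℬ.card ≤ nec G 1 x.verts ^ 2) ∧
        ((∅ ∈ 𝒜 ∧ x.verts ≠ Finset.univ ∧ ∀ u ∈ x.verts, ∀ v ∉ x.verts, ¬ G.Adj u v) →
          ℬ.card ≤ 2) := by
  obtain ⟨P, c₀, C, hC, hP⟩ := hω.multiplies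
  refine ⟨reduceProg P o, 14 + 5 * c₀, 6172 + 20 * (9204 + 4 * (C * 4 ^ (ω - 1))), ?_⟩
  intro n G w T x _ _ R _ R' hR' 𝒜 h𝒜 S hS s hs hin
  exact reduceProg_exec hω.two_le hC hP o x.one_le_size hR' (fun X hX => (h𝒜 X hX).1) hS hs hin
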